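/- Let $\mathbb K$ be a field of characteristic $0$, let $\mathcal A$ be a ($\mathbb Z$-graded) strictly unital $A_\infty$-algebra over $\mathbb K$, and let $\mathcal P$ be a strictly unital $A_\infty$-bimodule over $\mathcal A$ which is invertible for $\otimes_{\mathcal A}$. Let $V$ be a two-dimensional vector space with a basis, and let $w_0,w_1$ be the dual basis of $W=V^\vee$. Write $\mathit{hom}_{[\mathcal A,\mathcal A]}$ for the (normalized) morphism complexes of $A_\infty$-bimodules. **Divisors.** A *noncommutative divisor* on $\mathcal A$ with underlying bimodule $\mathcal P$ is a strictly unital $A_\infty$-structure $\mu_{\mathcal B}$ on $\mathcal B=\mathcal A\oplus\mathcal P[1]$, with the unit of $\mathcal A$, for which $\mathcal A\subset\mathcal B$ is an $A_\infty$-subalgebra and the induced bimodule structure on $\mathcal B/\mathcal A=\mathcal P[1]$ is the given one. The component $T(\mathcal A[1])\otimes\mathcal P\otimes T(\mathcal A[1])\to\mathcal A$ of $\mu_{\mathcal B}$ is a bimodule map $\mathcal P\to\mathcal A$; its class in $H^0(\mathit{hom}_{[\mathcal A,\mathcal A]}(\mathcal P,\mathcal A))$ is the *section* of the divisor. An *isomorphism*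 of two such divisors is a strictly unital $A_\infty$-isomorphism of the algebras $\mathcal B$ which restricts to the identity on $\mathcal A$ and induces the identity on the bimodule $\mathcal B/\mathcal A$. **Pencils.** Give $V$ degree $0$ and weight $-1$, $\mathcal A$ weight $0$ and $\mathcal P[1]$ weight $-1$. A *noncommutative pencil* is a linear map $\wp:T(\mathcal B[1])\to\mathcal B[2]\otimes\mathit{Sym}^*(V)$ that preserves degrees and weights, such that for each $w\in W$, evaluating polynomials at $w$ turns $\wp$ into a noncommutative divisor $\mu_{\mathcal B,w}$. Its two sections $[\rho],[\sigma]\in H^0(\mathit{hom}_{[\mathcal A,\mathcal A]}(\mathcal P,\mathcal A))$ are those of $\mu_{\mathcal B,w_0}$ and $\mu_{\mathcal B,w_1}$. Two pencils $\wp,\wp'$ are *isomorphic* if there is a linear map $\Phi:T(\mathcal B[1])\to\mathcal B[1]\otimes\mathit{Sym}^*(V)$ that preserves degrees and weights and whose specialization at each $w\in W$ is an isomorphism of divisors from $\mu_{\mathcal B,w}$ to $\mu'_{\mathcal B,w}$. **The automorphism $K_1$.** $K_1$ is the automorphism of $H^0(\mathit{hom}_{[\mathcal A,\mathcal A]}(\mathcal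 P,\mathcal A))$ such that $K_1([\phi])=[\psi]$ if and only if the two bimodule maps $$\mathcal P\otimes_{\mathcal A}\mathcal P\xrightarrow{\mathit{id}\otimes\phi}\mathcal P\otimes_{\mathcal A}\mathcal A\simeq\mathcal P,\qquad \mathcal P\otimes_{\mathcal A}\mathcal P\xrightarrow{\psi\otimes\mathit{id}}\mathcal A\otimes_{\mathcal A}\mathcal P\simeq\mathcal P$$ are homotopic. **Statement.** Suppose that $$H^d\big(\mathit{hom}_{[\mathcal A,\mathcal A]}(\mathcal P^{\otimes_{\mathcal A}i},\mathcal A)\big)=0\quad\text{for all } i\ge1 \text{ and all } d<0.$$ Then: 1. Two noncommutative pencils on $\mathcal A$ with underlying bimodule $\mathcal P$, with sections $\rho,\sigma$ and $\rho',\sigma'$, are isomorphic if and only if $[\rho]=[\rho']$ and $[\sigma]=[\sigma']$. 2. The automorphism $K_1$ exists, and for each noncommutative pencil, $K_1([\rho])=[\rho]$ and $K_1([\sigma])=[\sigma]$. -/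

import Mathlib

open scoped TensorProduct

set_option maxSynthPendingDepth 3

universe u v

noncomputable section

namespace NCPencil

section Bar

variable {K : Type u} [Field K] {E F : Type u} [AddCommGroup E] [Module K E]
  [AddCommGroup F] [Module K F]
variable {X Y Z : Type u} [AddCommGroup X] [Module K X] [AddCommGroup Y] [Module K Y]
  [AddCommGroup Z] [Module K Z]

/-- The bar word `e₁ ⊗ ⋯ ⊗ eₙ` (written from left to right) in the tensor space `T(E)`. -/
def word (l : List E) : TensorAlgebra K E := (l.map (TensorAlgebra.ι K)).prod

/-- The augmentation `T(E) → K`: it kills all words of positive length. -/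
def aug : TensorAlgebra K E →ₐ[K] K := TensorAlgebra.algebraMapInv

/-- One letter of the recursion that defines the deconcatenation coproduct: on pairs `(x, Δ x)`
the letter `a` acts by `(x, Δ x) ↦ (a x, 1 ⊗ a x + (a ⊗ 1) Δ x)`. -/
def deconcStep : E →ₗ[K] Module.End K
    (TensorAlgebra K E × (TensorAlgebra K E ⊗[K] TensorAlgebra K E)) :=
  LinearMap.mk₂ K
    (fun a z => (TensorAlgebra.ι K a * z.1,
      (1 : TensorAlgebra K E) ⊗ₜ[K] (TensorAlgebra.ι K a * z.1)
        + (TensorAlgebra.ι K a ⊗ₜ[K] (1 : TensorAlgebra K E)) * z.2))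
    (fun a b z => by
      simp only [map_add, add_mul, TensorProduct.tmul_add, TensorProduct.add_tmul, Prod.mk_add_mk]
      congr 1; abel)
    (fun c a z => by
      simp only [map_smul, smul_mul_assoc, TensorProduct.tmul_smul, ← TensorProduct.smul_tmul',
        Prod.smul_mk, smul_add])
    (fun a z w => by
      simp only [Prod.fst_add, Prod.snd_add, mul_add, TensorProduct.tmul_add, Prod.mk_add_mk]
      congr 1; abel)
    (fun c a z => by
      simp only [Prod.smul_fst, Prod.smul_snd, mul_smul_comm, TensorProduct.tmul_smul,
        Prod.smul_mk, smul_add])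

/-- The deconcatenation coproduct of `T(E)`, see `deconc_word`. -/
def deconc : TensorAlgebra K E →ₗ[K] TensorAlgebra K E ⊗[K] TensorAlgebra K E :=
  LinearMap.snd K _ _ ∘ₗ
    ((TensorAlgebra.lift K (deconcStep (K := K) (E := E))).toLinearMap.flip
      ((1 : TensorAlgebra K E), (1 : TensorAlgebra K E) ⊗ₜ[K] (1 : TensorAlgebra K E)))

lemma deconc_aux (x : TensorAlgebra K E) :
    ((TensorAlgebra.lift K (deconcStep (K := K) (E := E))) x
      ((1 : TensorAlgebra K E), (1 : TensorAlgebra K E) ⊗ₜ[K] (1 : TensorAlgebra K E))).1 = x := by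
  suffices h : ∀ z : TensorAlgebra K E × (TensorAlgebra K E ⊗[K] TensorAlgebra K E),
      ((TensorAlgebra.lift K (deconcStep (K := K) (E := E))) x z).1 = x * z.1 by
    rw [h, mul_one]
  induction x using TensorAlgebra.induction with
  | algebraMap r => intro z; simp [Algebra.smul_def]
  | ι a => intro z; simp [deconcStep]
  | mul x y hx hy => intro z; simp [hx, hy, mul_assoc]
  | add x y hx hy => intro z; simp [hx, hy, add_mul]

@[simp] lemma deconc_one : deconc (1 : TensorAlgebra K E) = 1 ⊗ₜ[K] 1 := by
  simp [deconc]

lemma deconc_ι_mul (a : E) (x : TensorAlgebra K E) :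
    deconc (TensorAlgebra.ι K a * x) =
      1 ⊗ₜ[K] (TensorAlgebra.ι K a * x) + (TensorAlgebra.ι K a ⊗ₜ[K] 1) * deconc x := by
  have h := deconc_aux (K := K) x
  simp only [deconc, LinearMap.coe_comp, Function.comp_apply, LinearMap.flip_apply,
    LinearMap.snd_apply, AlgHom.toLinearMap_apply, map_mul, TensorAlgebra.lift_ι_apply,
    Module.End.mul_apply]
  simp only [deconcStep, LinearMap.mk₂_apply] at h ⊢
  rw [h]

/-- Induction on words. -/
lemma word_induction {C : TensorAlgebra K E → Prop} (h0 : C 1)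
    (hι : ∀ a x, C x → C (TensorAlgebra.ι K a * x)) (hadd : ∀ x y, C x → C y → C (x + y))
    (hsmul : ∀ (c : K) x, C x → C (c • x)) (x : TensorAlgebra K E) : C x := by
  suffices h : ∀ y, C y → C (x * y) by simpa using h 1 h0
  induction x using TensorAlgebra.induction with
  | algebraMap r => intro y hy; simpa [Algebra.smul_def] using hsmul r y hy
  | ι a => intro y hy; exact hι a y hy
  | mul x y hx hy => intro z hz; rw [mul_assoc]; exact hx _ (hy _ hz)
  | add x y hx hy => intro z hz; rw [add_mul]; exact hadd _ _ (hx _ hz) (hy _ hz)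

lemma deconc_mul (x y : TensorAlgebra K E) :
    deconc (x * y) + x ⊗ₜ[K] y =
      deconc x * ((1 : TensorAlgebra K E) ⊗ₜ[K] y) + (x ⊗ₜ[K] (1 : TensorAlgebra K E)) * deconc y := by
  induction x using word_induction with
  | h0 => simp [add_comm, Algebra.TensorProduct.one_def.symm]
  | hι a x hx =>
    have := congrArg (fun z => (TensorAlgebra.ι K a ⊗ₜ[K] (1 : TensorAlgebra K E)) * z) hx
    simp only [mul_add, ← mul_assoc, Algebra.TensorProduct.tmul_mul_tmul, one_mul, mul_one] at this
    rw [mul_assoc, deconc_ι_mul, deconc_ι_mul, add_assoc, this, add_mul]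
    simp [mul_assoc, add_assoc]
  | hadd x y hx hy =>
    simp only [add_mul, map_add, TensorProduct.add_tmul]
    rw [add_add_add_comm, hx, hy]; abel
  | hsmul c x hx =>
    rw [smul_mul_assoc, map_smul, map_smul, ← TensorProduct.smul_tmul', ← TensorProduct.smul_tmul',
      ← smul_add, hx, smul_add, smul_mul_assoc, smul_mul_assoc]

lemma deconc_ι (a : E) : deconc (TensorAlgebra.ι K a) =
    1 ⊗ₜ[K] TensorAlgebra.ι K a + TensorAlgebra.ι K a ⊗ₜ[K] 1 := by
  have := deconc_ι_mul (K := K) a 1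
  simpa using this

lemma deconc_mid (x y : TensorAlgebra K E) (a : E) :
    deconc (x * TensorAlgebra.ι K a * y) =
      deconc x * ((1 : TensorAlgebra K E) ⊗ₜ[K] (TensorAlgebra.ι K a * y))
        + ((x * TensorAlgebra.ι K a) ⊗ₜ[K] (1 : TensorAlgebra K E)) * deconc y := by
  have h := deconc_mul (K := K) x (TensorAlgebra.ι K a * y)
  rw [deconc_ι_mul, mul_add, ← mul_assoc, ← mul_assoc] at h
  simp only [Algebra.TensorProduct.tmul_mul_tmul, mul_one, one_mul, mul_assoc] at h ⊢
  rw [add_comm (x ⊗ₜ[K] _) _, ← add_assoc] at h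
  exact add_right_cancel h

/-- `Δ(e₁ ⋯ eₙ) = ∑ᵢ (e₁ ⋯ eᵢ) ⊗ (eᵢ₊₁ ⋯ eₙ)`. -/
lemma deconc_word (l : List E) : deconc (word (K := K) l) =
    ∑ i ∈ Finset.range (l.length + 1), word (l.take i) ⊗ₜ[K] word (l.drop i) := by
  induction l with
  | nil => simp [word]
  | cons a l ih =>
    have h : word (K := K) (a :: l) = TensorAlgebra.ι K a * word l := by simp [word]
    rw [h, deconc_ι_mul, ih, List.length_cons, Finset.sum_range_succ' _ (l.length + 1),
      Finset.mul_sum, add_comm]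
    simp [word]

/-- Convolution: `conv m f g x = ∑ m (f x') (g x'')`, the sum being over all ways `x = x' x''` of
cutting a word in two. -/
def conv (m : X →ₗ[K] Y →ₗ[K] Z) :
    (TensorAlgebra K E →ₗ[K] X) →ₗ[K] (TensorAlgebra K E →ₗ[K] Y) →ₗ[K]
      (TensorAlgebra K E →ₗ[K] Z) :=
  LinearMap.mk₂ K (fun f g => TensorProduct.lift (m.compl₁₂ f g) ∘ₗ deconc)
    (fun f f' g => by
      rw [← LinearMap.add_comp]; congr 1; ext; simp)
    (fun c f g => by
      rw [← LinearMap.smul_comp]; congr 1; ext; simp)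
    (fun f g g' => by
      rw [← LinearMap.add_comp]; congr 1; ext; simp)
    (fun c f g => by
      rw [← LinearMap.smul_comp]; congr 1; ext; simp)

lemma conv_apply (m : X →ₗ[K] Y →ₗ[K] Z) (f : TensorAlgebra K E →ₗ[K] X)
    (g : TensorAlgebra K E →ₗ[K] Y) (x : TensorAlgebra K E) :
    conv m f g x = TensorProduct.lift (m.compl₁₂ f g) (deconc x) := rfl

lemma conv_word (m : X →ₗ[K] Y →ₗ[K] Z) (f : TensorAlgebra K E →ₗ[K] X)
    (g : TensorAlgebra K E →ₗ[K] Y) (l : List E) :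
    conv m f g (word l) =
      ∑ i ∈ Finset.range (l.length + 1), m (f (word (l.take i))) (g (word (l.drop i))) := by
  simp [conv_apply, deconc_word]

/-- Two convolutions agree on `x` if their summands agree for all cuts of all words. -/
lemma deconc_congr {W : Type u} [AddCommGroup W] [Module K W]
    (f g : TensorAlgebra K E ⊗[K] TensorAlgebra K E →ₗ[K] W)
    (h : ∀ a b, f (a ⊗ₜ b) = g (a ⊗ₜ b)) (x : TensorAlgebra K E) :
    f (deconc x) = g (deconc x) := by
  rw [TensorProduct.ext' h]

@[simp] lemma aug_ι (a : E) : aug (TensorAlgebra.ι K a) = 0 := by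
  simp [aug, TensorAlgebra.algebraMapInv]

lemma deconc_aug_left (x : TensorAlgebra K E) :
    TensorProduct.lift ((LinearMap.lsmul K (TensorAlgebra K E)).comp
      (aug (K := K) (E := E)).toLinearMap) (deconc x) = x := by
  induction x using word_induction with
  | h0 => simp
  | hι a x hx =>
    rw [deconc_ι_mul, map_add]
    have : ∀ z, TensorProduct.lift ((LinearMap.lsmul K (TensorAlgebra K E)).comp
      (aug (K := K) (E := E)).toLinearMap)
        ((TensorAlgebra.ι K a ⊗ₜ[K] (1 : TensorAlgebra K E)) * z) = 0 := by
      intro z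
      induction z using TensorProduct.induction_on with
      | zero => simp
      | tmul b c => simp
      | add b c hb hc => simp [mul_add, hb, hc]
    rw [this]; simp
  | hadd x y hx hy => simp only [map_add, hx, hy]
  | hsmul c x hx => simp only [map_smul, hx]

lemma deconc_aug_right (x : TensorAlgebra K E) :
    TensorProduct.lift ((LinearMap.lsmul K (TensorAlgebra K E)).comp
      (aug (K := K) (E := E)).toLinearMap).flip (deconc x) = x := by
  induction x using word_induction with
  | h0 => simp
  | hι a x hx =>
    rw [deconc_ι_mul, map_add]
    have : ∀ z, TensorProduct.lift ((LinearMap.lsmul K (TensorAlgebra K E)).comp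
      (aug (K := K) (E := E)).toLinearMap).flip
        ((TensorAlgebra.ι K a ⊗ₜ[K] (1 : TensorAlgebra K E)) * z) =
        TensorAlgebra.ι K a * TensorProduct.lift ((LinearMap.lsmul K (TensorAlgebra K E)).comp
      (aug (K := K) (E := E)).toLinearMap).flip z := by
      intro z
      induction z using TensorProduct.induction_on with
      | zero => simp
      | tmul b c => simp
      | add b c hb hc => simp [mul_add, hb, hc]
    rw [this, hx]; simp
  | hadd x y hx hy => simp only [map_add, hx, hy]
  | hsmul c x hx => simp only [map_smul, hx]

/-- The projection of `T(E)` to words of length one. -/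
def len1 : TensorAlgebra K E →ₗ[K] E := TensorAlgebra.ιInv

@[simp] lemma len1_ι (a : E) : len1 (TensorAlgebra.ι K a) = a := TensorAlgebra.ι_leftInverse a

lemma len1_mul (x y : TensorAlgebra K E) : len1 (x * y) = aug x • len1 y + aug y • len1 x := by
  let _ : Module Kᵐᵒᵖ E := Module.compHom _ ((RingHom.id K).fromOpposite mul_comm)
  have _ : IsCentralScalar K E := ⟨fun r m => rfl⟩
  have h1 : ∀ z : TensorAlgebra K E, len1 z = (TensorAlgebra.toTrivSqZeroExt z).snd := fun z => rfl
  have h2 : ∀ z : TensorAlgebra K E, aug z = (TensorAlgebra.toTrivSqZeroExt z).fst := by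
    intro z
    have : (aug (K := K) (E := E)) =
        (TrivSqZeroExt.fstHom K K E).comp TensorAlgebra.toTrivSqZeroExt := by
      ext a; simp
    rw [this]; rfl
  rw [h1, h1, h1, h2, h2, map_mul, TrivSqZeroExt.snd_mul]
  simp

@[simp] lemma len1_one : len1 (1 : TensorAlgebra K E) = 0 := by
  have h := len1_mul (1 : TensorAlgebra K E) 1
  simpa using h

end Bar

/-- The sign `(-1)^d` in `K`. -/
def ksign (K : Type u) [Field K] (d : ℤ) : K := if Even d then 1 else -1

/-- Data of a `ℤ`-graded vector space: the space, its homogeneous pieces, and the parity operator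
`v ↦ (-1)^{|v|} v`. The laws are in `GrSpace.IsGraded`. -/
structure GrSpace (K : Type u) [Field K] : Type (u + 1) where
  carrier : Type u
  [addCommGroup : AddCommGroup carrier]
  [module : Module K carrier]
  gr : ℤ → Submodule K carrier
  par : carrier →ₗ[K] carrier

attribute [instance] GrSpace.addCommGroup GrSpace.module

instance {K : Type u} [Field K] : CoeSort (GrSpace K) (Type u) := ⟨GrSpace.carrier⟩

/-- The homogeneous pieces form a direct sum decomposition, and `par` is the parity operator. -/
structure GrSpace.IsGraded {K : Type u} [Field K] (M : GrSpace K) : Prop where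
  internal : DirectSum.IsInternal M.gr
  par_apply : ∀ n : ℤ, ∀ v ∈ M.gr n, M.par v = ksign K n • v

/-- `HomWord 𝒢 c n x` says that `x` is a word `e₁ ⊗ ⋯ ⊗ e_r` with `e_i ∈ 𝒢 n_i` and
`n = ∑ (n_i + c)`. For `c = -1` this is the total reduced degree. -/
inductive HomWord {K : Type u} [Field K] {E : Type u} [AddCommGroup E] [Module K E]
    (𝒢 : ℤ → Submodule K E) (c : ℤ) : ℤ → TensorAlgebra K E → Prop
  | nil : HomWord 𝒢 c 0 1
  | cons {m n : ℤ} {e : E} {x : TensorAlgebra K E} (he : e ∈ 𝒢 m) (hx : HomWord 𝒢 c n x) :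
      HomWord 𝒢 c ((m + c) + n) (TensorAlgebra.ι K e * x)

section AInf

variable {K : Type u} [Field K]

/-- The tensor space `T(M[1])` (the shift only enters through degrees and signs). -/
abbrev Bar (M : GrSpace K) : Type u := TensorAlgebra K M

/-- The sign operator `e₁ ⊗ ⋯ ⊗ e_r ↦ (-1)^{‖e₁‖ + ⋯ + ‖e_r‖} e₁ ⊗ ⋯ ⊗ e_r`, `‖e‖ = |e| - 1`. -/
def GrSpace.sgn (M : GrSpace K) : Bar M →ₐ[K] Bar M :=
  TensorAlgebra.lift K (-(TensorAlgebra.ι K ∘ₗ M.par))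

/-- The `d`-th power of the sign operator. -/
def GrSpace.sgnPow (M : GrSpace K) (d : ℤ) : Bar M →ₗ[K] Bar M :=
  if Even d then LinearMap.id else M.sgn.toLinearMap

/-- The `d`-th power of the parity operator. -/
def GrSpace.parPow (M : GrSpace K) (d : ℤ) : M →ₗ[K] M :=
  if Even d then LinearMap.id else M.par

/-- The coderivation of `T(M[1])` associated to operations `μ`: it maps a word `w` to
`∑ (-1)^{‖w₃‖} w₁ ⊗ μ(w₂) ⊗ w₃`, the sum being over all decompositions `w = w₁ w₂ w₃`. -/
def GrSpace.coder (M : GrSpace K) (μ : Bar M →ₗ[K] M) : Bar M →ₗ[K] Bar M :=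
  conv (LinearMap.mul K (Bar M)) LinearMap.id
    (conv (LinearMap.mul K (Bar M)) (TensorAlgebra.ι K ∘ₗ μ) M.sgn.toLinearMap)

/-- `μ : T(M[1]) → M[2]` is a strictly unital `A_∞`-structure with unit `e`. The order of the
entries in a word is the one of `μ^d(a_d, …, a_1)`. Strict unitality means that `μ^1(e) = 0`,
`μ^2(a, e) = a = (-1)^{|a|} μ^2(e, a)`, and that `e` cannot be inserted into `μ^d`, `d ≥ 3`; the
equation `unital` below says all of this at once, and `assoc` is
`∑ (-1)^{‖a_1‖ + ⋯ + ‖a_i‖} μ(a_d, …, μ(a_{i+j}, …, a_{i+1}), a_i, …, a_1) = 0`. -/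
structure IsAInf (M : GrSpace K) (e : M) (μ : Bar M →ₗ[K] M) : Prop where
  graded : M.IsGraded
  unit_mem : e ∈ M.gr 0
  map_one : μ 1 = 0
  degree : ∀ n x, HomWord M.gr (-1) n x → μ x ∈ M.gr (n + 2)
  unital : ∀ x y, μ (x * TensorAlgebra.ι K e * y) = aug x • M.par (len1 y) + aug y • len1 x
  assoc : ∀ x, μ (M.coder μ x) = 0

end AInf

/-- A strictly unital `A_∞`-algebra over `K`. -/
structure AInfAlgebra (K : Type u) [Field K] extends GrSpace K where
  unit : carrier
  mu : Bar toGrSpace →ₗ[K] carrier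
  isAInf : IsAInf toGrSpace unit mu

/-- Data of an `A_∞`-bimodule over `A`: `op (a'_s ⊗ ⋯ ⊗ a'_1) (a_r ⊗ ⋯ ⊗ a_1) p` is
`μ^{s;1;r}(a'_s, …, a'_1; p; a_r, …, a_1)`. Strict unitality means that `μ^{0;1;1}(p; e) = p`,
`μ^{1;1;0}(e; p) = (-1)^{|p|+1} p`, and that `e` cannot be inserted elsewhere. The remaining laws
are in `IsBimodule`. -/
structure BimoduleData {K : Type u} [Field K] (A : AInfAlgebra K) extends GrSpace K where
  op : Bar A.toGrSpace →ₗ[K] Bar A.toGrSpace →ₗ[K] carrier →ₗ[K] carrier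
  unit_left : ∀ x x' y p, op (x * TensorAlgebra.ι K A.unit * x') y p =
    -((aug x * aug x' * aug y) • par p)
  unit_right : ∀ x y y' p, op x (y * TensorAlgebra.ι K A.unit * y') p =
    (aug x * aug y * aug y') • p

section Hom

variable {K : Type u} [Field K] (A : AInfAlgebra K)

/-- Families of multilinear maps `φ^{s;1;r} : A^{⊗ s} ⊗ P ⊗ A^{⊗ r} → Q`, with
`φ x y p = φ(x; p; y)`, where `x` and `y` are words in `A`. -/
abbrev Cochain (P Q : GrSpace K) : Type u :=
  Bar A.toGrSpace →ₗ[K] Bar A.toGrSpace →ₗ[K] P →ₗ[K] Q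

variable {A} {P Q R : GrSpace K}

/-- Composition of `ψ` with a map `φ` of degree `d`:
`(x; p; y) ↦ ∑ (-1)^{d ‖y''‖} ψ(x'; φ(x''; p; y'); y'')` over all `x = x' x''`, `y = y' y''`. -/
def Cochain.comp (d : ℤ) (ψ : Cochain A Q R) (φ : Cochain A P Q) : Cochain A P R :=
  conv ((conv (LinearMap.llcomp K P Q R).flip).flip ∘ₗ
    LinearMap.lcomp K (Q →ₗ[K] R) (A.sgnPow d)) ψ φ

/-- `(x; p; y) ↦ ∑ ± φ(…, μ_A(…), …; p; y) + ∑ ± φ(x; p; …, μ_A(…), …)`, the sign being `-1` to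
the power of the total (reduced) degree of everything to the right of `μ_A`. -/
def Cochain.insertMu (φ : Cochain A P Q) : Cochain A P Q :=
  φ.compl₂ (A.coder A.mu) +
    (φ.compl₁₂ (A.coder A.mu) A.sgn.toLinearMap).compr₂ (LinearMap.lcomp K Q P.par)

/-- `φ` factors through `T(Ā[1])` on both sides, where `Ā = A / K e`. -/
def Cochain.Normalized (φ : Cochain A P Q) : Prop :=
  (∀ x x' y, φ (x * TensorAlgebra.ι K A.unit * x') y = 0) ∧
    ∀ x y y', φ x (y * TensorAlgebra.ι K A.unit * y') = 0

variable (P Q) in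
/-- The degree `d` part of the morphism complex `hom_{[A,A]}(P, Q)`. -/
def homDeg (d : ℤ) : Submodule K (Cochain A P Q) where
  carrier := {φ | φ.Normalized ∧ ∀ k m n x y p, HomWord A.gr (-1) k x → HomWord A.gr (-1) n y →
    p ∈ P.gr m → φ x y p ∈ Q.gr (k + m + n + d)}
  zero_mem' := by simp [Cochain.Normalized]
  add_mem' := by
    rintro φ ψ ⟨⟨h1, h2⟩, h3⟩ ⟨⟨h1', h2'⟩, h3'⟩
    refine ⟨⟨fun x x' y => ?_, fun x y y' => ?_⟩, fun k m n x y p hx hy hp => ?_⟩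
    · simp [h1, h1']
    · simp [h2, h2']
    · exact add_mem (h3 k m n x y p hx hy hp) (h3' k m n x y p hx hy hp)
  smul_mem' := by
    rintro c φ ⟨⟨h1, h2⟩, h3⟩
    refine ⟨⟨fun x x' y => ?_, fun x y y' => ?_⟩, fun k m n x y p hx hy hp => ?_⟩
    · simp [h1]
    · simp [h2]
    · exact Submodule.smul_mem _ c (h3 k m n x y p hx hy hp)

end Hom

section HomComplex

variable {K : Type u} [Field K] {A : AInfAlgebra K}

/-- The `A_∞`-bimodule equations. -/
structure IsBimodule (P : BimoduleData A) : Prop where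
  graded : P.IsGraded
  degree : ∀ k m n x y p, HomWord A.gr (-1) k x → HomWord A.gr (-1) n y → p ∈ P.gr m →
    P.op x y p ∈ P.gr (k + m + n + 1)
  assoc : Cochain.comp (A := A) 1 P.op P.op + Cochain.insertMu P.op = 0

variable (P Q R : BimoduleData A)

/-- The differential of `hom_{[A,A]}(P, Q)` on elements of degree `d`,
`∂φ = μ_Q ∘ φ - (-1)^d (φ ∘ μ_P + φ ∘ μ_A)`. -/
def diff (d : ℤ) : Cochain A P.toGrSpace Q.toGrSpace →ₗ[K] Cochain A P.toGrSpace Q.toGrSpace where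
  toFun φ := Cochain.comp d Q.op φ - ksign K d • (Cochain.comp 1 φ P.op + φ.insertMu)
  map_add' φ ψ := by
    ext x y p
    simp only [Cochain.comp, Cochain.insertMu, map_add, map_smul, LinearMap.add_apply,
      LinearMap.sub_apply, LinearMap.smul_apply, LinearMap.compl₂_apply, LinearMap.compr₂_apply,
      LinearMap.compl₁₂_apply, RingHom.id_apply]
    module
  map_smul' c φ := by
    ext x y p
    simp only [Cochain.comp, Cochain.insertMu, map_add, map_smul, LinearMap.add_apply,
      LinearMap.sub_apply, LinearMap.smul_apply, LinearMap.compl₂_apply, LinearMap.compr₂_apply,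
      LinearMap.compl₁₂_apply, RingHom.id_apply]
    module

/-- The cocycles of degree `d`. -/
def cocycles (d : ℤ) : Submodule K (Cochain A P.toGrSpace Q.toGrSpace) :=
  homDeg P.toGrSpace Q.toGrSpace d ⊓ LinearMap.ker (diff P Q d)

/-- The coboundaries of degree `d`. -/
def coboundaries (d : ℤ) : Submodule K (Cochain A P.toGrSpace Q.toGrSpace) :=
  (homDeg P.toGrSpace Q.toGrSpace (d - 1)).map (diff P Q (d - 1))

/-- `H^d(hom_{[A,A]}(P, Q))`. -/
abbrev HomCoh (d : ℤ) : Type u :=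
  cocycles P Q d ⧸ (coboundaries P Q d).comap (cocycles P Q d).subtype

variable {P Q}

/-- `φ` induces an isomorphism from the cohomology of `(P, μ_P^{0;1;0})` to that of
`(Q, μ_Q^{0;1;0})`. -/
structure IsQuasiIso (φ : Cochain A P.toGrSpace Q.toGrSpace) : Prop where
  cocycle : φ ∈ cocycles P Q 0
  surjective : ∀ q, Q.op 1 1 q = 0 → ∃ p, P.op 1 1 p = 0 ∧ ∃ q', q = φ 1 1 p + Q.op 1 1 q'
  injective : ∀ p, P.op 1 1 p = 0 → (∃ q', φ 1 1 p = Q.op 1 1 q') → ∃ p', p = P.op 1 1 p'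

end HomComplex

section Aux

variable {K : Type u} [Field K]

@[simp] lemma sgn_ι (M : GrSpace K) (a : M) :
    M.sgn (TensorAlgebra.ι K a) = -TensorAlgebra.ι K (M.par a) := by
  simp [GrSpace.sgn]

@[simp] lemma aug_sgn (M : GrSpace K) (x : Bar M) : aug (M.sgn x) = aug x := by
  have : (aug (K := K)).comp M.sgn = aug (K := K) (E := M) := by
    ext a; simp
  exact DFunLike.congr_fun this x

lemma AInfAlgebra.par_unit (A : AInfAlgebra K) : A.par A.unit = A.unit := by
  have := A.isAInf.graded.par_apply 0 _ A.isAInf.unit_mem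
  simpa [ksign] using this

lemma AInfAlgebra.sgn_unit (A : AInfAlgebra K) :
    A.sgn (TensorAlgebra.ι K A.unit) = -TensorAlgebra.ι K A.unit := by
  rw [sgn_ι, A.par_unit]

/-- The degenerate elements: a cut of a word with an inserted unit. -/
lemma deconc_unit {W : Type u} [AddCommGroup W] [Module K W] {E : Type u} [AddCommGroup E]
    [Module K E] (G : TensorAlgebra K E ⊗[K] TensorAlgebra K E →ₗ[K] W)
    (x y : TensorAlgebra K E) (e : E) :
    G (deconc (x * TensorAlgebra.ι K e * y)) =
      (G ∘ₗ LinearMap.mulRight K ((1 : TensorAlgebra K E) ⊗ₜ[K] (TensorAlgebra.ι K e * y)))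
        (deconc x) +
      (G ∘ₗ LinearMap.mulLeft K ((x * TensorAlgebra.ι K e) ⊗ₜ[K] (1 : TensorAlgebra K E)))
        (deconc y) := by
  simp [deconc_mid]

end Aux

section Constructions

variable {K : Type u} [Field K] (A : AInfAlgebra K)

/-- `(x, y, a) ↦ x ⊗ a ⊗ y` on words. -/
def insertLetter (E : Type u) [AddCommGroup E] [Module K E] :
    TensorAlgebra K E →ₗ[K] TensorAlgebra K E →ₗ[K] E →ₗ[K] TensorAlgebra K E :=
  LinearMap.mk₂ K
    (fun x y => LinearMap.mulRight K y ∘ₗ LinearMap.mulLeft K x ∘ₗ TensorAlgebra.ι K)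
    (fun x x' y => LinearMap.ext fun a => by
      simp only [LinearMap.coe_comp, Function.comp_apply, LinearMap.mulLeft_apply,
        LinearMap.mulRight_apply, LinearMap.add_apply, add_mul])
    (fun c x y => LinearMap.ext fun a => by
      simp only [LinearMap.coe_comp, Function.comp_apply, LinearMap.mulLeft_apply,
        LinearMap.mulRight_apply, LinearMap.smul_apply, smul_mul_assoc])
    (fun x y y' => LinearMap.ext fun a => by
      simp only [LinearMap.coe_comp, Function.comp_apply, LinearMap.mulLeft_apply,
        LinearMap.mulRight_apply, LinearMap.add_apply, mul_add])
    (fun c x y => LinearMap.ext fun a => by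
      simp only [LinearMap.coe_comp, Function.comp_apply, LinearMap.mulLeft_apply,
        LinearMap.mulRight_apply, LinearMap.smul_apply, mul_smul_comm])

@[simp] lemma insertLetter_apply {E : Type u} [AddCommGroup E] [Module K E]
    (x y : TensorAlgebra K E) (a : E) :
    insertLetter E x y a = x * TensorAlgebra.ι K a * y := rfl

/-- The diagonal bimodule,
`μ^{s;1;r}(a'; a; a_r, …, a_1) = (-1)^{‖a_1‖ + ⋯ + ‖a_r‖ + 1} μ_A(a', a, a_r, …, a_1)`. -/
abbrev diagonal : BimoduleData A where
  toGrSpace := A.toGrSpace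
  op := -((insertLetter A.carrier).compl₂ A.sgn.toLinearMap).compr₂
    (LinearMap.llcomp K A.carrier (Bar A.toGrSpace) A.carrier A.mu)
  unit_left x x' y a := by
    have := A.isAInf.unital x (x' * TensorAlgebra.ι K a * A.sgn y)
    simp only [← mul_assoc] at this
    change -(A.mu (_ * TensorAlgebra.ι K a * A.sgn y)) = _
    rw [this]
    simp only [len1_mul, map_mul, aug_ι, aug_sgn, len1_ι, map_add, map_smul]
    simp only [mul_zero, zero_mul, zero_smul, add_zero, zero_add, smul_smul]
    congr 2; ring
  unit_right x y y' a := by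
    have := A.isAInf.unital (x * TensorAlgebra.ι K a * A.sgn y) (A.sgn y')
    have h : A.sgn (y * TensorAlgebra.ι K A.unit * y') =
        -(A.sgn y * TensorAlgebra.ι K A.unit * A.sgn y') := by
      rw [map_mul, map_mul, A.sgn_unit]; simp
    change -(A.mu (_ * TensorAlgebra.ι K a * A.sgn _)) = _
    rw [h, mul_neg, map_neg, neg_neg, ← mul_assoc, ← mul_assoc, this]
    simp only [len1_mul, map_mul, aug_ι, aug_sgn, len1_ι, map_add, map_smul]
    simp only [mul_zero, zero_mul, zero_smul, add_zero, smul_zero, zero_add, smul_smul]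
    congr 1; ring

variable {A}

/-- The space `Q ⊗ T(A[1]) ⊗ P`. -/
abbrev PreTensor (A : AInfAlgebra K) (Q P : GrSpace K) : Type u :=
  Q ⊗[K] (Bar A.toGrSpace ⊗[K] P)

/-- The span of all `q ⊗ a_t ⊗ ⋯ ⊗ a_1 ⊗ p` such that some `a_i` is the unit. -/
def degenerate (A : AInfAlgebra K) (Q P : GrSpace K) : Submodule K (PreTensor A Q P) :=
  Submodule.span K {z | ∃ q x y p, z = q ⊗ₜ[K] ((x * TensorAlgebra.ι K A.unit * y) ⊗ₜ[K] p)}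

/-- Cutting the word in the middle: `q ⊗ b ⊗ p ↦ ∑ (q ⊗ b') ⊗ (b'' ⊗ p)`. -/
def cut (A : AInfAlgebra K) (Q P : GrSpace K) :
    PreTensor A Q P →ₗ[K] (Q ⊗[K] Bar A.toGrSpace) ⊗[K] (Bar A.toGrSpace ⊗[K] P) :=
  (TensorProduct.assoc K Q (Bar A.toGrSpace) (Bar A.toGrSpace ⊗[K] P)).symm.toLinearMap ∘ₗ
    (TensorProduct.assoc K (Bar A.toGrSpace) (Bar A.toGrSpace) P).toLinearMap.lTensor Q ∘ₗ
      (deconc.rTensor P).lTensor Q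

/-- `φ ⊗ id`, for `φ` of degree `d`, before normalization:
`(x; q ⊗ b ⊗ p) ↦ ∑ (-1)^{d (‖b''‖ + |p|)} φ(x; q; b') ⊗ b'' ⊗ p` over all `b = b' b''`
(and zero if there are entries to the right of `p`). -/
def preLeft (d : ℤ) {Q Q' : GrSpace K} (φ : Cochain A Q Q') (P : GrSpace K) :
    Bar A.toGrSpace →ₗ[K] Bar A.toGrSpace →ₗ[K] PreTensor A Q P →ₗ[K] PreTensor A Q' P :=
  LinearMap.mk₂ K
    (fun x y => aug y • (TensorProduct.map (TensorProduct.lift (φ x).flip)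
      (TensorProduct.map (A.sgnPow d) (P.parPow d)) ∘ₗ cut A Q P))
    (fun x x' y => by
      rw [← smul_add, ← LinearMap.add_comp, ← TensorProduct.map_add_left]
      congr 3; ext; simp)
    (fun c x y => by
      have h : TensorProduct.lift (φ (c • x)).flip = c • TensorProduct.lift (φ x).flip := by
        ext; simp
      rw [h, TensorProduct.map_smul_left, LinearMap.smul_comp, smul_comm])
    (fun x y y' => by rw [map_add, add_smul])
    (fun c x y => by rw [map_smul, smul_assoc])

/-- `id ⊗ φ` before normalization: `(q ⊗ b ⊗ p; y) ↦ ∑ q ⊗ b' ⊗ φ(b''; p; y)` over all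
`b = b' b''` (and zero if there are entries to the left of `q`). -/
def preRight {P P' : GrSpace K} (φ : Cochain A P P') (Q : GrSpace K) :
    Bar A.toGrSpace →ₗ[K] Bar A.toGrSpace →ₗ[K] PreTensor A Q P →ₗ[K] PreTensor A Q P' :=
  LinearMap.mk₂ K
    (fun x y => aug x • ((TensorProduct.assoc K Q (Bar A.toGrSpace) P').toLinearMap ∘ₗ
      TensorProduct.map LinearMap.id (TensorProduct.lift (φ.flip y)) ∘ₗ cut A Q P))
    (fun x x' y => by rw [map_add, add_smul])
    (fun c x y => by rw [map_smul, smul_assoc])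
    (fun x y y' => by
      rw [← smul_add, ← LinearMap.comp_add, ← LinearMap.add_comp, ← TensorProduct.map_add_right]
      congr 4; ext; simp)
    (fun c x y => by
      have h : TensorProduct.lift (φ.flip (c • y)) = c • TensorProduct.lift (φ.flip y) := by
        ext; simp
      rw [h, TensorProduct.map_smul_right, LinearMap.smul_comp, LinearMap.comp_smul, smul_comm])

/-- The part of the differential that involves `μ_A`:
`q ⊗ b ⊗ p ↦ ∑ (-1)^{|p| + ‖b₃‖} q ⊗ b₁ ⊗ μ_A(b₂) ⊗ b₃ ⊗ p`. -/
def preMid (Q P : GrSpace K) :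
    Bar A.toGrSpace →ₗ[K] Bar A.toGrSpace →ₗ[K] PreTensor A Q P →ₗ[K] PreTensor A Q P :=
  LinearMap.mk₂ K
    (fun x y => (aug x * aug y) • (TensorProduct.map (A.coder A.mu) P.par).lTensor Q)
    (fun x x' y => by rw [map_add, add_mul, add_smul])
    (fun c x y => by rw [map_smul, smul_mul_assoc, smul_assoc])
    (fun x y y' => by rw [map_add, mul_add, add_smul])
    (fun c x y => by rw [map_smul, mul_smul_comm, smul_assoc])

variable (A) in
/-- A family of operations that respects degenerate elements descends to the quotients. -/
def descend {Q P Q' P' : GrSpace K}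
    (f : Bar A.toGrSpace →ₗ[K] Bar A.toGrSpace →ₗ[K] PreTensor A Q P →ₗ[K] PreTensor A Q' P')
    (hf : ∀ x y, degenerate A Q P ≤ (degenerate A Q' P').comap (f x y)) :
    Bar A.toGrSpace →ₗ[K] Bar A.toGrSpace →ₗ[K]
      (PreTensor A Q P ⧸ degenerate A Q P) →ₗ[K] (PreTensor A Q' P' ⧸ degenerate A Q' P') :=
  LinearMap.mk₂ K (fun x y => Submodule.mapQ _ _ (f x y) (hf x y))
    (fun x x' y => by ext; simp)
    (fun c x y => by ext; simp)
    (fun x y y' => by ext; simp)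
    (fun c x y => by ext; simp)

end Constructions

section TensorLemmas

variable {K : Type u} [Field K] {A : AInfAlgebra K}

lemma cut_tmul {Q P : GrSpace K} {W : Type u} [AddCommGroup W] [Module K W]
    (f : (Q ⊗[K] Bar A.toGrSpace) ⊗[K] (Bar A.toGrSpace ⊗[K] P) →ₗ[K] W)
    (g : Bar A.toGrSpace ⊗[K] Bar A.toGrSpace →ₗ[K] W) (q : Q) (b : Bar A.toGrSpace) (p : P)
    (h : ∀ b' b'', f ((q ⊗ₜ b') ⊗ₜ (b'' ⊗ₜ p)) = g (b' ⊗ₜ b'')) :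
    f (cut A Q P (q ⊗ₜ (b ⊗ₜ p))) = g (deconc b) := by
  simp only [cut, LinearMap.comp_apply, LinearMap.lTensor_tmul, LinearMap.rTensor_tmul]
  induction deconc b using TensorProduct.induction_on with
  | zero => simp
  | tmul b c => simpa using h b c
  | add b c hb hc => simp only [TensorProduct.add_tmul, map_add, TensorProduct.tmul_add, hb, hc]

lemma preLeft_tmul (d : ℤ) {Q Q' P : GrSpace K} (φ : Cochain A Q Q') (x y b : Bar A.toGrSpace)
    (q : Q) (p : P) :
    preLeft d φ P x y (q ⊗ₜ (b ⊗ₜ p)) = aug y • TensorProduct.map ((φ x).flip q)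
      ((TensorProduct.mk K (Bar A.toGrSpace) P).flip (P.parPow d p) ∘ₗ A.sgnPow d) (deconc b) := by
  simp only [preLeft, LinearMap.mk₂_apply, LinearMap.smul_apply, LinearMap.comp_apply]
  congr 1
  apply cut_tmul
  intro b' b''
  simp

lemma preRight_tmul {Q P P' : GrSpace K} (φ : Cochain A P P') (x y b : Bar A.toGrSpace)
    (q : Q) (p : P) :
    preRight φ Q x y (q ⊗ₜ (b ⊗ₜ p)) = aug x • (TensorProduct.mk K Q _ q ∘ₗ
      TensorProduct.map LinearMap.id ((φ.flip y).flip p)) (deconc b) := by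
  simp only [preRight, LinearMap.mk₂_apply, LinearMap.smul_apply]
  congr 1
  rw [← LinearMap.comp_assoc, LinearMap.comp_apply]
  apply cut_tmul
  intro b' b''
  simp

lemma preMid_tmul {Q P : GrSpace K} (x y b : Bar A.toGrSpace) (q : Q) (p : P) :
    preMid Q P x y (q ⊗ₜ (b ⊗ₜ p)) =
      (aug x * aug y) • (q ⊗ₜ[K] ((A.coder A.mu b) ⊗ₜ[K] P.par p)) := by
  simp [preMid]

lemma sgnPow_unit (d : ℤ) (x y : Bar A.toGrSpace) : ∃ c : K,
    A.sgnPow d (x * TensorAlgebra.ι K A.unit * y) =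
      c • (A.sgnPow d x * TensorAlgebra.ι K A.unit * A.sgnPow d y) := by
  unfold GrSpace.sgnPow
  split_ifs
  · exact ⟨1, by simp⟩
  · refine ⟨-1, ?_⟩
    simp only [AlgHom.toLinearMap_apply, map_mul, A.sgn_unit]
    simp

lemma mem_degenerate {Q P : GrSpace K} (q : Q) (x y : Bar A.toGrSpace) (p : P) :
    (q ⊗ₜ[K] ((x * TensorAlgebra.ι K A.unit * y) ⊗ₜ[K] p)) ∈ degenerate A Q P :=
  Submodule.subset_span ⟨q, x, y, p, rfl⟩

/-- Membership of `G (Δ b)` in a subspace can be checked on all cuts. -/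
lemma deconc_mem {W : Type u} [AddCommGroup W] [Module K W] {E : Type u} [AddCommGroup E]
    [Module K E] (S : Submodule K W) (G : TensorAlgebra K E ⊗[K] TensorAlgebra K E →ₗ[K] W)
    (h : ∀ a b, G (a ⊗ₜ b) ∈ S) (z : TensorAlgebra K E ⊗[K] TensorAlgebra K E) : G z ∈ S := by
  induction z using TensorProduct.induction_on with
  | zero => simp
  | tmul b c => exact h b c
  | add b c hb hc => rw [map_add]; exact add_mem hb hc

lemma preLeft_degenerate_of_normalized (d : ℤ) {Q Q' : GrSpace K} {φ : Cochain A Q Q'}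
    (hφ : φ.Normalized) (P : GrSpace K) (x y : Bar A.toGrSpace) :
    degenerate A Q P ≤ (degenerate A Q' P).comap (preLeft d φ P x y) := by
  refine Submodule.span_le.2 ?_
  rintro _ ⟨q, u, w, p, rfl⟩
  simp only [Submodule.comap_coe, Set.mem_preimage, SetLike.mem_coe, preLeft_tmul]
  refine Submodule.smul_mem _ _ ?_
  rw [deconc_unit]
  refine add_mem (deconc_mem _ _ (fun a b => ?_) _) (deconc_mem _ _ (fun a b => ?_) _)
  · obtain ⟨c, hc⟩ := sgnPow_unit (A := A) d b w
    simp only [LinearMap.comp_apply, LinearMap.mulRight_apply,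
      Algebra.TensorProduct.tmul_mul_tmul, TensorProduct.map_tmul, LinearMap.flip_apply,
      TensorProduct.mk_apply, ← mul_assoc, hc]
    rw [← TensorProduct.smul_tmul', TensorProduct.tmul_smul]
    exact Submodule.smul_mem _ _ (mem_degenerate _ _ _ _)
  · simp only [LinearMap.comp_apply, LinearMap.mulLeft_apply,
      Algebra.TensorProduct.tmul_mul_tmul, TensorProduct.map_tmul, LinearMap.flip_apply, hφ.2]
    simp

lemma preRight_degenerate_of_normalized {P P' : GrSpace K} {φ : Cochain A P P'}
    (hφ : φ.Normalized) (Q : GrSpace K) (x y : Bar A.toGrSpace) :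
    degenerate A Q P ≤ (degenerate A Q P').comap (preRight φ Q x y) := by
  refine Submodule.span_le.2 ?_
  rintro _ ⟨q, u, w, p, rfl⟩
  simp only [Submodule.comap_coe, Set.mem_preimage, SetLike.mem_coe, preRight_tmul]
  refine Submodule.smul_mem _ _ ?_
  rw [deconc_unit]
  refine add_mem (deconc_mem _ _ (fun a b => ?_) _) (deconc_mem _ _ (fun a b => ?_) _)
  · simp only [LinearMap.comp_apply, LinearMap.mulRight_apply,
      Algebra.TensorProduct.tmul_mul_tmul, TensorProduct.map_tmul, LinearMap.flip_apply,
      ← mul_assoc, hφ.1]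
    simp
  · simp only [LinearMap.comp_apply, LinearMap.mulLeft_apply,
      Algebra.TensorProduct.tmul_mul_tmul, TensorProduct.map_tmul, LinearMap.flip_apply,
      TensorProduct.mk_apply, LinearMap.id_apply]
    exact mem_degenerate _ _ _ _

end TensorLemmas

section TensorOp

variable {K : Type u} [Field K] {A : AInfAlgebra K}

lemma deconc_ι_mul_map {W E : Type u} [AddCommGroup W] [Module K W] [AddCommGroup E]
    [Module K E] (G : TensorAlgebra K E ⊗[K] TensorAlgebra K E →ₗ[K] W)
    (a : E) (x : TensorAlgebra K E) :
    G (deconc (TensorAlgebra.ι K a * x)) = G (1 ⊗ₜ[K] (TensorAlgebra.ι K a * x)) +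
      (G ∘ₗ LinearMap.mulLeft K (TensorAlgebra.ι K a ⊗ₜ[K] (1 : TensorAlgebra K E)))
        (deconc x) := by
  simp [deconc_ι_mul]

lemma deconc_len1_left (M : GrSpace K) (x : Bar M) :
    TensorProduct.lift ((LinearMap.mul K (Bar M)).compl₁₂
      (TensorAlgebra.ι K ∘ₗ M.par ∘ₗ len1) M.sgn.toLinearMap) (deconc x) =
      algebraMap K _ (aug x) - M.sgn x := by
  induction x using word_induction with
  | h0 => simp
  | hι a x hx =>
    rw [deconc_ι_mul_map, deconc_congr _ (LinearMap.mulLeft K (TensorAlgebra.ι K (M.par a)) ∘ₗ M.sgn.toLinearMap ∘ₗ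
        TensorProduct.lift ((LinearMap.lsmul K (Bar M)).comp
          (aug (K := K) (E := M)).toLinearMap))]
    · rw [LinearMap.comp_apply, LinearMap.comp_apply, deconc_aug_left]
      simp
    · intro b c
      simp [len1_mul]
  | hadd x y hx hy => simp only [map_add, hx, hy]; abel
  | hsmul c x hx => simp only [map_smul, hx]; simp [Algebra.smul_def, mul_sub]

lemma deconc_len1_right (M : GrSpace K) (x : Bar M) :
    TensorProduct.lift ((LinearMap.mul K (Bar M)).compl₁₂
      LinearMap.id (TensorAlgebra.ι K ∘ₗ len1)) (deconc x) =
      x - algebraMap K _ (aug x) := by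
  induction x using word_induction with
  | h0 => simp
  | hι a x hx =>
    rw [deconc_ι_mul_map, deconc_congr _ (LinearMap.mulLeft K (TensorAlgebra.ι K a) ∘ₗ
        TensorProduct.lift ((LinearMap.mul K (Bar M)).compl₁₂
      LinearMap.id (TensorAlgebra.ι K ∘ₗ len1)))]
    · rw [LinearMap.comp_apply, hx]
      simp [len1_mul, mul_sub, Algebra.algebraMap_eq_smul_one]
    · intro b c
      simp [mul_assoc]
  | hadd x y hx hy => simp only [map_add, hx, hy]; abel
  | hsmul c x hx => simp only [map_smul, hx]; simp [Algebra.smul_def, mul_sub]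

/-- The span of all words with some letter equal to the unit. -/
def unitIdeal (A : AInfAlgebra K) : Submodule K (Bar A.toGrSpace) :=
  Submodule.span K {z | ∃ x y, z = x * TensorAlgebra.ι K A.unit * y}

lemma mul_mem_unitIdeal (x : Bar A.toGrSpace) {z : Bar A.toGrSpace} (hz : z ∈ unitIdeal A) :
    x * z ∈ unitIdeal A := by
  have : unitIdeal A ≤ (unitIdeal A).comap (LinearMap.mulLeft K x) := by
    refine Submodule.span_le.2 ?_
    rintro _ ⟨u, w, rfl⟩
    exact Submodule.subset_span ⟨x * u, w, by simp [mul_assoc]⟩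
  exact this hz

lemma coder_unit (u w : Bar A.toGrSpace) :
    A.coder A.mu (u * TensorAlgebra.ι K A.unit * w) - (aug w • u - aug u • A.sgn w) ∈
      unitIdeal A := by
  set G : Bar A.toGrSpace →ₗ[K] Bar A.toGrSpace :=
    conv (LinearMap.mul K (Bar A.toGrSpace)) (TensorAlgebra.ι K ∘ₗ A.mu) A.sgn.toLinearMap with hG
  have h1 : ∀ b, G (b * TensorAlgebra.ι K A.unit * w) -
      (aug b • (algebraMap K _ (aug w) - A.sgn w) + TensorAlgebra.ι K (len1 b) * A.sgn w) ∈
        unitIdeal A := by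
    intro b
    rw [hG, conv_apply, deconc_unit, add_sub_assoc]
    refine add_mem (deconc_mem _ _ (fun s t => ?_) _) ?_
    · refine Submodule.subset_span ⟨-(TensorAlgebra.ι K (A.mu s) * A.sgn t), A.sgn w, ?_⟩
      simp only [LinearMap.comp_apply, LinearMap.mulRight_apply,
        Algebra.TensorProduct.tmul_mul_tmul, TensorProduct.lift.tmul, LinearMap.compl₁₂_apply,
        LinearMap.mul_apply', AlgHom.toLinearMap_apply, map_mul, A.sgn_unit, mul_one]
      simp [mul_assoc]
    · rw [deconc_congr _ (aug b • TensorProduct.lift ((LinearMap.mul K (Bar A.toGrSpace)).compl₁₂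
        (TensorAlgebra.ι K ∘ₗ A.par ∘ₗ len1) A.sgn.toLinearMap) +
        LinearMap.mulLeft K (TensorAlgebra.ι K (len1 b)) ∘ₗ A.sgn.toLinearMap ∘ₗ
        TensorProduct.lift ((LinearMap.lsmul K (Bar A.toGrSpace)).comp
          (aug (K := K) (E := A.carrier)).toLinearMap)), LinearMap.add_apply, LinearMap.smul_apply,
        deconc_len1_left, LinearMap.comp_apply, LinearMap.comp_apply, deconc_aug_left]
      · simp
      · intro s t
        simp only [LinearMap.comp_apply, LinearMap.mulLeft_apply,
          Algebra.TensorProduct.tmul_mul_tmul, TensorProduct.lift.tmul, LinearMap.compl₁₂_apply,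
          LinearMap.mul_apply', AlgHom.toLinearMap_apply, A.isAInf.unital, one_mul,
          LinearMap.add_apply, LinearMap.smul_apply, map_add, map_smul, LinearMap.lsmul_apply]
  have h2 : A.coder A.mu (u * TensorAlgebra.ι K A.unit * w) -
      (u * (algebraMap K _ (aug w) - A.sgn w) + (u - algebraMap K _ (aug u)) * A.sgn w) ∈
        unitIdeal A := by
    rw [GrSpace.coder, ← hG, conv_apply, deconc_unit, add_comm, add_sub_assoc]
    refine add_mem (deconc_mem _ _ (fun s t => ?_) _) ?_
    · refine Submodule.subset_span ⟨u, s * G t, ?_⟩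
      simp [mul_assoc]
    · have e : (u * (algebraMap K _ (aug w) - A.sgn w) + (u - algebraMap K _ (aug u)) * A.sgn w) =
          (LinearMap.mulRight K (algebraMap K (Bar A.toGrSpace) (aug w) - A.sgn w) ∘ₗ
            TensorProduct.lift ((LinearMap.lsmul K (Bar A.toGrSpace)).comp
              (aug (K := K) (E := A.carrier)).toLinearMap).flip +
           LinearMap.mulRight K (A.sgn w) ∘ₗ
            TensorProduct.lift ((LinearMap.mul K (Bar A.toGrSpace)).compl₁₂
              LinearMap.id (TensorAlgebra.ι K ∘ₗ len1))) (deconc u) := by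
        rw [LinearMap.add_apply, LinearMap.comp_apply, LinearMap.comp_apply, deconc_aug_right,
          deconc_len1_right]
        simp
      rw [e, ← LinearMap.sub_apply]
      refine deconc_mem _ _ (fun s t => ?_) _
      have := mul_mem_unitIdeal s (h1 t)
      convert this using 1
      simp only [LinearMap.sub_apply, LinearMap.add_apply, LinearMap.comp_apply,
        LinearMap.mulRight_apply, Algebra.TensorProduct.tmul_mul_tmul, TensorProduct.lift.tmul,
        LinearMap.compl₁₂_apply, LinearMap.mul_apply', LinearMap.id_apply, mul_one,
        LinearMap.flip_apply, LinearMap.lsmul_apply, AlgHom.toLinearMap_apply, mul_sub, mul_add,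
        smul_mul_assoc, mul_smul_comm, smul_sub, mul_assoc]
  convert h2 using 2
  simp only [mul_sub, sub_mul, Algebra.algebraMap_eq_smul_one, mul_smul_comm, smul_mul_assoc,
    mul_one, one_mul]
  abel

variable (Q P : BimoduleData A)

/-- The structure maps of `Q ⊗_A P` before normalization: the sum of the terms in which
`μ_Q`, `μ_A` and `μ_P` are applied. -/
def preOp : Bar A.toGrSpace →ₗ[K] Bar A.toGrSpace →ₗ[K]
    PreTensor A Q.toGrSpace P.toGrSpace →ₗ[K] PreTensor A Q.toGrSpace P.toGrSpace :=
  preLeft 1 Q.op P.toGrSpace + preMid Q.toGrSpace P.toGrSpace + preRight P.op Q.toGrSpace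

lemma preOp_degenerate (x y : Bar A.toGrSpace) : degenerate A Q.toGrSpace P.toGrSpace ≤
    (degenerate A Q.toGrSpace P.toGrSpace).comap (preOp Q P x y) := by
  refine Submodule.span_le.2 ?_
  rintro _ ⟨q, u, w, p, rfl⟩
  have s1 : A.sgnPow 1 = A.sgn.toLinearMap := by simp [GrSpace.sgnPow]
  have p1 : P.parPow 1 = P.par := by simp [GrSpace.parPow]
  set D := degenerate A Q.toGrSpace P.toGrSpace
  set z : PreTensor A Q.toGrSpace P.toGrSpace :=
    q ⊗ₜ[K] ((u * TensorAlgebra.ι K A.unit * w) ⊗ₜ[K] p) with hz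
  set z1 : PreTensor A Q.toGrSpace P.toGrSpace := q ⊗ₜ[K] (A.sgn w ⊗ₜ[K] P.par p) with hz1
  set z2 : PreTensor A Q.toGrSpace P.toGrSpace := q ⊗ₜ[K] (u ⊗ₜ[K] P.par p) with hz2
  have h1 : preLeft 1 Q.op P.toGrSpace x y z - (aug x * aug y * aug u) • z1 ∈ D := by
    rw [hz, preLeft_tmul, deconc_unit, smul_add, add_sub_assoc, s1, p1]
    refine add_mem (Submodule.smul_mem _ _ (deconc_mem _ _ (fun a b => ?_) _)) ?_
    · simp only [LinearMap.comp_apply, LinearMap.mulRight_apply, AlgHom.toLinearMap_apply,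
        Algebra.TensorProduct.tmul_mul_tmul, TensorProduct.map_tmul, LinearMap.flip_apply,
        TensorProduct.mk_apply, ← mul_assoc, map_mul, A.sgn_unit, mul_neg, neg_mul,
        TensorProduct.neg_tmul, TensorProduct.tmul_neg]
      exact neg_mem (mem_degenerate _ _ _ _)
    · rw [deconc_congr _ ((aug x * aug u) • (TensorProduct.mk K Q.carrier _ q ∘ₗ
        (TensorProduct.mk K (Bar A.toGrSpace) P.carrier).flip (P.par p) ∘ₗ A.sgn.toLinearMap ∘ₗ
        TensorProduct.lift ((LinearMap.lsmul K (Bar A.toGrSpace)).comp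
          (aug (K := K) (E := A.carrier)).toLinearMap)))]
      · simp only [LinearMap.smul_apply, LinearMap.comp_apply, deconc_aug_left,
          LinearMap.flip_apply, TensorProduct.mk_apply, AlgHom.toLinearMap_apply, smul_smul]
        rw [← hz1, ← sub_smul]
        have : aug y * (aug x * aug u) - aug x * aug y * aug u = 0 := by ring
        simp [this]
      · intro a b
        simp only [LinearMap.comp_apply, LinearMap.mulLeft_apply, LinearMap.smul_apply,
          Algebra.TensorProduct.tmul_mul_tmul, TensorProduct.map_tmul, LinearMap.flip_apply,
          TensorProduct.mk_apply, AlgHom.toLinearMap_apply, Q.unit_right, one_mul,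
          TensorProduct.lift.tmul, LinearMap.lsmul_apply, map_smul,
          TensorProduct.tmul_smul, smul_smul, ← TensorProduct.smul_tmul']
  have h2 : preMid Q.toGrSpace P.toGrSpace x y z -
      (aug x * aug y) • (aug w • z2 - aug u • z1) ∈ D := by
    rw [hz, preMid_tmul, ← smul_sub]
    refine Submodule.smul_mem _ _ ?_
    have key : unitIdeal A ≤ D.comap (TensorProduct.mk K Q.carrier _ q ∘ₗ
        (TensorProduct.mk K (Bar A.toGrSpace) P.carrier).flip (P.par p)) := by
      refine Submodule.span_le.2 ?_
      rintro _ ⟨a, b, rfl⟩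
      exact mem_degenerate _ _ _ _
    have := key (coder_unit u w)
    rw [Submodule.mem_comap, map_sub, map_sub, map_smul, map_smul] at this
    exact this
  have h3 : preRight P.op Q.toGrSpace x y z - (-(aug x * aug y * aug w)) • z2 ∈ D := by
    rw [hz, preRight_tmul, deconc_unit, smul_add, add_comm, add_sub_assoc]
    refine add_mem (Submodule.smul_mem _ _ (deconc_mem _ _ (fun a b => ?_) _)) ?_
    · simp only [LinearMap.comp_apply, LinearMap.mulLeft_apply,
        Algebra.TensorProduct.tmul_mul_tmul, TensorProduct.map_tmul, LinearMap.flip_apply,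
        TensorProduct.mk_apply, LinearMap.id_apply]
      exact mem_degenerate _ _ _ _
    · obtain ⟨c, hc⟩ : ∃ c : K, c = -(aug w * aug y) := ⟨_, rfl⟩
      rw [deconc_congr _ (c • (TensorProduct.mk K Q.carrier _ q ∘ₗ
        (TensorProduct.mk K (Bar A.toGrSpace) P.carrier).flip (P.par p) ∘ₗ
        TensorProduct.lift ((LinearMap.lsmul K (Bar A.toGrSpace)).comp
          (aug (K := K) (E := A.carrier)).toLinearMap).flip))]
      · simp only [LinearMap.smul_apply, LinearMap.comp_apply, deconc_aug_right,
          LinearMap.flip_apply, TensorProduct.mk_apply, smul_smul]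
        rw [← hz2, ← sub_smul]
        have : aug x * c - -(aug x * aug y * aug w) = 0 := by rw [hc]; ring
        rw [this, zero_smul]
        exact zero_mem _
      · intro a b
        have : -((aug b * aug w * aug y) • P.par p) = (c * aug b) • P.par p := by
          rw [hc, ← neg_smul]; congr 1; ring
        simp only [LinearMap.comp_apply, LinearMap.mulRight_apply, LinearMap.smul_apply,
          Algebra.TensorProduct.tmul_mul_tmul, TensorProduct.map_tmul, LinearMap.flip_apply,
          TensorProduct.mk_apply, AlgHom.toLinearMap_apply, ← mul_assoc, P.unit_left, mul_one,
          TensorProduct.lift.tmul, LinearMap.lsmul_apply, map_smul, LinearMap.id_apply,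
          this, TensorProduct.tmul_smul, smul_smul]
  have h := add_mem (add_mem h1 h2) h3
  simp only [Submodule.comap_coe, Set.mem_preimage, SetLike.mem_coe, preOp, LinearMap.add_apply]
  convert h using 1
  module

end TensorOp

section TensorBimodule

variable {K : Type u} [Field K] {A : AInfAlgebra K}

/-- The parity operator of `Q ⊗ T(A[1]) ⊗ P`. -/
def prePar (A : AInfAlgebra K) (Q P : GrSpace K) : PreTensor A Q P →ₗ[K] PreTensor A Q P :=
  TensorProduct.map Q.par (TensorProduct.map A.sgn.toLinearMap P.par)

lemma prePar_degenerate (Q P : GrSpace K) :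
    degenerate A Q P ≤ (degenerate A Q P).comap (prePar A Q P) := by
  refine Submodule.span_le.2 ?_
  rintro _ ⟨q, u, w, p, rfl⟩
  have h : A.sgn (u * TensorAlgebra.ι K A.unit * w) =
      -(A.sgn u * TensorAlgebra.ι K A.unit * A.sgn w) := by
    rw [map_mul, map_mul, A.sgn_unit]; simp
  simp only [Submodule.comap_coe, Set.mem_preimage, SetLike.mem_coe, prePar,
    TensorProduct.map_tmul, AlgHom.toLinearMap_apply, h, TensorProduct.neg_tmul,
    TensorProduct.tmul_neg]
  exact neg_mem (mem_degenerate _ _ _ _)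

/-- Linear maps on `Q ⊗ T(Ā[1]) ⊗ P` that agree on generators are equal. -/
lemma preTensor_qext {Q P : GrSpace K} {W : Type u} [AddCommGroup W] [Module K W]
    {f g : (PreTensor A Q P ⧸ degenerate A Q P) →ₗ[K] W}
    (h : ∀ q b p, f (Submodule.Quotient.mk (q ⊗ₜ (b ⊗ₜ p))) =
      g (Submodule.Quotient.mk (q ⊗ₜ (b ⊗ₜ p)))) : f = g := by
  apply Submodule.linearMap_qext
  ext q b p
  exact h q b p

/-- The tensor product `Q ⊗_A P`, with underlying space `Q ⊗ T(Ā[1]) ⊗ P`, where `T(Ā[1])`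
is the quotient of `T(A[1])` by all words that contain the unit. -/
def tensor (Q P : BimoduleData A) : BimoduleData A where
  carrier := PreTensor A Q.toGrSpace P.toGrSpace ⧸ degenerate A Q.toGrSpace P.toGrSpace
  gr n := Submodule.span K {z | ∃ i j k q b p, q ∈ Q.gr i ∧ HomWord A.gr (-1) j b ∧ p ∈ P.gr k ∧
    n = i + j + k ∧ z = Submodule.Quotient.mk (q ⊗ₜ[K] (b ⊗ₜ[K] p))}
  par := Submodule.mapQ _ _ (prePar A Q.toGrSpace P.toGrSpace) (prePar_degenerate _ _)
  op := descend A (preOp Q P) (preOp_degenerate Q P)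
  unit_left x x' y z := by
    refine DFunLike.congr_fun (f := descend A (preOp Q P) (preOp_degenerate Q P)
      (x * TensorAlgebra.ι K A.unit * x') y) (g := -((aug x * aug x' * aug y) •
      Submodule.mapQ _ _ (prePar A Q.toGrSpace P.toGrSpace) (prePar_degenerate _ _))) ?_ z
    apply preTensor_qext
    intro q b p
    simp only [descend, LinearMap.mk₂_apply, LinearMap.neg_apply, LinearMap.smul_apply,
      Submodule.mapQ_apply, ← Submodule.Quotient.mk_smul, ← Submodule.Quotient.mk_neg]
    congr 1
    simp only [preOp, LinearMap.add_apply, preMid_tmul, preRight_tmul, preLeft_tmul, map_mul,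
      aug_ι, mul_zero, zero_mul, zero_smul, add_zero]
    obtain ⟨c, hc⟩ : ∃ c : K, c = -(aug x * aug x') := ⟨_, rfl⟩
    rw [deconc_congr _ (c • (TensorProduct.mk K Q.carrier _ (Q.par q) ∘ₗ
        (TensorProduct.mk K (Bar A.toGrSpace) P.carrier).flip (P.par p) ∘ₗ A.sgn.toLinearMap ∘ₗ
        TensorProduct.lift ((LinearMap.lsmul K (Bar A.toGrSpace)).comp
          (aug (K := K) (E := A.carrier)).toLinearMap)))]
    · simp only [LinearMap.smul_apply, LinearMap.comp_apply, deconc_aug_left,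
          LinearMap.flip_apply, TensorProduct.mk_apply, smul_smul, AlgHom.toLinearMap_apply]
      rw [← neg_smul]
      have : aug y * c = -(aug x * aug x' * aug y) := by rw [hc]; ring
      rw [this]; rfl
    · intro a b
      have : -((aug x * aug x' * aug a) • Q.par q) = (c * aug a) • Q.par q := by
        rw [hc, ← neg_smul]; congr 1; ring
      have s1 : A.sgnPow 1 = A.sgn.toLinearMap := by simp [GrSpace.sgnPow]
      have p1 : P.parPow 1 = P.par := by simp [GrSpace.parPow]
      simp only [LinearMap.comp_apply, LinearMap.smul_apply, s1, p1,
          TensorProduct.map_tmul, LinearMap.flip_apply,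
          TensorProduct.mk_apply, AlgHom.toLinearMap_apply, Q.unit_left,
          TensorProduct.lift.tmul, LinearMap.lsmul_apply, map_smul,
          this, smul_smul, ← TensorProduct.smul_tmul']
  unit_right x y y' z := by
    refine DFunLike.congr_fun (f := descend A (preOp Q P) (preOp_degenerate Q P)
      x (y * TensorAlgebra.ι K A.unit * y')) (g := ((aug x * aug y * aug y') •
      LinearMap.id)) ?_ z
    apply preTensor_qext
    intro q b p
    simp only [descend, LinearMap.mk₂_apply, LinearMap.smul_apply,
      Submodule.mapQ_apply, LinearMap.id_apply, ← Submodule.Quotient.mk_smul]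
    congr 1
    simp only [preOp, LinearMap.add_apply, preMid_tmul, preRight_tmul, preLeft_tmul, map_mul,
      aug_ι, mul_zero, zero_mul, zero_smul, zero_add]
    rw [deconc_congr _ ((aug y * aug y') • (TensorProduct.mk K Q.carrier _ q ∘ₗ
        (TensorProduct.mk K (Bar A.toGrSpace) P.carrier).flip p ∘ₗ
        TensorProduct.lift ((LinearMap.lsmul K (Bar A.toGrSpace)).comp
          (aug (K := K) (E := A.carrier)).toLinearMap).flip))]
    · simp only [LinearMap.smul_apply, LinearMap.comp_apply, deconc_aug_right,
          LinearMap.flip_apply, TensorProduct.mk_apply, smul_smul, mul_assoc]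
    · intro a b
      have : aug b * aug y * aug y' = aug y * aug y' * aug b := by ring
      simp only [LinearMap.comp_apply, LinearMap.smul_apply,
          TensorProduct.map_tmul, LinearMap.flip_apply,
          TensorProduct.mk_apply, AlgHom.toLinearMap_apply, P.unit_right, LinearMap.id_apply,
          TensorProduct.lift.tmul, LinearMap.lsmul_apply, map_smul,
          this, smul_smul, ← TensorProduct.smul_tmul', TensorProduct.tmul_smul]

/-- The tensor powers `P^{⊗_A i}`. -/
def tensorPow (P : BimoduleData A) : ℕ → BimoduleData A
  | 0 => diagonal A
  | 1 => P
  | (i + 2) => tensor P (tensorPow P (i + 1))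

/-- `φ ⊗ id_R : P ⊗_A R → Q ⊗_A R` for `φ : P → Q` of degree `d`. -/
def tensorId (d : ℤ) {P Q : BimoduleData A} (φ : homDeg (A := A) P.toGrSpace Q.toGrSpace d)
    (R : BimoduleData A) : Cochain A (tensor P R).toGrSpace (tensor Q R).toGrSpace :=
  descend A (preLeft d φ.1 R.toGrSpace) (preLeft_degenerate_of_normalized d φ.2.1 _)

/-- `id_R ⊗ φ : R ⊗_A P → R ⊗_A Q` for `φ : P → Q` of degree `d`. -/
def idTensor (d : ℤ) {P Q : BimoduleData A} (φ : homDeg (A := A) P.toGrSpace Q.toGrSpace d)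
    (R : BimoduleData A) : Cochain A (tensor R P).toGrSpace (tensor R Q).toGrSpace :=
  descend A (preRight φ.1 R.toGrSpace) (preRight_degenerate_of_normalized φ.2.1 _)

/-- The map underlying `evalLeft`. -/
def preEvalLeft (P : BimoduleData A) (x y : Bar A.toGrSpace) :
    PreTensor A A.toGrSpace P.toGrSpace →ₗ[K] P.carrier :=
  -(TensorProduct.lift ((P.op.flip (A.sgn y)).compl₁₂
      (TensorProduct.lift ((insertLetter A.carrier x).flip.compl₂ A.sgn.toLinearMap)) P.par) ∘ₗ
    (TensorProduct.assoc K A.carrier (Bar A.toGrSpace) P.carrier).symm.toLinearMap)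

@[simp] lemma preEvalLeft_tmul (P : BimoduleData A) (x y b : Bar A.toGrSpace) (a : A.carrier)
    (p : P.carrier) : preEvalLeft P x y (a ⊗ₜ (b ⊗ₜ p)) =
      -P.op (x * TensorAlgebra.ι K a * A.sgn b) (A.sgn y) (P.par p) := rfl

/-- The map underlying `evalRight`. -/
def preEvalRight (P : BimoduleData A) (x y : Bar A.toGrSpace) :
    PreTensor A P.toGrSpace A.toGrSpace →ₗ[K] P.carrier :=
  TensorProduct.lift ((P.op x).flip.compl₂
    (TensorProduct.lift ((insertLetter A.carrier).flip (A.sgn y))))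

@[simp] lemma preEvalRight_tmul (P : BimoduleData A) (x y b : Bar A.toGrSpace) (a : A.carrier)
    (p : P.carrier) : preEvalRight P x y (p ⊗ₜ (b ⊗ₜ a)) =
      P.op x (b * TensorAlgebra.ι K a * A.sgn y) p := rfl

lemma preEvalLeft_degenerate (P : BimoduleData A) (x y : Bar A.toGrSpace) :
    degenerate A A.toGrSpace P.toGrSpace ≤ LinearMap.ker (preEvalLeft P x y) := by
  refine Submodule.span_le.2 ?_
  rintro _ ⟨a, u, w, p, rfl⟩
  have h : x * TensorAlgebra.ι K a * A.sgn (u * TensorAlgebra.ι K A.unit * w) =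
      -((x * TensorAlgebra.ι K a * A.sgn u) * TensorAlgebra.ι K A.unit * A.sgn w) := by
    rw [map_mul, map_mul, A.sgn_unit]; simp [mul_assoc]
  rw [SetLike.mem_coe, LinearMap.mem_ker, preEvalLeft_tmul, h, map_neg, LinearMap.neg_apply,
    LinearMap.neg_apply, P.unit_left]
  simp

lemma preEvalRight_degenerate (P : BimoduleData A) (x y : Bar A.toGrSpace) :
    degenerate A P.toGrSpace A.toGrSpace ≤ LinearMap.ker (preEvalRight P x y) := by
  refine Submodule.span_le.2 ?_
  rintro _ ⟨p, u, w, a, rfl⟩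
  have h : u * TensorAlgebra.ι K A.unit * w * TensorAlgebra.ι K a * A.sgn y =
      u * TensorAlgebra.ι K A.unit * (w * TensorAlgebra.ι K a * A.sgn y) := by
    simp [mul_assoc]
  rw [SetLike.mem_coe, LinearMap.mem_ker, preEvalRight_tmul, h, P.unit_right]
  simp

/-- The map `evalLeft`, on the underlying spaces. -/
def evalLeftAux (P : BimoduleData A) : Bar A.toGrSpace →ₗ[K] Bar A.toGrSpace →ₗ[K]
    (PreTensor A A.toGrSpace P.toGrSpace ⧸ degenerate A A.toGrSpace P.toGrSpace) →ₗ[K] P.carrier :=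
  LinearMap.mk₂ K
    (fun x y => Submodule.liftQ _ (preEvalLeft P x y) (preEvalLeft_degenerate P x y))
    (fun x x' y => preTensor_qext fun a b p => by
      rw [LinearMap.add_apply]
      simp only [Submodule.liftQ_apply, preEvalLeft_tmul, add_mul, map_add, LinearMap.add_apply]
      abel)
    (fun c x y => preTensor_qext fun a b p => by
      rw [LinearMap.smul_apply]
      simp only [Submodule.liftQ_apply, preEvalLeft_tmul, smul_mul_assoc, map_smul,
        LinearMap.smul_apply, smul_neg])
    (fun x y y' => preTensor_qext fun a b p => by
      rw [LinearMap.add_apply]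
      simp only [Submodule.liftQ_apply, preEvalLeft_tmul, map_add, LinearMap.add_apply]
      abel)
    (fun c x y => preTensor_qext fun a b p => by
      rw [LinearMap.smul_apply]
      simp only [Submodule.liftQ_apply, preEvalLeft_tmul, map_smul,
        LinearMap.smul_apply, smul_neg])

/-- The map `evalRight`, on the underlying spaces. -/
def evalRightAux (P : BimoduleData A) : Bar A.toGrSpace →ₗ[K] Bar A.toGrSpace →ₗ[K]
    (PreTensor A P.toGrSpace A.toGrSpace ⧸ degenerate A P.toGrSpace A.toGrSpace) →ₗ[K] P.carrier :=
  LinearMap.mk₂ K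
    (fun x y => Submodule.liftQ _ (preEvalRight P x y) (preEvalRight_degenerate P x y))
    (fun x x' y => preTensor_qext fun a b p => by
      rw [LinearMap.add_apply]
      simp only [Submodule.liftQ_apply, preEvalRight_tmul, map_add, LinearMap.add_apply])
    (fun c x y => preTensor_qext fun a b p => by
      rw [LinearMap.smul_apply]
      simp only [Submodule.liftQ_apply, preEvalRight_tmul, map_smul, LinearMap.smul_apply])
    (fun x y y' => preTensor_qext fun a b p => by
      rw [LinearMap.add_apply]
      simp only [Submodule.liftQ_apply, preEvalRight_tmul, map_add, mul_add, LinearMap.add_apply])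
    (fun c x y => preTensor_qext fun a b p => by
      rw [LinearMap.smul_apply]
      simp only [Submodule.liftQ_apply, preEvalRight_tmul, map_smul, mul_smul_comm,
        LinearMap.smul_apply])

/-- The canonical quasi-isomorphism `A ⊗_A P → P`,
`(x; a ⊗ b ⊗ p; y) ↦ (-1)^{‖b‖ + |p| + ‖y‖ + 1} μ_P(x, a, b; p; y)`; on cohomology it maps
`[e] ⊗ [p]` to `[p]`. -/
def evalLeft (P : BimoduleData A) : Cochain A (tensor (diagonal A) P).toGrSpace P.toGrSpace :=
  evalLeftAux P

/-- The canonical quasi-isomorphism `P ⊗_A A → P`,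
`(x; p ⊗ b ⊗ a; y) ↦ (-1)^{‖y‖} μ_P(x; p; b, a, y)`; on cohomology it maps `[p] ⊗ [e]`
to `[p]`. -/
def evalRight (P : BimoduleData A) : Cochain A (tensor P (diagonal A)).toGrSpace P.toGrSpace :=
  evalRightAux P

/-- `P` is invertible with respect to the tensor product over `A`. -/
def Invertible (P : BimoduleData A) : Prop :=
  ∃ P' : BimoduleData A, IsBimodule P' ∧
    (∃ f : Cochain A (tensor P' P).toGrSpace (diagonal A).toGrSpace,
      IsQuasiIso (P := tensor P' P) (Q := diagonal A) f) ∧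
    (∃ g : Cochain A (tensor P P').toGrSpace (diagonal A).toGrSpace,
      IsQuasiIso (P := tensor P P') (Q := diagonal A) g)

end TensorBimodule

section SelfConjugation

variable {K : Type u} [Field K] {A : AInfAlgebra K} (P : BimoduleData A)

/-- The composition `P ⊗_A P → P ⊗_A A ≃ P` of `id_P ⊗ φ` and the canonical map, for
`φ : P → A` of degree `d`. -/
def conjLeft (d : ℤ) (φ : homDeg (A := A) P.toGrSpace (diagonal A).toGrSpace d) :
    Cochain A (tensor P P).toGrSpace P.toGrSpace :=
  Cochain.comp d (evalRight P) (idTensor (Q := diagonal A) d φ P)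

/-- The composition `P ⊗_A P → A ⊗_A P ≃ P` of `φ ⊗ id_P` and the canonical map, for
`φ : P → A` of degree `d`. -/
def conjRight (d : ℤ) (φ : homDeg (A := A) P.toGrSpace (diagonal A).toGrSpace d) :
    Cochain A (tensor P P).toGrSpace P.toGrSpace :=
  Cochain.comp d (evalLeft P) (tensorId (Q := diagonal A) d φ P)

/-- `κ` is the self-conjugation map `K_1` in degree `d`: the endomorphism of
`H^d(hom_{[A,A]}(P, A))` such that `κ [φ] = [ψ]` if and only if `id_P ⊗ φ` and `ψ ⊗ id_P` define
the same class in `H^d(hom_{[A,A]}(P ⊗_A P, P))`. This determines `κ` uniquely. -/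
def IsSelfConjugation (d : ℤ)
    (κ : HomCoh P (diagonal A) d ≃ₗ[K] HomCoh P (diagonal A) d) : Prop :=
  ∀ φ ψ : cocycles P (diagonal A) d,
    κ (Submodule.Quotient.mk φ) = Submodule.Quotient.mk ψ ↔
      conjLeft P d ⟨φ.1, φ.2.1⟩ - conjRight P d ⟨ψ.1, ψ.2.1⟩ ∈ coboundaries (tensor P P) P d

end SelfConjugation

section Divisors

variable {K : Type u} [Field K] {A : AInfAlgebra K} (P : BimoduleData A)

/-- The graded space `B = A ⊕ P[1]`. -/
abbrev extSpace : GrSpace K where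
  carrier := A.carrier × P.carrier
  gr n := (A.gr n).prod (P.gr (n + 1))
  par := A.par.prodMap (-P.par)

/-- The inclusion `T(A[1]) ⊂ T(B[1])`. -/
def inA : Bar A.toGrSpace →ₐ[K] Bar (extSpace P) :=
  TensorAlgebra.lift K (TensorAlgebra.ι K ∘ₗ LinearMap.inl K A.carrier P.carrier)

/-- The word `x ⊗ p ⊗ y` in `T(A[1]) ⊗ P[2] ⊗ T(A[1]) ⊂ T(B[1])`. -/
def onceP (x y : Bar A.toGrSpace) (p : P.carrier) : Bar (extSpace P) :=
  inA P x * TensorAlgebra.ι K ((0, p) : A.carrier × P.carrier) * inA P y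

/-- `μ` is a noncommutative divisor on `A` with underlying bimodule `P`: a strictly unital
`A_∞`-structure on `B = A ⊕ P[1]`, with the unit of `A`, such that `A ⊂ B` is an
`A_∞`-subalgebra and the induced bimodule structure on `B / A = P[1]` is the given one. -/
structure IsDivisor (μ : Bar (extSpace P) →ₗ[K] (extSpace P)) : Prop where
  isAInf : IsAInf (extSpace P) (A.unit, 0) μ
  subalgebra : ∀ x, μ (inA P x) = (A.mu x, 0)
  quotient : ∀ x y p, (μ (onceP P x y p)).2 = P.op x y p

/-- The section of a noncommutative divisor: the component
`T(A[1]) ⊗ P ⊗ T(A[1]) → A` of `μ`. -/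
def sectionCochain (μ : Bar (extSpace P) →ₗ[K] (extSpace P)) :
    Cochain A P.toGrSpace A.toGrSpace :=
  ((insertLetter (A.carrier × P.carrier)).compl₁₂ (inA P).toLinearMap
      (inA P).toLinearMap).compr₂
    (LinearMap.lcomp K A.carrier (LinearMap.inr K A.carrier P.carrier) ∘ₗ
      LinearMap.llcomp K (A.carrier × P.carrier) (Bar (extSpace P)) A.carrier
        (LinearMap.fst K A.carrier P.carrier ∘ₗ μ))

lemma sectionCochain_apply (μ : Bar (extSpace P) →ₗ[K] (extSpace P)) (x y : Bar A.toGrSpace)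
    (p : P.carrier) : sectionCochain P μ x y p = (μ (onceP P x y p)).1 := rfl

@[simp] lemma inA_ι (a : A.carrier) : inA P (TensorAlgebra.ι K a) =
    TensorAlgebra.ι K ((a, 0) : A.carrier × P.carrier) := by
  simp [inA]

@[simp] lemma aug_inA (x : Bar A.toGrSpace) : aug (inA P x) = aug x := by
  have : (aug (K := K) (E := A.carrier × P.carrier)).comp (inA P) =
      aug (K := K) (E := A.carrier) := by
    ext a
    change aug (inA P (TensorAlgebra.ι K a)) = aug (TensorAlgebra.ι K a)
    rw [inA_ι, aug_ι, aug_ι]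
  exact DFunLike.congr_fun this x

lemma sgn_inA (x : Bar A.toGrSpace) : (extSpace P).sgn (inA P x) = inA P (A.sgn x) := by
  have : ((extSpace P).sgn).comp (inA P) = (inA P).comp A.sgn := by
    ext a
    change (extSpace P).sgn (inA P (TensorAlgebra.ι K a)) = inA P (A.sgn (TensorAlgebra.ι K a))
    rw [inA_ι, sgn_ι, sgn_ι, map_neg, inA_ι]
    simp
  exact DFunLike.congr_fun this x

lemma deconc_inA (x : Bar A.toGrSpace) : deconc (inA P x) =
    TensorProduct.map (inA P).toLinearMap (inA P).toLinearMap (deconc x) := by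
  induction x using word_induction with
  | h0 => simp
  | hι a x hx =>
    rw [deconc_ι_mul_map, map_mul, inA_ι, deconc_ι_mul, hx]
    congr 1
    · simp
    · rw [← LinearMap.mulLeft_apply (R := K), ← LinearMap.comp_apply]
      apply deconc_congr
      intro b c
      simp
  | hadd x y hx hy => simp only [map_add, hx, hy]
  | hsmul c x hx => simp only [map_smul, hx]

variable {P}

lemma deconc_inA_congr {W : Type u} [AddCommGroup W] [Module K W]
    (f : Bar (extSpace P) ⊗[K] Bar (extSpace P) →ₗ[K] W)
    (g : Bar A.toGrSpace ⊗[K] Bar A.toGrSpace →ₗ[K] W)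
    (h : ∀ a b, f (inA P a ⊗ₜ inA P b) = g (a ⊗ₜ b)) (x : Bar A.toGrSpace) :
    f (deconc (inA P x)) = g (deconc x) := by
  rw [deconc_inA, ← LinearMap.comp_apply]
  apply deconc_congr
  intro a b
  simpa using h a b

/-- `(ψ ∘ φ)(x; p; y) = ∑ (-1)^{d ‖y''‖} ψ(x'; φ(x''; p; y'); y'')` on words. -/
lemma comp_word {P Q R : GrSpace K} (d : ℤ) (ψ : Cochain A Q R) (φ : Cochain A P Q)
    (l m : List A.carrier) (p : P) :
    Cochain.comp d ψ φ (word l) (word m) p =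
      ∑ i ∈ Finset.range (l.length + 1), ∑ j ∈ Finset.range (m.length + 1),
        ψ (word (l.take i)) (A.sgnPow d (word (m.drop j)))
          (φ (word (l.drop i)) (word (m.take j)) p) := by
  let ev : (P →ₗ[K] R) →ₗ[K] R := LinearMap.applyₗ p
  simp only [Cochain.comp, conv_word, LinearMap.sum_apply, LinearMap.comp_apply,
    LinearMap.flip_apply]
  rfl

lemma HomWord.mul {E : Type u} [AddCommGroup E] [Module K E] {𝒢 : ℤ → Submodule K E} {c : ℤ}
    {m n : ℤ} {x y : TensorAlgebra K E} (hx : HomWord 𝒢 c m x) (hy : HomWord 𝒢 c n y) :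
    HomWord 𝒢 c (m + n) (x * y) := by
  induction hx with
  | nil => simpa using hy
  | cons he _ ih => rw [mul_assoc, add_assoc]; exact HomWord.cons he ih

lemma HomWord.inA {n : ℤ} {x : Bar A.toGrSpace} (hx : HomWord A.gr (-1) n x) :
    HomWord (extSpace P).gr (-1) n (NCPencil.inA P x) := by
  induction hx with
  | nil => simpa using HomWord.nil
  | cons he _ ih =>
    rw [map_mul, inA_ι]
    exact HomWord.cons (Submodule.mem_prod.2 ⟨he, zero_mem _⟩) ih

lemma map_unit_inA {μ : Bar (extSpace P) →ₗ[K] (extSpace P)} (h : IsDivisor P μ)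
    (x x' : Bar (extSpace P)) :
    μ (x * inA P (TensorAlgebra.ι K A.unit) * x') =
      aug x • (extSpace P).par (len1 x') + aug x' • len1 x := by
  rw [inA_ι]
  exact h.isAInf.unital x x'

lemma section_normalized {μ : Bar (extSpace P) →ₗ[K] (extSpace P)} (h : IsDivisor P μ) :
    (sectionCochain P μ).Normalized := by
  constructor
  · intro x x' y
    ext p
    rw [sectionCochain_apply, onceP, map_mul (inA P), map_mul (inA P), mul_assoc, mul_assoc, map_unit_inA h]
    simp [len1_mul, ← mul_assoc]
  · intro x y y'
    ext p
    rw [sectionCochain_apply, onceP, map_mul (inA P), map_mul (inA P)]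
    simp only [← mul_assoc]
    rw [map_unit_inA h]
    simp [len1_mul]

lemma HomWord.onceP {k m n : ℤ} {x y : Bar A.toGrSpace} {p : P.carrier}
    (hx : HomWord A.gr (-1) k x) (hy : HomWord A.gr (-1) n y) (hp : p ∈ P.gr m) :
    HomWord (extSpace P).gr (-1) (k + (((m - 1) + -1) + n)) (NCPencil.onceP P x y p) := by
  rw [NCPencil.onceP, mul_assoc]
  refine hx.inA.mul (HomWord.cons ?_ hy.inA)
  exact Submodule.mem_prod.2 ⟨zero_mem _, by simpa using hp⟩

lemma section_mem_homDeg {μ : Bar (extSpace P) →ₗ[K] (extSpace P)} (h : IsDivisor P μ) :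
    sectionCochain P μ ∈ homDeg P.toGrSpace A.toGrSpace 0 := by
  refine ⟨section_normalized h, fun k m n x y p hx hy hp => ?_⟩
  have := (Submodule.mem_prod.1 (h.isAInf.degree _ _ (hx.onceP hy hp))).1
  rw [sectionCochain_apply]
  convert this using 2
  ring

/-- The `A`-component of `μ` on words with exactly one letter in `P`. -/
lemma map_onceP {μ : Bar (extSpace P) →ₗ[K] (extSpace P)} (h : IsDivisor P μ)
    (x y : Bar A.toGrSpace) (p : P.carrier) :
    μ (onceP P x y p) = (sectionCochain P μ x y p, P.op x y p) :=
  Prod.ext rfl (h.quotient x y p)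

/-- The inner part of `coder`. -/
def GrSpace.coderAux (M : GrSpace K) (μ : Bar M →ₗ[K] M) : Bar M →ₗ[K] Bar M :=
  conv (LinearMap.mul K (Bar M)) (TensorAlgebra.ι K ∘ₗ μ) M.sgn.toLinearMap

lemma coderAux_inA {μ : Bar (extSpace P) →ₗ[K] (extSpace P)} (h : IsDivisor P μ)
    (x : Bar A.toGrSpace) : (extSpace P).coderAux μ (inA P x) = inA P (A.coderAux A.mu x) := by
  rw [GrSpace.coderAux, GrSpace.coderAux, conv_apply, conv_apply]
  refine deconc_inA_congr _ ((inA P).toLinearMap ∘ₗ TensorProduct.lift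
    ((LinearMap.mul K (Bar A.toGrSpace)).compl₁₂ (TensorAlgebra.ι K ∘ₗ A.mu)
        A.sgn.toLinearMap)) (fun a b => ?_) x
  simp only [TensorProduct.lift.tmul, LinearMap.compl₁₂_apply, LinearMap.mul_apply',
    LinearMap.comp_apply, AlgHom.toLinearMap_apply, map_mul, h.subalgebra, inA_ι]
  congr 1
  exact sgn_inA P b

/-- `y ↦ (x ⊗ p ⊗ y)`. -/
def onceR (P : BimoduleData A) (x : Bar A.toGrSpace) (p : P.carrier) :
    Bar A.toGrSpace →ₗ[K] Bar (extSpace P) :=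
  LinearMap.mulLeft K (inA P x * TensorAlgebra.ι K ((0, p) : A.carrier × P.carrier)) ∘ₗ
    (inA P).toLinearMap

lemma sgn_once (p : P.carrier) :
    (extSpace P).sgn (TensorAlgebra.ι K ((0, p) : A.carrier × P.carrier)) =
      TensorAlgebra.ι K ((0, P.par p) : A.carrier × P.carrier) := by
  rw [sgn_ι, ← map_neg]
  simp

lemma coderAux_onceP {μ : Bar (extSpace P) →ₗ[K] (extSpace P)} (h : IsDivisor P μ)
    (x y : Bar A.toGrSpace) (p : P.carrier) :
    (extSpace P).coderAux μ (onceP P x y p) =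
      onceP P (A.coderAux A.mu x) (A.sgn y) (P.par p) +
      TensorProduct.lift ((LinearMap.mul K (Bar (extSpace P))).compl₁₂
        (TensorAlgebra.ι K ∘ₗ μ ∘ₗ onceR P x p) ((inA P).toLinearMap ∘ₗ A.sgn.toLinearMap))
        (deconc y) := by
  rw [GrSpace.coderAux, conv_apply, onceP, deconc_unit]
  congr 1
  · rw [onceP, ← coderAux_inA h, GrSpace.coderAux, conv_apply, ← sgn_inA, ← sgn_once]
    rw [mul_assoc, ← map_mul ((extSpace P).sgn)]
    refine deconc_congr _ (LinearMap.mulRight K ((extSpace P).sgn (TensorAlgebra.ι K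
      ((0, p) : A.carrier × P.carrier) * inA P y)) ∘ₗ TensorProduct.lift
        ((LinearMap.mul K (Bar (extSpace P))).compl₁₂ (TensorAlgebra.ι K ∘ₗ μ)
          (extSpace P).sgn.toLinearMap)) (fun a b => ?_) (inA P x)
    simp [mul_assoc]
  · apply deconc_inA_congr
    intro a b
    simp only [LinearMap.comp_apply, LinearMap.mulLeft_apply,
      Algebra.TensorProduct.tmul_mul_tmul, TensorProduct.lift.tmul, LinearMap.compl₁₂_apply,
      LinearMap.mul_apply', AlgHom.toLinearMap_apply, one_mul]
    congr 1
    exact sgn_inA P b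

lemma coder_onceP {μ : Bar (extSpace P) →ₗ[K] (extSpace P)} (h : IsDivisor P μ)
    (x y : Bar A.toGrSpace) (p : P.carrier) :
    (μ ((extSpace P).coder μ (onceP P x y p))).1 =
      sectionCochain P μ (A.coder A.mu x) (A.sgn y) (P.par p) +
      (Cochain.comp 1 (sectionCochain P μ) P.op x y p -
      Cochain.comp 0 (diagonal A).op (sectionCochain P μ) x y p) +
      sectionCochain P μ x (A.coder A.mu y) p := by
  let F : Bar (extSpace P) →ₗ[K] A.carrier := LinearMap.fst K A.carrier P.carrier ∘ₗ μ
  let ev : (Bar A.toGrSpace →ₗ[K] P.carrier →ₗ[K] A.carrier) →ₗ[K] A.carrier :=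
    LinearMap.applyₗ p ∘ₗ LinearMap.applyₗ y
  change F _ = _
  rw [GrSpace.coder, conv_apply]
  change F (TensorProduct.lift ((LinearMap.mul K (Bar (extSpace P))).compl₁₂ LinearMap.id
    ((extSpace P).coderAux μ)) (deconc _)) = _
  rw [← LinearMap.comp_apply, onceP, deconc_unit]
  congr 1
  · let L1 : Bar A.toGrSpace ⊗[K] Bar A.toGrSpace →ₗ[K] A.carrier :=
      (((sectionCochain P μ).flip (A.sgn y)).flip (P.par p)) ∘ₗ TensorProduct.lift
        ((LinearMap.mul K (Bar A.toGrSpace)).compl₁₂ LinearMap.id (A.coderAux A.mu))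
    let Lc (d : ℤ) (Q : GrSpace K) (ψ : Cochain A Q A.toGrSpace)
        (φ : Cochain A P.toGrSpace Q) : Bar A.toGrSpace ⊗[K] Bar A.toGrSpace →ₗ[K] A.carrier :=
      ev ∘ₗ TensorProduct.lift
        (((conv (LinearMap.llcomp K P.carrier Q.carrier A.carrier).flip).flip ∘ₗ
          LinearMap.lcomp K (Q.carrier →ₗ[K] A.carrier) (A.sgnPow d)).compl₁₂ ψ φ)
    have e : sectionCochain P μ (A.coder A.mu x) (A.sgn y) (P.par p) +
      (Cochain.comp 1 (sectionCochain P μ) P.op x y p -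
      Cochain.comp 0 (diagonal A).op (sectionCochain P μ) x y p) =
      (L1 + (Lc 1 P.toGrSpace (sectionCochain P μ) P.op -
        Lc 0 A.toGrSpace (diagonal A).op (sectionCochain P μ))) (deconc x) := rfl
    rw [e]
    apply deconc_inA_congr
    intro a b
    rw [LinearMap.comp_apply, LinearMap.mulRight_apply, Algebra.TensorProduct.tmul_mul_tmul,
      mul_one, ← mul_assoc (inA P b), LinearMap.comp_apply, TensorProduct.lift.tmul]
    change F (inA P a * (extSpace P).coderAux μ (onceP P b y p)) = _
    rw [coderAux_onceP h, mul_add, map_add, LinearMap.add_apply]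
    congr 1
    · change _ = F (inA P (a * A.coderAux A.mu b) * _ * _)
      simp only [onceP, map_mul (inA P), mul_assoc]
      rfl
    · let I (d : ℤ) (Q : GrSpace K) (ψ : Cochain A Q A.toGrSpace) (φ : Cochain A P.toGrSpace Q) :
          Bar A.toGrSpace ⊗[K] Bar A.toGrSpace →ₗ[K] A.carrier :=
        (LinearMap.applyₗ p : (P.carrier →ₗ[K] A.carrier) →ₗ[K] A.carrier) ∘ₗ
          TensorProduct.lift ((LinearMap.llcomp K P.carrier Q.carrier A.carrier).flip.compl₁₂
            (φ b) (ψ a ∘ₗ A.sgnPow d))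
      refine deconc_congr (F ∘ₗ LinearMap.mulLeft K (inA P a) ∘ₗ TensorProduct.lift
        ((LinearMap.mul K (Bar (extSpace P))).compl₁₂
        (TensorAlgebra.ι K ∘ₗ μ ∘ₗ onceR P b p) ((inA P).toLinearMap ∘ₗ A.sgn.toLinearMap)))
        (I 1 P.toGrSpace (sectionCochain P μ) P.op -
          I 0 A.toGrSpace (diagonal A).op (sectionCochain P μ)) (fun c d => ?_) y
      change F (inA P a * (TensorAlgebra.ι K (μ (onceP P b c p)) * inA P (A.sgn d))) =
        sectionCochain P μ a (A.sgnPow 1 d) (P.op b c p) -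
          -A.mu (a * TensorAlgebra.ι K (sectionCochain P μ b c p) * A.sgn (A.sgnPow 0 d))
      have s1 : A.sgnPow 1 d = A.sgn d := by simp [GrSpace.sgnPow]
      have s0 : A.sgnPow 0 d = d := by simp [GrSpace.sgnPow]
      have e1 : μ (onceP P b c p) = ((sectionCochain P μ b c p, 0) : A.carrier × P.carrier) +
          ((0, P.op b c p) : A.carrier × P.carrier) := by
        rw [map_onceP h]; simp
      have e2 : F (inA P a * (TensorAlgebra.ι K
          ((sectionCochain P μ b c p, 0) : A.carrier × P.carrier) * inA P (A.sgn d))) =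
          A.mu (a * TensorAlgebra.ι K (sectionCochain P μ b c p) * A.sgn d) := by
        rw [← inA_ι, ← map_mul, ← map_mul, ← mul_assoc]
        exact congrArg Prod.fst (h.subalgebra _)
      have e3 : F (inA P a * (TensorAlgebra.ι K
          ((0, P.op b c p) : A.carrier × P.carrier) * inA P (A.sgn d))) =
          sectionCochain P μ a (A.sgn d) (P.op b c p) := by
        rw [← mul_assoc]; rfl
      rw [s1, s0, e1, map_add (TensorAlgebra.ι K), add_mul, mul_add, map_add, e2, e3,
        sub_neg_eq_add, add_comm]
  · change _ = F (onceP P x (A.coder A.mu y) p)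
    have e : F (onceP P x (A.coder A.mu y) p) = (F ∘ₗ onceR P x p ∘ₗ TensorProduct.lift
        ((LinearMap.mul K (Bar A.toGrSpace)).compl₁₂ LinearMap.id (A.coderAux A.mu)))
          (deconc y) := rfl
    rw [e]
    apply deconc_inA_congr
    intro a b
    simp only [LinearMap.comp_apply, LinearMap.mulLeft_apply,
      Algebra.TensorProduct.tmul_mul_tmul, TensorProduct.lift.tmul, LinearMap.compl₁₂_apply,
      LinearMap.mul_apply', one_mul, LinearMap.id_apply, onceR, coderAux_inA h,
      AlgHom.toLinearMap_apply, map_mul (inA P), mul_assoc]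

/-- The section of a noncommutative divisor is a bimodule map `P → A`. -/
lemma section_mem_cocycles {μ : Bar (extSpace P) →ₗ[K] (extSpace P)} (h : IsDivisor P μ) :
    sectionCochain P μ ∈ cocycles P (diagonal A) 0 := by
  refine ⟨section_mem_homDeg h, ?_⟩
  change diff P (diagonal A) 0 (sectionCochain P μ) = 0
  refine LinearMap.ext fun x => LinearMap.ext fun y => LinearMap.ext fun p => ?_
  have h1 := coder_onceP h x y p
  rw [h.isAInf.assoc] at h1
  have h2 : diff P (diagonal A) 0 (sectionCochain P μ) x y p =
      Cochain.comp 0 (diagonal A).op (sectionCochain P μ) x y p - ksign K 0 •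
        (Cochain.comp 1 (sectionCochain P μ) P.op x y p +
          (sectionCochain P μ x (A.coder A.mu y) p +
            sectionCochain P μ (A.coder A.mu x) (A.sgn y) (P.par p))) := rfl
  have h3 : ksign K 0 = 1 := by simp [ksign]
  have h4 : ((0 : A.carrier × P.carrier)).1 = 0 := rfl
  rw [h2, h3, one_smul, LinearMap.zero_apply, LinearMap.zero_apply, LinearMap.zero_apply]
  change (0 : A.carrier) = _ at h1
  rw [← neg_eq_zero, h1]
  abel

end Divisors

section Pencils

variable {K : Type u} [Field K] {A : AInfAlgebra K} (P : BimoduleData A)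

/-- The section of a noncommutative divisor, as a class in `H^0(hom_{[A,A]}(P, A))`. -/
def divisorSection {μ : Bar (extSpace P) →ₗ[K] (extSpace P)} (h : IsDivisor P μ) :
    HomCoh P (diagonal A) 0 :=
  Submodule.Quotient.mk ⟨sectionCochain P μ, section_mem_cocycles h⟩

/-- `f^{⊗ r}` on `T(B[1])`: the sum of `f(x_1) ⊗ ⋯ ⊗ f(x_r)` over all ways `x = x_1 ⋯ x_r` of
cutting a word into `r` pieces. -/
def convPow {M : GrSpace K} (f : Bar M →ₗ[K] Bar M) : ℕ → Bar M →ₗ[K] Bar M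
  | 0 => Algebra.linearMap K (Bar M) ∘ₗ (aug (K := K) (E := M.carrier)).toLinearMap
  | r + 1 => conv (LinearMap.mul K (Bar M)) f (convPow f r)

/-- `Φ : T(B[1]) → B[1]` is an isomorphism from the noncommutative divisor `μ` to `μ'`: a
strictly unital `A_∞`-homomorphism which restricts to the identity on `A`, and which induces the
identity on the bimodule `B / A = P[1]`. -/
structure IsDivisorIso (μ μ' Φ : Bar (extSpace P) →ₗ[K] (extSpace P)) : Prop where
  map_one : Φ 1 = 0
  degree : ∀ n x, HomWord (extSpace P).gr (-1) n x → Φ x ∈ (extSpace P).gr (n + 1)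
  unital : ∀ x y, Φ (x * TensorAlgebra.ι K ((A.unit, 0) : A.carrier × P.carrier) * y) =
    (aug x * aug y) • ((A.unit, 0) : A.carrier × P.carrier)
  hom : ∀ l : List (A.carrier × P.carrier),
    ∑ r ∈ Finset.range (l.length + 1), μ' (convPow (TensorAlgebra.ι K ∘ₗ Φ) r (word l)) =
      Φ ((extSpace P).coder μ (word l))
  subalgebra : ∀ x, Φ (inA P x) = (len1 x, 0)
  quotient : ∀ x y p, (Φ (onceP P x y p)).2 = (aug x * aug y) • p

/-- The weight grading of `B`: `A` has weight `0` and `P[1]` has weight `-1`. -/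
def extWt (n : ℤ) : Submodule K (A.carrier × P.carrier) :=
  if n = 0 then LinearMap.range (LinearMap.inl K A.carrier P.carrier)
  else if n = -1 then LinearMap.range (LinearMap.inr K A.carrier P.carrier)
  else ⊥

variable (V : Type v) [AddCommGroup V] [Module K V]

/-- `B ⊗ Sym(V)`. -/
abbrev ExtSym : Type (max u v) := (extSpace P).carrier ⊗[K] SymmetricAlgebra K V

variable {V}

/-- The map `B ⊗ Sym(V) → B` given by evaluating polynomials at `w ∈ W = Vᵛ`. -/
def specialize (w : Module.Dual K V) : ExtSym P V →ₗ[K] (extSpace P) :=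
  (TensorProduct.rid K (extSpace P)).toLinearMap ∘ₗ
    (SymmetricAlgebra.lift w).toLinearMap.lTensor (extSpace P).carrier

/-- `f` is a map `T(B[1]) → B[s] ⊗ Sym(V)` that preserves the ordinary grading and the grading by
weight, where `V` has degree `0` and weight `-1`. -/
structure PreservesGradings (s : ℤ) (f : Bar (extSpace P) →ₗ[K] ExtSym P V) : Prop where
  degree : ∀ n x, HomWord (extSpace P).gr (-1) n x →
    f x ∈ LinearMap.range (TensorProduct.mapIncl ((extSpace P).gr (n + s))
      (⊤ : Submodule K (SymmetricAlgebra K V)))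
  weight : ∀ m x, HomWord (extWt P) 0 m x →
    f x ∈ ⨆ j : ℕ, LinearMap.range (TensorProduct.mapIncl (extWt P (m + j))
      (LinearMap.range (SymmetricAlgebra.ι K V) ^ j))

variable (V) in
/-- A noncommutative pencil on `A` with underlying bimodule `P`. -/
structure Pencil where
  toFun : Bar (extSpace P) →ₗ[K] ExtSym P V
  gradings : PreservesGradings P 2 toFun
  divisor : ∀ w : Module.Dual K V, IsDivisor P (specialize P w ∘ₗ toFun)

variable {P}

/-- The class of the section of the noncommutative divisor associated to `w ∈ W`. -/
def Pencil.sectionClass (𝔭 : Pencil P V) (w : Module.Dual K V) : HomCoh P (diagonal A) 0 :=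
  divisorSection P (𝔭.divisor w)

/-- Two noncommutative pencils are isomorphic if there is a map `T(B[1]) → B[1] ⊗ Sym(V)` that
preserves both gradings and whose specialization at each `w ∈ W` is an isomorphism between the
associated noncommutative divisors. -/
def Pencil.Isomorphic (𝔭 𝔮 : Pencil P V) : Prop :=
  ∃ Φ : Bar (extSpace P) →ₗ[K] ExtSym P V, PreservesGradings P 1 Φ ∧
    ∀ w : Module.Dual K V, IsDivisorIso P (specialize P w ∘ₗ 𝔭.toFun)
      (specialize P w ∘ₗ 𝔮.toFun) (specialize P w ∘ₗ Φ)

end Pencils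

end NCPencil

end

open NCPencil

set_option linter.unusedSimpArgs false

noncomputable section

namespace NCPencil

/-! ### Sums over cuts of words -/

section Cuts

variable {K : Type u} [Field K] {E : Type u} {X Y : Type u}

/-- The sum of `F u v` over all ways `l = u ++ v` of cutting a list in two. -/
def spl {E : Type*} {X : Type*} [AddCommMonoid X] (l : List E) (F : List E → List E → X) : X :=
  ∑ i ∈ Finset.range (l.length + 1), F (l.take i) (l.drop i)

section Monoid

variable [AddCommMonoid X] [AddCommMonoid Y]

@[simp] lemma spl_nil (F : List E → List E → X) : spl [] F = F [] [] := by simp [spl]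

lemma spl_cons (a : E) (l : List E) (F : List E → List E → X) :
    spl (a :: l) F = F [] (a :: l) + spl l fun u v => F (a :: u) v := by
  simp only [spl, List.length_cons]
  rw [Finset.sum_range_succ' _ (l.length + 1), add_comm]
  simp

lemma spl_congr {l : List E} {F G : List E → List E → X}
    (h : ∀ u v, u ++ v = l → F u v = G u v) : spl l F = spl l G :=
  Finset.sum_congr rfl fun i _ => h _ _ (List.take_append_drop i l)

lemma spl_add (l : List E) (F G : List E → List E → X) :
    (spl l fun u v => F u v + G u v) = spl l F + spl l G := Finset.sum_add_distrib

@[simp] lemma spl_zero (l : List E) : (spl l fun _ _ => (0 : X)) = 0 := by simp [spl]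

lemma spl_eq_zero {l : List E} {F : List E → List E → X} (h : ∀ u v, u ++ v = l → F u v = 0) :
    spl l F = 0 := by
  rw [spl_congr h, spl_zero]

lemma spl_append_cons (u v : List E) (c : E) (F : List E → List E → X) :
    spl (u ++ c :: v) F = (spl u fun a b => F a (b ++ c :: v)) +
      spl v fun a b => F (u ++ c :: a) b := by
  induction u generalizing F with
  | nil => simp [spl_cons]
  | cons d u ih =>
    rw [List.cons_append, spl_cons, ih, spl_cons, add_assoc]
    simp

lemma spl_coassoc (l : List E) (F : List E → List E → List E → X) :
    (spl l fun u v => spl u fun a b => F a b v) = spl l fun u v => spl v fun b c => F u b c := by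
  induction l generalizing F with
  | nil => simp
  | cons a l ih =>
    simp only [spl_cons, spl_nil, spl_add]
    rw [ih]
    abel

lemma spl_map {E' : Type*} (g : E' → E) (l : List E') (F : List E → List E → X) :
    spl (l.map g) F = spl l fun u v => F (u.map g) (v.map g) := by
  simp [spl, List.map_take, List.map_drop]

lemma spl_comm {E' : Type*} (l : List E) (m : List E')
    (F : List E → List E → List E' → List E' → X) :
    (spl l fun u v => spl m fun s t => F u v s t) = spl m fun s t => spl l fun u v => F u v s t :=
  Finset.sum_comm

lemma spl_hom {F' : Type*} [FunLike F' X Y] [AddMonoidHomClass F' X Y] (f : F') (l : List E)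
    (F : List E → List E → X) : f (spl l F) = spl l fun u v => f (F u v) := map_sum f _ _

lemma spl_left (l : List E) (F : List E → List E → X)
    (h : ∀ a u v, a :: u ++ v = l → F (a :: u) v = 0) : spl l F = F [] l := by
  cases l with
  | nil => simp
  | cons a l =>
    rw [spl_cons, spl_eq_zero, add_zero]
    exact fun u v e => h a u v (by rw [← e]; rfl)

lemma spl_right (l : List E) (F : List E → List E → X)
    (h : ∀ u a v, u ++ a :: v = l → F u (a :: v) = 0) :
    spl l F = F l [] := by
  induction l generalizing F with
  | nil => simp
  | cons a l ih =>
    rw [spl_cons, h [] a l rfl, zero_add, ih]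
    intro u b v e
    exact h _ _ _ (by rw [← e]; rfl)

end Monoid

lemma spl_neg [AddCommGroup X] (l : List E) (F : List E → List E → X) :
    (spl l fun u v => -F u v) = -spl l F := by simp [spl]

lemma spl_sub [AddCommGroup X] (l : List E) (F G : List E → List E → X) :
    (spl l fun u v => F u v - G u v) = spl l F - spl l G := by simp [spl]

lemma spl_smul [AddCommGroup X] [Module K X] (c : K) (l : List E) (F : List E → List E → X) :
    (spl l fun u v => c • F u v) = c • spl l F := by simp [spl, Finset.smul_sum]

variable [AddCommGroup E] [Module K E]

@[simp] lemma word_nil : word (K := K) ([] : List E) = 1 := by simp [word]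

lemma word_cons (a : E) (l : List E) :
    word (K := K) (a :: l) = TensorAlgebra.ι K a * word l := by simp [word]

lemma word_append (l m : List E) : word (K := K) (l ++ m) = word l * word m := by simp [word]

lemma word_singleton (a : E) : word (K := K) [a] = TensorAlgebra.ι K a := by simp [word]

lemma word_mid (l m : List E) (a : E) :
    word (K := K) l * TensorAlgebra.ι K a * word m = word (l ++ a :: m) := by
  rw [word_append, word_cons, mul_assoc]

@[simp] lemma aug_word_cons (a : E) (l : List E) : aug (word (K := K) (a :: l)) = 0 := by
  simp [word_cons]

@[simp] lemma aug_word_append_cons (u l : List E) (a : E) :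
    aug (word (K := K) (u ++ a :: l)) = 0 := by
  simp [word_append]

lemma span_word : Submodule.span K (Set.range (word (K := K) (E := E))) = ⊤ := by
  refine Submodule.eq_top_iff'.2 fun x => ?_
  induction x using word_induction with
  | h0 => exact Submodule.subset_span ⟨[], by simp⟩
  | hι a x hx =>
    induction hx using Submodule.span_induction with
    | mem x h =>
      obtain ⟨l, rfl⟩ := h
      exact Submodule.subset_span ⟨a :: l, by simp [word_cons]⟩
    | zero => simp
    | add x y _ _ h1 h2 => rw [mul_add]; exact add_mem h1 h2
    | smul c x _ h => rw [mul_smul_comm]; exact Submodule.smul_mem _ _ h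
  | hadd x y hx hy => exact add_mem hx hy
  | hsmul c x hx => exact Submodule.smul_mem _ _ hx

/-- Linear maps on `T(E)` that agree on words are equal. -/
lemma word_ext [AddCommGroup X] [Module K X] {f g : TensorAlgebra K E →ₗ[K] X}
    (h : ∀ l, f (word l) = g (word l)) : f = g :=
  LinearMap.ext_on span_word (by rintro _ ⟨l, rfl⟩; exact h l)

variable [AddCommGroup X] [Module K X] in
lemma spl_aug_left (l : List E) (F : List E → List E → X) :
    (spl l fun u v => aug (word (K := K) u) • F u v) = F [] l := by
  rw [spl_left _ _ (by simp)]; simp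

variable [AddCommGroup X] [Module K X] in
lemma spl_aug_right (l : List E) (F : List E → List E → X) :
    (spl l fun u v => aug (word (K := K) v) • F u v) = F l [] := by
  rw [spl_right _ _ (by simp)]; simp

lemma conv_word_spl {Z : Type u} [AddCommGroup X] [Module K X] [AddCommGroup Y] [Module K Y]
    [AddCommGroup Z] [Module K Z] (m : X →ₗ[K] Y →ₗ[K] Z) (f : TensorAlgebra K E →ₗ[K] X)
    (g : TensorAlgebra K E →ₗ[K] Y) (l : List E) :
    conv m f g (word l) = spl l fun u v => m (f (word u)) (g (word v)) := conv_word m f g l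

end Cuts

section Signs

variable {K : Type u} [Field K] (M : GrSpace K)

@[simp] lemma ksign_add (d e : ℤ) : ksign K (d + e) = ksign K d * ksign K e := by
  unfold ksign
  by_cases h1 : Even d <;> by_cases h2 : Even e <;> simp [h1, h2, Int.even_add]

@[simp] lemma ksign_one : ksign K 1 = -1 := by simp [ksign]
@[simp] lemma ksign_zero : ksign K 0 = 1 := by simp [ksign]
@[simp] lemma ksign_neg (d : ℤ) : ksign K (-d) = ksign K d := by simp [ksign]
@[simp] lemma ksign_sub (d e : ℤ) : ksign K (d - e) = ksign K d * ksign K e := by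
  rw [sub_eq_add_neg, ksign_add, ksign_neg]
@[simp] lemma ksign_mul_self (d : ℤ) : ksign K d * ksign K d = 1 := by
  unfold ksign; split_ifs <;> simp
@[simp] lemma ksign_even_mul (d : ℤ) : ksign K (2 * d) = 1 := by simp [ksign]
@[simp] lemma ksign_two : ksign K 2 = 1 := by simp [ksign]

/-- The reduced sign of a letter. -/
def GrSpace.letterSgn : ℤ → M →ₗ[K] M := fun d => if Even d then LinearMap.id else -M.par

lemma sgn_word (l : List M) : M.sgn (word l) = word (l.map (M.letterSgn 1)) := by
  induction l with
  | nil => simp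
  | cons a l ih => simp [word_cons, ih, GrSpace.letterSgn]

lemma sgnPow_word (d : ℤ) (l : List M) :
    M.sgnPow d (word l) = word (l.map (M.letterSgn d)) := by
  unfold GrSpace.sgnPow GrSpace.letterSgn
  split_ifs
  · simp
  · have := sgn_word M l
    simpa [GrSpace.letterSgn] using this

@[simp] lemma sgnPow_one_eq (d : ℤ) : M.sgnPow d (1 : Bar M) = 1 := by
  unfold GrSpace.sgnPow; split_ifs <;> simp

@[simp] lemma sgnPow_mul (d : ℤ) (x y : Bar M) : M.sgnPow d (x * y) = M.sgnPow d x * M.sgnPow d y := by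
  unfold GrSpace.sgnPow; split_ifs <;> simp

lemma sgnPow_ι (d : ℤ) (a : M) : M.sgnPow d (TensorAlgebra.ι K a) =
    TensorAlgebra.ι K (M.letterSgn d a) := by
  unfold GrSpace.sgnPow GrSpace.letterSgn
  split_ifs <;> simp

lemma sgnPow_one : M.sgnPow 1 = M.sgn.toLinearMap := by simp [GrSpace.sgnPow]
lemma sgnPow_zero : M.sgnPow 0 = LinearMap.id := by simp [GrSpace.sgnPow]
lemma parPow_one : M.parPow 1 = M.par := by simp [GrSpace.parPow]
lemma parPow_zero : M.parPow 0 = LinearMap.id := by simp [GrSpace.parPow]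

@[simp] lemma aug_sgnPow (d : ℤ) (x : Bar M) : aug (M.sgnPow d x) = aug x := by
  unfold GrSpace.sgnPow; split_ifs <;> simp

variable {M}

lemma GrSpace.IsGraded.span_eq_top (h : M.IsGraded) : (⨆ n, M.gr n) = ⊤ :=
  h.internal.submodule_iSup_eq_top

lemma GrSpace.IsGraded.induction (h : M.IsGraded) {C : M → Prop} (hm : ∀ n, ∀ v ∈ M.gr n, C v)
    (hadd : ∀ v w, C v → C w → C (v + w)) (v : M) : C v := by
  have : v ∈ ⨆ n, M.gr n := h.span_eq_top ▸ Submodule.mem_top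
  exact Submodule.iSup_induction (motive := C) _ this hm (hm 0 0 (zero_mem _)) hadd

lemma GrSpace.IsGraded.hom_ext (h : M.IsGraded) {X : Type u} [AddCommGroup X] [Module K X]
    {f g : M →ₗ[K] X} (hm : ∀ n, ∀ v ∈ M.gr n, f v = g v) : f = g := by
  ext v
  induction v using h.induction with
  | hm n v hv => exact hm n v hv
  | hadd v w h1 h2 => rw [map_add, map_add, h1, h2]

lemma GrSpace.IsGraded.par_par (h : M.IsGraded) (v : M) : M.par (M.par v) = v := by
  have : M.par ∘ₗ M.par = LinearMap.id := h.hom_ext fun n v hv => by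
    simp only [LinearMap.comp_apply, LinearMap.id_apply]
    rw [h.par_apply n v hv, map_smul, h.par_apply n v hv, smul_smul, ksign_mul_self, one_smul]
  exact DFunLike.congr_fun this v

lemma GrSpace.IsGraded.letterSgn_letterSgn (h : M.IsGraded) (d e : ℤ) (v : M) :
    M.letterSgn d (M.letterSgn e v) = M.letterSgn (d + e) v := by
  unfold GrSpace.letterSgn
  by_cases h1 : Even d <;> by_cases h2 : Even e <;> simp [h1, h2, Int.even_add, h.par_par]

lemma GrSpace.IsGraded.sgnPow_sgnPow (h : M.IsGraded) (d e : ℤ) (x : Bar M) :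
    M.sgnPow d (M.sgnPow e x) = M.sgnPow (d + e) x := by
  have : M.sgnPow d ∘ₗ M.sgnPow e = M.sgnPow (d + e) := word_ext fun l => by
    simp only [LinearMap.comp_apply, sgnPow_word, List.map_map]
    congr 1
    refine List.map_congr_left fun a _ => h.letterSgn_letterSgn d e a
  exact DFunLike.congr_fun this x

lemma GrSpace.IsGraded.sgn_sgn (h : M.IsGraded) (x : Bar M) : M.sgn (M.sgn x) = x := by
  have := h.sgnPow_sgnPow 1 1 x
  simpa [GrSpace.sgnPow] using this

lemma GrSpace.IsGraded.parPow_parPow (h : M.IsGraded) (d e : ℤ) (v : M) :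
    M.parPow d (M.parPow e v) = M.parPow (d + e) v := by
  unfold GrSpace.parPow
  by_cases h1 : Even d <;> by_cases h2 : Even e <;> simp [h1, h2, Int.even_add, h.par_par]

lemma HomWord.sgn (h : M.IsGraded) {n : ℤ} {x : Bar M} (hx : HomWord M.gr (-1) n x) :
    M.sgn x = ksign K n • x := by
  induction hx with
  | nil => simp
  | cons he _ ih =>
    rw [map_mul, ih, sgn_ι, h.par_apply _ _ he]
    simp [smul_smul, mul_comm]

/-- Homogeneous words span `T(E)`. -/
lemma GrSpace.IsGraded.bar_induction (h : M.IsGraded) {C : Bar M → Prop}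
    (hw : ∀ n x, HomWord M.gr (-1) n x → C x) (hadd : ∀ x y, C x → C y → C (x + y))
    (hsmul : ∀ (c : K) x, C x → C (c • x)) (x : Bar M) : C x := by
  have h0 : C 0 := by simpa using hsmul 0 1 (hw 0 1 .nil)
  suffices hs : x ∈ Submodule.span K {x | ∃ n, HomWord M.gr (-1) n x} by
    induction hs using Submodule.span_induction with
    | mem x h => obtain ⟨n, h⟩ := h; exact hw n x h
    | zero => exact h0
    | add x y _ _ h1 h2 => exact hadd x y h1 h2
    | smul c x _ h1 => exact hsmul c x h1
  induction x using word_induction with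
  | h0 => exact Submodule.subset_span ⟨0, .nil⟩
  | hι a x hx =>
    induction hx using Submodule.span_induction with
    | mem x hx =>
      obtain ⟨n, hx⟩ := hx
      induction a using h.induction with
      | hm m v hv => exact Submodule.subset_span ⟨_, .cons hv hx⟩
      | hadd v w h1 h2 => rw [map_add, add_mul]; exact add_mem h1 h2
    | zero => simp
    | add x y _ _ h1 h2 => rw [mul_add]; exact add_mem h1 h2
    | smul c x _ h => rw [mul_smul_comm]; exact Submodule.smul_mem _ _ h
  | hadd x y hx hy => exact add_mem hx hy
  | hsmul c x hx => exact Submodule.smul_mem _ _ hx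

/-- `l` is a list of homogeneous letters with `∑ (|l_i| + c) = n`. -/
def HomList {E : Type u} [AddCommGroup E] [Module K E] (𝒢 : ℤ → Submodule K E) (c : ℤ) :
    ℤ → List E → Prop
  | n, [] => n = 0
  | n, a :: l => ∃ m k, a ∈ 𝒢 m ∧ HomList 𝒢 c k l ∧ n = (m + c) + k

section HomList

variable {E : Type u} [AddCommGroup E] [Module K E] {𝒢 : ℤ → Submodule K E} {c m n : ℤ}

lemma HomList.split {u v : List E} (h : HomList 𝒢 c n (u ++ v)) :
    ∃ i j, n = i + j ∧ HomList 𝒢 c i u ∧ HomList 𝒢 c j v := by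
  induction u generalizing n with
  | nil => exact ⟨0, n, by simp, rfl, h⟩
  | cons a u ih =>
    obtain ⟨m, k, ha, hk, rfl⟩ := h
    obtain ⟨i, j, rfl, hi, hj⟩ := ih hk
    exact ⟨m + c + i, j, by ring, ⟨m, i, ha, hi, rfl⟩, hj⟩

lemma HomList.append {u v : List E} (hu : HomList 𝒢 c m u) (hv : HomList 𝒢 c n v) :
    HomList 𝒢 c (m + n) (u ++ v) := by
  induction u generalizing m with
  | nil => obtain rfl : m = 0 := hu; simpa using hv
  | cons a u ih =>
    obtain ⟨i, k, ha, hk, rfl⟩ := hu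
    exact ⟨i, _, ha, ih hk, by ring⟩

lemma HomList.homWord {l : List E} (h : HomList 𝒢 c n l) : HomWord 𝒢 c n (word l) := by
  induction l generalizing n with
  | nil => obtain rfl : n = 0 := h; simpa using .nil
  | cons a u ih =>
    obtain ⟨i, k, ha, hk, rfl⟩ := h
    rw [word_cons]; exact .cons ha (ih hk)

lemma HomWord.exists_word {x : TensorAlgebra K E} (hx : HomWord 𝒢 c n x) :
    ∃ l : List E, x = word l ∧ HomList 𝒢 c n l := by
  induction hx with
  | nil => exact ⟨[], by simp, rfl⟩
  | @cons m n e x he hx ih =>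
    obtain ⟨l, rfl, hl⟩ := ih
    exact ⟨e :: l, by simp [word_cons], m, n, he, hl, rfl⟩

end HomList

lemma spl_mem {E : Type*} {X : Type*} [AddCommGroup X] [Module K X] {S : Submodule K X}
    {l : List E} {F : List E → List E → X} (h : ∀ u v, u ++ v = l → F u v ∈ S) : spl l F ∈ S :=
  Submodule.sum_mem _ fun i _ => h _ _ (List.take_append_drop i l)

lemma GrSpace.IsGraded.letterSgn_mem (h : M.IsGraded) (d : ℤ) {n : ℤ} {v : M} (hv : v ∈ M.gr n) :
    M.letterSgn d v ∈ M.gr n := by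
  unfold GrSpace.letterSgn
  split_ifs
  · exact hv
  · rw [LinearMap.neg_apply, h.par_apply n v hv]
    exact neg_mem (Submodule.smul_mem _ _ hv)

lemma HomList.map_letterSgn (h : M.IsGraded) (d : ℤ) {c n : ℤ} {l : List M}
    (hl : HomList M.gr c n l) : HomList M.gr c n (l.map (M.letterSgn d)) := by
  induction l generalizing n with
  | nil => exact hl
  | cons a u ih =>
    obtain ⟨i, k, ha, hk, rfl⟩ := hl
    exact ⟨i, k, h.letterSgn_mem d ha, ih hk, rfl⟩

lemma HomWord.sgnPow (h : M.IsGraded) (d : ℤ) {n : ℤ} {x : Bar M} (hx : HomWord M.gr (-1) n x) :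
    HomWord M.gr (-1) n (M.sgnPow d x) := by
  induction hx with
  | nil => simpa using .nil
  | cons he _ ih =>
    rw [sgnPow_mul, sgnPow_ι]
    exact .cons (h.letterSgn_mem d he) ih

lemma GrSpace.IsGraded.parPow_mem (h : M.IsGraded) (d : ℤ) {n : ℤ} {v : M} (hv : v ∈ M.gr n) :
    M.parPow d v ∈ M.gr n := by
  unfold GrSpace.parPow
  split_ifs
  · exact hv
  · rw [h.par_apply n v hv]
    exact Submodule.smul_mem _ _ hv

end Signs

/-! ### Calculus of cochains -/

section Coder

variable {K : Type u} [Field K] {M : GrSpace K}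
variable {X Y Z : Type u} [AddCommGroup X] [Module K X] [AddCommGroup Y] [Module K Y]
  [AddCommGroup Z] [Module K Z]

lemma spl_apply {E : Type u} (l : List E) (F : List E → List E → X →ₗ[K] Y) (x : X) :
    spl l F x = spl l fun u v => F u v x := LinearMap.sum_apply _ _ _

/-- The convolution product of maps from `T(M)` to itself. -/
def star {E : Type u} [AddCommGroup E] [Module K E] {R : Type u} [Ring R] [Algebra K R]
    (f g : TensorAlgebra K E →ₗ[K] R) : TensorAlgebra K E →ₗ[K] R := conv (LinearMap.mul K R) f g

lemma star_word {E : Type u} [AddCommGroup E] [Module K E] {R : Type u} [Ring R] [Algebra K R]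
    (f g : TensorAlgebra K E →ₗ[K] R) (l : List E) :
    star f g (word l) = spl l fun u v => f (word u) * g (word v) := by
  rw [star, conv_word_spl]; rfl

lemma star_assoc {E : Type u} [AddCommGroup E] [Module K E] {R : Type u} [Ring R] [Algebra K R]
    (f g h : TensorAlgebra K E →ₗ[K] R) : star (star f g) h = star f (star g h) :=
  word_ext fun l => by
    simp only [star_word]
    have h1 : ∀ (u : List E) (r : R), (spl u fun a b => f (word a) * g (word b)) * r =
        spl u fun a b => f (word a) * g (word b) * r := fun u r => Finset.sum_mul _ _ _
    have h2 : ∀ (u : List E) (r : R), r * (spl u fun a b => g (word a) * h (word b)) =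
        spl u fun a b => r * (g (word a) * h (word b)) := fun u r => Finset.mul_sum _ _ _
    simp only [h1, h2, ← mul_assoc]
    exact spl_coassoc l fun a b c => f (word a) * g (word b) * h (word c)

lemma coder_word (μ : Bar M →ₗ[K] M) (l : List M) :
    M.coder μ (word l) = spl l fun a w => spl w fun b c =>
      word (a ++ μ (word b) :: c.map (M.letterSgn 1)) := by
  rw [GrSpace.coder, conv_word_spl]
  refine spl_congr fun a w _ => ?_
  rw [conv_word_spl, spl_hom]
  refine spl_congr fun b c _ => ?_
  simp [sgn_word, word_append, word_cons]

lemma conv_sgnPow (m : X →ₗ[K] Y →ₗ[K] Z) (f : Bar M →ₗ[K] X) (g : Bar M →ₗ[K] Y) (d : ℤ) :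
    conv m f g ∘ₗ M.sgnPow d = conv m (f ∘ₗ M.sgnPow d) (g ∘ₗ M.sgnPow d) := word_ext fun l => by
  simp [conv_word_spl, sgnPow_word, spl_map]

/-- `coder μ` is a coderivation. -/
lemma conv_coder (m : X →ₗ[K] Y →ₗ[K] Z) (f : Bar M →ₗ[K] X) (g : Bar M →ₗ[K] Y)
    (μ : Bar M →ₗ[K] M) :
    conv m f g ∘ₗ M.coder μ = conv m (f ∘ₗ M.coder μ) (g ∘ₗ M.sgnPow 1) +
      conv m f (g ∘ₗ M.coder μ) := word_ext fun l => by
  simp only [LinearMap.comp_apply, LinearMap.add_apply, conv_word_spl, coder_word, spl_hom]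
  simp only [spl_append_cons, spl_add, spl_map, sgnPow_word, LinearMap.map_add, spl_hom,
    LinearMap.add_apply, spl_apply]
  rw [add_comm]
  congr 1
  · rw [spl_coassoc l fun a w v => spl w fun b c =>
      m (f (word (a ++ μ (word b) :: c.map (M.letterSgn 1)))) (g (word (v.map (M.letterSgn 1))))]
    refine spl_congr fun a w _ => ?_
    rw [spl_coassoc w fun b c v =>
      m (f (word (a ++ μ (word b) :: c.map (M.letterSgn 1)))) (g (word (v.map (M.letterSgn 1))))]
  · rw [← spl_coassoc l fun a b w => spl w fun c e =>
      m (f (word a)) (g (word (b ++ μ (word c) :: e.map (M.letterSgn 1))))]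
    exact spl_congr fun a w _ => spl_comm w a fun c e a b =>
      m (f (word a)) (g (word (b ++ μ (word c) :: e.map (M.letterSgn 1))))

lemma star_coder (f g : Bar M →ₗ[K] Bar M) (μ : Bar M →ₗ[K] M) : star f g ∘ₗ M.coder μ =
    star (f ∘ₗ M.coder μ) (g ∘ₗ M.sgnPow 1) + star f (g ∘ₗ M.coder μ) := conv_coder _ _ _ _

lemma star_sgnPow (f g : Bar M →ₗ[K] Bar M) (d : ℤ) : star f g ∘ₗ M.sgnPow d =
    star (f ∘ₗ M.sgnPow d) (g ∘ₗ M.sgnPow d) := conv_sgnPow _ _ _ _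

@[simp] lemma coder_one {μ : Bar M →ₗ[K] M} (h : μ 1 = 0) : M.coder μ 1 = 0 := by
  have := coder_word μ []
  simpa [h, word_cons] using this

lemma aug_coder {μ : Bar M →ₗ[K] M} (x : Bar M) : aug (M.coder μ x) = 0 := by
  have : (aug (K := K) (E := M)).toLinearMap ∘ₗ M.coder μ = 0 := word_ext fun l => by
    simp [coder_word, spl_hom]
  exact DFunLike.congr_fun this x

lemma len1_coder {μ : Bar M →ₗ[K] M} (x : Bar M) : len1 (M.coder μ x) = μ x := by
  have : len1 ∘ₗ M.coder μ = μ := word_ext fun l => by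
    simp only [LinearMap.comp_apply, coder_word, spl_hom, word_append, word_cons, len1_mul,
      aug_ι, map_mul, zero_mul, zero_smul, add_zero, zero_add, len1_ι, spl_smul]
    rw [spl_aug_left, ← spl_aug_right (K := K) l fun u _ => μ (word u)]
    refine spl_congr fun u v _ => ?_
    rw [← sgnPow_word, aug_sgnPow]
  exact DFunLike.congr_fun this x

end Coder

section AInfFacts

variable {K : Type u} [Field K] {M : GrSpace K} {e : M} {μ : Bar M →ₗ[K] M}

lemma IsAInf.par_map (h : IsAInf M e μ) (x : Bar M) : M.par (μ x) = μ (M.sgn x) := by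
  induction x using h.graded.bar_induction with
  | hw n x hx =>
    rw [h.graded.par_apply _ _ (h.degree n x hx), hx.sgn h.graded, map_smul, ksign_add, ksign_two,
      mul_one]
  | hadd x y h1 h2 => simp only [map_add, h1, h2]
  | hsmul c x h1 => simp only [map_smul, h1]

lemma IsAInf.sgn_coder (h : IsAInf M e μ) (x : Bar M) :
    M.sgn (M.coder μ x) = -M.coder μ (M.sgn x) := by
  have : M.sgn.toLinearMap ∘ₗ M.coder μ = -(M.coder μ ∘ₗ M.sgn.toLinearMap) := word_ext fun l => by
    simp only [LinearMap.comp_apply, AlgHom.toLinearMap_apply, LinearMap.neg_apply, sgn_word,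
      coder_word, spl_map, spl_hom, ← spl_neg]
    refine spl_congr fun a w _ => spl_congr fun b c _ => ?_
    simp only [List.map_append, List.map_cons, word_append, word_cons]
    have : M.letterSgn 1 (μ (word b)) = -μ (word (b.map (M.letterSgn 1))) := by
      rw [← sgn_word, ← h.par_map]; simp [GrSpace.letterSgn]
    rw [this]; simp
  exact DFunLike.congr_fun this x

lemma IsAInf.sgnPow_coder (h : IsAInf M e μ) (d : ℤ) (x : Bar M) :
    M.sgnPow d (M.coder μ x) = ksign K d • M.coder μ (M.sgnPow d x) := by
  unfold GrSpace.sgnPow ksign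
  split_ifs
  · simp
  · simp [h.sgn_coder]

/-- `T(M[1])` is a differential graded coalgebra. -/
lemma IsAInf.coder_coder (h : IsAInf M e μ) (x : Bar M) : M.coder μ (M.coder μ x) = 0 := by
  have hs : M.sgnPow 1 ∘ₗ M.coder μ = -(M.coder μ ∘ₗ M.sgnPow 1) := LinearMap.ext fun x => by
    simp [sgnPow_one, h.sgn_coder]
  have hc : M.coder μ = star LinearMap.id (star (TensorAlgebra.ι K ∘ₗ μ) (M.sgnPow 1)) := by
    rw [sgnPow_one]; rfl
  have h0 : (TensorAlgebra.ι K ∘ₗ μ) ∘ₗ M.coder μ = 0 := LinearMap.ext fun x => by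
    simp [h.assoc]
  have : M.coder μ ∘ₗ M.coder μ = 0 := by
    conv_lhs => enter [1]; rw [hc]
    rw [star_coder, star_coder, h0, hs, star_sgnPow, LinearMap.id_comp, hc]
    simp only [star_sgnPow, LinearMap.id_comp]
    have h1 : ∀ f : Bar M →ₗ[K] Bar M, star (0 : Bar M →ₗ[K] Bar M) f = 0 := fun f => by
      simp [star]
    have h2 : ∀ f g : Bar M →ₗ[K] Bar M, star f (-g) = -star f g := fun f g => by
      simp [star]
    rw [h1, zero_add, h2, h2, star_assoc, star_assoc]
    abel
  exact DFunLike.congr_fun this x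

end AInfFacts

section CochainCalculus

variable {K : Type u} [Field K] {A : AInfAlgebra K} {P Q R S : GrSpace K}

lemma Cochain.ext_word {φ ψ : Cochain A P Q}
    (h : ∀ l m p, φ (word l) (word m) p = ψ (word l) (word m) p) : φ = ψ :=
  word_ext fun l => word_ext fun m => LinearMap.ext fun p => h l m p

lemma comp_word_spl (d : ℤ) (ψ : Cochain A Q R) (φ : Cochain A P Q) (l m : List A.carrier)
    (p : P) : Cochain.comp d ψ φ (word l) (word m) p = spl l fun a b => spl m fun c e =>
      ψ (word a) (A.sgnPow d (word e)) (φ (word b) (word c) p) := comp_word d ψ φ l m p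

lemma insertMu_apply (φ : Cochain A P Q) (x y : Bar A.toGrSpace) (p : P) :
    φ.insertMu x y p = φ x (A.coder A.mu y) p + φ (A.coder A.mu x) (A.sgn y) (P.par p) := rfl

lemma spl_coassoc₂ {E : Type u} {X : Type u} [AddCommMonoid X] (l m : List E)
    (F : List E → List E → List E → List E → List E → List E → X) :
    (spl l fun a b => spl m fun c e => spl a fun a₁ a₂ => spl e fun e₁ e₂ => F a₁ a₂ b c e₁ e₂) =
      spl l fun a b => spl m fun c e => spl b fun b₁ b₂ => spl c fun c₁ c₂ =>
        F a b₁ b₂ c₁ c₂ e := by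
  calc _ = spl l fun a b => spl a fun a₁ a₂ => spl m fun c e => spl e fun e₁ e₂ =>
        F a₁ a₂ b c e₁ e₂ := spl_congr fun a b _ => spl_comm _ _ _
    _ = spl l fun a b => spl b fun b₁ b₂ => spl m fun c e => spl e fun e₁ e₂ =>
        F a b₁ b₂ c e₁ e₂ := spl_coassoc l fun a₁ a₂ b => spl m fun c e => spl e fun e₁ e₂ =>
        F a₁ a₂ b c e₁ e₂
    _ = spl l fun a b => spl b fun b₁ b₂ => spl m fun c e => spl c fun c₁ c₂ =>
        F a b₁ b₂ c₁ c₂ e := spl_congr fun a b _ => spl_congr fun b₁ b₂ _ =>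
        (spl_coassoc m fun c₁ c₂ e => F a b₁ b₂ c₁ c₂ e).symm
    _ = _ := spl_congr fun a b _ => spl_comm _ _ _

lemma comp_assoc (d e : ℤ) (χ : Cochain A R S) (ψ : Cochain A Q R) (φ : Cochain A P Q) :
    Cochain.comp d (Cochain.comp e χ ψ) φ = Cochain.comp (d + e) χ (Cochain.comp d ψ φ) := by
  refine Cochain.ext_word fun l m p => ?_
  simp only [comp_word_spl, spl_hom, sgnPow_word, spl_map]
  simp only [← sgnPow_word, A.isAInf.graded.sgnPow_sgnPow, add_comm d e]
  exact spl_coassoc₂ l m fun a₁ a₂ b c e₁ e₂ => χ (word a₁) (A.sgnPow (e + d) (word e₂))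
    (ψ (word a₂) (A.sgnPow d (word e₁)) (φ (word b) (word c) p))

lemma comp_word_left (d : ℤ) (ψ : Cochain A Q R) (φ : Cochain A P Q) (l : List A.carrier) :
    Cochain.comp d ψ φ (word l) = spl l fun a b =>
      conv (LinearMap.llcomp K P Q R).flip (φ (word b)) (ψ (word a) ∘ₗ A.sgnPow d) :=
  conv_word_spl _ _ _ _

/-- Precomposition of a cochain with an operator on the words on the left. -/
abbrev Cochain.left (φ : Cochain A P Q) (f : Bar A.toGrSpace →ₗ[K] Bar A.toGrSpace) :
    Cochain A P Q := φ ∘ₗ f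

/-- Precomposition of a cochain with an operator on the words on the right. -/
abbrev Cochain.right (φ : Cochain A P Q) (f : Bar A.toGrSpace →ₗ[K] Bar A.toGrSpace) :
    Cochain A P Q := φ.compl₂ f

lemma comp_coder_left (d : ℤ) (ψ : Cochain A Q R) (φ : Cochain A P Q) (x y : Bar A.toGrSpace)
    (p : P) : Cochain.comp d ψ φ (A.coder A.mu x) y p =
      Cochain.comp d (ψ.left (A.coder A.mu)) (φ.left (A.sgnPow 1)) x y p +
      Cochain.comp d ψ (φ.left (A.coder A.mu)) x y p := by
  have := conv_coder (M := A.toGrSpace) ((conv (LinearMap.llcomp K P Q R).flip).flip ∘ₗ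
    LinearMap.lcomp K (Q →ₗ[K] R) (A.sgnPow d)) ψ φ A.mu
  exact congrArg (fun f : Cochain A P R => f x y p) this

lemma comp_coder_right (d : ℤ) (ψ : Cochain A Q R) (φ : Cochain A P Q) (l : List A.carrier)
    (y : Bar A.toGrSpace) (p : P) : Cochain.comp d ψ φ (word l) (A.coder A.mu y) p =
      Cochain.comp d (ψ.right (A.sgnPow 1)) (φ.right (A.coder A.mu)) (word l) y p +
      ksign K d • Cochain.comp d (ψ.right (A.coder A.mu)) φ (word l) y p := by
  simp only [comp_word_left, spl_apply, ← spl_smul, ← spl_add]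
  refine spl_congr fun a b _ => ?_
  have := conv_coder (M := A.toGrSpace) (LinearMap.llcomp K P Q R).flip (φ (word b))
    (ψ (word a) ∘ₗ A.sgnPow d) A.mu
  have h1 := congrArg (fun f : Bar A.toGrSpace →ₗ[K] P →ₗ[K] R => f y p) this
  refine h1.trans ?_
  rw [LinearMap.add_apply, LinearMap.add_apply]
  congr 1
  · have : (ψ (word a) ∘ₗ A.sgnPow d) ∘ₗ A.sgnPow 1 = ψ.right (A.sgnPow 1) (word a) ∘ₗ A.sgnPow d :=
      LinearMap.ext fun z => by simp [A.isAInf.graded.sgnPow_sgnPow, add_comm]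
    rw [this]; rfl
  · have : (ψ (word a) ∘ₗ A.sgnPow d) ∘ₗ A.coder A.mu =
        ksign K d • (ψ.right (A.coder A.mu) (word a) ∘ₗ A.sgnPow d) :=
      LinearMap.ext fun z => by simp [A.isAInf.sgnPow_coder]
    rw [this, map_smul]; rfl

/-- `φ` is homogeneous of parity `d` with respect to the parity operators. -/
def Cochain.HasParity (φ : Cochain A P Q) (d : ℤ) : Prop :=
  ∀ x y p, Q.par (φ x y p) = ksign K d • φ (A.sgn x) (A.sgn y) (P.par p)

/-- The part of `insertMu` in which `μ_A` is applied to the left of the module. -/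
def Cochain.leftMu (φ : Cochain A P Q) : Cochain A P Q :=
  (φ.compl₁₂ (A.coder A.mu) A.sgn.toLinearMap).compr₂ (LinearMap.lcomp K Q P.par)

lemma leftMu_apply (φ : Cochain A P Q) (x y : Bar A.toGrSpace) (p : P) :
    φ.leftMu x y p = φ (A.coder A.mu x) (A.sgn y) (P.par p) := rfl

@[simp] lemma insertMu_add (φ ψ : Cochain A P Q) :
    (φ + ψ).insertMu = φ.insertMu + ψ.insertMu := by
  ext x y p; simp [insertMu_apply]; abel

@[simp] lemma insertMu_smul (c : K) (φ : Cochain A P Q) :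
    (c • φ).insertMu = c • φ.insertMu := by
  ext x y p; simp [insertMu_apply]

@[simp] lemma insertMu_neg (φ : Cochain A P Q) : (-φ).insertMu = -φ.insertMu := by
  ext x y p; simp [insertMu_apply]; abel

@[simp] lemma insertMu_sub (φ ψ : Cochain A P Q) :
    (φ - ψ).insertMu = φ.insertMu - ψ.insertMu := by
  simp [sub_eq_add_neg]

lemma ksign_eq (K : Type u) [Field K] (d : ℤ) : ksign K d = 1 ∨ ksign K d = -1 := by
  unfold ksign; split_ifs <;> simp

lemma insertMu_eq (φ : Cochain A P Q) : φ.insertMu = φ.right (A.coder A.mu) + φ.leftMu := rfl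

/-- `Cochain.comp` as a bilinear map. -/
def compₗ (A : AInfAlgebra K) (P Q R : GrSpace K) (d : ℤ) :
    Cochain A Q R →ₗ[K] Cochain A P Q →ₗ[K] Cochain A P R :=
  conv ((conv (LinearMap.llcomp K P Q R).flip).flip ∘ₗ
    LinearMap.lcomp K (Q →ₗ[K] R) (A.sgnPow d))

lemma compₗ_apply (d : ℤ) (ψ : Cochain A Q R) (φ : Cochain A P Q) :
    compₗ A P Q R d ψ φ = Cochain.comp d ψ φ := rfl

@[simp] lemma comp_add_left (d : ℤ) (ψ ψ' : Cochain A Q R) (φ : Cochain A P Q) :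
    Cochain.comp d (ψ + ψ') φ = Cochain.comp d ψ φ + Cochain.comp d ψ' φ := by
  simp only [← compₗ_apply, map_add, LinearMap.add_apply]

@[simp] lemma comp_add_right (d : ℤ) (ψ : Cochain A Q R) (φ φ' : Cochain A P Q) :
    Cochain.comp d ψ (φ + φ') = Cochain.comp d ψ φ + Cochain.comp d ψ φ' := by
  simp only [← compₗ_apply, map_add]

@[simp] lemma comp_smul_left (d : ℤ) (c : K) (ψ : Cochain A Q R) (φ : Cochain A P Q) :
    Cochain.comp d (c • ψ) φ = c • Cochain.comp d ψ φ := by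
  simp only [← compₗ_apply, map_smul, LinearMap.smul_apply]

@[simp] lemma comp_smul_right (d : ℤ) (c : K) (ψ : Cochain A Q R) (φ : Cochain A P Q) :
    Cochain.comp d ψ (c • φ) = c • Cochain.comp d ψ φ := by
  simp only [← compₗ_apply, map_smul]

@[simp] lemma comp_neg_left (d : ℤ) (ψ : Cochain A Q R) (φ : Cochain A P Q) :
    Cochain.comp d (-ψ) φ = -Cochain.comp d ψ φ := by
  simp only [← compₗ_apply, map_neg, LinearMap.neg_apply]

@[simp] lemma comp_neg_right (d : ℤ) (ψ : Cochain A Q R) (φ : Cochain A P Q) :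
    Cochain.comp d ψ (-φ) = -Cochain.comp d ψ φ := by
  simp only [← compₗ_apply, map_neg]

@[simp] lemma comp_sub_left (d : ℤ) (ψ ψ' : Cochain A Q R) (φ : Cochain A P Q) :
    Cochain.comp d (ψ - ψ') φ = Cochain.comp d ψ φ - Cochain.comp d ψ' φ := by
  simp only [← compₗ_apply, map_sub, LinearMap.sub_apply]

@[simp] lemma comp_sub_right (d : ℤ) (ψ : Cochain A Q R) (φ φ' : Cochain A P Q) :
    Cochain.comp d ψ (φ - φ') = Cochain.comp d ψ φ - Cochain.comp d ψ φ' := by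
  simp only [← compₗ_apply, map_sub]

@[simp] lemma comp_zero_left (d : ℤ) (φ : Cochain A P Q) :
    Cochain.comp d (0 : Cochain A Q R) φ = 0 := by
  simp only [← compₗ_apply, map_zero, LinearMap.zero_apply]

@[simp] lemma comp_zero_right (d : ℤ) (ψ : Cochain A Q R) :
    Cochain.comp d ψ (0 : Cochain A P Q) = 0 := by
  simp only [← compₗ_apply, map_zero]

lemma sgnPow_one_apply (M : GrSpace K) (x : Bar M) : M.sgnPow 1 x = M.sgn x := by
  rw [sgnPow_one]; rfl

/-- `comp` depends on the degree only through its parity. -/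
lemma comp_congr_even {d e : ℤ} (h : Even (d - e)) (ψ : Cochain A Q R) (φ : Cochain A P Q) :
    Cochain.comp d ψ φ = Cochain.comp e ψ φ := by
  have : A.sgnPow d = A.sgnPow e := by
    have : Even d ↔ Even e := Int.even_sub.1 h
    simp [GrSpace.sgnPow, this]
  simp only [Cochain.comp, this]

lemma insertMu_comp (d : ℤ) (ψ : Cochain A Q R) {φ : Cochain A P Q} (hφ : φ.HasParity d) :
    (Cochain.comp d ψ φ).insertMu =
      Cochain.comp (d + 1) ψ φ.insertMu + ksign K d • Cochain.comp d ψ.insertMu φ := by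
  refine Cochain.ext_word fun l m p => ?_
  rw [insertMu_apply, comp_coder_right, comp_coder_left]
  simp only [insertMu_eq, comp_add_left, comp_add_right, LinearMap.add_apply,
    LinearMap.smul_apply, smul_add]
  have e : A.sgn (word m) = word (m.map (A.letterSgn 1)) := sgn_word _ _
  have h1 : Cochain.comp d (ψ.right (A.sgnPow 1)) (φ.right (A.coder A.mu)) (word l) (word m) p =
      Cochain.comp (d + 1) ψ (φ.right (A.coder A.mu)) (word l) (word m) p := by
    simp only [comp_word_spl]
    refine spl_congr fun a b _ => spl_congr fun c e _ => ?_
    simp [A.isAInf.graded.sgnPow_sgnPow, add_comm]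
  have h4 : Cochain.comp d ψ (φ.left (A.coder A.mu)) (word l) (A.sgn (word m)) (P.par p) =
      Cochain.comp (d + 1) ψ φ.leftMu (word l) (word m) p := by
    rw [e]
    simp only [comp_word_spl, spl_map]
    simp only [leftMu_apply, ← sgn_word, LinearMap.comp_apply]
    refine spl_congr fun a b _ => spl_congr fun c e _ => ?_
    rw [← A.isAInf.graded.sgnPow_sgnPow, sgnPow_one]; rfl
  have h3 : Cochain.comp d (ψ.left (A.coder A.mu)) (φ.left (A.sgnPow 1)) (word l)
      (A.sgn (word m)) (P.par p) = ksign K d • Cochain.comp d ψ.leftMu φ (word l) (word m) p := by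
    rw [e]
    simp only [comp_word_spl, spl_map, ← spl_smul]
    simp only [leftMu_apply, ← sgn_word, LinearMap.comp_apply]
    refine spl_congr fun a b _ => spl_congr fun c e _ => ?_
    have h5 : A.sgnPow d (A.sgn (word e)) = A.sgn (A.sgnPow d (word e)) := by
      rw [← sgnPow_one_apply, ← sgnPow_one_apply, A.isAInf.graded.sgnPow_sgnPow,
        A.isAInf.graded.sgnPow_sgnPow, add_comm]
    rw [hφ, map_smul, smul_smul, ksign_mul_self, one_smul, sgnPow_one, h5]
    rfl
  rw [h1, h3, h4]
  abel

lemma insertMu_insertMu (φ : Cochain A P Q) : φ.insertMu.insertMu = 0 := by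
  refine LinearMap.ext fun x => LinearMap.ext fun y => LinearMap.ext fun p => ?_
  simp [insertMu_apply, A.isAInf.coder_coder, A.isAInf.sgn_coder]

section Degrees

/-- `φ` has degree `d`. -/
def Cochain.HasDegree (φ : Cochain A P Q) (d : ℤ) : Prop :=
  ∀ k m n x y p, HomWord A.gr (-1) k x → HomWord A.gr (-1) n y → p ∈ P.gr m →
    φ x y p ∈ Q.gr (k + m + n + d)

lemma Cochain.HasDegree.hasParity (hP : P.IsGraded) (hQ : Q.IsGraded) {φ : Cochain A P Q} {d : ℤ}
    (hφ : φ.HasDegree d) : φ.HasParity d := by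
  intro x y p
  induction x using A.isAInf.graded.bar_induction with
  | hadd x x' h1 h2 => simp only [map_add, LinearMap.add_apply, h1, h2, smul_add]
  | hsmul c x h => simp only [map_smul, LinearMap.smul_apply, h]; rw [smul_comm]
  | hw k x hx =>
  induction y using A.isAInf.graded.bar_induction with
  | hadd x x' h1 h2 => simp only [map_add, LinearMap.add_apply, h1, h2, smul_add]
  | hsmul c x h => simp only [map_smul, LinearMap.smul_apply, h]; rw [smul_comm]
  | hw n y hy =>
  induction p using hP.induction with
  | hadd x x' h1 h2 => simp only [map_add, h1, h2, smul_add]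
  | hm m p hp =>
    rw [hx.sgn A.isAInf.graded, hy.sgn A.isAInf.graded, hP.par_apply m p hp,
      hQ.par_apply _ _ (hφ k m n x y p hx hy hp)]
    simp only [map_smul, LinearMap.smul_apply, smul_smul, ksign_add]
    congr 1; ring

variable {A : AInfAlgebra K} {P Q R S : BimoduleData A}

lemma IsBimodule.hasDegree (hP : IsBimodule P) : Cochain.HasDegree (A := A) P.op 1 := hP.degree

lemma IsBimodule.hasParity (hP : IsBimodule P) : Cochain.HasParity (A := A) P.op 1 :=
  hP.hasDegree.hasParity hP.graded hP.graded

lemma homDeg.hasParity (hP : IsBimodule P) (hQ : IsBimodule Q)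
    {φ : Cochain A P.toGrSpace Q.toGrSpace} {d : ℤ}
    (hφ : φ ∈ homDeg P.toGrSpace Q.toGrSpace d) : φ.HasParity d :=
  Cochain.HasDegree.hasParity hP.graded hQ.graded hφ.2

lemma diff_apply (d : ℤ) (φ : Cochain A P.toGrSpace Q.toGrSpace) : diff P Q d φ =
    Cochain.comp d Q.op φ - ksign K d • (Cochain.comp 1 φ P.op + φ.insertMu) := rfl

/-- The Leibniz rule for the composition of cochains. -/
lemma diff_comp (d e : ℤ) (ψ : Cochain A Q.toGrSpace R.toGrSpace)
    {φ : Cochain A P.toGrSpace Q.toGrSpace} (hφ : φ.HasParity d) :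
    diff P R (d + e) (Cochain.comp d ψ φ) =
      Cochain.comp d (diff Q R e ψ) φ + ksign K e • Cochain.comp (d + 1) ψ (diff P Q d φ) := by
  simp only [diff_apply, insertMu_comp d ψ hφ, comp_sub_left, comp_sub_right, comp_add_left,
    comp_add_right, comp_smul_left, comp_smul_right, comp_assoc, ksign_add]
  rw [add_comm 1 d]
  rcases ksign_eq K d with h1 | h1 <;> rcases ksign_eq K e with h2 | h2 <;> rw [h1, h2] <;>
    simp only [one_smul, neg_smul, mul_one, mul_neg, neg_neg] <;> abel

lemma diff_diff (hP : IsBimodule P) (hQ : IsBimodule Q) (d : ℤ)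
    {φ : Cochain A P.toGrSpace Q.toGrSpace} (hφ : φ.HasParity d) :
    diff P Q (d + 1) (diff P Q d φ) = 0 := by
  have h1 : Cochain.insertMu (A := A) P.op = -Cochain.comp 1 P.op P.op :=
    eq_neg_of_add_eq_zero_right hP.assoc
  have h2 : Cochain.insertMu (A := A) Q.op = -Cochain.comp 1 Q.op Q.op :=
    eq_neg_of_add_eq_zero_right hQ.assoc
  simp only [diff_apply, insertMu_comp d Q.op hφ, comp_sub_left, comp_sub_right, comp_add_left,
    comp_add_right, comp_smul_left, comp_smul_right, comp_assoc, ksign_add, insertMu_add,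
    insertMu_sub, insertMu_smul, insertMu_comp 1 φ hP.hasParity, h1, h2, comp_neg_left,
    comp_neg_right, insertMu_insertMu, ksign_one]
  rw [add_comm 1 d]
  rcases ksign_eq K d with h1 | h1 <;> rw [h1] <;>
    simp only [one_smul, neg_smul, mul_one, mul_neg, neg_neg, smul_neg, smul_add] <;> abel

/-- Composition preserves degrees. -/
lemma Cochain.HasDegree.comp {P Q R : GrSpace K} {d e : ℤ} {ψ : Cochain A Q R}
    {φ : Cochain A P Q} (hψ : ψ.HasDegree e) (hφ : φ.HasDegree d) (i : ℤ) :
    (Cochain.comp i ψ φ).HasDegree (d + e) := by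
  intro k m n x y p hx hy hp
  obtain ⟨l, rfl, hl⟩ := hx.exists_word
  obtain ⟨r, rfl, hr⟩ := hy.exists_word
  rw [comp_word_spl]
  refine spl_mem fun a b hab => spl_mem fun c f hcf => ?_
  obtain ⟨k₁, k₂, hk, ha, hb⟩ := (hab ▸ hl).split
  obtain ⟨n₁, n₂, hn, hc, hf⟩ := (hcf ▸ hr).split
  have := hψ _ _ _ _ _ _ ha.homWord (hf.homWord.sgnPow A.isAInf.graded i)
    (hφ _ _ _ _ _ _ hb.homWord hc.homWord hp)
  convert this using 2
  rw [hk, hn]; ring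

end Degrees

end CochainCalculus

section DegreeOfDiff

variable {K : Type u} [Field K]

/-- `coder μ` has degree one. -/
lemma IsAInf.coder_mem {M : GrSpace K} {e : M} {μ : Bar M →ₗ[K] M} (h : IsAInf M e μ)
    {X : Type u} [AddCommGroup X] [Module K X] {S : Submodule K X} {f : Bar M →ₗ[K] X} {n : ℤ}
    (hf : ∀ z, HomWord M.gr (-1) (n + 1) z → f z ∈ S) {x : Bar M} (hx : HomWord M.gr (-1) n x) :
    f (M.coder μ x) ∈ S := by
  obtain ⟨l, rfl, hl⟩ := hx.exists_word
  rw [coder_word, spl_hom]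
  refine spl_mem fun a w haw => ?_
  rw [spl_hom]
  refine spl_mem fun b c hbc => hf _ (HomList.homWord ?_)
  obtain ⟨i, j, rfl, ha, hw⟩ := (haw ▸ hl).split
  obtain ⟨j, k, rfl, hb, hc⟩ := (hbc ▸ hw).split
  have := ha.append (u := a) (v := μ (word b) :: c.map (M.letterSgn 1))
    ⟨j + 2, k, h.degree _ _ hb.homWord, hc.map_letterSgn h.graded 1, rfl⟩
  convert this using 1
  ring

variable {A : AInfAlgebra K}

lemma Cochain.HasDegree.insertMu {P Q : GrSpace K} (hP : P.IsGraded) {φ : Cochain A P Q} {d : ℤ}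
    (hφ : φ.HasDegree d) : (Cochain.insertMu φ).HasDegree (d + 1) := by
  intro k m n x y p hx hy hp
  rw [insertMu_apply]
  refine add_mem ?_ ?_
  · refine A.isAInf.coder_mem (f := (φ x).flip p) (fun z hz => ?_) hy
    have := hφ _ _ _ _ _ _ hx hz hp
    rw [LinearMap.flip_apply]
    convert this using 2
    ring
  · refine A.isAInf.coder_mem (f := (φ.flip (A.sgn y)).flip (P.par p)) (fun z hz => ?_) hx
    have := hφ _ _ _ _ _ _ hz (hy.sgnPow A.isAInf.graded 1) (hP.parPow_mem 1 hp)
    rw [sgnPow_one_apply, parPow_one] at this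
    simp only [LinearMap.flip_apply]
    convert this using 2
    ring

lemma Cochain.HasDegree.cast {P Q : GrSpace K} {φ : Cochain A P Q} {d e : ℤ}
    (hφ : φ.HasDegree d) (h : d = e) : φ.HasDegree e := h ▸ hφ

lemma Cochain.HasDegree.sub {P Q : GrSpace K} {φ ψ : Cochain A P Q} {d : ℤ}
    (hφ : φ.HasDegree d) (hψ : ψ.HasDegree d) : (φ - ψ).HasDegree d :=
  fun k m n x y p hx hy hp => sub_mem (hφ k m n x y p hx hy hp) (hψ k m n x y p hx hy hp)

lemma Cochain.HasDegree.add {P Q : GrSpace K} {φ ψ : Cochain A P Q} {d : ℤ}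
    (hφ : φ.HasDegree d) (hψ : ψ.HasDegree d) : (φ + ψ).HasDegree d :=
  fun k m n x y p hx hy hp => add_mem (hφ k m n x y p hx hy hp) (hψ k m n x y p hx hy hp)

lemma Cochain.HasDegree.smul {P Q : GrSpace K} {φ : Cochain A P Q} {d : ℤ}
    (hφ : φ.HasDegree d) (c : K) : (c • φ).HasDegree d :=
  fun k m n x y p hx hy hp => Submodule.smul_mem _ _ (hφ k m n x y p hx hy hp)

variable {P Q R : GrSpace K}

lemma Cochain.normalized_of_word {φ : Cochain A P Q}
    (h1 : ∀ u v m p, φ (word (u ++ A.unit :: v)) (word m) p = 0)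
    (h2 : ∀ l u v p, φ (word l) (word (u ++ A.unit :: v)) p = 0) : φ.Normalized := by
  have key {f : Bar A.toGrSpace →ₗ[K] Q} (h : ∀ l, f (word l) = 0) (x : Bar A.toGrSpace) :
      f x = 0 := DFunLike.congr_fun (word_ext (g := 0) h) x
  refine ⟨fun x x' y => LinearMap.ext fun p => ?_, fun x y y' => LinearMap.ext fun p => ?_⟩
  · refine key (f := ((φ.flip y).flip p) ∘ₗ LinearMap.mulLeft K (x * TensorAlgebra.ι K A.unit))
      (fun v => ?_) x'
    refine key (f := ((φ.flip y).flip p) ∘ₗ LinearMap.mulRight K (word v) ∘ₗ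
      LinearMap.mulRight K (TensorAlgebra.ι K A.unit)) (fun u => ?_) x
    refine key (f := (φ (word u * TensorAlgebra.ι K A.unit * word v)).flip p) (fun m => ?_) y
    rw [word_mid]
    exact h1 u v m p
  · refine key (f := ((φ x).flip p) ∘ₗ LinearMap.mulLeft K (y * TensorAlgebra.ι K A.unit))
      (fun v => ?_) y'
    refine key (f := ((φ x).flip p) ∘ₗ LinearMap.mulRight K (word v) ∘ₗ
      LinearMap.mulRight K (TensorAlgebra.ι K A.unit)) (fun u => ?_) y
    refine key (f := (φ.flip (word u * TensorAlgebra.ι K A.unit * word v)).flip p) (fun l => ?_) x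
    rw [word_mid]
    exact h2 l u v p

lemma Cochain.Normalized.left_word {φ : Cochain A P Q} (h : φ.Normalized) (u v : List A.carrier) :
    φ (word (u ++ A.unit :: v)) = 0 := by
  ext y p
  rw [← word_mid, h.1]; simp

lemma Cochain.Normalized.right_word {φ : Cochain A P Q} (h : φ.Normalized) (x : Bar A.toGrSpace)
    (u v : List A.carrier) : φ x (word (u ++ A.unit :: v)) = 0 := by
  rw [← word_mid, h.2]

lemma letterSgn_unit (A : AInfAlgebra K) (d : ℤ) : A.letterSgn d A.unit = ksign K d • A.unit := by
  unfold GrSpace.letterSgn ksign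
  split_ifs <;> simp [A.par_unit]

lemma sgnPow_word_unit (d : ℤ) (u v : List A.carrier) : A.sgnPow d (word (u ++ A.unit :: v)) =
    ksign K d • (A.sgnPow d (word u) * TensorAlgebra.ι K A.unit * A.sgnPow d (word v)) := by
  rw [← word_mid, sgnPow_mul, sgnPow_mul, sgnPow_ι, letterSgn_unit]
  simp

lemma Cochain.Normalized.right_sgnPow {φ : Cochain A P Q} (h : φ.Normalized) (x : Bar A.toGrSpace)
    (d : ℤ) (u v : List A.carrier) : φ x (A.sgnPow d (word (u ++ A.unit :: v))) = 0 := by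
  rw [sgnPow_word_unit, map_smul, h.2, smul_zero]

lemma Cochain.Normalized.comp {ψ : Cochain A Q R} {φ : Cochain A P Q} (hψ : ψ.Normalized)
    (hφ : φ.Normalized) (d : ℤ) : (Cochain.comp d ψ φ).Normalized := by
  refine Cochain.normalized_of_word (fun u v m p => ?_) (fun l u v p => ?_)
  · rw [comp_word_spl, spl_append_cons]
    simp [hψ.left_word, hφ.left_word]
  · rw [comp_word_spl]
    refine spl_eq_zero fun a b _ => ?_
    rw [spl_append_cons]
    simp [hψ.right_sgnPow, hφ.right_word]

lemma comp_mem_homDeg {d e : ℤ} {ψ : Cochain A Q R} {φ : Cochain A P Q} (hψ : ψ ∈ homDeg Q R e)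
    (hφ : φ ∈ homDeg P Q d) : Cochain.comp d ψ φ ∈ homDeg P R (d + e) :=
  ⟨hψ.1.comp hφ.1 d, Cochain.HasDegree.comp hψ.2 hφ.2 d⟩

lemma map_coder_unit {X : Type u} [AddCommGroup X] [Module K X] (f : Bar A.toGrSpace →ₗ[K] X)
    (hf : ∀ x x', f (x * TensorAlgebra.ι K A.unit * x') = 0) (u w : Bar A.toGrSpace) :
    f (A.coder A.mu (u * TensorAlgebra.ι K A.unit * w)) = aug w • f u - aug u • f (A.sgn w) := by
  have h : unitIdeal A ≤ LinearMap.ker f := by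
    refine Submodule.span_le.2 ?_
    rintro _ ⟨x, y, rfl⟩
    exact hf x y
  have := h (coder_unit u w)
  rw [LinearMap.mem_ker, map_sub, sub_eq_zero] at this
  rw [this]; simp

end DegreeOfDiff

section DiffHomDeg

variable {K : Type u} [Field K] {A : AInfAlgebra K} {P Q : BimoduleData A}

lemma diff_normalized {d : ℤ} {φ : Cochain A P.toGrSpace Q.toGrSpace} (hφ : φ.Normalized)
    (hpar : φ.HasParity d) : (diff P Q d φ).Normalized := by
  refine Cochain.normalized_of_word (fun u v m p => ?_) (fun l u v p => ?_)
  · have h1 : Cochain.comp d Q.op φ (word (u ++ A.unit :: v)) (word m) p =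
        -(aug (word (K := K) u) • Q.par (φ (word v) (word m) p)) := by
      rw [comp_word_spl, spl_append_cons]
      simp only [hφ.1, ← word_mid, Q.unit_left, LinearMap.zero_apply, map_zero, spl_zero,
        zero_add, spl_neg, aug_sgnPow, mul_smul, spl_smul, spl_aug_left, spl_aug_right]
    have h2 : Cochain.comp 1 φ P.op (word (u ++ A.unit :: v)) (word m) p =
        -(aug (word (K := K) v) • φ (word u) (A.sgn (word m)) (P.par p)) := by
      rw [comp_word_spl, spl_append_cons]
      simp only [hφ.1, ← word_mid, P.unit_left, LinearMap.zero_apply, map_zero, spl_zero,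
        add_zero, map_neg, spl_neg, mul_smul, map_smul, spl_smul, spl_aug_left, spl_aug_right,
        sgnPow_one_apply]
    have h3 : φ.insertMu (word (u ++ A.unit :: v)) (word m) p =
        aug (word (K := K) v) • φ (word u) (A.sgn (word m)) (P.par p) -
          aug (word (K := K) u) • φ (A.sgn (word v)) (A.sgn (word m)) (P.par p) := by
      rw [insertMu_apply, hφ.left_word, ← word_mid, map_coder_unit φ]
      · simp
      · intro x x'; ext y p; simp [hφ.1]
    have h4 := hpar (word v) (word m) p
    change Cochain.comp d Q.op φ (word (u ++ A.unit :: v)) (word m) p - ksign K d •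
      (Cochain.comp 1 φ P.op (word (u ++ A.unit :: v)) (word m) p +
        φ.insertMu (word (u ++ A.unit :: v)) (word m) p) = 0
    rw [h1, h2, h3, h4]
    module
  · have h1 : Cochain.comp d Q.op φ (word l) (word (u ++ A.unit :: v)) p =
        ksign K d • aug (word (K := K) v) • φ (word l) (word u) p := by
      rw [comp_word_spl]
      simp only [spl_append_cons, hφ.right_word, sgnPow_word_unit, Q.unit_right,
        LinearMap.zero_apply, map_zero, spl_zero, add_zero, map_smul, LinearMap.smul_apply,
        aug_sgnPow, mul_smul, spl_smul, spl_aug_left, spl_aug_right]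
    have h2 : Cochain.comp 1 φ P.op (word l) (word (u ++ A.unit :: v)) p =
        aug (word (K := K) u) • φ (word l) (A.sgn (word v)) p := by
      rw [comp_word_spl]
      simp only [spl_append_cons, hφ.right_sgnPow, LinearMap.zero_apply, spl_zero, zero_add]
      simp only [← word_mid, P.unit_right, mul_smul, map_smul, spl_smul, spl_aug_left, spl_aug_right,
        sgnPow_one_apply]
    have h3 : φ.insertMu (word l) (word (u ++ A.unit :: v)) p =
        aug (word (K := K) v) • φ (word l) (word u) p -
          aug (word (K := K) u) • φ (word l) (A.sgn (word v)) p := by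
      rw [insertMu_apply, ← sgnPow_one_apply, hφ.right_sgnPow, ← word_mid,
        map_coder_unit (φ (word l)) (hφ.2 _)]
      simp
    change Cochain.comp d Q.op φ (word l) (word (u ++ A.unit :: v)) p - ksign K d •
      (Cochain.comp 1 φ P.op (word l) (word (u ++ A.unit :: v)) p +
        φ.insertMu (word l) (word (u ++ A.unit :: v)) p) = 0
    rw [h1, h2, h3]
    module

lemma diff_hasDegree (hP : IsBimodule P) (hQ : IsBimodule Q) {d : ℤ}
    {φ : Cochain A P.toGrSpace Q.toGrSpace} (hφ : φ.HasDegree d) :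
    Cochain.HasDegree (A := A) (diff P Q d φ) (d + 1) :=
  (hQ.hasDegree.comp hφ d).sub ((((hφ.comp hP.hasDegree 1).cast (add_comm 1 d)).add
    (hφ.insertMu hP.graded)).smul _)

lemma diff_mem_homDeg (hP : IsBimodule P) (hQ : IsBimodule Q) {d : ℤ}
    {φ : Cochain A P.toGrSpace Q.toGrSpace} (hφ : φ ∈ homDeg P.toGrSpace Q.toGrSpace d) :
    diff P Q d φ ∈ homDeg P.toGrSpace Q.toGrSpace (d + 1) :=
  ⟨diff_normalized hφ.1 (homDeg.hasParity hP hQ hφ), diff_hasDegree hP hQ hφ.2⟩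

end DiffHomDeg

/-! ### Quasi-isomorphisms induce isomorphisms on morphism complexes -/

section Projections

variable {K : Type u} [Field K] {M N : GrSpace K}
variable {X : Type u} [AddCommGroup X] [Module K X]

/-- Linear maps can be defined degree by degree. -/
lemma GrSpace.IsGraded.exists_glue (h : M.IsGraded) (s : ℤ → M →ₗ[K] X) :
    ∃ S : M →ₗ[K] X, ∀ n, ∀ v ∈ M.gr n, S v = s n v := by
  let e := LinearEquiv.ofBijective (DirectSum.coeLinearMap M.gr) h.internal
  refine ⟨DirectSum.toModule K ℤ X (fun n => s n ∘ₗ (M.gr n).subtype) ∘ₗ e.symm.toLinearMap,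
    fun n v hv => ?_⟩
  have : e.symm v = DirectSum.lof K ℤ (fun n => M.gr n) n ⟨v, hv⟩ := by
    rw [LinearEquiv.symm_apply_eq]
    change v = DirectSum.coeLinearMap M.gr _
    rw [DirectSum.coeLinearMap_lof]
  simp [this]

/-- The projection to the part of degree `n`. -/
lemma GrSpace.IsGraded.exists_proj (h : M.IsGraded) (n : ℤ) : ∃ π : M →ₗ[K] M,
    (∀ v ∈ M.gr n, π v = v) ∧ (∀ m, m ≠ n → ∀ v ∈ M.gr m, π v = 0) ∧ ∀ v, π v ∈ M.gr n := by
  obtain ⟨S, hS⟩ := h.exists_glue fun m => if m = n then LinearMap.id else (0 : M →ₗ[K] M)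
  have h1 : ∀ v ∈ M.gr n, S v = v := fun v hv => by simp [hS n v hv]
  have h2 : ∀ m, m ≠ n → ∀ v ∈ M.gr m, S v = 0 := fun m hm v hv => by simp [hS m v hv, hm]
  refine ⟨S, h1, h2, fun v => ?_⟩
  induction v using h.induction with
  | hm m v hv =>
    by_cases hmn : m = n
    · subst hmn; rwa [h1 v hv]
    · rw [h2 m hmn v hv]; exact zero_mem _
  | hadd v w h1 h2 => rw [map_add]; exact add_mem h1 h2

/-- The projection to the part of degree `n`. -/
def GrSpace.IsGraded.proj (h : M.IsGraded) (n : ℤ) : M →ₗ[K] M := (h.exists_proj n).choose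

lemma GrSpace.IsGraded.proj_of_mem (h : M.IsGraded) {n : ℤ} {v : M} (hv : v ∈ M.gr n) :
    h.proj n v = v := (h.exists_proj n).choose_spec.1 v hv

lemma GrSpace.IsGraded.proj_of_ne (h : M.IsGraded) {m n : ℤ} (hmn : m ≠ n) {v : M}
    (hv : v ∈ M.gr m) : h.proj n v = 0 := (h.exists_proj n).choose_spec.2.1 m hmn v hv

lemma GrSpace.IsGraded.proj_mem (h : M.IsGraded) (n : ℤ) (v : M) : h.proj n v ∈ M.gr n :=
  (h.exists_proj n).choose_spec.2.2 v

lemma GrSpace.IsGraded.proj_comm (hM : M.IsGraded) (hN : N.IsGraded) {F : M →ₗ[K] N} {k : ℤ}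
    (hF : ∀ n, ∀ v ∈ M.gr n, F v ∈ N.gr (n + k)) (n : ℤ) (v : M) :
    hN.proj (n + k) (F v) = F (hM.proj n v) := by
  induction v using hM.induction with
  | hm m v hv =>
    by_cases h : m = n
    · subst h; rw [hN.proj_of_mem (hF _ _ hv), hM.proj_of_mem hv]
    · rw [hN.proj_of_ne (by simpa using h) (hF _ _ hv), hM.proj_of_ne h hv, map_zero]
  | hadd v w h1 h2 => simp only [map_add, h1, h2]

/-- A linear section over a subspace. -/
lemma exists_section {X Y : Type u} [AddCommGroup X] [Module K X] [AddCommGroup Y] [Module K Y]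
    (δ : Y →ₗ[K] X) (Z : Submodule K X) (W : Submodule K Y) (h : ∀ z ∈ Z, ∃ w ∈ W, δ w = z) :
    ∃ σ : X →ₗ[K] Y, ∀ z ∈ Z, σ z ∈ W ∧ δ (σ z) = z := by
  let g : (W ⊓ Z.comap δ : Submodule K Y) →ₗ[K] Z :=
    (δ ∘ₗ (W ⊓ Z.comap δ).subtype).codRestrict Z fun w => w.2.2
  have hg : Function.Surjective g := by
    rintro ⟨z, hz⟩
    obtain ⟨w, hw, rfl⟩ := h z hz
    exact ⟨⟨w, hw, hz⟩, rfl⟩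
  obtain ⟨s, hs⟩ := g.exists_rightInverse_of_surjective (LinearMap.range_eq_top.2 hg)
  obtain ⟨σ, hσ⟩ := ((W ⊓ Z.comap δ).subtype ∘ₗ s).exists_extend
  refine ⟨σ, fun z hz => ?_⟩
  have h1 : σ z = (s ⟨z, hz⟩ : Y) := DFunLike.congr_fun hσ ⟨z, hz⟩
  have h2 := congrArg Subtype.val (LinearMap.congr_fun hs ⟨z, hz⟩)
  rw [h1]
  exact ⟨(s ⟨z, hz⟩).2.1, h2⟩

/-- A sum of linear maps of which only finitely many are nonzero on each vector. -/
lemma exists_tsum {X Y : Type u} [AddCommGroup X] [Module K X] [AddCommGroup Y] [Module K Y]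
    (g : ℕ → X →ₗ[K] Y) (h : ∀ x, ∃ n, ∀ k, n ≤ k → g k x = 0) :
    ∃ S : X →ₗ[K] Y, ∀ x n, (∀ k, n ≤ k → g k x = 0) → S x = ∑ k ∈ Finset.range n, g k x := by
  have hf (x : X) : (Function.support fun k => g k x).Finite := by
    obtain ⟨n, hn⟩ := h x
    refine (Finset.range n).finite_toSet.subset fun k hk => ?_
    by_contra hk'
    exact hk (hn k (by simpa using hk'))
  refine ⟨⟨⟨fun x => ∑ᶠ k, g k x, fun x y => ?_⟩, fun c x => ?_⟩, fun x n hn => ?_⟩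
  · simp only [map_add]; exact finsum_add_distrib (hf x) (hf y)
  · simp only [map_smul, RingHom.id_apply]; exact (smul_finsum c _).symm
  · refine finsum_eq_sum_of_support_subset _ fun k hk => ?_
    by_contra hk'
    exact hk (hn k (by simpa using hk'))

end Projections

section Contraction

variable {K : Type u} [Field K] {A : AInfAlgebra K} {M N : BimoduleData A}

lemma op_one_one (hM : IsBimodule M) (v : M.carrier) : M.op 1 1 (M.op 1 1 v) = 0 := by
  have := congrArg (fun φ : Cochain A M.toGrSpace M.toGrSpace => φ (word []) (word []) v) hM.assoc
  have h2 : Cochain.comp (A := A) 1 M.op M.op (word []) (word []) v +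
    Cochain.insertMu (A := A) M.op (word []) (word []) v = 0 := this
  simp only [comp_word_spl, insertMu_apply] at h2
  simpa [A.isAInf.map_one] using h2

lemma cocycle_one_one {f : Cochain A M.toGrSpace N.toGrSpace} (hf : f ∈ cocycles M N 0)
    (v : M.carrier) : N.op 1 1 (f 1 1 v) = f 1 1 (M.op 1 1 v) := by
  have := congrArg (fun φ : Cochain A M.toGrSpace N.toGrSpace => φ (word []) (word []) v)
    (LinearMap.mem_ker.1 hf.2)
  have h2 : Cochain.comp 0 N.op f (word []) (word []) v - ksign K 0 •
    (Cochain.comp 1 f M.op (word []) (word []) v + f.insertMu (word []) (word []) v) = 0 := this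
  simp only [comp_word_spl, insertMu_apply] at h2
  simpa [A.isAInf.map_one, sub_eq_zero] using h2

/-- A contraction of the mapping cone of a quasi-isomorphism. -/
lemma IsQuasiIso.exists_contraction (hM : IsBimodule M) (hN : IsBimodule N)
    {f : Cochain A M.toGrSpace N.toGrSpace} (hf : IsQuasiIso (P := M) (Q := N) f) :
    ∃ (a : M.carrier →ₗ[K] M.carrier) (b : N.carrier →ₗ[K] M.carrier)
      (c : M.carrier →ₗ[K] N.carrier) (e : N.carrier →ₗ[K] N.carrier),
      (∀ n, ∀ v ∈ M.gr n, a v ∈ M.gr (n + -1)) ∧ (∀ n, ∀ v ∈ N.gr n, b v ∈ M.gr (n + 0)) ∧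
      (∀ n, ∀ v ∈ M.gr n, c v ∈ N.gr (n + -2)) ∧ (∀ n, ∀ v ∈ N.gr n, e v ∈ N.gr (n + -1)) ∧
      (∀ v, M.op 1 1 (a v) + a (M.op 1 1 v) + b (f 1 1 v) = v) ∧
      (∀ v, M.op 1 1 (b v) = b (N.op 1 1 v)) ∧
      (∀ v, f 1 1 (a v) + e (f 1 1 v) + c (M.op 1 1 v) = N.op 1 1 (c v)) ∧
      ∀ v, f 1 1 (b v) - N.op 1 1 (e v) - e (N.op 1 1 v) = v := by
  have gM := hM.graded
  have gN := hN.graded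
  have hdM : ∀ n, ∀ v ∈ M.gr n, M.op 1 1 v ∈ M.gr (n + 1) := fun n v hv => by
    have := hM.degree 0 n 0 1 1 v .nil .nil hv
    simpa using this
  have hdN : ∀ n, ∀ v ∈ N.gr n, N.op 1 1 v ∈ N.gr (n + 1) := fun n v hv => by
    have := hN.degree 0 n 0 1 1 v .nil .nil hv
    simpa using this
  have hf0 : ∀ n, ∀ v ∈ M.gr n, f 1 1 v ∈ N.gr (n + 0) := fun n v hv => by
    have := hf.cocycle.1.2 0 n 0 1 1 v .nil .nil hv
    simpa using this
  have hf0' : ∀ n, ∀ v ∈ M.gr n, f 1 1 v ∈ N.gr n := fun n v hv => by simpa using hf0 n v hv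
  have hcl := cocycle_one_one hf.cocycle
  let δ : M.carrier × N.carrier →ₗ[K] M.carrier × N.carrier :=
    (M.op 1 1 ∘ₗ LinearMap.fst K _ _).prod
      (f 1 1 ∘ₗ LinearMap.fst K _ _ - N.op 1 1 ∘ₗ LinearMap.snd K _ _)
  have δ_apply : ∀ m v, δ (m, v) = (M.op 1 1 m, f 1 1 m - N.op 1 1 v) := fun m v => rfl
  have δδ : ∀ x, δ (δ x) = 0 := by
    rintro ⟨m, v⟩
    rw [δ_apply, δ_apply, op_one_one hM, map_sub, op_one_one hN, hcl]
    simp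
  let W : ℤ → Submodule K (M.carrier × N.carrier) := fun n => (M.gr n).prod (N.gr (n - 1))
  have hδW : ∀ n, ∀ x ∈ W n, δ x ∈ W (n + 1) := by
    rintro n ⟨m, v⟩ ⟨h1, h2⟩
    refine ⟨hdM n m h1, ?_⟩
    have : n + 1 - 1 = n := by ring
    rw [δ_apply, this]
    refine sub_mem (hf0' n m h1) ?_
    have := hdN _ _ h2
    rwa [sub_add_cancel] at this
  have hex : ∀ n, ∃ σ : M.carrier × N.carrier →ₗ[K] M.carrier × N.carrier,
      ∀ z ∈ W n ⊓ LinearMap.ker δ, σ z ∈ W (n - 1) ∧ δ (σ z) = z := by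
    intro n
    refine exists_section δ _ _ ?_
    rintro ⟨m, v⟩ ⟨⟨h1, h2⟩, h3⟩
    replace h3 : δ (m, v) = 0 := h3
    rw [δ_apply, Prod.mk_eq_zero, sub_eq_zero] at h3
    obtain ⟨p, hp⟩ := hf.injective m h3.1 ⟨v, h3.2⟩
    have hp1 : m = M.op 1 1 (gM.proj (n - 1) p) := by
      rw [← gM.proj_comm gM hdM, ← hp, gM.proj_of_mem]
      rwa [sub_add_cancel]
    have hp2 := gM.proj_mem (n - 1) p
    obtain ⟨q, hq, q', hq'⟩ := hf.surjective (v - f 1 1 (gM.proj (n - 1) p)) (by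
      rw [map_sub, hcl, ← hp1, h3.2, sub_self])
    have e1 : v - f 1 1 (gM.proj (n - 1) p) =
        f 1 1 (gM.proj (n - 1) q) + N.op 1 1 (gN.proj (n - 1 - 1) q') := by
      have h4 := congrArg (gN.proj (n - 1)) hq'
      have h5 := gM.proj_comm gN hf0 (n - 1) q
      have h6 := gN.proj_comm gN hdN (n - 1 - 1) q'
      rw [add_zero] at h5
      rw [sub_add_cancel] at h6
      rw [gN.proj_of_mem (sub_mem h2 (hf0' _ _ hp2)), map_add, h5, h6] at h4
      exact h4
    refine ⟨(gM.proj (n - 1) p + gM.proj (n - 1) q, -gN.proj (n - 1 - 1) q'),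
      ⟨add_mem hp2 (gM.proj_mem _ _), neg_mem (gN.proj_mem _ _)⟩, ?_⟩
    rw [δ_apply, map_add, ← hp1, ← gM.proj_comm gM hdM, hq, map_add, map_neg]
    refine Prod.ext (by simp) ?_
    change _ = v
    rw [sub_neg_eq_add, add_assoc, ← e1, add_sub_cancel]
  choose σ hσ using hex
  let s : ℤ → M.carrier × N.carrier →ₗ[K] M.carrier × N.carrier := fun n =>
    σ n ∘ₗ (LinearMap.id - σ (n + 1) ∘ₗ δ)
  have hs : ∀ n, ∀ x ∈ W n, s n x ∈ W (n - 1) ∧ δ (s n x) + s (n + 1) (δ x) = x := by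
    intro n x hx
    have h1 := hσ (n + 1) (δ x) ⟨hδW n x hx, LinearMap.mem_ker.2 (δδ x)⟩
    rw [add_sub_cancel_right] at h1
    have h2 := hσ n (x - σ (n + 1) (δ x)) ⟨sub_mem hx h1.1, by
      change δ _ = 0
      rw [map_sub, h1.2, sub_self]⟩
    refine ⟨h2.1, ?_⟩
    have e1 : s n x = σ n (x - σ (n + 1) (δ x)) := rfl
    have e2 : s (n + 1) (δ x) = σ (n + 1) (δ x - σ (n + 1 + 1) (δ (δ x))) := rfl
    rw [e1, e2, h2.2, δδ, map_zero, sub_zero, sub_add_cancel]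
  obtain ⟨a, ha⟩ := gM.exists_glue fun n => LinearMap.fst K _ _ ∘ₗ s n ∘ₗ LinearMap.inl K _ _
  obtain ⟨c, hc⟩ := gM.exists_glue fun n => LinearMap.snd K _ _ ∘ₗ s n ∘ₗ LinearMap.inl K _ _
  obtain ⟨b, hb⟩ := gN.exists_glue fun n =>
    LinearMap.fst K _ _ ∘ₗ s (n + 1) ∘ₗ LinearMap.inr K _ _
  obtain ⟨e, he⟩ := gN.exists_glue fun n =>
    LinearMap.snd K _ _ ∘ₗ s (n + 1) ∘ₗ LinearMap.inr K _ _
  have hM1 : ∀ n, ∀ v ∈ M.gr n, s n (v, 0) = (a v, c v) := fun n v hv => by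
    rw [ha n v hv, hc n v hv]; rfl
  have hN1 : ∀ n, ∀ v ∈ N.gr n, s (n + 1) (0, v) = (b v, e v) := fun n v hv => by
    rw [hb n v hv, he n v hv]; rfl
  have wM : ∀ n, ∀ v ∈ M.gr n, ((v, 0) : M.carrier × N.carrier) ∈ W n := fun n v hv =>
    ⟨hv, zero_mem _⟩
  have wN : ∀ n, ∀ v ∈ N.gr n, ((0, v) : M.carrier × N.carrier) ∈ W (n + 1) := fun n v hv =>
    ⟨zero_mem _, by simpa using hv⟩
  have kM : ∀ n, ∀ v ∈ M.gr n, δ (a v, c v) + ((a (M.op 1 1 v), c (M.op 1 1 v)) +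
      (b (f 1 1 v), e (f 1 1 v))) = (v, 0) := fun n v hv => by
    have h1 := (hs n _ (wM n v hv)).2
    have h2 : δ (v, 0) = (M.op 1 1 v, 0) + (0, f 1 1 v) := by simp [δ_apply]
    rw [h2, map_add, hM1 _ _ hv, hM1 _ _ (hdM n v hv), hN1 _ _ (hf0' n v hv)] at h1
    exact h1
  have kN : ∀ n, ∀ v ∈ N.gr n, δ (b v, e v) - (b (N.op 1 1 v), e (N.op 1 1 v)) = (0, v) :=
    fun n v hv => by
    have h1 := (hs _ _ (wN n v hv)).2
    have h2 : δ (0, v) = -(0, N.op 1 1 v) := by simp [δ_apply]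
    rw [h2, map_neg, hN1 _ _ hv, hN1 _ _ (hdN n v hv), ← sub_eq_add_neg] at h1
    exact h1
  refine ⟨a, b, c, e, fun n v hv => ?_, fun n v hv => ?_, fun n v hv => ?_, fun n v hv => ?_,
    fun v => ?_, fun v => ?_, fun v => ?_, fun v => ?_⟩
  · have := (hs n _ (wM n v hv)).1
    rw [hM1 n v hv] at this
    exact this.1
  · have := (hs _ _ (wN n v hv)).1
    rw [hN1 n v hv] at this
    simpa using this.1
  · have := (hs n _ (wM n v hv)).1
    rw [hM1 n v hv] at this
    rw [show n + -2 = n - 1 - 1 by ring]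
    exact this.2
  · have := (hs _ _ (wN n v hv)).1
    rw [hN1 n v hv] at this
    rw [show n + -1 = n + 1 - 1 - 1 by ring]
    exact this.2
  · induction v using gM.induction with
    | hm n v hv => simpa [δ_apply, add_assoc] using congrArg Prod.fst (kM n v hv)
    | hadd v w h1 h2 =>
      conv_rhs => rw [← h1, ← h2]
      simp only [map_add]; abel
  · induction v using gN.induction with
    | hm n v hv => simpa [δ_apply, sub_eq_zero] using congrArg Prod.fst (kN n v hv)
    | hadd v w h1 h2 => simp only [map_add, h1, h2]
  · induction v using gM.induction with
    | hm n v hv =>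
      have := congrArg Prod.snd (kM n v hv)
      simp only [δ_apply, Prod.snd_add] at this
      rw [← sub_eq_zero, ← this]; abel
    | hadd v w h1 h2 => simp only [map_add, ← h1, ← h2]; abel
  · induction v using gN.induction with
    | hm n v hv =>
      have := congrArg Prod.snd (kN n v hv)
      simp only [δ_apply, Prod.snd_sub] at this
      exact this
    | hadd v w h1 h2 =>
      conv_rhs => rw [← h1, ← h2]
      simp only [map_add]; abel

end Contraction

section Acyclicity

variable {K : Type u} [Field K] {A : AInfAlgebra K}

/-- `φ` vanishes on all words of total length less than `n`. -/
def Cochain.VanishesBelow {P Q : GrSpace K} (n : ℕ) (φ : Cochain A P Q) : Prop :=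
  ∀ l m, l.length + m.length < n → φ (word l) (word m) = 0

lemma Cochain.VanishesBelow.comp_apply {P Q R : GrSpace K} {n : ℕ} {φ : Cochain A P Q}
    (h : φ.VanishesBelow n) (d : ℤ) (ψ : Cochain A Q R) {l m : List A.carrier}
    (hlm : l.length + m.length ≤ n) (p : P) :
    Cochain.comp d ψ φ (word l) (word m) p = ψ 1 1 (φ (word l) (word m) p) := by
  rw [comp_word_spl, spl_left, spl_right]
  · simp
  · rintro u a v rfl
    rw [h _ _ (by simp at hlm ⊢; omega)]; simp
  · rintro a u v rfl
    refine spl_eq_zero ?_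
    rintro c e rfl
    rw [h _ _ (by simp at hlm ⊢; omega)]; simp

lemma Cochain.VanishesBelow.comp {P Q R : GrSpace K} {n : ℕ} {φ : Cochain A P Q}
    (h : φ.VanishesBelow n) (d : ℤ) (ψ : Cochain A Q R) : (Cochain.comp d ψ φ).VanishesBelow n :=
  fun l m hlm => LinearMap.ext fun p => by
    rw [h.comp_apply d ψ hlm.le, h l m hlm]; simp

lemma Cochain.VanishesBelow.comp_left {P Q R : GrSpace K} {n : ℕ} {ψ : Cochain A Q R}
    (h : ψ.VanishesBelow n) (d : ℤ) (φ : Cochain A P Q) : (Cochain.comp d ψ φ).VanishesBelow n := by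
  intro l m hlm
  ext p
  rw [comp_word_spl]
  refine spl_eq_zero ?_
  rintro a b rfl
  refine spl_eq_zero ?_
  rintro c e rfl
  rw [sgnPow_word, h _ _ (by simp at hlm ⊢; omega)]; rfl

lemma Cochain.VanishesBelow.insertMu {P Q : GrSpace K} {n : ℕ} {φ : Cochain A P Q}
    (h : φ.VanishesBelow n) : (Cochain.insertMu φ).VanishesBelow n := by
  intro l m hlm
  ext p
  rw [insertMu_apply, sgn_word, coder_word, coder_word]
  simp only [spl_hom, spl_apply, LinearMap.zero_apply]
  have h0 : ∀ a c (b : List A.carrier) k, a.length + b.length + c.length + k < n →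
      ∀ x : List A.carrier, x.length = k → φ (word x) (word (a ++ A.mu (word b) :: c)) = 0 ∧
        φ (word (a ++ A.mu (word b) :: c)) (word x) = 0 := by
    intro a c b k hk x hx
    cases b with
    | nil =>
      have : word (K := K) (a ++ A.mu (word []) :: c) = 0 := by
        simp [word_append, word_cons, A.isAInf.map_one]
      rw [this]; simp
    | cons b₁ b =>
      constructor
      · exact h _ _ (by simp at hk ⊢; omega)
      · exact h _ _ (by simp at hk ⊢; omega)
  rw [spl_eq_zero, spl_eq_zero, add_zero]
  · rintro a w rfl
    refine spl_eq_zero ?_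
    rintro b c rfl
    rw [(h0 a (c.map (A.letterSgn 1)) b (m.map (A.letterSgn 1)).length
      (by simp at hlm ⊢; omega) _ rfl).2]; rfl
  · rintro a w rfl
    refine spl_eq_zero ?_
    rintro b c rfl
    rw [(h0 a (c.map (A.letterSgn 1)) b l.length (by simp at hlm ⊢; omega) _ rfl).1]; rfl

lemma Cochain.VanishesBelow.sub {P Q : GrSpace K} {n : ℕ} {φ ψ : Cochain A P Q}
    (h : φ.VanishesBelow n) (h' : ψ.VanishesBelow n) : (φ - ψ).VanishesBelow n := fun l m hlm => by
  rw [LinearMap.sub_apply, LinearMap.sub_apply, h l m hlm, h' l m hlm, sub_zero]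

lemma Cochain.VanishesBelow.add {P Q : GrSpace K} {n : ℕ} {φ ψ : Cochain A P Q}
    (h : φ.VanishesBelow n) (h' : ψ.VanishesBelow n) : (φ + ψ).VanishesBelow n := fun l m hlm => by
  rw [LinearMap.add_apply, LinearMap.add_apply, h l m hlm, h' l m hlm, add_zero]

lemma Cochain.VanishesBelow.smul {P Q : GrSpace K} {n : ℕ} {φ : Cochain A P Q}
    (h : φ.VanishesBelow n) (c : K) : (c • φ).VanishesBelow n := fun l m hlm => by
  rw [LinearMap.smul_apply, LinearMap.smul_apply, h l m hlm, smul_zero]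

lemma Cochain.eq_zero_of_vanishes {P Q : GrSpace K} {φ : Cochain A P Q}
    (h : ∀ n, φ.VanishesBelow n) : φ = 0 :=
  Cochain.ext_word fun l m p => by rw [h _ l m (Nat.lt_succ_self _)]; rfl

/-- Postcomposition with a linear map. -/
def Cochain.post {P Q R : GrSpace K} (s : Q →ₗ[K] R) : Cochain A P Q →ₗ[K] Cochain A P R where
  toFun φ := φ.compr₂ (LinearMap.llcomp K P Q R s)
  map_add' φ ψ := by ext; simp
  map_smul' c φ := by ext; simp

@[simp] lemma post_apply {P Q R : GrSpace K} (s : Q →ₗ[K] R) (φ : Cochain A P Q)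
    (x y : Bar A.toGrSpace) (p : P) : Cochain.post s φ x y p = s (φ x y p) := rfl

lemma Cochain.VanishesBelow.post {P Q R : GrSpace K} {n : ℕ} {φ : Cochain A P Q}
    (h : φ.VanishesBelow n) (s : Q →ₗ[K] R) : (Cochain.post s φ).VanishesBelow n :=
  fun l m hlm => LinearMap.ext fun p => by rw [post_apply, h l m hlm]; simp

lemma comp_post {P Q R S : GrSpace K} (s : R →ₗ[K] S) (d : ℤ) (ψ : Cochain A Q R)
    (φ : Cochain A P Q) : Cochain.comp d (Cochain.post s ψ) φ =
      Cochain.post s (Cochain.comp d ψ φ) := Cochain.ext_word fun l m p => by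
  simp [comp_word_spl, spl_hom]

lemma insertMu_post {P Q R : GrSpace K} (s : Q →ₗ[K] R) (φ : Cochain A P Q) :
    (Cochain.post s φ).insertMu = Cochain.post s φ.insertMu := by
  ext x y p; simp [insertMu_apply]

lemma post_mem_homDeg {P Q R : GrSpace K} {s : Q →ₗ[K] R} {k d : ℤ}
    (hs : ∀ n, ∀ v ∈ Q.gr n, s v ∈ R.gr (n + k)) {φ : Cochain A P Q} (hφ : φ ∈ homDeg P Q d) :
    Cochain.post s φ ∈ homDeg P R (d + k) := by
  refine ⟨⟨fun x x' y => ?_, fun x y y' => ?_⟩, fun i m n x y p hx hy hp => ?_⟩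
  · ext p; rw [post_apply, hφ.1.1]; simp
  · ext p; rw [post_apply, hφ.1.2]; simp
  · rw [post_apply, ← add_assoc]
    exact hs _ _ (hφ.2 i m n x y p hx hy hp)

lemma cast_mem_homDeg {P Q : GrSpace K} {d e : ℤ} {φ : Cochain A P Q} (h : φ ∈ homDeg P Q d)
    (hde : d = e) : φ ∈ homDeg P Q e := hde ▸ h

/-- A locally finite sum of cochains. -/
lemma exists_cochain_tsum {P Q : GrSpace K} (g : ℕ → Cochain A P Q)
    (h : ∀ k, (g k).VanishesBelow k) :
    ∃ S : Cochain A P Q, ∀ n, (S - ∑ k ∈ Finset.range n, g k).VanishesBelow n := by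
  obtain ⟨S, hS⟩ := exists_tsum (K := K) (X := Bar A.toGrSpace ⊗[K] Bar A.toGrSpace)
      (Y := P.carrier →ₗ[K] Q.carrier) (fun k => TensorProduct.lift (g k)) (fun x => by
    have key : ∀ l m, ∀ k, l.length + m.length + 1 ≤ k → g k (word l) (word m) = 0 :=
      fun l m k hk => h k l m (by omega)
    induction x using TensorProduct.induction_on with
    | zero => exact ⟨0, by simp⟩
    | add x y hx hy =>
      obtain ⟨n, hn⟩ := hx
      obtain ⟨m, hm⟩ := hy
      exact ⟨max n m, fun k hk => by
        rw [map_add, hn k (le_trans (le_max_left _ _) hk), hm k (le_trans (le_max_right _ _) hk),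
          add_zero]⟩
    | tmul x y =>
      have hx : x ∈ Submodule.span K (Set.range (word (K := K) (E := A.carrier))) :=
        span_word (K := K) (E := A.carrier) ▸ Submodule.mem_top
      have hy : y ∈ Submodule.span K (Set.range (word (K := K) (E := A.carrier))) :=
        span_word (K := K) (E := A.carrier) ▸ Submodule.mem_top
      induction hx using Submodule.span_induction with
      | zero => exact ⟨0, by simp⟩
      | add x x' _ _ h1 h2 =>
        obtain ⟨n, hn⟩ := h1
        obtain ⟨m, hm⟩ := h2
        exact ⟨max n m, fun k hk => by
          rw [TensorProduct.add_tmul, map_add, hn k (le_trans (le_max_left _ _) hk),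
            hm k (le_trans (le_max_right _ _) hk), add_zero]⟩
      | smul c x _ h1 =>
        obtain ⟨n, hn⟩ := h1
        exact ⟨n, fun k hk => by rw [← TensorProduct.smul_tmul', map_smul, hn k hk, smul_zero]⟩
      | mem x hx =>
      obtain ⟨l, rfl⟩ := hx
      induction hy using Submodule.span_induction with
      | zero => exact ⟨0, by simp⟩
      | add x x' _ _ h1 h2 =>
        obtain ⟨n, hn⟩ := h1
        obtain ⟨m, hm⟩ := h2
        exact ⟨max n m, fun k hk => by
          rw [TensorProduct.tmul_add, map_add, hn k (le_trans (le_max_left _ _) hk),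
            hm k (le_trans (le_max_right _ _) hk), add_zero]⟩
      | smul c x _ h1 =>
        obtain ⟨n, hn⟩ := h1
        exact ⟨n, fun k hk => by rw [TensorProduct.tmul_smul, map_smul, hn k hk, smul_zero]⟩
      | mem x hx =>
        obtain ⟨m, rfl⟩ := hx
        exact ⟨l.length + m.length + 1, fun k hk => by
          rw [TensorProduct.lift.tmul, key l m k hk]⟩)
  refine ⟨TensorProduct.curry S, fun n l m hlm => ?_⟩
  have := hS (word l ⊗ₜ word m) n fun k hk => by
    rw [TensorProduct.lift.tmul, h k l m (by omega)]
  simp only [LinearMap.sub_apply, LinearMap.sum_apply, TensorProduct.curry_apply]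
  rw [this]
  simp

lemma mem_homDeg_of_approx {P Q : GrSpace K} {d : ℤ} {φ : Cochain A P Q}
    (h : ∀ n, ∃ ψ ∈ homDeg P Q d, (φ - ψ).VanishesBelow n) : φ ∈ homDeg P Q d := by
  have h' : ∀ l m, ∃ ψ ∈ homDeg P Q d, φ (word l) (word m) = ψ (word l) (word m) := by
    intro l m
    obtain ⟨ψ, hψ, hv⟩ := h (l.length + m.length + 1)
    exact ⟨ψ, hψ, sub_eq_zero.1 (hv l m (by omega))⟩
  refine ⟨Cochain.normalized_of_word (fun u v m p => ?_) fun l u v p => ?_,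
    fun k m n x y p hx hy hp => ?_⟩
  · obtain ⟨ψ, hψ, e⟩ := h' (u ++ A.unit :: v) m
    rw [e, hψ.1.left_word]; rfl
  · obtain ⟨ψ, hψ, e⟩ := h' l (u ++ A.unit :: v)
    rw [e, hψ.1.right_word]; rfl
  · obtain ⟨l, rfl, hl⟩ := hx.exists_word
    obtain ⟨r, rfl, hr⟩ := hy.exists_word
    obtain ⟨ψ, hψ, e⟩ := h' l r
    rw [e]
    exact hψ.2 k m n _ _ p hx hy hp

variable {M N Q : BimoduleData A}

lemma Cochain.VanishesBelow.diff {n : ℕ} {φ : Cochain A M.toGrSpace N.toGrSpace}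
    (h : φ.VanishesBelow n) (d : ℤ) : Cochain.VanishesBelow n (diff M N d φ) :=
  (h.comp d N.op).sub (((h.comp_left 1 M.op).add h.insertMu).smul _)

/-- The mapping cone of postcomposition with a quasi-isomorphism is acyclic. -/
lemma IsQuasiIso.cone_acyclic (hM : IsBimodule M) (hN : IsBimodule N) (hQ : IsBimodule Q)
    {f : Cochain A M.toGrSpace N.toGrSpace} (hf : IsQuasiIso (P := M) (Q := N) f) {d : ℤ}
    {φ : Cochain A Q.toGrSpace M.toGrSpace} {ψ : Cochain A Q.toGrSpace N.toGrSpace}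
    (hφ : φ ∈ homDeg Q.toGrSpace M.toGrSpace (d + 1)) (hψ : ψ ∈ homDeg Q.toGrSpace N.toGrSpace d)
    (h1 : diff Q M (d + 1) φ = 0) (h2 : Cochain.comp (d + 1) f φ = diff Q N d ψ) :
    ∃ φ' ∈ homDeg Q.toGrSpace M.toGrSpace d, ∃ ψ' ∈ homDeg Q.toGrSpace N.toGrSpace (d - 1),
      φ = diff Q M d φ' ∧ ψ = Cochain.comp d f φ' - diff Q N (d - 1) ψ' := by
  obtain ⟨a, b, c, e, ha, hb, hc, he, k1, k2, k3, k4⟩ := hf.exists_contraction hM hN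
  have hf0 := hf.cocycle.1
  have hfd : diff M N 0 f = 0 := hf.cocycle.2
  let C := Cochain A Q.toGrSpace M.toGrSpace × Cochain A Q.toGrSpace N.toGrSpace
  let good : C → Prop := fun x => x.1 ∈ homDeg Q.toGrSpace M.toGrSpace (d + 1) ∧
    x.2 ∈ homDeg Q.toGrSpace N.toGrSpace d ∧ diff Q M (d + 1) x.1 = 0 ∧
    Cochain.comp (d + 1) f x.1 = diff Q N d x.2
  let H : C → C := fun x => (Cochain.post a x.1 + Cochain.post b x.2,
    Cochain.post c x.1 + Cochain.post e x.2)
  let D : C → C := fun x => (diff Q M d x.1, Cochain.comp d f x.1 - diff Q N (d - 1) x.2)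
  have hH : ∀ x, good x → (H x).1 ∈ homDeg Q.toGrSpace M.toGrSpace d ∧
      (H x).2 ∈ homDeg Q.toGrSpace N.toGrSpace (d - 1) := by
    rintro x ⟨g1, g2, -, -⟩
    refine ⟨add_mem ?_ ?_, add_mem ?_ ?_⟩
    · exact cast_mem_homDeg (post_mem_homDeg ha g1) (by ring)
    · exact cast_mem_homDeg (post_mem_homDeg hb g2) (by ring)
    · exact cast_mem_homDeg (post_mem_homDeg hc g1) (by ring)
    · exact cast_mem_homDeg (post_mem_homDeg he g2) (by ring)
  have step : ∀ x, good x → good (x - D (H x)) := by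
    intro x g
    obtain ⟨p1, p2⟩ := hH x g
    obtain ⟨g1, g2, g3, g4⟩ := g
    have q1 := homDeg.hasParity hQ hM p1
    have q2 := homDeg.hasParity hQ hN p2
    have e1 := diff_diff hQ hM d q1
    have e2 := diff_diff hQ hN (d - 1) q2
    have e3 := diff_comp d 0 f q1
    rw [add_zero, hfd, comp_zero_left, zero_add, ksign_zero, one_smul] at e3
    rw [sub_add_cancel] at e2
    refine ⟨sub_mem g1 (diff_mem_homDeg hQ hM p1), sub_mem g2 (sub_mem ?_ ?_), ?_, ?_⟩
    · exact cast_mem_homDeg (comp_mem_homDeg hf0 p1) (by ring)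
    · exact cast_mem_homDeg (diff_mem_homDeg hQ hN p2) (by ring)
    · change diff Q M (d + 1) (x.1 - diff Q M d (H x).1) = 0
      rw [map_sub, g3, e1, sub_zero]
    · change Cochain.comp (d + 1) f (x.1 - diff Q M d (H x).1) =
        diff Q N d (x.2 - (Cochain.comp d f (H x).1 - diff Q N (d - 1) (H x).2))
      rw [comp_sub_right, map_sub, map_sub, e2, sub_zero, e3, g4]
  have van : ∀ x n, good x → x.1.VanishesBelow n → x.2.VanishesBelow n →
      (x - D (H x)).1.VanishesBelow (n + 1) ∧ (x - D (H x)).2.VanishesBelow (n + 1) := by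
    rintro ⟨φ, ψ⟩ n ⟨g1, g2, g3, g4⟩ v1 v2
    have hd : ksign K (d - 1) = -ksign K d := by simp
    have hd' : ksign K (d + 1) = -ksign K d := by simp
    have key : ∀ l m, l.length + m.length < n + 1 → ∀ p : Q.carrier,
        M.op 1 1 (φ (word l) (word m) p) + ksign K d •
          (Cochain.comp 1 φ Q.op (word l) (word m) p + φ.insertMu (word l) (word m) p) = 0 ∧
        f 1 1 (φ (word l) (word m) p) = N.op 1 1 (ψ (word l) (word m) p) - ksign K d •
          (Cochain.comp 1 ψ Q.op (word l) (word m) p + ψ.insertMu (word l) (word m) p) := by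
      intro l m hlm p
      have e1 := congrArg (fun φ : Cochain A Q.toGrSpace M.toGrSpace => φ (word l) (word m) p) g3
      have e2 := congrArg (fun φ : Cochain A Q.toGrSpace N.toGrSpace => φ (word l) (word m) p) g4
      simp only [diff_apply, hd', LinearMap.sub_apply, LinearMap.smul_apply, LinearMap.add_apply,
        v1.comp_apply _ _ (Nat.lt_succ_iff.1 hlm), v2.comp_apply _ _ (Nat.lt_succ_iff.1 hlm),
        neg_smul, sub_neg_eq_add, LinearMap.zero_apply] at e1 e2
      exact ⟨e1, e2⟩
    constructor
    · intro l m hlm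
      ext p
      obtain ⟨e1, e2⟩ := key l m hlm p
      change φ (word l) (word m) p - diff Q M d (Cochain.post a φ + Cochain.post b ψ)
        (word l) (word m) p = 0
      have w := (v1.post a).add (v2.post b)
      rw [diff_apply, LinearMap.sub_apply, LinearMap.sub_apply, LinearMap.sub_apply,
        w.comp_apply _ _ (Nat.lt_succ_iff.1 hlm)]
      simp only [comp_add_left, insertMu_add, comp_post, insertMu_post, LinearMap.smul_apply,
        LinearMap.add_apply, post_apply, map_add]
      have f1 := congrArg a e1
      have f2 := congrArg b e2
      have f3 := k1 (φ (word l) (word m) p)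
      have f4 := k2 (ψ (word l) (word m) p)
      simp only [map_smul, map_add, map_sub, map_zero] at f1 f2
      linear_combination (norm := module) f1 + f2 - f3 - f4
    · intro l m hlm
      ext p
      obtain ⟨e1, e2⟩ := key l m hlm p
      change ψ (word l) (word m) p - (Cochain.comp d f (Cochain.post a φ + Cochain.post b ψ)
        (word l) (word m) p - diff Q N (d - 1) (Cochain.post c φ + Cochain.post e ψ)
        (word l) (word m) p) = 0
      have w := (v1.post a).add (v2.post b)
      have w' := (v1.post c).add (v2.post e)
      rw [diff_apply, LinearMap.sub_apply, LinearMap.sub_apply, LinearMap.sub_apply,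
        w'.comp_apply _ _ (Nat.lt_succ_iff.1 hlm), w.comp_apply _ _ (Nat.lt_succ_iff.1 hlm), hd]
      simp only [comp_add_left, insertMu_add, comp_post, insertMu_post, LinearMap.smul_apply,
        LinearMap.add_apply, post_apply, map_add]
      have f1 := congrArg c e1
      have f2 := congrArg e e2
      have f3 := k3 (φ (word l) (word m) p)
      have f4 := k4 (ψ (word l) (word m) p)
      simp only [map_smul, map_add, map_sub, map_zero] at f1 f2
      linear_combination (norm := module) f1 + f2 - f3 - f4
  let x : ℕ → C := fun k => Nat.rec (φ, ψ) (fun _ z => z - D (H z)) k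
  have x_succ : ∀ k, x (k + 1) = x k - D (H (x k)) := fun k => rfl
  have hx : ∀ k, good (x k) ∧ (x k).1.VanishesBelow k ∧ (x k).2.VanishesBelow k := by
    intro k
    induction k with
    | zero => exact ⟨⟨hφ, hψ, h1, h2⟩, fun l m h => absurd h (Nat.not_lt_zero _),
        fun l m h => absurd h (Nat.not_lt_zero _)⟩
    | succ k ih => rw [x_succ]; exact ⟨step _ ih.1, van _ _ ih.1 ih.2.1 ih.2.2⟩
  obtain ⟨S, hS⟩ := exists_cochain_tsum (fun k => (H (x k)).1) fun k =>
    ((hx k).2.1.post a).add ((hx k).2.2.post b)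
  obtain ⟨T, hT⟩ := exists_cochain_tsum (fun k => (H (x k)).2) fun k =>
    ((hx k).2.1.post c).add ((hx k).2.2.post e)
  have hxs : ∀ n, (x n).1 = φ - diff Q M d (∑ k ∈ Finset.range n, (H (x k)).1) ∧
      (x n).2 = ψ - (Cochain.comp d f (∑ k ∈ Finset.range n, (H (x k)).1) -
        diff Q N (d - 1) (∑ k ∈ Finset.range n, (H (x k)).2)) := by
    intro n
    induction n with
    | zero =>
      simp only [Finset.range_zero, Finset.sum_empty, map_zero, sub_zero, comp_zero_right]
      exact ⟨rfl, rfl⟩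
    | succ n ih =>
      rw [Finset.sum_range_succ, Finset.sum_range_succ, map_add, map_add (diff Q N (d - 1)),
        comp_add_right, x_succ]
      change (x n).1 - diff Q M d _ = _ ∧ (x n).2 - (Cochain.comp d f _ - diff Q N (d - 1) _) = _
      exact ⟨by rw [← sub_sub, ← ih.1], by rw [add_sub_add_comm, ← sub_sub, ← ih.2]⟩
  refine ⟨S, mem_homDeg_of_approx fun n => ⟨_, sum_mem fun k _ => (hH _ (hx k).1).1, hS n⟩,
    T, mem_homDeg_of_approx fun n => ⟨_, sum_mem fun k _ => (hH _ (hx k).1).2, hT n⟩, ?_, ?_⟩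
  · refine sub_eq_zero.1 (Cochain.eq_zero_of_vanishes fun n => ?_)
    have := (hx n).2.1.sub ((hS n).diff d)
    rw [(hxs n).1, map_sub] at this
    convert this using 1; abel
  · refine sub_eq_zero.1 (Cochain.eq_zero_of_vanishes fun n => ?_)
    have := (hx n).2.2.sub (((hS n).comp d f).sub ((hT n).diff (d - 1)))
    rw [(hxs n).2, map_sub, comp_sub_right] at this
    convert this using 1; abel

/-- Composition with a quasi-isomorphism is injective on cohomology. -/
lemma IsQuasiIso.comp_injective (hM : IsBimodule M) (hN : IsBimodule N) (hQ : IsBimodule Q)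
    {f : Cochain A M.toGrSpace N.toGrSpace} (hf : IsQuasiIso (P := M) (Q := N) f) {d : ℤ}
    {φ : Cochain A Q.toGrSpace M.toGrSpace} (hφ : φ ∈ cocycles Q M d)
    (h : ∃ ψ ∈ homDeg Q.toGrSpace N.toGrSpace (d - 1), diff Q N (d - 1) ψ = Cochain.comp d f φ) :
    ∃ φ' ∈ homDeg Q.toGrSpace M.toGrSpace (d - 1), diff Q M (d - 1) φ' = φ := by
  obtain ⟨ψ, hψ, e⟩ := h
  obtain ⟨e0, rfl⟩ : ∃ e0, d = e0 + 1 := ⟨d - 1, by ring⟩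
  rw [add_sub_cancel_right] at *
  obtain ⟨φ', h1, ψ', -, h3, -⟩ := hf.cone_acyclic hM hN hQ hφ.1 hψ hφ.2 e.symm
  exact ⟨φ', h1, h3.symm⟩

/-- Composition with a quasi-isomorphism is surjective on cohomology. -/
lemma IsQuasiIso.comp_surjective (hM : IsBimodule M) (hN : IsBimodule N) (hQ : IsBimodule Q)
    {f : Cochain A M.toGrSpace N.toGrSpace} (hf : IsQuasiIso (P := M) (Q := N) f) {d : ℤ}
    {ψ : Cochain A Q.toGrSpace N.toGrSpace} (hψ : ψ ∈ cocycles Q N d) :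
    ∃ φ ∈ cocycles Q M d, ∃ ψ' ∈ homDeg Q.toGrSpace N.toGrSpace (d - 1),
      diff Q N (d - 1) ψ' = Cochain.comp d f φ - ψ := by
  obtain ⟨φ', h1, ψ', h2, h3, h4⟩ := hf.cone_acyclic (d := d) (φ := 0) hM hN hQ (zero_mem _) hψ.1
    (map_zero _) (by rw [comp_zero_right]; exact hψ.2.symm)
  refine ⟨φ', ⟨h1, h3.symm⟩, ψ', h2, ?_⟩
  rw [h4]; abel

end Acyclicity

/-! ### The calculus of `Q ⊗ T(A[1]) ⊗ P` -/

section TrivialSides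

variable {K : Type u} [Field K] {A : AInfAlgebra K} {P Q R : GrSpace K}

/-- `φ` vanishes if there are entries on the right of the module. -/
def Cochain.RightTrivial (φ : Cochain A P Q) : Prop := ∀ x y p, φ x y p = aug y • φ x 1 p

/-- `φ` vanishes if there are entries on the left of the module. -/
def Cochain.LeftTrivial (φ : Cochain A P Q) : Prop := ∀ x y p, φ x y p = aug x • φ 1 y p

lemma comp_rightTrivial_inner {φ : Cochain A P Q} (h : φ.RightTrivial) (d : ℤ)
    (ψ : Cochain A Q R) (l : List A.carrier) (y : Bar A.toGrSpace) (p : P) :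
    Cochain.comp d ψ φ (word l) y p =
      spl l fun a b => ψ (word a) (A.sgnPow d y) (φ (word b) 1 p) := by
  have : (Cochain.comp d ψ φ (word l)).flip p =
      spl l fun a b => (ψ (word a)).flip (φ (word b) 1 p) ∘ₗ A.sgnPow d := word_ext fun m => by
    rw [LinearMap.flip_apply, comp_word_spl, spl_apply]
    refine spl_congr fun a b _ => ?_
    rw [LinearMap.comp_apply, LinearMap.flip_apply,
      ← spl_aug_left (K := K) m fun c e => ψ (word a) (A.sgnPow d (word e)) (φ (word b) 1 p)]
    exact spl_congr fun c e _ => by rw [h, map_smul]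
  have h2 := congrArg (fun f : Bar A.toGrSpace →ₗ[K] R => f y) this
  simpa only [LinearMap.flip_apply, spl_apply, LinearMap.comp_apply] using h2

lemma comp_rightTrivial_outer {ψ : Cochain A Q R} (h : ψ.RightTrivial) (d : ℤ)
    (φ : Cochain A P Q) (l : List A.carrier) (y : Bar A.toGrSpace) (p : P) :
    Cochain.comp d ψ φ (word l) y p = spl l fun a b => ψ (word a) 1 (φ (word b) y p) := by
  have : (Cochain.comp d ψ φ (word l)).flip p =
      spl l fun a b => ψ (word a) 1 ∘ₗ (φ (word b)).flip p := word_ext fun m => by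
    rw [LinearMap.flip_apply, comp_word_spl, spl_apply]
    refine spl_congr fun a b _ => ?_
    rw [LinearMap.comp_apply, LinearMap.flip_apply,
      ← spl_aug_right (K := K) m fun c e => ψ (word a) 1 (φ (word b) (word c) p)]
    exact spl_congr fun c e _ => by rw [h, aug_sgnPow]
  have h2 := congrArg (fun f : Bar A.toGrSpace →ₗ[K] R => f y) this
  simpa only [LinearMap.flip_apply, spl_apply, LinearMap.comp_apply] using h2

lemma comp_leftTrivial_inner {φ : Cochain A P Q} (h : φ.LeftTrivial) (d : ℤ)
    (ψ : Cochain A Q R) (x : Bar A.toGrSpace) (m : List A.carrier) (p : P) :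
    Cochain.comp d ψ φ x (word m) p =
      spl m fun c e => ψ x (A.sgnPow d (word e)) (φ 1 (word c) p) := by
  have : ((Cochain.comp d ψ φ).flip (word m)).flip p =
      spl m fun c e => (ψ.flip (A.sgnPow d (word e))).flip (φ 1 (word c) p) := word_ext fun l => by
    rw [LinearMap.flip_apply, LinearMap.flip_apply, comp_word_spl, spl_apply, spl_comm]
    refine spl_congr fun c e _ => ?_
    simp only [LinearMap.flip_apply]
    rw [← spl_aug_right (K := K) l fun a b => ψ (word a) (A.sgnPow d (word e)) (φ 1 (word c) p)]
    exact spl_congr fun a b _ => by rw [h, map_smul]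
  have h2 := congrArg (fun f : Bar A.toGrSpace →ₗ[K] R => f x) this
  simpa only [LinearMap.flip_apply, spl_apply, LinearMap.comp_apply] using h2

lemma Cochain.HasParity.parPow {φ : Cochain A P Q} {e : ℤ} (h : φ.HasParity e) (d : ℤ)
    (x y : Bar A.toGrSpace) (p : P) : Q.parPow d (φ x y p) =
      ksign K (d * e) • φ (A.sgnPow d x) (A.sgnPow d y) (P.parPow d p) := by
  unfold GrSpace.parPow GrSpace.sgnPow
  by_cases hd : Even d
  · simp [hd, ksign]
  · simp only [hd, if_false, h x y p]
    have : ksign K (d * e) = ksign K e := by simp [ksign, Int.even_mul, hd]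
    rw [this]; rfl

end TrivialSides

section PreTensor

variable {K : Type u} [Field K] {A : AInfAlgebra K} {P P' P'' Q Q' Q'' : GrSpace K}

variable (A P Q) in
/-- The graded space `Q ⊗ T(A[1]) ⊗ P`. -/
def preSpace : GrSpace K where
  carrier := PreTensor A Q P
  gr n := Submodule.span K {z | ∃ i j k q b p, q ∈ Q.gr i ∧ HomWord A.gr (-1) j b ∧ p ∈ P.gr k ∧
    n = i + j + k ∧ z = q ⊗ₜ[K] (b ⊗ₜ[K] p)}
  par := prePar A Q P

variable (A P Q) in
/-- The elements `q ⊗ b ⊗ p` of `Q ⊗ T(A[1]) ⊗ P`. -/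
def preT : Q →ₗ[K] Bar A.toGrSpace →ₗ[K] P →ₗ[K] preSpace A P Q :=
  LinearMap.mk₂ K (fun q b => (TensorProduct.mk K Q _ q ∘ₗ TensorProduct.mk K _ P b :
      P →ₗ[K] PreTensor A Q P))
    (fun _ _ _ => LinearMap.ext fun _ => TensorProduct.add_tmul _ _ _)
    (fun _ _ _ => LinearMap.ext fun _ => rfl)
    (fun q b b' => LinearMap.ext fun p =>
      (congrArg (q ⊗ₜ[K] ·) (TensorProduct.add_tmul b b' p)).trans (TensorProduct.tmul_add _ _ _))
    (fun c q b => LinearMap.ext fun p => TensorProduct.tmul_smul c q (b ⊗ₜ[K] p))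

lemma preSpace_hom_ext {W : Type u} [AddCommGroup W] [Module K W] {F G : preSpace A P Q →ₗ[K] W}
    (h : ∀ q b p, F (preT A P Q q (word b) p) = G (preT A P Q q (word b) p)) : F = G :=
  TensorProduct.ext (LinearMap.ext fun q => TensorProduct.ext
    (word_ext fun b => LinearMap.ext fun p => h q b p))

lemma preSpace_ext {W : GrSpace K} {F G : Cochain A (preSpace A P Q) W}
    (h : ∀ l m b q p, F (word l) (word m) (preT A P Q q (word b) p) =
      G (word l) (word m) (preT A P Q q (word b) p)) : F = G :=
  word_ext fun l => word_ext fun m => preSpace_hom_ext fun q b p => h l m b q p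

lemma preSpace_par (q : Q) (b : Bar A.toGrSpace) (p : P) : (preSpace A P Q).par (preT A P Q q b p) =
    preT A P Q (Q.par q) (A.sgn b) (P.par p) := rfl

variable (P) in
/-- `preLeft` as a cochain. -/
def Cochain.preL (d : ℤ) (φ : Cochain A Q Q') : Cochain A (preSpace A P Q) (preSpace A P Q') :=
  preLeft d φ P

variable (Q) in
/-- `preRight` as a cochain. -/
def Cochain.preR (φ : Cochain A P P') : Cochain A (preSpace A P Q) (preSpace A P' Q) :=
  preRight φ Q

variable (A P Q) in
/-- `preMid` as a cochain. -/
def preM : Cochain A (preSpace A P Q) (preSpace A P Q) := preMid Q P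

/-- `q ⊗ b ⊗ p` as a function of `q` and `b`. -/
def preT' (A : AInfAlgebra K) (Q : GrSpace K) {P : GrSpace K} (p : P) :
    Q →ₗ[K] Bar A.toGrSpace →ₗ[K] preSpace A P Q := (preT A P Q).compr₂ (LinearMap.applyₗ p)

@[simp] lemma preT'_apply (p : P) (q : Q) (b : Bar A.toGrSpace) :
    preT' A Q p q b = preT A P Q q b p := rfl

lemma preL_conv (d : ℤ) (φ : Cochain A Q Q') (x y b : Bar A.toGrSpace) (q : Q) (p : P) :
    φ.preL P d x y (preT A P Q q b p) =
      aug y • conv (preT' A Q' (P.parPow d p)) ((φ x).flip q) (A.sgnPow d) b := by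
  refine (preLeft_tmul d φ x y b q p).trans ?_
  rw [conv_apply]
  exact congrArg (aug y • ·) (deconc_congr _ _ (fun a b => rfl) b)

lemma preR_conv (φ : Cochain A P P') (x y b : Bar A.toGrSpace) (q : Q) (p : P) :
    φ.preR Q x y (preT A P Q q b p) =
      aug x • conv (preT A P' Q q) LinearMap.id ((φ.flip y).flip p) b := by
  refine (preRight_tmul φ x y b q p).trans ?_
  rw [conv_apply]
  have := deconc_congr (TensorProduct.mk K Q.carrier _ q ∘ₗ
    TensorProduct.map LinearMap.id ((LinearMap.flip φ y).flip p)) (TensorProduct.lift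
      ((preT A P' Q q).compl₁₂ LinearMap.id ((LinearMap.flip φ y).flip p))) (fun a b => rfl) b
  exact congrArg (aug x • ·) this

lemma preL_word (d : ℤ) (φ : Cochain A Q Q') (x y : Bar A.toGrSpace) (b : List A.carrier)
    (q : Q) (p : P) : φ.preL P d x y (preT A P Q q (word b) p) =
      aug y • spl b fun u v => preT A P Q' (φ x (word u) q) (A.sgnPow d (word v)) (P.parPow d p) := by
  rw [preL_conv, conv_word_spl]; rfl

lemma preR_word (φ : Cochain A P P') (x y : Bar A.toGrSpace) (b : List A.carrier)
    (q : Q) (p : P) : φ.preR Q x y (preT A P Q q (word b) p) =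
      aug x • spl b fun u v => preT A P' Q q (word u) (φ (word v) y p) := by
  rw [preR_conv, conv_word_spl]; rfl

lemma preM_apply (x y b : Bar A.toGrSpace) (q : Q) (p : P) : preM A P Q x y (preT A P Q q b p) =
    (aug x * aug y) • preT A P Q q (A.coder A.mu b) (P.par p) := rfl

lemma preL_rightTrivial (d : ℤ) (φ : Cochain A Q Q') : (φ.preL P d).RightTrivial := fun x y z => by
  have : φ.preL P d x y = aug y • φ.preL P d x 1 := preSpace_hom_ext fun q b p => by
    simp [preL_word]
  rw [this]; rfl

lemma preR_leftTrivial (φ : Cochain A P P') : (φ.preR Q).LeftTrivial := fun x y z => by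
  have : φ.preR Q x y = aug x • φ.preR Q 1 y := preSpace_hom_ext fun q b p => by
    simp [preR_word]
  rw [this]; rfl

lemma preM_rightTrivial : (preM A P Q).RightTrivial := fun x y z => by
  have : preM A P Q x y = aug y • preM A P Q x 1 := preSpace_hom_ext fun q b p => by
    simp [preM_apply, smul_smul, mul_comm]
  rw [this]; rfl

lemma preM_leftTrivial : (preM A P Q).LeftTrivial := fun x y z => by
  have : preM A P Q x y = aug x • preM A P Q 1 y := preSpace_hom_ext fun q b p => by
    simp [preM_apply, smul_smul]
  rw [this]; rfl

lemma preM_one (q : Q) (b : Bar A.toGrSpace) (p : P) :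
    preM A P Q 1 1 (preT A P Q q b p) = preT A P Q q (A.coder A.mu b) (P.par p) := by
  simp [preM_apply]

lemma comp_preM_inner {W : GrSpace K} (d : ℤ) (F : Cochain A (preSpace A P Q) W)
    (l : List A.carrier) (y : Bar A.toGrSpace) (z : preSpace A P Q) :
    Cochain.comp d F (preM A P Q) (word l) y z = F (word l) (A.sgnPow d y) (preM A P Q 1 1 z) := by
  rw [comp_rightTrivial_inner preM_rightTrivial, ← spl_aug_right (K := K) l fun a b =>
    F (word a) (A.sgnPow d y) (preM A P Q 1 1 z)]
  exact spl_congr fun a b _ => by rw [preM_leftTrivial, map_smul]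

lemma comp_preM_outer {W : GrSpace K} (d : ℤ) (F : Cochain A W (preSpace A P Q))
    (l : List A.carrier) (y : Bar A.toGrSpace) (z : W) :
    Cochain.comp d (preM A P Q) F (word l) y z = preM A P Q 1 1 (F (word l) y z) := by
  rw [comp_rightTrivial_outer preM_rightTrivial, ← spl_aug_left (K := K) l fun a b =>
    preM A P Q 1 1 (F (word b) y z)]
  exact spl_congr fun a b _ => by rw [preM_leftTrivial]

lemma comp_preL_preL (d e : ℤ) (hP : P.IsGraded) (ψ : Cochain A Q' Q'') (φ : Cochain A Q Q') :
    Cochain.comp d (ψ.preL P e) (φ.preL P d) = (Cochain.comp d ψ φ).preL P (d + e) := by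
  refine preSpace_ext fun l m b q p => ?_
  rw [comp_rightTrivial_inner (preL_rightTrivial d φ)]
  simp only [preL_word, aug_sgnPow, map_one, one_smul, spl_hom, comp_word_spl, spl_apply,
    ← spl_smul, sgnPow_word, spl_map]
  simp only [← sgnPow_word, A.isAInf.graded.sgnPow_sgnPow, hP.parPow_parPow, add_comm e d]
  rw [spl_comm, aug_sgnPow]
  exact ((spl_congr fun u v _ => spl_comm _ _ _).trans (spl_coassoc b fun u v w => spl l fun a c =>
    aug (word (K := K) m) • preT A P Q'' (ψ (word a) (A.sgnPow d (word v)) (φ (word c) (word u) q))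
      (A.sgnPow (d + e) (word w)) (P.parPow (d + e) p)).symm).trans
        (spl_congr fun u v _ => spl_comm _ _ _)

lemma comp_preR_preR (d : ℤ) (ψ : Cochain A P' P'') (φ : Cochain A P P') :
    Cochain.comp d (ψ.preR Q) (φ.preR Q) = (Cochain.comp d ψ φ).preR Q := by
  refine preSpace_ext fun l m b q p => ?_
  rw [comp_leftTrivial_inner (preR_leftTrivial φ)]
  simp only [preR_word, map_one, one_smul, spl_hom, comp_word_spl, ← spl_smul]
  rw [spl_comm]
  exact (spl_congr fun u v _ => spl_comm _ _ _).trans (spl_coassoc b fun u v w => spl m fun c e =>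
    aug (word (K := K) l) •
    preT A P'' Q q (word u) (ψ (word v) (A.sgnPow d (word e)) (φ (word w) (word c) p)))

lemma comp_preL_preR (d e : ℤ) {ψ : Cochain A P P'} (hψ : ψ.HasParity e) (φ : Cochain A Q Q') :
    Cochain.comp e (φ.preL P' d) (ψ.preR Q) =
      ksign K (d * e) • Cochain.comp d (ψ.preR Q') (φ.preL P d) := by
  refine preSpace_ext fun l m b q p => ?_
  rw [LinearMap.smul_apply, LinearMap.smul_apply, LinearMap.smul_apply,
    comp_rightTrivial_outer (preL_rightTrivial d φ), comp_rightTrivial_inner (preL_rightTrivial d φ)]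
  simp only [preR_word, preL_word, map_smul, spl_smul, spl_aug_left, spl_aug_right, map_one,
    one_smul, spl_hom, sgnPow_word, spl_map, hψ.parPow]
  congr 1
  exact spl_coassoc b fun u v w => preT A P' Q' (φ (word l) (word u) q)
    (word (v.map (A.letterSgn d))) (ψ (word (w.map (A.letterSgn d)))
      (word (m.map (A.letterSgn d))) (P.parPow d p))

lemma preL_insertMu (d : ℤ) (hP : P.IsGraded) (φ : Cochain A Q Q') :
    φ.insertMu.preL P (d + 1) = Cochain.comp 1 (φ.preL P d) (preM A P Q) + (φ.preL P d).insertMu -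
      ksign K d • Cochain.comp d (preM A P Q') (φ.preL P d) := by
  refine preSpace_ext fun l m b q p => ?_
  have h2 := congrArg (fun f : Bar A.toGrSpace →ₗ[K] preSpace A P Q' => f (word b))
    (conv_coder (M := A.toGrSpace) (preT' A Q' (P.parPow d (P.par p))) ((φ (word l)).flip q)
      (A.sgnPow d) A.mu)
  simp only [LinearMap.comp_apply, LinearMap.add_apply, conv_word_spl] at h2
  simp only [LinearMap.sub_apply, LinearMap.add_apply, LinearMap.smul_apply, comp_preM_inner,
    comp_preM_outer, preM_one, insertMu_apply, preSpace_par]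
  simp only [preL_conv, aug_coder, zero_smul, zero_add, h2, map_smul, conv_word_spl,
    sgn_word, spl_map, spl_hom]
  simp only [← sgn_word, ← sgnPow_one_apply, aug_sgnPow, ← parPow_one, hP.parPow_parPow,
    A.isAInf.graded.sgnPow_sgnPow]
  rw [smul_comm (ksign K d), ← smul_add, ← smul_sub]
  congr 1
  rw [← spl_smul, ← spl_add, ← spl_add, ← spl_sub]
  refine spl_congr fun u v _ => ?_
  simp only [LinearMap.flip_apply, preT'_apply, preM_one, A.isAInf.sgnPow_coder, map_smul,
    insertMu_apply, LinearMap.smul_apply, map_add, LinearMap.add_apply, ← sgnPow_one_apply,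
    ← parPow_one, hP.parPow_parPow, add_comm 1 d]
  abel

lemma preR_insertMu (e : ℤ) {ψ : Cochain A P P'} (hψ : ψ.HasParity e) :
    ψ.insertMu.preR Q = Cochain.comp 1 (ψ.preR Q) (preM A P Q) + (ψ.preR Q).insertMu -
      ksign K e • Cochain.comp e (preM A P' Q) (ψ.preR Q) := by
  refine preSpace_ext fun l m b q p => ?_
  have h2 := congrArg (fun f : Bar A.toGrSpace →ₗ[K] preSpace A P' Q => f (word b))
    (conv_coder (M := A.toGrSpace) (preT A P' Q q) LinearMap.id
      ((ψ.flip (A.sgnPow 1 (word m))).flip (P.par p)) A.mu)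
  simp only [LinearMap.comp_apply, LinearMap.add_apply, conv_word_spl] at h2
  simp only [LinearMap.sub_apply, LinearMap.add_apply, LinearMap.smul_apply, comp_preM_inner,
    comp_preM_outer, preM_one, insertMu_apply, preSpace_par]
  simp only [preR_conv, aug_coder, zero_smul, add_zero, h2, map_smul, conv_word_spl,
    sgn_word, spl_map, spl_hom]
  rw [smul_comm (ksign K e), ← smul_add, ← smul_sub]
  congr 1
  rw [← spl_smul, ← spl_add, ← spl_add, ← spl_sub]
  refine spl_congr fun u v _ => ?_
  simp only [LinearMap.flip_apply, LinearMap.id_apply, preM_one, hψ (word v), map_smul, smul_smul,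
    ksign_mul_self, one_smul, insertMu_apply, map_add, sgnPow_one_apply]
  abel

lemma preM_preM : Cochain.comp 1 (preM A P Q) (preM A P Q) + (preM A P Q).insertMu = 0 := by
  refine preSpace_ext fun l m b q p => ?_
  rw [LinearMap.add_apply, LinearMap.add_apply, LinearMap.add_apply, comp_preM_inner,
    insertMu_apply, preSpace_par]
  simp [aug_coder, preM_apply, A.isAInf.coder_coder]

end PreTensor

/-! ### The tensor product of bimodules -/

section Covers

variable {K : Type u} [Field K] {A : AInfAlgebra K} {V W X V' W' X' : GrSpace K}

/-- `F'` is induced by `F` on quotients. -/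
def Cochain.Covers (π : V →ₗ[K] V') (π' : W →ₗ[K] W') (F : Cochain A V W)
    (F' : Cochain A V' W') : Prop := ∀ x y v, F' x y (π v) = π' (F x y v)

variable {π : V →ₗ[K] V'} {π' : W →ₗ[K] W'} {π'' : X →ₗ[K] X'}

lemma Cochain.Covers.comp {G : Cochain A W X} {G' : Cochain A W' X'} {F : Cochain A V W}
    {F' : Cochain A V' W'} (hG : G.Covers π' π'' G') (hF : F.Covers π π' F') (d : ℤ) :
    (Cochain.comp d G F).Covers π π'' (Cochain.comp d G' F') := by
  intro x y v
  suffices h : (Cochain.comp d G' F').compl₂ (LinearMap.id) = Cochain.comp d G' F' ∧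
      (Cochain.comp d G' F').compr₂ (LinearMap.lcomp K X' π) =
        (Cochain.comp d G F).compr₂ (LinearMap.llcomp K V X X' π'') by
    exact congrArg (fun f : Bar A.toGrSpace →ₗ[K] Bar A.toGrSpace →ₗ[K] V →ₗ[K] X' => f x y v) h.2
  refine ⟨rfl, word_ext fun l => word_ext fun m => LinearMap.ext fun v => ?_⟩
  change Cochain.comp d G' F' (word l) (word m) (π v) = π'' (Cochain.comp d G F (word l) (word m) v)
  simp only [comp_word_spl, spl_hom]
  exact spl_congr fun a b _ => spl_congr fun c e _ => by rw [hF, hG]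

lemma Cochain.Covers.insertMu (hπ : ∀ v, V'.par (π v) = π (V.par v)) {F : Cochain A V W}
    {F' : Cochain A V' W'} (hF : F.Covers π π' F') : F.insertMu.Covers π π' F'.insertMu := by
  intro x y v
  simp only [insertMu_apply, hπ, map_add, hF _ _ _]

lemma Cochain.Covers.add {F G : Cochain A V W} {F' G' : Cochain A V' W'} (hF : F.Covers π π' F')
    (hG : G.Covers π π' G') : (F + G).Covers π π' (F' + G') := fun x y v => by
  simp only [LinearMap.add_apply, map_add, hF _ _ _, hG _ _ _]

lemma Cochain.Covers.sub {F G : Cochain A V W} {F' G' : Cochain A V' W'} (hF : F.Covers π π' F')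
    (hG : G.Covers π π' G') : (F - G).Covers π π' (F' - G') := fun x y v => by
  simp only [LinearMap.sub_apply, map_sub, hF _ _ _, hG _ _ _]

lemma Cochain.Covers.smul {F : Cochain A V W} {F' : Cochain A V' W'} (hF : F.Covers π π' F')
    (c : K) : (c • F).Covers π π' (c • F') := fun x y v => by
  simp only [LinearMap.smul_apply, map_smul, hF _ _ _]

lemma Cochain.Covers.eq (hπ : Function.Surjective π) {F G : Cochain A V W}
    {F' G' : Cochain A V' W'} (hF : F.Covers π π' F') (hG : G.Covers π π' G') (h : F = G) :
    F' = G' := by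
  subst h
  refine LinearMap.ext fun x => LinearMap.ext fun y => LinearMap.ext fun v => ?_
  obtain ⟨v, rfl⟩ := hπ v
  rw [hF, hG]

lemma Cochain.Covers.zero : (0 : Cochain A V W).Covers π π' 0 := fun x y v => by simp

end Covers

section PreDegrees

variable {K : Type u} [Field K] {A : AInfAlgebra K} {P P' Q Q' : GrSpace K}

lemma preT_mem {i j k n : ℤ} {q : Q} {b : Bar A.toGrSpace} {p : P} (hq : q ∈ Q.gr i)
    (hb : HomWord A.gr (-1) j b) (hp : p ∈ P.gr k) (h : n = i + j + k) :
    preT A P Q q b p ∈ (preSpace A P Q).gr n :=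
  Submodule.subset_span (R := K) (M := PreTensor A Q P) ⟨i, j, k, q, b, p, hq, hb, hp, h, rfl⟩

lemma preSpace_gr_induction {n : ℤ} {W : Type u} [AddCommGroup W] [Module K W]
    {F : preSpace A P Q →ₗ[K] W} {S : Submodule K W}
    (h : ∀ i j k q b p, q ∈ Q.gr i → HomList A.gr (-1) j b → p ∈ P.gr k → n = i + j + k →
      F (preT A P Q q (word b) p) ∈ S) {v : preSpace A P Q} (hv : v ∈ (preSpace A P Q).gr n) :
    F v ∈ S := by
  have : (preSpace A P Q).gr n ≤ S.comap F := by
    refine Submodule.span_le.2 ?_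
    rintro _ ⟨i, j, k, q, b, p, hq, hb, hp, hn, rfl⟩
    obtain ⟨l, rfl, hl⟩ := hb.exists_word
    exact h i j k q l p hq hl hp hn
  exact this hv

/-- A map that is trivial on one side preserves degrees if it does so without entries there. -/
lemma Cochain.RightTrivial.hasDegree {V W : GrSpace K} {F : Cochain A V W} (hF : F.RightTrivial)
    {d : ℤ} (h : ∀ k m x v, HomWord A.gr (-1) k x → v ∈ V.gr m → F x 1 v ∈ W.gr (k + m + d)) :
    F.HasDegree d := by
  intro k m n x y v hx hy hv
  obtain ⟨l, rfl, hl⟩ := hy.exists_word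
  rw [hF]
  cases l with
  | nil => obtain rfl : n = 0 := hl; simpa using h k m x v hx hv
  | cons a l => simp

lemma Cochain.LeftTrivial.hasDegree {V W : GrSpace K} {F : Cochain A V W} (hF : F.LeftTrivial)
    {d : ℤ} (h : ∀ m n y v, HomWord A.gr (-1) n y → v ∈ V.gr m → F 1 y v ∈ W.gr (m + n + d)) :
    F.HasDegree d := by
  intro k m n x y v hx hy hv
  obtain ⟨l, rfl, hl⟩ := hx.exists_word
  rw [hF]
  cases l with
  | nil => obtain rfl : k = 0 := hl; simpa using h m n y v hy hv
  | cons a l => simp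

lemma preL_hasDegree (hP : P.IsGraded) {d : ℤ} {φ : Cochain A Q Q'} (hφ : φ.HasDegree d) :
    (φ.preL P d).HasDegree d := by
  refine (preL_rightTrivial d φ).hasDegree fun k m x v hx hv => ?_
  refine preSpace_gr_induction (fun i j r q b p hq hb hp hm => ?_) hv
  rw [preL_word]
  refine Submodule.smul_mem _ _ (spl_mem fun u w huw => ?_)
  obtain ⟨j₁, j₂, rfl, hu, hw⟩ := (huw ▸ hb).split
  refine preT_mem (hφ _ _ _ _ _ _ hx hu.homWord hq) (hw.homWord.sgnPow A.isAInf.graded d)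
    (hP.parPow_mem d hp) ?_
  rw [hm]; ring

lemma preR_hasDegree {d : ℤ} {φ : Cochain A P P'} (hφ : φ.HasDegree d) :
    (φ.preR Q).HasDegree d := by
  refine (preR_leftTrivial φ).hasDegree fun m n y v hy hv => ?_
  refine preSpace_gr_induction (fun i j r q b p hq hb hp hm => ?_) hv
  rw [preR_word]
  refine Submodule.smul_mem _ _ (spl_mem fun u w huw => ?_)
  obtain ⟨j₁, j₂, rfl, hu, hw⟩ := (huw ▸ hb).split
  refine preT_mem hq hu.homWord (hφ _ _ _ _ _ _ hw.homWord hy hp) ?_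
  rw [hm]; ring

lemma preM_hasDegree (hP : P.IsGraded) : (preM A P Q).HasDegree 1 := by
  refine preM_rightTrivial.hasDegree fun k m x v hx hv => ?_
  refine preSpace_gr_induction (fun i j r q b p hq hb hp hm => ?_) hv
  obtain ⟨l, rfl, hl⟩ := hx.exists_word
  cases l with
  | cons a l => simp [preM_apply]
  | nil =>
  obtain rfl : k = 0 := hl
  rw [word_nil, preM_one]
  refine A.isAInf.coder_mem (f := (preT A P Q q).flip (P.par p)) (fun z hz => ?_) hb.homWord
  refine preT_mem hq hz (parPow_one P ▸ hP.parPow_mem 1 hp) ?_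
  rw [hm]; ring

end PreDegrees

section Grading

variable {K : Type u} [Field K] {A : AInfAlgebra K}

lemma two_zpow_injective (K : Type u) [Field K] [CharZero K] :
    Function.Injective fun n : ℤ => (2 : K) ^ n := by
  intro m n h
  have h2 : (((2 : ℚ) ^ m : ℚ) : K) = ((2 : ℚ) ^ n : ℚ) := by push_cast; exact h
  exact zpow_right_injective₀ (by norm_num) (by norm_num) (Rat.cast_injective h2)

/-- Subspaces on which an operator acts by different powers of two are independent. -/
lemma isInternal_of_scaling [CharZero K] {V : Type u} [AddCommGroup V] [Module K V]
    {𝒢 : ℤ → Submodule K V} (ρ : V →ₗ[K] V) (hρ : ∀ n, ∀ v ∈ 𝒢 n, ρ v = (2 : K) ^ n • v)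
    (h : ⨆ n, 𝒢 n = ⊤) : DirectSum.IsInternal 𝒢 := by
  rw [DirectSum.isInternal_submodule_iff_iSupIndep_and_iSup_eq_top]
  refine ⟨?_, h⟩
  have h1 := (Module.End.eigenspaces_iSupIndep ρ).comp (two_zpow_injective K)
  exact h1.mono fun n v hv => Module.End.mem_eigenspace_iff.2 (hρ n v hv)

lemma GrSpace.IsGraded.exists_scaling {M : GrSpace K} (h : M.IsGraded) :
    ∃ ρ : M →ₗ[K] M, ∀ n, ∀ v ∈ M.gr n, ρ v = (2 : K) ^ n • v := by
  obtain ⟨ρ, hρ⟩ := h.exists_glue fun n => (2 : K) ^ n • LinearMap.id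
  exact ⟨ρ, fun n v hv => by simp [hρ n v hv]⟩

lemma exists_bar_scaling [CharZero K] {M : GrSpace K} (h : M.IsGraded) :
    ∃ ρ : Bar M →ₐ[K] Bar M, (∀ n x, HomWord M.gr (-1) n x → ρ x = (2 : K) ^ n • x) := by
  obtain ⟨ρ, hρ⟩ := h.exists_scaling
  refine ⟨TensorAlgebra.lift K (TensorAlgebra.ι K ∘ₗ ((2 : K) ^ (-1 : ℤ) • ρ)), fun n x hx => ?_⟩
  induction hx with
  | nil => simp
  | @cons m n e x he hx ih =>
    rw [map_mul, ih, TensorAlgebra.lift_ι_apply, LinearMap.comp_apply, LinearMap.smul_apply,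
      hρ m e he, zpow_add₀ two_ne_zero, zpow_add₀ two_ne_zero]
    simp only [map_smul, smul_mul_assoc, mul_smul_comm, smul_smul]
    congr 1; ring

end Grading

section Linearity

variable {K : Type u} [Field K] {A : AInfAlgebra K} {P P' Q Q' : GrSpace K}

@[simp] lemma preL_add (d : ℤ) (φ ψ : Cochain A Q Q') :
    (φ + ψ).preL P d = φ.preL P d + ψ.preL P d := preSpace_ext fun l m b q p => by
  simp [preL_word, spl_add]

@[simp] lemma preL_smul (d : ℤ) (c : K) (φ : Cochain A Q Q') :
    (c • φ).preL P d = c • φ.preL P d := preSpace_ext fun l m b q p => by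
  simp [preL_word, spl_smul, smul_comm c]

@[simp] lemma preL_zero (d : ℤ) : (0 : Cochain A Q Q').preL P d = 0 := by
  simpa using preL_smul (P := P) d (0 : K) (0 : Cochain A Q Q')

@[simp] lemma preL_sub (d : ℤ) (φ ψ : Cochain A Q Q') :
    (φ - ψ).preL P d = φ.preL P d - ψ.preL P d := by
  rw [eq_sub_iff_add_eq, ← preL_add, sub_add_cancel]

@[simp] lemma preR_add (φ ψ : Cochain A P P') :
    (φ + ψ).preR Q = φ.preR Q + ψ.preR Q := preSpace_ext fun l m b q p => by
  simp [preR_word, spl_add]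

@[simp] lemma preR_smul (c : K) (φ : Cochain A P P') :
    (c • φ).preR Q = c • φ.preR Q := preSpace_ext fun l m b q p => by
  simp [preR_word, spl_smul, smul_comm c]

@[simp] lemma preR_zero : (0 : Cochain A P P').preR Q = 0 := by
  simpa using preR_smul (Q := Q) (0 : K) (0 : Cochain A P P')

@[simp] lemma preR_sub (φ ψ : Cochain A P P') :
    (φ - ψ).preR Q = φ.preR Q - ψ.preR Q := by
  rw [eq_sub_iff_add_eq, ← preR_add, sub_add_cancel]

end Linearity

section TensorIsBimodule

variable {K : Type u} [Field K] {A : AInfAlgebra K} {Q Q' P P' R : BimoduleData A}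

variable (Q P) in
/-- The projection `Q ⊗ T(A[1]) ⊗ P → Q ⊗_A P`. -/
def tensorMk : preSpace A P.toGrSpace Q.toGrSpace →ₗ[K] (tensor Q P).carrier :=
  (degenerate A Q.toGrSpace P.toGrSpace).mkQ

lemma tensorMk_surjective : Function.Surjective (tensorMk Q P) := fun v =>
  Quotient.inductionOn' v fun w => ⟨w, rfl⟩

lemma tensorMk_unit (q : Q.carrier) (x y : Bar A.toGrSpace) (p : P.carrier) :
    tensorMk Q P (preT A P.toGrSpace Q.toGrSpace q (x * TensorAlgebra.ι K A.unit * y) p) = 0 :=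
  (Submodule.Quotient.mk_eq_zero _).2 (mem_degenerate q x y p)

lemma tensor_hom_ext {W : Type u} [AddCommGroup W] [Module K W]
    {f g : (tensor Q P).carrier →ₗ[K] W}
    (h : ∀ q b p, f (tensorMk Q P (preT A P.toGrSpace Q.toGrSpace q (word b) p)) =
      g (tensorMk Q P (preT A P.toGrSpace Q.toGrSpace q (word b) p))) : f = g := by
  refine Submodule.linearMap_qext _ ?_
  exact preSpace_hom_ext h

lemma tensor_gr (n : ℤ) : (tensor Q P).gr n =
    ((preSpace A P.toGrSpace Q.toGrSpace).gr n).map (tensorMk Q P) := by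
  refine le_antisymm (Submodule.span_le.2 ?_) (Submodule.map_le_iff_le_comap.2
    (Submodule.span_le.2 ?_))
  · rintro _ ⟨i, j, k, q, b, p, hq, hb, hp, hn, rfl⟩
    exact ⟨_, preT_mem hq hb hp hn, rfl⟩
  · rintro _ ⟨i, j, k, q, b, p, hq, hb, hp, hn, rfl⟩
    exact Submodule.subset_span ⟨i, j, k, q, b, p, hq, hb, hp, hn, rfl⟩

lemma tensor_par (v : preSpace A P.toGrSpace Q.toGrSpace) :
    (tensor Q P).par (tensorMk Q P v) = tensorMk Q P ((preSpace A P.toGrSpace Q.toGrSpace).par v) :=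
  rfl

variable (Q P) in
/-- The structure maps of the tensor product, before normalization. -/
def preO : Cochain A (preSpace A P.toGrSpace Q.toGrSpace) (preSpace A P.toGrSpace Q.toGrSpace) :=
  Cochain.preL P.toGrSpace 1 Q.op + preM A P.toGrSpace Q.toGrSpace + Cochain.preR Q.toGrSpace P.op

lemma preO_covers : (preO Q P).Covers (tensorMk Q P) (tensorMk Q P) (tensor Q P).op :=
  fun _ _ _ => rfl

lemma tensorId_covers (d : ℤ) (φ : homDeg (A := A) Q.toGrSpace Q'.toGrSpace d) :
    (Cochain.preL P.toGrSpace d φ.1).Covers (tensorMk Q P) (tensorMk Q' P) (tensorId d φ P) :=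
  fun _ _ _ => rfl

lemma idTensor_covers (d : ℤ) (φ : homDeg (A := A) P.toGrSpace P'.toGrSpace d) :
    (Cochain.preR Q.toGrSpace φ.1).Covers (tensorMk Q P) (tensorMk Q P') (idTensor d φ Q) :=
  fun _ _ _ => rfl

lemma Cochain.HasDegree.of_covers {d : ℤ}
    {F : Cochain A (preSpace A P.toGrSpace Q.toGrSpace) (preSpace A P'.toGrSpace Q'.toGrSpace)}
    (hF : F.HasDegree d) {F' : Cochain A (tensor Q P).toGrSpace (tensor Q' P').toGrSpace}
    (h : F.Covers (tensorMk Q P) (tensorMk Q' P') F') : F'.HasDegree d := by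
  intro k m n x y v hx hy hv
  rw [tensor_gr] at hv ⊢
  obtain ⟨v, hv, rfl⟩ := hv
  rw [h]
  exact ⟨_, hF k m n x y v hx hy hv, rfl⟩

lemma tensor_isGraded [CharZero K] (hQ : Q.IsGraded) (hP : P.IsGraded) :
    (tensor Q P).IsGraded := by
  have span : ⨆ n, (tensor Q P).gr n = ⊤ := by
    refine Submodule.eq_top_iff'.2 fun v => ?_
    obtain ⟨v, rfl⟩ := tensorMk_surjective v
    have : LinearMap.range (tensorMk Q P) ≤ ⨆ n, (tensor Q P).gr n := by
      have h : ∀ q b p, tensorMk Q P (preT A P.toGrSpace Q.toGrSpace q b p) ∈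
          ⨆ n, (tensor Q P).gr n := by
        intro q b p
        induction q using hQ.induction with
        | hadd q q' h1 h2 => simp only [map_add, LinearMap.add_apply]; exact add_mem h1 h2
        | hm i q hq =>
        induction p using hP.induction with
        | hadd p p' h1 h2 => simp only [map_add]; exact add_mem h1 h2
        | hm k p hp =>
        induction b using A.isAInf.graded.bar_induction with
        | hadd p p' h1 h2 => simp only [map_add, LinearMap.add_apply]; exact add_mem h1 h2
        | hsmul c b h => simp only [map_smul, LinearMap.smul_apply]; exact Submodule.smul_mem _ _ h
        | hw j b hb =>
          refine Submodule.mem_iSup_of_mem (i + j + k) ?_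
          rw [tensor_gr]
          exact ⟨_, preT_mem hq hb hp rfl, rfl⟩
      have h2 : (⨆ n, (tensor Q P).gr n).mkQ ∘ₗ tensorMk Q P = 0 :=
        preSpace_hom_ext fun q b p => (Submodule.Quotient.mk_eq_zero _).2 (h q _ p)
      rintro _ ⟨v, rfl⟩
      exact (Submodule.Quotient.mk_eq_zero _).1 (congrArg (fun f => f v) h2)
    exact this ⟨v, rfl⟩
  obtain ⟨ρQ, hρQ⟩ := hQ.exists_scaling
  obtain ⟨ρP, hρP⟩ := hP.exists_scaling
  obtain ⟨ρA, hρA⟩ := exists_bar_scaling A.isAInf.graded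
  let ρ : preSpace A P.toGrSpace Q.toGrSpace →ₗ[K] preSpace A P.toGrSpace Q.toGrSpace :=
    TensorProduct.map ρQ (TensorProduct.map ρA.toLinearMap ρP)
  have hdeg : degenerate A Q.toGrSpace P.toGrSpace ≤
      (degenerate A Q.toGrSpace P.toGrSpace).comap ρ := by
    refine Submodule.span_le.2 ?_
    rintro _ ⟨q, x, y, p, rfl⟩
    have h1 := hρA _ _ (.cons A.isAInf.unit_mem .nil)
    rw [mul_one] at h1
    change ρQ q ⊗ₜ[K] (ρA (x * TensorAlgebra.ι K A.unit * y) ⊗ₜ[K] ρP p) ∈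
      degenerate A Q.toGrSpace P.toGrSpace
    rw [map_mul, map_mul, h1, mul_smul_comm, smul_mul_assoc, ← TensorProduct.smul_tmul',
      TensorProduct.tmul_smul]
    exact Submodule.smul_mem _ _ (mem_degenerate _ _ _ _)
  refine ⟨isInternal_of_scaling (Submodule.mapQ _ _ ρ hdeg) (fun n v hv => ?_) span,
    fun n v hv => ?_⟩
  · rw [tensor_gr] at hv
    obtain ⟨v, hv, rfl⟩ := hv
    change tensorMk Q P (ρ v) = (2 : K) ^ n • tensorMk Q P v
    rw [← map_smul]
    congr 1
    have := preSpace_gr_induction (F := ρ - (2 : K) ^ n • LinearMap.id) (S := ⊥)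
      (fun i j k q b p hq hb hp h => ?_) hv
    · simpa [sub_eq_zero] using this
    · rw [Submodule.mem_bot, LinearMap.sub_apply, sub_eq_zero]
      change preT A P.toGrSpace Q.toGrSpace (ρQ q) (ρA (word b)) (ρP p) =
        (2 : K) ^ n • preT A P.toGrSpace Q.toGrSpace q (word b) p
      rw [hρQ _ _ hq, hρA _ _ hb.homWord, hρP _ _ hp, h, zpow_add₀ two_ne_zero,
        zpow_add₀ two_ne_zero]
      simp only [map_smul, LinearMap.smul_apply, smul_smul]
      congr 1; ring
  · rw [tensor_gr] at hv
    obtain ⟨v, hv, rfl⟩ := hv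
    rw [tensor_par, ← map_smul]
    congr 1
    have := preSpace_gr_induction (F := (preSpace A P.toGrSpace Q.toGrSpace).par -
      ksign K n • LinearMap.id) (S := ⊥) (fun i j k q b p hq hb hp h => ?_) hv
    · simpa [sub_eq_zero] using this
    · rw [Submodule.mem_bot, LinearMap.sub_apply, sub_eq_zero, preSpace_par, hQ.par_apply _ _ hq,
        hb.homWord.sgn A.isAInf.graded, hP.par_apply _ _ hp, h, ksign_add, ksign_add]
      simp only [map_smul, LinearMap.smul_apply, smul_smul, LinearMap.id_apply]
      congr 1; ring

lemma preO_assoc (hQ : IsBimodule Q) (hP : IsBimodule P) :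
    Cochain.comp 1 (preO Q P) (preO Q P) + (preO Q P).insertMu = 0 := by
  have h1 := preL_insertMu (A := A) 1 hP.graded Q.op
  have h2 := preR_insertMu (Q := Q.toGrSpace) 1 hP.hasParity
  have h3 := comp_preL_preR (A := A) 1 1 hP.hasParity Q.op
  have h4 := preM_preM (A := A) (P := P.toGrSpace) (Q := Q.toGrSpace)
  have h5 := comp_preL_preL (A := A) 1 1 hP.graded Q.op Q.op
  have h6 := comp_preR_preR (A := A) (Q := Q.toGrSpace) 1 P.op P.op
  have a1 : Cochain.preL (A := A) P.toGrSpace (1 + 1) (Cochain.comp (A := A) 1 Q.op Q.op) +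
      Cochain.preL P.toGrSpace (1 + 1) (Cochain.insertMu (A := A) Q.op) = 0 := by
    rw [← preL_add]; exact (congrArg _ hQ.assoc).trans (preL_zero _)
  have a2 : Cochain.preR (A := A) Q.toGrSpace (Cochain.comp (A := A) 1 P.op P.op) +
      Cochain.preR Q.toGrSpace (Cochain.insertMu (A := A) P.op) = 0 := by
    rw [← preR_add]; exact (congrArg _ hP.assoc).trans preR_zero
  rw [h1, ← h5] at a1
  rw [h2, ← h6] at a2
  simp only [mul_one, ksign_one, neg_smul, one_smul] at h3 a1 a2
  simp only [preO, comp_add_left, comp_add_right, insertMu_add, h3]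
  have := congrArg₂ (· + ·) (congrArg₂ (· + ·) a1 a2) h4
  simp only [add_zero] at this
  rw [← this]
  abel

lemma preO_hasDegree (hQ : IsBimodule Q) (hP : IsBimodule P) : (preO Q P).HasDegree 1 :=
  ((preL_hasDegree hP.graded hQ.hasDegree).add (preM_hasDegree hP.graded)).add
    (preR_hasDegree hP.hasDegree)

lemma tensor_assoc (hQ : IsBimodule Q) (hP : IsBimodule P) :
    Cochain.comp (A := A) 1 (tensor Q P).op (tensor Q P).op +
      Cochain.insertMu (A := A) (P := (tensor Q P).toGrSpace) (Q := (tensor Q P).toGrSpace)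
        (tensor Q P).op = 0 := by
  have h1 := (preO_covers (Q := Q) (P := P)).comp preO_covers 1
  have h2 := (preO_covers (Q := Q) (P := P)).insertMu tensor_par
  have h3 := h1.add h2
  rw [preO_assoc hQ hP] at h3
  exact Cochain.Covers.eq tensorMk_surjective h3 Cochain.Covers.zero rfl

lemma IsBimodule.tensor [CharZero K] (hQ : IsBimodule Q) (hP : IsBimodule P) :
    IsBimodule (tensor Q P) where
  graded := tensor_isGraded hQ.graded hP.graded
  degree := (preO_hasDegree hQ hP).of_covers preO_covers
  assoc := tensor_assoc hQ hP

end TensorIsBimodule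

section TensorMaps

variable {K : Type u} [Field K] {A : AInfAlgebra K} {Q Q' P P' R : BimoduleData A}

variable (Q P) in
/-- The elements `q ⊗ b ⊗ p` of `Q ⊗_A P`. -/
def tens : Q.carrier →ₗ[K] Bar A.toGrSpace →ₗ[K] P.carrier →ₗ[K] (tensor Q P).carrier :=
  (preT A P.toGrSpace Q.toGrSpace).compr₂ (LinearMap.llcomp K _ _ _ (tensorMk Q P))

lemma tens_unit (q : Q.carrier) (x y : Bar A.toGrSpace) (p : P.carrier) :
    tens Q P q (x * TensorAlgebra.ι K A.unit * y) p = 0 := tensorMk_unit q x y p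

lemma tens_ext {W : Type u} [AddCommGroup W] [Module K W] {f g : (tensor Q P).carrier →ₗ[K] W}
    (h : ∀ q b p, f (tens Q P q (word b) p) = g (tens Q P q (word b) p)) : f = g :=
  tensor_hom_ext h

lemma tens_par (q : Q.carrier) (b : Bar A.toGrSpace) (p : P.carrier) :
    (tensor Q P).par (tens Q P q b p) = tens Q P (Q.par q) (A.sgn b) (P.par p) := rfl

lemma tensorId_tens (d : ℤ) (φ : homDeg (A := A) Q.toGrSpace Q'.toGrSpace d) (x y : Bar A.toGrSpace)
    (q : Q.carrier) (b : List A.carrier) (p : P.carrier) :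
    tensorId d φ P x y (tens Q P q (word b) p) = aug y • spl b fun u v =>
      tens Q' P (φ.1 x (word u) q) (A.sgnPow d (word v)) (P.parPow d p) := by
  have := tensorId_covers (P := P) d φ x y (preT A P.toGrSpace Q.toGrSpace q (word b) p)
  rw [preL_word, map_smul, spl_hom] at this
  exact this

lemma idTensor_tens (d : ℤ) (φ : homDeg (A := A) P.toGrSpace P'.toGrSpace d) (x y : Bar A.toGrSpace)
    (q : Q.carrier) (b : List A.carrier) (p : P.carrier) :
    idTensor d φ Q x y (tens Q P q (word b) p) = aug x • spl b fun u v =>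
      tens Q P' q (word u) (φ.1 (word v) y p) := by
  have := idTensor_covers (Q := Q) d φ x y (preT A P.toGrSpace Q.toGrSpace q (word b) p)
  rw [preR_word, map_smul, spl_hom] at this
  exact this

lemma op_tens (x y : Bar A.toGrSpace) (q : Q.carrier) (b : List A.carrier) (p : P.carrier) :
    (tensor Q P).op x y (tens Q P q (word b) p) =
      (aug y • spl b fun u v => tens Q P (Q.op x (word u) q) (A.sgn (word v)) (P.par p)) +
      (aug x * aug y) • tens Q P q (A.coder A.mu (word b)) (P.par p) +
      aug x • spl b fun u v => tens Q P q (word u) (P.op (word v) y p) := by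
  have h1 := preO_covers (Q := Q) (P := P) x y (preT A P.toGrSpace Q.toGrSpace q (word b) p)
  have h2 := preL_word (A := A) (P := P.toGrSpace) 1 Q.op x y b q p
  have h3 := preR_word (A := A) (Q := Q.toGrSpace) P.op x y b q p
  have h4 : preO Q P x y (preT A P.toGrSpace Q.toGrSpace q (word b) p) =
    Cochain.preL (A := A) P.toGrSpace 1 Q.op x y (preT A P.toGrSpace Q.toGrSpace q (word b) p) +
    preM A P.toGrSpace Q.toGrSpace x y (preT A P.toGrSpace Q.toGrSpace q (word b) p) +
    Cochain.preR (A := A) Q.toGrSpace P.op x y (preT A P.toGrSpace Q.toGrSpace q (word b) p) := rfl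
  rw [h4, h2, h3, preM_apply, map_add, map_add, map_smul, map_smul, map_smul, spl_hom, spl_hom,
    parPow_one, sgnPow_one] at h1
  exact h1

/-- Maps on `Q ⊗_A P` from trilinear maps. -/
def tensLift {W : Type u} [AddCommGroup W] [Module K W]
    (t : Q.carrier →ₗ[K] Bar A.toGrSpace →ₗ[K] P.carrier →ₗ[K] W)
    (h : ∀ q x y p, t q (x * TensorAlgebra.ι K A.unit * y) p = 0) :
    (tensor Q P).carrier →ₗ[K] W :=
  Submodule.liftQ _ (TensorProduct.lift (LinearMap.mk₂ K (fun q z => TensorProduct.lift (t q) z)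
    (fun q q' z => by
      have : TensorProduct.lift (t (q + q')) = TensorProduct.lift (t q) + TensorProduct.lift (t q') :=
        TensorProduct.ext' fun b p => by simp
      rw [this]; rfl)
    (fun c q z => by
      have : TensorProduct.lift (t (c • q)) = c • TensorProduct.lift (t q) :=
        TensorProduct.ext' fun b p => by simp
      rw [this]; rfl)
    (fun q z z' => map_add _ _ _) (fun c q z => map_smul _ _ _))) <| by
      refine Submodule.span_le.2 ?_
      rintro _ ⟨q, x, y, p, rfl⟩
      exact h q x y p

lemma preL_diff (hR : R.IsGraded) (hR' : Cochain.HasParity (A := A) R.op 1) (d : ℤ)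
    (φ : Cochain A Q.toGrSpace Q'.toGrSpace) :
    Cochain.preL R.toGrSpace (d + 1) (diff Q Q' d φ) =
      Cochain.comp d (preO Q' R) (φ.preL R.toGrSpace d) - ksign K d •
        (Cochain.comp 1 (φ.preL R.toGrSpace d) (preO Q R) + (φ.preL R.toGrSpace d).insertMu) := by
  have h1 := comp_preL_preL (A := A) d 1 hR Q'.op φ
  have h2 := comp_preL_preL (A := A) 1 d hR φ Q.op
  have h3 := preL_insertMu d hR φ
  have h4 := comp_preL_preR d 1 hR' φ
  rw [mul_one] at h4
  rw [add_comm 1 d] at h2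
  simp only [diff_apply, preL_sub, preL_smul, preL_add, ← h1, ← h2, h3, preO, comp_add_left,
    comp_add_right, h4]
  rcases ksign_eq K d with h | h <;> rw [h] <;>
    simp only [one_smul, neg_smul, sub_neg_eq_add, smul_neg, neg_neg] <;> abel

lemma preR_diff (d : ℤ) {φ : Cochain A P.toGrSpace P'.toGrSpace} (hφ : φ.HasParity d) :
    Cochain.preR R.toGrSpace (diff P P' d φ) =
      Cochain.comp d (preO R P') (φ.preR R.toGrSpace) - ksign K d •
        (Cochain.comp 1 (φ.preR R.toGrSpace) (preO R P) + (φ.preR R.toGrSpace).insertMu) := by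
  have h1 := comp_preR_preR (A := A) (Q := R.toGrSpace) d P'.op φ
  have h2 := comp_preR_preR (A := A) (Q := R.toGrSpace) 1 φ P.op
  have h3 := preR_insertMu (Q := R.toGrSpace) d hφ
  have h4 := comp_preL_preR (A := A) 1 d hφ R.op
  rw [one_mul] at h4
  simp only [diff_apply, preR_sub, preR_smul, preR_add, ← h1, ← h2, h3, preO, comp_add_left,
    comp_add_right, h4]
  rcases ksign_eq K d with h | h <;> rw [h] <;>
    simp only [one_smul, neg_smul, sub_neg_eq_add, smul_neg, neg_neg] <;> abel

lemma diff_covers (d : ℤ)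
    {F : Cochain A (preSpace A P.toGrSpace Q.toGrSpace) (preSpace A P'.toGrSpace Q'.toGrSpace)}
    {F' : Cochain A (tensor Q P).toGrSpace (tensor Q' P').toGrSpace}
    (h : F.Covers (tensorMk Q P) (tensorMk Q' P') F') :
    (Cochain.comp d (preO Q' P') F - ksign K d • (Cochain.comp 1 F (preO Q P) + F.insertMu)).Covers
      (tensorMk Q P) (tensorMk Q' P') (diff (tensor Q P) (tensor Q' P') d F') :=
  (preO_covers.comp h d).sub (((h.comp preO_covers 1).add (h.insertMu tensor_par)).smul _)

lemma diff_tensorId (hR : IsBimodule R) (d : ℤ)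
    (φ : homDeg (A := A) Q.toGrSpace Q'.toGrSpace d)
    (ψ : homDeg (A := A) Q.toGrSpace Q'.toGrSpace (d + 1)) (h : ψ.1 = diff Q Q' d φ.1) :
    diff (tensor Q R) (tensor Q' R) d (tensorId d φ R) = tensorId (d + 1) ψ R := by
  have h1 := diff_covers d (tensorId_covers (P := R) d φ)
  rw [← preL_diff hR.graded hR.hasParity, ← h] at h1
  exact h1.eq tensorMk_surjective (tensorId_covers (d + 1) ψ) rfl

lemma diff_idTensor (d : ℤ) (φ : homDeg (A := A) P.toGrSpace P'.toGrSpace d)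
    (hφ : φ.1.HasParity d) (ψ : homDeg (A := A) P.toGrSpace P'.toGrSpace (d + 1))
    (h : ψ.1 = diff P P' d φ.1) :
    diff (tensor R P) (tensor R P') d (idTensor d φ R) = idTensor (d + 1) ψ R := by
  have h1 := diff_covers d (idTensor_covers (Q := R) d φ)
  rw [← preR_diff d hφ, ← h] at h1
  exact h1.eq tensorMk_surjective (idTensor_covers (d + 1) ψ) rfl

lemma comp_tensorId {Q'' : BimoduleData A} (hR : R.IsGraded) {d e f : ℤ} (hf : d + e = f)
    (φ : homDeg (A := A) Q.toGrSpace Q'.toGrSpace d)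
    (ψ : homDeg (A := A) Q'.toGrSpace Q''.toGrSpace e)
    (χ : homDeg (A := A) Q.toGrSpace Q''.toGrSpace f) (h : χ.1 = Cochain.comp d ψ.1 φ.1) :
    Cochain.comp d (tensorId e ψ R) (tensorId d φ R) = tensorId f χ R := by
  subst hf
  have h1 := (tensorId_covers (P := R) e ψ).comp (tensorId_covers d φ) d
  rw [comp_preL_preL d e hR, ← h] at h1
  exact h1.eq tensorMk_surjective (tensorId_covers (d + e) χ) rfl

lemma comp_idTensor {P'' : BimoduleData A} {d e f : ℤ}
    (φ : homDeg (A := A) P.toGrSpace P'.toGrSpace d)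
    (ψ : homDeg (A := A) P'.toGrSpace P''.toGrSpace e)
    (χ : homDeg (A := A) P.toGrSpace P''.toGrSpace f) (h : χ.1 = Cochain.comp d ψ.1 φ.1) :
    Cochain.comp d (idTensor e ψ R) (idTensor d φ R) = idTensor f χ R := by
  have h1 := (idTensor_covers (Q := R) e ψ).comp (idTensor_covers d φ) d
  rw [comp_preR_preR d, ← h] at h1
  exact h1.eq tensorMk_surjective (idTensor_covers f χ) rfl

/-- The exchange law. -/
lemma tensorId_idTensor {d e : ℤ} (φ : homDeg (A := A) Q.toGrSpace Q'.toGrSpace d)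
    (ψ : homDeg (A := A) P.toGrSpace P'.toGrSpace e) (hψ : ψ.1.HasParity e) :
    Cochain.comp e (tensorId d φ P') (idTensor e ψ Q) =
      ksign K (d * e) • Cochain.comp d (idTensor e ψ Q') (tensorId d φ P) :=
  Cochain.Covers.eq tensorMk_surjective ((tensorId_covers d φ).comp (idTensor_covers e ψ) e)
    (((idTensor_covers e ψ).comp (tensorId_covers d φ) d).smul _) (comp_preL_preR d e hψ φ.1)

lemma tensorId_mem (hR : R.IsGraded) {d : ℤ} (φ : homDeg (A := A) Q.toGrSpace Q'.toGrSpace d) :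
    tensorId d φ R ∈ homDeg (tensor Q R).toGrSpace (tensor Q' R).toGrSpace d := by
  refine ⟨⟨fun x x' y => tens_ext fun q b p => ?_, fun x y y' => tens_ext fun q b p => ?_⟩,
    (preL_hasDegree hR φ.2.2).of_covers (tensorId_covers d φ)⟩
  · rw [tensorId_tens]; simp [φ.2.1.1]
  · rw [tensorId_tens]; simp

lemma idTensor_mem {d : ℤ} (φ : homDeg (A := A) P.toGrSpace P'.toGrSpace d) :
    idTensor d φ R ∈ homDeg (tensor R P).toGrSpace (tensor R P').toGrSpace d := by
  refine ⟨⟨fun x x' y => tens_ext fun q b p => ?_, fun x y y' => tens_ext fun q b p => ?_⟩,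
    (preR_hasDegree φ.2.2).of_covers (idTensor_covers d φ)⟩
  · rw [idTensor_tens]; simp
  · rw [idTensor_tens]; simp [φ.2.1.2]

end TensorMaps

section CoderMid

variable {K : Type u} [Field K] {M : GrSpace K}

lemma mul_spl {E : Type*} {X : Type*} [NonUnitalNonAssocSemiring X] (x : X) (l : List E)
    (F : List E → List E → X) : x * spl l F = spl l fun u v => x * F u v := Finset.mul_sum _ _ _

lemma spl_mul {E : Type*} {X : Type*} [NonUnitalNonAssocSemiring X] (x : X) (l : List E)
    (F : List E → List E → X) : spl l F * x = spl l fun u v => F u v * x := Finset.sum_mul _ _ _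

lemma coder_mid (μ : Bar M →ₗ[K] M) (u v : List M) (a : M) :
    M.coder μ (word u * TensorAlgebra.ι K a * word v) =
      word u * TensorAlgebra.ι K a * M.coder μ (word v) +
      M.coder μ (word u) * M.sgn (TensorAlgebra.ι K a * word v) +
      spl u fun u₁ u₂ => spl v fun v₁ v₂ => word u₁ *
        TensorAlgebra.ι K (μ (word u₂ * TensorAlgebra.ι K a * word v₁)) * M.sgn (word v₂) := by
  rw [word_mid, coder_word μ (u ++ a :: v), coder_word μ v, coder_word μ u, spl_append_cons]
  have h1 : ∀ s t : List M, s ++ t = u →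
      (spl (t ++ a :: v) fun b c => word (K := K) (s ++ μ (word b) :: c.map (M.letterSgn 1))) =
      (spl t fun b c => word (K := K) (s ++ μ (word b) :: c.map (M.letterSgn 1)) *
        M.sgn (TensorAlgebra.ι K a * word v)) +
      spl v fun v₁ v₂ => word s * TensorAlgebra.ι K (μ (word t * TensorAlgebra.ι K a * word v₁)) *
        M.sgn (word v₂) := by
    intro s t _
    rw [spl_append_cons]
    congr 1
    · refine spl_congr fun b c _ => ?_
      rw [← word_cons, sgn_word, ← word_append]
      simp
    · refine spl_congr fun b c _ => ?_
      rw [word_mid, sgn_word, word_mid]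
  have h2 : (spl u fun s t => spl t fun b c =>
      word (K := K) (s ++ μ (word b) :: c.map (M.letterSgn 1)) *
        M.sgn (TensorAlgebra.ι K a * word v)) =
      (spl u fun s t => spl t fun b c => word (s ++ μ (word b) :: c.map (M.letterSgn 1))) *
        M.sgn (TensorAlgebra.ι K a * word v) := by
    simp only [spl_mul]
  have h3 : (spl v fun s t => spl t fun b c =>
      word (K := K) (u ++ a :: s ++ μ (word b) :: c.map (M.letterSgn 1))) =
      word u * TensorAlgebra.ι K a *
        spl v fun s t => spl t fun b c => word (s ++ μ (word b) :: c.map (M.letterSgn 1)) := by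
    simp only [mul_spl]
    refine spl_congr fun s t _ => spl_congr fun b c _ => ?_
    simp only [word_append, word_cons, mul_assoc]
  rw [spl_congr h1, spl_add, h2, h3]
  abel

end CoderMid

section Evaluations

variable {K : Type u} [Field K] {A : AInfAlgebra K} {P Q R : BimoduleData A}

lemma tens_cochain_ext {W : GrSpace K} {φ ψ : Cochain A (tensor Q P).toGrSpace W}
    (h : ∀ l m q b p, φ (word l) (word m) (tens Q P q (word b) p) =
      ψ (word l) (word m) (tens Q P q (word b) p)) : φ = ψ :=
  word_ext fun l => word_ext fun m => tens_ext fun q b p => h l m q b p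

lemma tens_mem {i j k n : ℤ} {q : Q.carrier} {b : Bar A.toGrSpace} {p : P.carrier} (hq : q ∈ Q.gr i)
    (hb : HomWord A.gr (-1) j b) (hp : p ∈ P.gr k) (h : n = i + j + k) :
    tens Q P q b p ∈ (tensor Q P).gr n :=
  Submodule.subset_span (R := K) (M := PreTensor A Q.toGrSpace P.toGrSpace ⧸
    degenerate A Q.toGrSpace P.toGrSpace) ⟨i, j, k, q, b, p, hq, hb, hp, h, rfl⟩

variable (A) in
/-- The diagonal bimodule. -/
def diagM : BimoduleData A := diagonal A

/-- The underlying space of `diagM A` is that of `A`. -/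
def toA : (diagM A).carrier →ₗ[K] A.carrier := LinearMap.id

/-- `evalLeft`, with source expressed through `diagM A`. -/
def evL (P : BimoduleData A) : Cochain A (tensor (diagM A) P).toGrSpace P.toGrSpace := evalLeft P

/-- `evalRight`, with source expressed through `diagM A`. -/
def evR (P : BimoduleData A) : Cochain A (tensor P (diagM A)).toGrSpace P.toGrSpace := evalRight P

lemma evL_tens (x y b : Bar A.toGrSpace) (a : (diagM A).carrier) (p : P.carrier) :
    evL P x y (tens (diagM A) P a b p) =
      -P.op (x * TensorAlgebra.ι K (toA a) * A.sgn b) (A.sgn y) (P.par p) := rfl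

lemma evR_tens (x y b : Bar A.toGrSpace) (a : (diagM A).carrier) (p : P.carrier) :
    evR P x y (tens P (diagM A) p b a) =
      P.op x (b * TensorAlgebra.ι K (toA a) * A.sgn y) p := rfl

lemma toA_op (x y : Bar A.toGrSpace) (a : (diagM A).carrier) :
    toA ((diagM A).op x y a) = -A.mu (x * TensorAlgebra.ι K (toA a) * A.sgn y) := rfl

lemma toA_par (a : (diagM A).carrier) : toA ((diagM A).par a) = A.par (toA a) := rfl

lemma diff_evL (hP : IsBimodule P) : diff (tensor (diagM A) P) P 0 (evL P) = 0 := by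
  rw [diff_apply]
  refine tens_cochain_ext fun l m a b p => ?_
  have h := congrArg (fun f : Cochain A P.toGrSpace P.toGrSpace =>
    f (word l * TensorAlgebra.ι K (toA a) * A.sgn (word b)) (A.sgn (word m)) (P.par p)) hP.assoc
  have hg := hP.graded
  have hA := A.isAInf
  have hs : ∀ b : List A.carrier, A.sgn (word b) = word (b.map (A.letterSgn 1)) := sgn_word (M := A.toGrSpace)
  have hc : A.coder A.mu (word (l ++ toA a :: b.map (A.letterSgn 1))) =
      -(word l * TensorAlgebra.ι K (toA a) * A.sgn (A.coder A.mu (word b))) +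
      A.coder A.mu (word l) * A.sgn (TensorAlgebra.ι K (toA a) * A.sgn (word b)) +
      spl l fun u₁ u₂ => spl b fun v₁ v₂ => word u₁ *
        TensorAlgebra.ι K (A.mu (word u₂ * TensorAlgebra.ι K (toA a) * A.sgn (word v₁))) *
          word v₂ := by
    rw [← word_mid, coder_mid, hA.sgn_coder, hs, spl_comm, spl_map, spl_comm]
    simp only [mul_neg, neg_neg, ← sgn_word, hA.graded.sgn_sgn]
  simp only [LinearMap.add_apply, LinearMap.zero_apply, insertMu_apply] at h
  have hcomp : Cochain.comp (A := A) 1 P.op P.op (word (l ++ toA a :: b.map (A.letterSgn 1)))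
      (A.sgn (word m)) (P.par p) =
      (spl l fun u v => spl m fun c e => P.op (word u) (word e)
        (P.op (word v * TensorAlgebra.ι K (toA a) * A.sgn (word b)) (A.sgn (word c)) (P.par p))) +
      spl b fun s t => spl m fun c e => P.op (word l * TensorAlgebra.ι K (toA a) * A.sgn (word s))
        (word e) (P.op (A.sgn (word t)) (A.sgn (word c)) (P.par p)) := by
    rw [hs, comp_word_spl, spl_append_cons, spl_map]
    simp only [spl_map, ← hs, hA.graded.sgn_sgn, sgnPow_one, AlgHom.toLinearMap_apply, ← word_mid]
  rw [hs b, word_mid, hcomp, hc] at h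
  simp only [LinearMap.sub_apply, LinearMap.smul_apply, LinearMap.add_apply, comp_word_spl, insertMu_apply,
    evL_tens, op_tens, tens_par, sgnPow_zero, sgnPow_one, ksign_zero, one_smul, map_add, map_smul, spl_hom,
    LinearMap.id_apply, AlgHom.toLinearMap_apply, toA_op, toA_par, hg.par_par, 
    spl_append_cons, LinearMap.zero_apply, spl_add, mul_smul, spl_smul, spl_aug_left, spl_aug_right,
    hA.graded.sgn_sgn, hA.sgn_coder, spl_apply]
  have hp : ∀ x y p, P.par (P.op x y p) = -P.op (A.sgn x) (A.sgn y) (P.par p) := fun x y p => by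
    have := hP.hasParity x y p
    simpa using this
  rw [spl_comm b m] at h
  simp only [hp, hg.par_par, hA.graded.sgn_sgn, hA.sgn_coder, map_neg, mul_neg, neg_mul, neg_neg, spl_neg,
    LinearMap.neg_apply, map_add, LinearMap.add_apply, map_mul, sgn_ι, spl_hom, spl_apply, mul_assoc] at h ⊢
  rw [← word_mid, hs] at h
  linear_combination (norm := skip) -h
  simp only [mul_assoc, ← hs]
  abel

lemma diff_evR (hP : IsBimodule P) : diff (tensor P (diagM A)) P 0 (evR P) = 0 := by
  rw [diff_apply]
  refine tens_cochain_ext fun l m p b a => ?_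
  have h := congrArg (fun f : Cochain A P.toGrSpace P.toGrSpace =>
    f (word l) (word b * TensorAlgebra.ι K (toA a) * A.sgn (word m)) p) hP.assoc
  have hA := A.isAInf
  have hs : ∀ b : List A.carrier, A.sgn (word b) = word (b.map (A.letterSgn 1)) :=
    sgn_word (M := A.toGrSpace)
  have hc : A.coder A.mu (word (b ++ toA a :: m.map (A.letterSgn 1))) =
      -(word b * TensorAlgebra.ι K (toA a) * A.sgn (A.coder A.mu (word m))) +
      A.coder A.mu (word b) * A.sgn (TensorAlgebra.ι K (toA a) * A.sgn (word m)) +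
      spl b fun u₁ u₂ => spl m fun v₁ v₂ => word u₁ *
        TensorAlgebra.ι K (A.mu (word u₂ * TensorAlgebra.ι K (toA a) * A.sgn (word v₁))) *
          word v₂ := by
    rw [← word_mid, coder_mid, hA.sgn_coder, hs, spl_comm, spl_map, spl_comm]
    simp only [mul_neg, neg_neg, ← sgn_word, hA.graded.sgn_sgn]
  simp only [LinearMap.add_apply, LinearMap.zero_apply, insertMu_apply] at h
  have hcomp : Cochain.comp (A := A) 1 P.op P.op (word l)
      (word (b ++ toA a :: m.map (A.letterSgn 1))) p =
      (spl l fun u v => spl b fun s t => P.op (word u)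
        (A.sgn (word t * TensorAlgebra.ι K (toA a) * A.sgn (word m))) (P.op (word v) (word s) p)) +
      spl l fun u v => spl m fun c e => P.op (word u) (word e)
        (P.op (word v) (word b * TensorAlgebra.ι K (toA a) * A.sgn (word c)) p) := by
    rw [comp_word_spl, ← spl_add]
    refine spl_congr fun u v _ => ?_
    rw [spl_append_cons, spl_map]
    simp only [← hs, hA.graded.sgn_sgn, sgnPow_one, AlgHom.toLinearMap_apply, ← word_mid]
  rw [hs m, word_mid, hcomp, hc] at h
  simp only [LinearMap.sub_apply, LinearMap.smul_apply, LinearMap.add_apply, comp_word_spl,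
    insertMu_apply, evR_tens, op_tens, tens_par, sgnPow_zero, sgnPow_one, ksign_zero, one_smul, map_add,
    map_smul, spl_hom, LinearMap.id_apply, AlgHom.toLinearMap_apply, toA_op, toA_par,
    spl_append_cons, LinearMap.zero_apply, spl_add, mul_smul, spl_smul, spl_aug_left, spl_aug_right,
    hA.graded.sgn_sgn, hA.sgn_coder, spl_apply]
  rw [spl_comm b m] at h
  simp only [hA.graded.sgn_sgn, hA.sgn_coder, map_neg, mul_neg, neg_mul, neg_neg, spl_neg,
    LinearMap.neg_apply, map_add, LinearMap.add_apply, map_mul, sgn_ι, spl_hom, spl_apply, mul_assoc] at h ⊢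
  rw [← word_mid, hs] at h
  linear_combination (norm := skip) h
  simp only [mul_assoc, ← hs, map_mul, sgn_ι, neg_mul, mul_neg, hA.graded.sgn_sgn, map_neg, LinearMap.neg_apply]
  abel

lemma evL_mem (hP : IsBimodule P) :
    evL P ∈ homDeg (tensor (diagM A) P).toGrSpace P.toGrSpace 0 := by
  have hA := A.isAInf.graded
  refine ⟨⟨fun x x' y => tens_ext fun a b p => ?_, fun x y y' => tens_ext fun a b p => ?_⟩, ?_⟩
  · rw [evL_tens, mul_assoc, mul_assoc, P.unit_left]
    simp
  · rw [evL_tens, map_mul A.sgn, map_mul A.sgn, A.sgn_unit, mul_neg, neg_mul, map_neg, LinearMap.neg_apply, P.unit_right]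
    simp
  · intro k m n x y v hx hy hv
    induction hv using Submodule.span_induction with
    | mem z hz =>
      obtain ⟨i, j, r, a, b, p, ha, hb, hp, rfl, rfl⟩ := hz
      change evL P x y (tens (diagM A) P a b p) ∈ _
      rw [evL_tens]
      have := hP.degree _ _ _ _ _ _ ((hx.mul (.cons (e := toA a) ha .nil)).mul (hb.sgnPow hA 1)) (hy.sgnPow hA 1)
        (hP.graded.parPow_mem 1 hp)
      rw [parPow_one, sgnPow_one] at this
      refine neg_mem ?_
      convert this using 2
      · ring
      · simp
    | zero => rw [map_zero]; exact zero_mem _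
    | add v w _ _ h1 h2 => rw [map_add]; exact add_mem h1 h2
    | smul c v _ h => rw [map_smul]; exact Submodule.smul_mem _ _ h

lemma evR_mem (hP : IsBimodule P) :
    evR P ∈ homDeg (tensor P (diagM A)).toGrSpace P.toGrSpace 0 := by
  have hA := A.isAInf.graded
  refine ⟨⟨fun x x' y => tens_ext fun p b a => ?_, fun x y y' => tens_ext fun p b a => ?_⟩, ?_⟩
  · rw [evR_tens, P.unit_left]
    simp
  · rw [evR_tens, map_mul A.sgn, map_mul A.sgn, A.sgn_unit, mul_neg, neg_mul, mul_neg, map_neg, LinearMap.neg_apply,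
      ← mul_assoc, ← mul_assoc, P.unit_right]
    simp
  · intro k m n x y v hx hy hv
    induction hv using Submodule.span_induction with
    | mem z hz =>
      obtain ⟨i, j, r, p, b, a, hp, hb, ha, rfl, rfl⟩ := hz
      change evR P x y (tens P (diagM A) p b a) ∈ _
      rw [evR_tens]
      have := hP.degree _ _ _ _ _ _ hx ((hb.mul (.cons (e := toA a) ha .nil)).mul (hy.sgnPow hA 1)) hp
      rw [sgnPow_one] at this
      convert this using 2
      · ring
      · simp
    | zero => rw [map_zero]; exact zero_mem _
    | add v w _ _ h1 h2 => rw [map_add]; exact add_mem h1 h2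
    | smul c v _ h => rw [map_smul]; exact Submodule.smul_mem _ _ h

lemma evL_cocycle (hP : IsBimodule P) : evL P ∈ cocycles (tensor (diagM A) P) P 0 :=
  ⟨evL_mem hP, LinearMap.mem_ker.2 (diff_evL hP)⟩

lemma evR_cocycle (hP : IsBimodule P) : evR P ∈ cocycles (tensor P (diagM A)) P 0 :=
  ⟨evR_mem hP, LinearMap.mem_ker.2 (diff_evR hP)⟩

end Evaluations

section Units

variable {K : Type u} [Field K] {A : AInfAlgebra K} {P Q R : BimoduleData A}

variable (A) in
/-- The unit of `A` as an element of the diagonal bimodule. -/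
def unitM : (diagM A).carrier := A.unit

@[simp] lemma toA_unitM : toA (unitM A) = A.unit := rfl

@[simp] lemma par_unitM : (diagM A).par (unitM A) = unitM A := A.par_unit

lemma parPow_unitM (d : ℤ) : (diagM A).parPow d (unitM A) = unitM A := by
  unfold GrSpace.parPow
  split_ifs
  · rfl
  · exact par_unitM

lemma toA_injective : Function.Injective (toA : (diagM A).carrier →ₗ[K] A.carrier) := fun _ _ h => h

/-- The inverse of `toA`. -/
def ofA : A.carrier →ₗ[K] (diagM A).carrier := LinearMap.id

lemma ofA_toA (a : (diagM A).carrier) : ofA (toA a) = a := rfl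

lemma diagM_op (x y : Bar A.toGrSpace) (a : (diagM A).carrier) :
    (diagM A).op x y a = ofA (-A.mu (x * TensorAlgebra.ι K (toA a) * A.sgn y)) := rfl

lemma par_len1_sgn (y : Bar A.toGrSpace) : A.par (len1 (A.sgn y)) = -len1 y := by
  have hA := A.isAInf.graded
  refine LinearMap.congr_fun (f := A.par ∘ₗ len1 ∘ₗ A.sgn.toLinearMap) (g := -len1) (word_ext fun l => ?_) y
  change A.par (len1 (A.sgn (word l))) = -len1 (word l)
  cases l with
  | nil => simp
  | cons a l =>
    rw [word_cons, map_mul, sgn_ι, neg_mul, map_neg, len1_mul, len1_mul, aug_ι, aug_ι, zero_smul, zero_smul,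
      zero_add, zero_add, len1_ι, len1_ι, aug_sgn, map_neg, map_smul, hA.par_par]

lemma diagM_op_unit (x y : Bar A.toGrSpace) :
    (diagM A).op x y (unitM A) = ofA (aug x • len1 y - aug y • len1 x) := by
  rw [diagM_op, toA_unitM, A.isAInf.unital, par_len1_sgn, aug_sgn]
  congr 1
  module

lemma GrSpace.smul_mem_gr (M : GrSpace K) {n : ℤ} (c : K) {v : M} (h : v ∈ M.gr n) : c • v ∈ M.gr n :=
  Submodule.smul_mem _ _ h

lemma GrSpace.zero_smul_mem (M : GrSpace K) {n : ℤ} (v : M) : (0 : K) • v ∈ M.gr n := by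
  rw [zero_smul]; exact zero_mem _

/-- The canonical quasi-isomorphism `P → A ⊗_A P`. -/
def iL (P : BimoduleData A) : Cochain A P.toGrSpace (tensor (diagM A) P).toGrSpace :=
  LinearMap.mk₂ K (fun x y => aug y • tens (diagM A) P (unitM A) x)
    (fun x x' y => by rw [map_add, smul_add]) (fun c x y => by rw [map_smul, smul_comm])
    (fun x y y' => by rw [map_add, add_smul]) (fun c x y => by rw [map_smul, smul_assoc])

/-- The canonical quasi-isomorphism `P → P ⊗_A A`. -/
def iR (P : BimoduleData A) : Cochain A P.toGrSpace (tensor P (diagM A)).toGrSpace :=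
  LinearMap.mk₂ K (fun x y => aug x • ((tens P (diagM A)).flip y).flip (unitM A))
    (fun x x' y => by rw [map_add, add_smul]) (fun c x y => by rw [map_smul, smul_assoc])
    (fun x y y' => by ext p; simp) (fun c x y => by ext p; simp only [map_smul, LinearMap.smul_apply, LinearMap.flip_apply]; rw [smul_comm])

lemma iL_apply (x y : Bar A.toGrSpace) (p : P.carrier) :
    iL P x y p = aug y • tens (diagM A) P (unitM A) x p := rfl

lemma iR_apply (x y : Bar A.toGrSpace) (p : P.carrier) :
    iR P x y p = aug x • tens P (diagM A) p y (unitM A) := rfl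

lemma iL_mem : iL P ∈ homDeg P.toGrSpace (tensor (diagM A) P).toGrSpace 0 := by
  refine ⟨⟨fun x x' y => LinearMap.ext fun p => ?_, fun x y y' => LinearMap.ext fun p => ?_⟩, ?_⟩
  · rw [iL_apply, tens_unit, smul_zero]; rfl
  · simp [iL_apply]
  · intro k m n x y p hx hy hp
    rw [iL_apply]
    by_cases h : aug y = 0
    · rw [h]; exact GrSpace.zero_smul_mem _ _
    · have hn : n = 0 := by
        cases hy with
        | nil => rfl
        | cons => simp at h
      have hz : tens (diagM A) P (unitM A) x p ∈ (tensor (diagM A) P).gr (k + m + n + 0) :=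
        tens_mem (Q := diagM A) A.isAInf.unit_mem hx hp (by rw [hn]; ring)
      exact GrSpace.smul_mem_gr _ _ hz

lemma iR_mem : iR P ∈ homDeg P.toGrSpace (tensor P (diagM A)).toGrSpace 0 := by
  refine ⟨⟨fun x x' y => LinearMap.ext fun p => ?_, fun x y y' => LinearMap.ext fun p => ?_⟩, ?_⟩
  · simp [iR_apply]
  · rw [iR_apply, tens_unit, smul_zero]; rfl
  · intro k m n x y p hx hy hp
    rw [iR_apply]
    by_cases h : aug x = 0
    · rw [h]; exact GrSpace.zero_smul_mem _ _
    · have hn : k = 0 := by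
        cases hx with
        | nil => rfl
        | cons => simp at h
      have hz : tens P (diagM A) p y (unitM A) ∈ (tensor P (diagM A)).gr (k + m + n + 0) :=
        tens_mem (P := diagM A) hp hy A.isAInf.unit_mem (by rw [hn]; ring)
      exact GrSpace.smul_mem_gr _ _ hz

lemma idTensor_iL (d : ℤ) (φ : homDeg (A := A) P.toGrSpace Q.toGrSpace d) :
    Cochain.comp 0 (idTensor d φ (diagM A)) (iL P) = Cochain.comp d (iL Q) φ.1 := by
  refine Cochain.ext_word fun l m p => ?_
  simp only [comp_word_spl, iL_apply, map_smul, idTensor_tens, sgnPow_zero, LinearMap.id_apply,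
    spl_smul, spl_aug_left, spl_aug_right, aug_sgnPow]

lemma tensorId_iR (d : ℤ) (φ : homDeg (A := A) P.toGrSpace Q.toGrSpace d) :
    Cochain.comp 0 (tensorId d φ (diagM A)) (iR P) = Cochain.comp d (iR Q) φ.1 := by
  refine Cochain.ext_word fun l m p => ?_
  simp only [comp_word_spl, iR_apply, map_smul, tensorId_tens, sgnPow_zero, LinearMap.id_apply,
    spl_smul, spl_aug_left, spl_aug_right, aug_sgnPow, parPow_unitM]

lemma diff_iL : diff P (tensor (diagM A) P) 0 (iL P) = 0 := by
  refine Cochain.ext_word fun l m p => ?_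
  simp only [diff_apply, LinearMap.sub_apply, LinearMap.smul_apply, LinearMap.add_apply,
    LinearMap.zero_apply, comp_word_spl, insertMu_apply, iL_apply, map_smul, op_tens, sgnPow_zero,
    LinearMap.id_apply, spl_smul, spl_add, smul_add, diagM_op_unit, mul_smul, aug_coder, zero_smul,
    sgnPow_one, AlgHom.toLinearMap_apply, aug_sgn, ksign_zero, one_smul, map_sub,
    map_smul, LinearMap.sub_apply, LinearMap.smul_apply, spl_sub, smul_sub, spl_aug_left, spl_aug_right,
    spl_smul, par_unitM]
  abel

lemma diff_iR : diff P (tensor P (diagM A)) 0 (iR P) = 0 := by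
  refine Cochain.ext_word fun l m p => ?_
  simp only [diff_apply, LinearMap.sub_apply, LinearMap.smul_apply, LinearMap.add_apply,
    LinearMap.zero_apply, comp_word_spl, insertMu_apply, iR_apply, map_smul, op_tens, sgnPow_zero,
    LinearMap.id_apply, spl_smul, spl_add, smul_add, diagM_op_unit, mul_smul, aug_coder, zero_smul,
    sgnPow_one, AlgHom.toLinearMap_apply, aug_sgn, ksign_zero, one_smul, map_sub,
    map_smul, LinearMap.sub_apply, LinearMap.smul_apply, spl_sub, smul_sub, spl_aug_left, spl_aug_right,
    spl_smul, par_unitM]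
  abel

end Units

section QuasiIso

variable {K : Type u} [Field K] {A : AInfAlgebra K} {P Q R M N : BimoduleData A}

lemma isQuasiIso_of_retraction {F : Cochain A M.toGrSpace N.toGrSpace}
    {G : Cochain A N.toGrSpace M.toGrSpace} (hF : F ∈ cocycles M N 0) (hG : G ∈ cocycles N M 0)
    (h1 : ∀ v, G 1 1 (F 1 1 v) = v) (s : N.carrier →ₗ[K] N.carrier)
    (h2 : ∀ v, N.op 1 1 (s v) + s (N.op 1 1 v) = v - F 1 1 (G 1 1 v)) :
    IsQuasiIso (P := M) (Q := N) F ∧ IsQuasiIso (P := N) (Q := M) G := by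
  refine ⟨⟨hF, fun q hq => ⟨G 1 1 q, ?_, s q, ?_⟩, ?_⟩, ⟨hG, fun q hq => ⟨F 1 1 q, ?_, 0, ?_⟩, ?_⟩⟩
  · rw [cocycle_one_one hG, hq, map_zero]
  · have := h2 q
    rw [hq, map_zero, add_zero] at this
    rw [this]; abel
  · rintro p - ⟨q', h⟩
    refine ⟨G 1 1 q', ?_⟩
    rw [cocycle_one_one hG, ← h, h1]
  · rw [cocycle_one_one hF, hq, map_zero]
  · simp [h1]
  · rintro p hp ⟨q', h⟩
    refine ⟨s p + F 1 1 q', ?_⟩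
    have := h2 p
    rw [hp, map_zero, add_zero, h, ← cocycle_one_one hF] at this
    rw [map_add, this]; abel

/-- A contracting homotopy for `A ⊗_A P → P`. -/
def homL (P : BimoduleData A) : (tensor (diagM A) P).carrier →ₗ[K] (tensor (diagM A) P).carrier :=
  tensLift (((LinearMap.mul K (Bar A.toGrSpace)).compl₁₂ (TensorAlgebra.ι K ∘ₗ toA)
    A.sgn.toLinearMap).compr₂ ((LinearMap.lcomp K _ P.par) ∘ₗ (tens (diagM A) P (unitM A))))
    (fun a x y p => by
      change tens (diagM A) P (unitM A) (TensorAlgebra.ι K (toA a) *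
        A.sgn (x * TensorAlgebra.ι K A.unit * y)) (P.par p) = 0
      rw [map_mul A.sgn, map_mul A.sgn, A.sgn_unit, mul_neg, neg_mul, mul_neg, map_neg, LinearMap.neg_apply,
        ← mul_assoc, ← mul_assoc, tens_unit, neg_zero])

lemma homL_tens (a : (diagM A).carrier) (b : Bar A.toGrSpace) (p : P.carrier) :
    homL P (tens (diagM A) P a b p) =
      tens (diagM A) P (unitM A) (TensorAlgebra.ι K (toA a) * A.sgn b) (P.par p) := rfl

/-- A contracting homotopy for `P ⊗_A A → P`. -/
def homR (P : BimoduleData A) : (tensor P (diagM A)).carrier →ₗ[K] (tensor P (diagM A)).carrier :=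
  tensLift (LinearMap.mk₂ K (fun p b => -((tens P (diagM A) p).flip (unitM A) ∘ₗ
      LinearMap.mulLeft K b ∘ₗ TensorAlgebra.ι K ∘ₗ toA))
    (fun p p' b => LinearMap.ext fun a => by
      change -tens P (diagM A) (p + p') (b * TensorAlgebra.ι K (toA a)) (unitM A) =
        -tens P (diagM A) p (b * TensorAlgebra.ι K (toA a)) (unitM A) +
          -tens P (diagM A) p' (b * TensorAlgebra.ι K (toA a)) (unitM A)
      rw [map_add, LinearMap.add_apply, LinearMap.add_apply, neg_add])
    (fun c p b => LinearMap.ext fun a => by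
      change -tens P (diagM A) (c • p) (b * TensorAlgebra.ι K (toA a)) (unitM A) =
        c • -tens P (diagM A) p (b * TensorAlgebra.ι K (toA a)) (unitM A)
      rw [map_smul, LinearMap.smul_apply, LinearMap.smul_apply, smul_neg])
    (fun p b b' => LinearMap.ext fun a => by
      change -tens P (diagM A) p ((b + b') * TensorAlgebra.ι K (toA a)) (unitM A) =
        -tens P (diagM A) p (b * TensorAlgebra.ι K (toA a)) (unitM A) +
          -tens P (diagM A) p (b' * TensorAlgebra.ι K (toA a)) (unitM A)
      rw [add_mul, map_add, LinearMap.add_apply, neg_add])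
    (fun c p b => LinearMap.ext fun a => by
      change -tens P (diagM A) p (c • b * TensorAlgebra.ι K (toA a)) (unitM A) =
        c • -tens P (diagM A) p (b * TensorAlgebra.ι K (toA a)) (unitM A)
      rw [smul_mul_assoc, map_smul, LinearMap.smul_apply, smul_neg]))
    (fun p x y a => by
      change -tens P (diagM A) p (x * TensorAlgebra.ι K A.unit * y * TensorAlgebra.ι K (toA a)) (unitM A) = 0
      rw [mul_assoc, tens_unit, neg_zero])

lemma homR_tens (p : P.carrier) (b : Bar A.toGrSpace) (a : (diagM A).carrier) :
    homR P (tens P (diagM A) p b a) =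
      -tens P (diagM A) p (b * TensorAlgebra.ι K (toA a)) (unitM A) := rfl

lemma isQuasiIso_left (hP : IsBimodule P) :
    IsQuasiIso (P := P) (Q := tensor (diagM A) P) (iL P) ∧
      IsQuasiIso (P := tensor (diagM A) P) (Q := P) (evL P) := by
  have hA := A.isAInf
  refine isQuasiIso_of_retraction ⟨iL_mem, LinearMap.mem_ker.2 diff_iL⟩ (evL_cocycle hP) (fun p => ?_) (homL P) ?_
  · simp only [iL_apply, map_one, one_smul, evL_tens, toA_unitM, mul_one]
    have := P.unit_left 1 1 1 (P.par p)
    simp only [one_mul, mul_one, map_one, one_smul, hP.graded.par_par] at this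
    rw [one_mul, this, neg_neg]
  · suffices h : (tensor (diagM A) P).op 1 1 ∘ₗ homL P + homL P ∘ₗ (tensor (diagM A) P).op 1 1 =
        LinearMap.id - iL P 1 1 ∘ₗ evL P 1 1 from fun v => congrArg (fun f => f v) h
    refine tens_ext fun a b p => ?_
    have hs : ∀ b : List A.carrier, A.sgn (word b) = word (b.map (A.letterSgn 1)) :=
      sgn_word (M := A.toGrSpace)
    have hc := coder_mid A.mu [] (b.map (A.letterSgn 1)) (toA a)
    have ho := op_tens (Q := diagM A) (P := P) 1 1 (unitM A) (toA a :: b.map (A.letterSgn 1)) (P.par p)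
    rw [word_cons, ← hs] at ho
    simp only [word_nil, one_mul, ← hs, coder_one hA.map_one, zero_mul, add_zero] at hc
    have hl : ∀ y : Bar A.toGrSpace, len1 (TensorAlgebra.ι K (toA a) * y) = aug y • toA a := fun y => by
      rw [len1_mul, aug_ι, len1_ι, zero_smul, zero_add]
    have hp : ∀ x p, P.par (P.op x 1 p) = -P.op (A.sgn x) 1 (P.par p) := fun x p => by
      have := hP.hasParity x 1 p
      simpa using this
    simp only [LinearMap.add_apply, LinearMap.sub_apply, LinearMap.comp_apply, homL_tens, ho, hc, op_tens,
      LinearMap.id_apply, spl_cons, spl_map, ← hs, hP.graded.par_par, hA.graded.sgn_sgn, spl_nil, map_one, one_mul,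
      one_smul, map_add, spl_hom, LinearMap.add_apply, spl_apply, hA.sgn_coder, map_neg, mul_neg,
      LinearMap.neg_apply, iL_apply, evL_tens, toA_op, diagM_op_unit, hl, zero_smul, sub_zero, smul_zero, aug_word_cons,
      len1_one, word_nil, map_smul, LinearMap.smul_apply, spl_aug_left, neg_mul, spl_neg, ofA_toA, word_cons, map_zero, LinearMap.zero_apply,
      aug_sgn, hp]
    abel

lemma isQuasiIso_right (hP : IsBimodule P) :
    IsQuasiIso (P := P) (Q := tensor P (diagM A)) (iR P) ∧
      IsQuasiIso (P := tensor P (diagM A)) (Q := P) (evR P) := by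
  have hA := A.isAInf
  refine isQuasiIso_of_retraction ⟨iR_mem, LinearMap.mem_ker.2 diff_iR⟩ (evR_cocycle hP) (fun p => ?_) (homR P) ?_
  · simp only [iR_apply, map_one, one_smul, evR_tens, toA_unitM, mul_one]
    have := P.unit_right 1 1 1 p
    simpa using this
  · suffices h : (tensor P (diagM A)).op 1 1 ∘ₗ homR P + homR P ∘ₗ (tensor P (diagM A)).op 1 1 =
        LinearMap.id - iR P 1 1 ∘ₗ evR P 1 1 from fun v => congrArg (fun f => f v) h
    refine tens_ext fun p b a => ?_
    have hc := coder_mid A.mu b [] (toA a)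
    have ho := op_tens (Q := P) (P := diagM A) 1 1 p (b ++ [toA a]) (unitM A)
    rw [← word_mid, spl_append_cons] at ho
    simp only [word_nil, mul_one, coder_one hA.map_one, mul_zero, zero_add] at hc ho
    have hl : ∀ y : Bar A.toGrSpace, len1 (y * TensorAlgebra.ι K (toA a)) = aug y • toA a := fun y => by
      rw [len1_mul, aug_ι, len1_ι, zero_smul, add_zero]
    simp only [LinearMap.add_apply, LinearMap.sub_apply, LinearMap.comp_apply, homR_tens, ho, hc, op_tens,
      LinearMap.id_apply, spl_nil, map_one, one_mul, mul_one,
      one_smul, map_add, spl_hom, LinearMap.add_apply, spl_apply, map_neg, mul_neg,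
      LinearMap.neg_apply, iR_apply, evR_tens, toA_op, diagM_op_unit, hl, zero_smul, zero_sub, sub_zero, smul_zero,
      len1_one, word_nil, map_smul, LinearMap.smul_apply, spl_aug_left, spl_aug_right, neg_mul, spl_neg, ofA_toA, map_zero,
      LinearMap.zero_apply, word_append, word_cons, map_mul A.sgn, sgn_ι, aug_word_append_cons, par_unitM,
      spl_append_cons, toA_par]
    abel

end QuasiIso

section Strict

variable {K : Type u} [Field K] {A : AInfAlgebra K}

/-- The family of multilinear maps whose only component is the linear map `f`. -/
def Cochain.strict {P Q : GrSpace K} (f : P →ₗ[K] Q) : Cochain A P Q :=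
  LinearMap.mk₂ K (fun x y => (aug x * aug y) • f)
    (fun x x' y => by rw [map_add, add_mul, add_smul])
    (fun c x y => by rw [map_smul, smul_mul_assoc, smul_assoc])
    (fun x y y' => by rw [map_add, mul_add, add_smul])
    (fun c x y => by rw [map_smul, mul_smul_comm, smul_assoc])

lemma strict_apply {P Q : GrSpace K} (f : P →ₗ[K] Q) (x y : Bar A.toGrSpace) (p : P) :
    Cochain.strict (A := A) f x y p = (aug x * aug y) • f p := rfl

lemma comp_strict {P Q R : GrSpace K} (φ : Cochain A Q R) (f : P →ₗ[K] Q) (x y : Bar A.toGrSpace)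
    (p : P) : Cochain.comp 0 φ (Cochain.strict f) x y p = φ x y (f p) := by
  suffices h : Cochain.comp 0 φ (Cochain.strict f) = φ.compr₂ (LinearMap.lcomp K R f) by rw [h]; rfl
  refine Cochain.ext_word fun l m p => ?_
  simp only [comp_word_spl, strict_apply, map_smul, mul_smul, sgnPow_zero, LinearMap.id_apply,
    spl_smul, spl_aug_left, spl_aug_right]
  rfl

lemma strict_comp {P Q R : GrSpace K} (d : ℤ) (φ : Cochain A P Q) (f : Q →ₗ[K] R)
    (x y : Bar A.toGrSpace) (p : P) : Cochain.comp d (Cochain.strict f) φ x y p = f (φ x y p) := by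
  suffices h : Cochain.comp d (Cochain.strict f) φ = Cochain.post f φ by rw [h]; rfl
  refine Cochain.ext_word fun l m p => ?_
  simp only [comp_word_spl, strict_apply, mul_smul, spl_smul, spl_aug_left, spl_aug_right, aug_sgnPow]
  rfl

@[simp] lemma strict_id_comp {P Q : GrSpace K} (d : ℤ) (φ : Cochain A P Q) :
    Cochain.comp d (Cochain.strict LinearMap.id) φ = φ :=
  LinearMap.ext fun x => LinearMap.ext fun y => LinearMap.ext fun p => strict_comp d φ _ x y p

@[simp] lemma comp_strict_id {P Q : GrSpace K} (φ : Cochain A P Q) :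
    Cochain.comp 0 φ (Cochain.strict LinearMap.id) = φ :=
  LinearMap.ext fun x => LinearMap.ext fun y => LinearMap.ext fun p => comp_strict φ _ x y p

lemma strict_mem {P Q : GrSpace K} {f : P →ₗ[K] Q} (hf : ∀ n, ∀ p ∈ P.gr n, f p ∈ Q.gr n) :
    Cochain.strict (A := A) f ∈ homDeg P Q 0 := by
  refine ⟨⟨fun x x' y => LinearMap.ext fun p => ?_, fun x y y' => LinearMap.ext fun p => ?_⟩, ?_⟩
  · simp [strict_apply]
  · simp [strict_apply]
  · intro k m n x y p hx hy hp
    rw [strict_apply]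
    cases hx with
    | nil =>
      cases hy with
      | nil => simpa using hf _ _ hp
      | cons => simp
    | cons => simp

variable {M N : BimoduleData A}

lemma strict_cocycle {f : M.carrier →ₗ[K] N.carrier} (hf : ∀ n, ∀ p ∈ M.gr n, f p ∈ N.gr n)
    (hop : ∀ x y v, f (M.op x y v) = N.op x y (f v)) : Cochain.strict f ∈ cocycles M N 0 := by
  refine ⟨strict_mem hf, LinearMap.mem_ker.2 ?_⟩
  refine LinearMap.ext fun x => LinearMap.ext fun y => LinearMap.ext fun p => ?_
  simp only [diff_apply, LinearMap.sub_apply, LinearMap.smul_apply, LinearMap.add_apply, comp_strict,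
    strict_comp, insertMu_apply, strict_apply, aug_coder, hop]
  simp

lemma id_cocycle (M : BimoduleData A) : Cochain.strict LinearMap.id ∈ cocycles M M 0 :=
  strict_cocycle (fun _ _ h => h) fun _ _ _ => rfl

lemma comp_one_one {P Q R : GrSpace K} (d : ℤ) (ψ : Cochain A Q R) (φ : Cochain A P Q) (p : P) :
    Cochain.comp d ψ φ 1 1 p = ψ 1 1 (φ 1 1 p) := by
  have := comp_word_spl d ψ φ [] [] p
  simpa using this

end Strict

section Homotopy

variable {K : Type u} [Field K] {A : AInfAlgebra K} {L M N : BimoduleData A}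

lemma cocycle_comp (hL : IsBimodule L) (hM : IsBimodule M) {d e f : ℤ} (hf : d + e = f)
    {ψ : Cochain A M.toGrSpace N.toGrSpace} {φ : Cochain A L.toGrSpace M.toGrSpace}
    (hψ : ψ ∈ cocycles M N e) (hφ : φ ∈ cocycles L M d) :
    Cochain.comp d ψ φ ∈ cocycles L N f := by
  subst hf
  refine ⟨comp_mem_homDeg hψ.1 hφ.1, LinearMap.mem_ker.2 ?_⟩
  rw [diff_comp d e ψ (homDeg.hasParity hL hM hφ.1), LinearMap.mem_ker.1 hψ.2, LinearMap.mem_ker.1 hφ.2]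
  simp

lemma coboundary_comp (hL : IsBimodule L) (hM : IsBimodule M) {d e f : ℤ} (hf : d + e = f)
    {ψ : Cochain A M.toGrSpace N.toGrSpace} {φ : Cochain A L.toGrSpace M.toGrSpace}
    (hψ : ψ ∈ coboundaries M N e) (hφ : φ ∈ cocycles L M d) :
    Cochain.comp d ψ φ ∈ coboundaries L N f := by
  subst hf
  obtain ⟨h, hh, rfl⟩ := hψ
  refine ⟨Cochain.comp d h φ, cast_mem_homDeg (comp_mem_homDeg hh hφ.1) (by ring), ?_⟩
  rw [show d + e - 1 = d + (e - 1) by ring, diff_comp d (e - 1) h (homDeg.hasParity hL hM hφ.1),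
    LinearMap.mem_ker.1 hφ.2]
  simp

lemma comp_coboundary (hL : IsBimodule L) (hM : IsBimodule M) {d e f : ℤ} (hf : d + e = f)
    {ψ : Cochain A M.toGrSpace N.toGrSpace} {φ : Cochain A L.toGrSpace M.toGrSpace}
    (hψ : ψ ∈ cocycles M N e) (hφ : φ ∈ coboundaries L M d) :
    Cochain.comp d ψ φ ∈ coboundaries L N f := by
  subst hf
  obtain ⟨h, hh, rfl⟩ := hφ
  have e1 := diff_comp (d - 1) e ψ (homDeg.hasParity hL hM hh)
  rw [LinearMap.mem_ker.1 hψ.2, sub_add_cancel, comp_zero_left, zero_add] at e1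
  have h1 : Cochain.comp (d - 1) ψ h ∈ homDeg L.toGrSpace N.toGrSpace (d + e - 1) :=
    cast_mem_homDeg (comp_mem_homDeg hψ.1 hh) (by ring)
  refine ⟨ksign K e • Cochain.comp (d - 1) ψ h, Submodule.smul_mem _ _ h1, ?_⟩
  rw [map_smul, show d + e - 1 = d - 1 + e by ring, e1, smul_smul, ksign_mul_self, one_smul]

lemma IsQuasiIso.comp {F : Cochain A M.toGrSpace N.toGrSpace} {G : Cochain A L.toGrSpace M.toGrSpace}
    (hL : IsBimodule L) (hM : IsBimodule M)
    (hF : IsQuasiIso (P := M) (Q := N) F) (hG : IsQuasiIso (P := L) (Q := M) G) :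
    IsQuasiIso (P := L) (Q := N) (Cochain.comp 0 F G) := by
  refine ⟨cocycle_comp hL hM (zero_add 0) hF.cocycle hG.cocycle, fun q hq => ?_, fun p hp => ?_⟩
  · obtain ⟨m, hm, q', rfl⟩ := hF.surjective q hq
    obtain ⟨l, hl, m', rfl⟩ := hG.surjective m hm
    refine ⟨l, hl, F 1 1 m' + q', ?_⟩
    rw [comp_one_one, map_add, map_add, cocycle_one_one hF.cocycle, add_assoc]
  · rintro ⟨q', h⟩
    rw [comp_one_one] at h
    exact hG.injective p hp (hF.injective _ (by rw [cocycle_one_one hG.cocycle, hp, map_zero]) ⟨q', h⟩)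

lemma isQuasiIso_of_homotopyInverse {F : Cochain A M.toGrSpace N.toGrSpace}
    {G : Cochain A N.toGrSpace M.toGrSpace} (hF : F ∈ cocycles M N 0) (hG : G ∈ cocycles N M 0)
    (h1 : Cochain.comp 0 F G - Cochain.strict LinearMap.id ∈ coboundaries N N 0)
    (h2 : Cochain.comp 0 G F - Cochain.strict LinearMap.id ∈ coboundaries M M 0) :
    IsQuasiIso (P := M) (Q := N) F := by
  have key : ∀ {L : BimoduleData A} {φ : Cochain A L.toGrSpace L.toGrSpace},
      φ - Cochain.strict LinearMap.id ∈ coboundaries L L 0 → ∀ v, L.op 1 1 v = 0 →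
      ∃ w, φ 1 1 v = v + L.op 1 1 w := by
    rintro L φ ⟨h, -, hh⟩ v hv
    refine ⟨h 1 1 v, ?_⟩
    have e := congrArg (fun f : Cochain A L.toGrSpace L.toGrSpace => f 1 1 v) hh
    simp only [diff_apply, LinearMap.sub_apply, LinearMap.smul_apply, LinearMap.add_apply, comp_one_one,
      insertMu_apply, coder_one A.isAInf.map_one, hv, map_zero, LinearMap.zero_apply, strict_apply, map_one,
      one_mul, one_smul, LinearMap.id_apply, add_zero, smul_zero, sub_zero] at e
    rw [e]; abel
  refine ⟨hF, fun q hq => ⟨G 1 1 q, by rw [cocycle_one_one hG, hq, map_zero], ?_⟩, ?_⟩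
  · obtain ⟨w, hw⟩ := key h1 q hq
    rw [comp_one_one] at hw
    exact ⟨-w, by rw [hw, map_neg]; abel⟩
  · rintro p hp ⟨q', h⟩
    obtain ⟨w, hw⟩ := key h2 p hp
    rw [comp_one_one, h, ← cocycle_one_one hG] at hw
    exact ⟨G 1 1 q' - w, by rw [map_sub, hw]; abel⟩

lemma isQuasiIso_strict (e : M.carrier ≃ₗ[K] N.carrier) (h : Cochain.strict e.toLinearMap ∈ cocycles M N 0) :
    IsQuasiIso (P := M) (Q := N) (Cochain.strict e.toLinearMap) := by
  have h1 : ∀ v, Cochain.strict (A := A) (P := M.toGrSpace) (Q := N.toGrSpace) e.toLinearMap 1 1 v = e v := fun v => by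
    simp [strict_apply]
  have h2 := fun v => cocycle_one_one h v
  simp only [h1] at h2
  refine ⟨h, fun q hq => ⟨e.symm q, e.injective ?_, 0, ?_⟩, ?_⟩
  · rw [← h2, e.apply_symm_apply, hq, map_zero]
  · simp [h1]
  · rintro p hp ⟨q', h⟩
    refine ⟨e.symm q', e.injective ?_⟩
    rw [← h2, e.apply_symm_apply, ← h, h1]

/-- A quasi-isomorphism has a homotopy inverse. -/
lemma IsQuasiIso.exists_homotopyInverse (hM : IsBimodule M) (hN : IsBimodule N)
    {F : Cochain A M.toGrSpace N.toGrSpace} (hF : IsQuasiIso (P := M) (Q := N) F) :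
    ∃ G ∈ cocycles N M 0, Cochain.comp 0 F G - Cochain.strict LinearMap.id ∈ coboundaries N N 0 ∧
      Cochain.comp 0 G F - Cochain.strict LinearMap.id ∈ coboundaries M M 0 := by
  obtain ⟨G, hG, h, hh, e⟩ := hF.comp_surjective hM hN hN (id_cocycle N)
  have h1 : Cochain.comp 0 F G - Cochain.strict LinearMap.id ∈ coboundaries N N 0 := ⟨h, hh, e⟩
  refine ⟨G, hG, h1, ?_⟩
  have hGF : Cochain.comp 0 G F - Cochain.strict LinearMap.id ∈ cocycles M M 0 :=
    sub_mem (cocycle_comp hM hN (zero_add 0) hG hF.cocycle) (id_cocycle M)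
  have h2 : Cochain.comp 0 F (Cochain.comp 0 G F - Cochain.strict LinearMap.id) ∈ coboundaries M N 0 := by
    have h3 := coboundary_comp hM hN (zero_add 0) h1 hF.cocycle
    have h4 := comp_assoc 0 0 F G F
    rw [show (0 : ℤ) + 0 = 0 from rfl] at h4
    rw [comp_sub_left, strict_id_comp, h4] at h3
    rw [comp_sub_right, comp_strict_id]
    exact h3
  obtain ⟨k, hk, e⟩ := hF.comp_injective hM hN hM hGF h2
  exact ⟨k, hk, e⟩

end Homotopy

section Associator

variable {K : Type u} [Field K] {A : AInfAlgebra K} {P Q R R' Q' : BimoduleData A}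

/-- `q ⊗ b ⊗ (p ⊗ c ⊗ r) ↦ (q ⊗ b ⊗ p) ⊗ c ⊗ r` for fixed `q` and `b`. -/
def ascAux (Q P R : BimoduleData A) (q : Q.carrier) (b : Bar A.toGrSpace) :
    (tensor P R).carrier →ₗ[K] (tensor (tensor Q P) R).carrier :=
  tensLift ((tens (tensor Q P) R) ∘ₗ tens Q P q b) fun p x y r =>
    tens_unit (Q := tensor Q P) (tens Q P q b p) x y r

lemma ascAux_tens (q : Q.carrier) (b : Bar A.toGrSpace) (p : P.carrier) (c : Bar A.toGrSpace)
    (r : R.carrier) : ascAux Q P R q b (tens P R p c r) =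
      tens (tensor Q P) R (tens Q P q b p) c r := rfl

/-- The associator `Q ⊗ (P ⊗ R) → (Q ⊗ P) ⊗ R`. -/
def asc (Q P R : BimoduleData A) :
    (tensor Q (tensor P R)).carrier →ₗ[K] (tensor (tensor Q P) R).carrier :=
  tensLift (LinearMap.mk₂ K (ascAux Q P R)
    (fun q q' b => tens_ext fun p c r => by simp only [ascAux_tens, map_add, LinearMap.add_apply])
    (fun k q b => tens_ext fun p c r => by simp only [ascAux_tens, map_smul, LinearMap.smul_apply])
    (fun q b b' => tens_ext fun p c r => by simp only [ascAux_tens, map_add, LinearMap.add_apply])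
    (fun k q b => tens_ext fun p c r => by simp only [ascAux_tens, map_smul, LinearMap.smul_apply]))
    (fun q x y t => by
      refine LinearMap.congr_fun (f := ascAux Q P R q (x * TensorAlgebra.ι K A.unit * y)) (g := 0)
        (tens_ext fun p c r => ?_) t
      rw [ascAux_tens, tens_unit, map_zero]; rfl)

lemma asc_tens (q : Q.carrier) (b : Bar A.toGrSpace) (p : P.carrier) (c : Bar A.toGrSpace)
    (r : R.carrier) : asc Q P R (tens Q (tensor P R) q b (tens P R p c r)) =
      tens (tensor Q P) R (tens Q P q b p) c r := rfl

/-- `(q ⊗ b ⊗ p) ⊗ c ⊗ r ↦ q ⊗ b ⊗ (p ⊗ c ⊗ r)` for fixed `c` and `r`. -/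
def ascInvAux (Q P R : BimoduleData A) (c : Bar A.toGrSpace) (r : R.carrier) :
    (tensor Q P).carrier →ₗ[K] (tensor Q (tensor P R)).carrier :=
  tensLift ((tens Q (tensor P R)).compr₂ (LinearMap.lcomp K _ (((tens P R).flip c).flip r)))
    fun q x y p => tens_unit (P := tensor P R) q x y (tens P R p c r)

lemma ascInvAux_tens (q : Q.carrier) (b : Bar A.toGrSpace) (p : P.carrier) (c : Bar A.toGrSpace)
    (r : R.carrier) : ascInvAux Q P R c r (tens Q P q b p) =
      tens Q (tensor P R) q b (tens P R p c r) := rfl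

/-- The inverse associator `(Q ⊗ P) ⊗ R → Q ⊗ (P ⊗ R)`. -/
def ascInv (Q P R : BimoduleData A) :
    (tensor (tensor Q P) R).carrier →ₗ[K] (tensor Q (tensor P R)).carrier :=
  tensLift (LinearMap.flip (LinearMap.mk₂ K (fun c z => LinearMap.flip (LinearMap.mk₂ K
      (fun r z => ascInvAux Q P R c r z)
      (fun r r' z => by
        refine LinearMap.congr_fun (f := ascInvAux Q P R c (r + r'))
          (g := ascInvAux Q P R c r + ascInvAux Q P R c r') (tens_ext fun q b p => ?_) z
        simp only [ascInvAux_tens, map_add, LinearMap.add_apply])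
      (fun k r z => by
        refine LinearMap.congr_fun (f := ascInvAux Q P R c (k • r))
          (g := k • ascInvAux Q P R c r) (tens_ext fun q b p => ?_) z
        simp only [ascInvAux_tens, map_smul, LinearMap.smul_apply])
      (fun r z z' => map_add _ _ _) (fun k r z => map_smul _ _ _)) z)
    (fun c c' z => LinearMap.ext fun r => by
      refine LinearMap.congr_fun (f := ascInvAux Q P R (c + c') r)
        (g := ascInvAux Q P R c r + ascInvAux Q P R c' r) (tens_ext fun q b p => ?_) z
      simp only [ascInvAux_tens, map_add, LinearMap.add_apply])
    (fun k c z => LinearMap.ext fun r => by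
      refine LinearMap.congr_fun (f := ascInvAux Q P R (k • c) r)
        (g := k • ascInvAux Q P R c r) (tens_ext fun q b p => ?_) z
      simp only [ascInvAux_tens, map_smul, LinearMap.smul_apply])
    (fun c z z' => LinearMap.ext fun r => map_add (ascInvAux Q P R c r) _ _)
    (fun k c z => LinearMap.ext fun r => map_smul (ascInvAux Q P R c r) _ _)))
    (fun z x y r => by
      refine LinearMap.congr_fun (f := ascInvAux Q P R (x * TensorAlgebra.ι K A.unit * y) r) (g := 0)
        (tens_ext fun q b p => ?_) z
      rw [ascInvAux_tens, tens_unit, map_zero]; rfl)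

lemma ascInv_tens (q : Q.carrier) (b : Bar A.toGrSpace) (p : P.carrier) (c : Bar A.toGrSpace)
    (r : R.carrier) : ascInv Q P R (tens (tensor Q P) R (tens Q P q b p) c r) =
      tens Q (tensor P R) q b (tens P R p c r) := rfl

lemma tens_tens_ext_right {W : Type u} [AddCommGroup W] [Module K W]
    {f g : (tensor Q (tensor P R)).carrier →ₗ[K] W}
    (h : ∀ q b p c r, f (tens Q (tensor P R) q (word b) (tens P R p (word c) r)) =
      g (tens Q (tensor P R) q (word b) (tens P R p (word c) r))) : f = g :=
  tens_ext fun q b t => LinearMap.congr_fun (f := f ∘ₗ tens Q (tensor P R) q (word b))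
    (g := g ∘ₗ tens Q (tensor P R) q (word b)) (tens_ext fun p c r => h q b p c r) t

lemma tens_tens_ext_left {W : Type u} [AddCommGroup W] [Module K W]
    {f g : (tensor (tensor Q P) R).carrier →ₗ[K] W}
    (h : ∀ q b p c r, f (tens (tensor Q P) R (tens Q P q (word b) p) (word c) r) =
      g (tens (tensor Q P) R (tens Q P q (word b) p) (word c) r)) : f = g :=
  tens_ext fun t c r => LinearMap.congr_fun (f := f ∘ₗ ((tens (tensor Q P) R).flip (word c)).flip r)
    (g := g ∘ₗ ((tens (tensor Q P) R).flip (word c)).flip r) (tens_ext fun q b p => h q b p c r) t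

/-- The associator as an isomorphism. -/
def ascEquiv (Q P R : BimoduleData A) :
    (tensor Q (tensor P R)).carrier ≃ₗ[K] (tensor (tensor Q P) R).carrier :=
  LinearEquiv.ofLinearMap (asc Q P R) (ascInv Q P R) (tens_tens_ext_left fun _ _ _ _ _ => rfl)
    (tens_tens_ext_right fun _ _ _ _ _ => rfl)

lemma asc_op (x y : Bar A.toGrSpace) (v : (tensor Q (tensor P R)).carrier) :
    asc Q P R ((tensor Q (tensor P R)).op x y v) = (tensor (tensor Q P) R).op x y (asc Q P R v) := by
  refine LinearMap.congr_fun (f := asc Q P R ∘ₗ (tensor Q (tensor P R)).op x y)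
    (g := (tensor (tensor Q P) R).op x y ∘ₗ asc Q P R) (tens_tens_ext_right fun q b p c r => ?_) v
  simp only [LinearMap.comp_apply, asc_tens, op_tens, tens_par, map_add, map_smul, spl_hom, LinearMap.add_apply,
    LinearMap.smul_apply, spl_apply, spl_smul, mul_smul, spl_aug_left, spl_aug_right, smul_add, spl_add]
  rw [spl_comm b c]
  module

lemma asc_mem {n : ℤ} {v : (tensor Q (tensor P R)).carrier} (hv : v ∈ (tensor Q (tensor P R)).gr n) :
    asc Q P R v ∈ (tensor (tensor Q P) R).gr n := by
  induction hv using Submodule.span_induction with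
  | mem z hz =>
    obtain ⟨i, j, k, q, b, t, hq, hb, ht, rfl, rfl⟩ := hz
    change ascAux Q P R q b t ∈ _
    induction ht using Submodule.span_induction with
    | mem z hz =>
      obtain ⟨i', j', k', p, c, r, hp, hc, hr, rfl, rfl⟩ := hz
      exact tens_mem (tens_mem hq hb hp rfl) hc hr (by ring)
    | zero => exact zero_mem _
    | add v w _ _ h1 h2 => rw [map_add]; exact add_mem h1 h2
    | smul c v _ h => rw [map_smul]; exact GrSpace.smul_mem_gr _ _ h
  | zero => exact zero_mem _
  | add v w _ _ h1 h2 => rw [map_add]; exact add_mem h1 h2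
  | smul c v _ h => rw [map_smul]; exact GrSpace.smul_mem_gr _ _ h

lemma ascInv_mem {n : ℤ} {v : (tensor (tensor Q P) R).carrier} (hv : v ∈ (tensor (tensor Q P) R).gr n) :
    ascInv Q P R v ∈ (tensor Q (tensor P R)).gr n := by
  induction hv using Submodule.span_induction with
  | mem z hz =>
    obtain ⟨i, j, k, t, c, r, ht, hc, hr, rfl, rfl⟩ := hz
    change ascInvAux Q P R c r t ∈ _
    induction ht using Submodule.span_induction with
    | mem z hz =>
      obtain ⟨i', j', k', q, b, p, hq, hb, hp, rfl, rfl⟩ := hz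
      exact tens_mem hq hb (tens_mem hp hc hr rfl) (by ring)
    | zero => exact zero_mem _
    | add v w _ _ h1 h2 => rw [map_add]; exact add_mem h1 h2
    | smul c v _ h => rw [map_smul]; exact GrSpace.smul_mem_gr _ _ h
  | zero => exact zero_mem _
  | add v w _ _ h1 h2 => rw [map_add]; exact add_mem h1 h2
  | smul c v _ h => rw [map_smul]; exact GrSpace.smul_mem_gr _ _ h

lemma isQuasiIso_asc : IsQuasiIso (P := tensor Q (tensor P R)) (Q := tensor (tensor Q P) R)
    (Cochain.strict (asc Q P R)) :=
  isQuasiIso_strict (ascEquiv Q P R) (strict_cocycle (fun _ _ => asc_mem) asc_op)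

lemma isQuasiIso_ascInv : IsQuasiIso (P := tensor (tensor Q P) R) (Q := tensor Q (tensor P R))
    (Cochain.strict (ascInv Q P R)) := by
  refine isQuasiIso_strict (ascEquiv Q P R).symm (strict_cocycle (fun _ _ => ascInv_mem) fun x y v => ?_)
  refine (ascEquiv Q P R).injective ?_
  rw [LinearEquiv.coe_coe, LinearEquiv.apply_symm_apply]
  refine Eq.trans ?_ (asc_op x y _).symm
  congr 1
  exact ((ascEquiv Q P R).apply_symm_apply v).symm

end Associator

section FullyFaithful

variable {K : Type u} [Field K] {A : AInfAlgebra K}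

/-- A functor on the differential graded category of bimodules. -/
structure HomFunctor (A : AInfAlgebra K) where
  obj : BimoduleData A → BimoduleData A
  isBimodule : ∀ {M}, IsBimodule M → IsBimodule (obj M)
  map : ∀ {M N : BimoduleData A} (d : ℤ), homDeg (A := A) M.toGrSpace N.toGrSpace d →ₗ[K]
    homDeg (A := A) (obj M).toGrSpace (obj N).toGrSpace d
  diff_map : ∀ {M N : BimoduleData A}, IsBimodule M → IsBimodule N → ∀ (d : ℤ)
    (φ : homDeg (A := A) M.toGrSpace N.toGrSpace d)
    (ψ : homDeg (A := A) M.toGrSpace N.toGrSpace (d + 1)), ψ.1 = diff M N d φ.1 →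
      diff (obj M) (obj N) d (map d φ).1 = (map (d + 1) ψ).1
  map_id : ∀ M, (map 0 ⟨Cochain.strict LinearMap.id, (id_cocycle M).1⟩).1 = Cochain.strict LinearMap.id
  map_comp : ∀ {L M N : BimoduleData A} (φ : homDeg (A := A) L.toGrSpace M.toGrSpace 0)
    (ψ : homDeg (A := A) M.toGrSpace N.toGrSpace 0) (χ : homDeg (A := A) L.toGrSpace N.toGrSpace 0),
    χ.1 = Cochain.comp 0 ψ.1 φ.1 → Cochain.comp 0 (map 0 ψ).1 (map 0 φ).1 = (map 0 χ).1

variable {M N : BimoduleData A} (F G : HomFunctor A)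

lemma HomFunctor.map_cocycle (hM : IsBimodule M) (hN : IsBimodule N) {d : ℤ}
    (φ : homDeg (A := A) M.toGrSpace N.toGrSpace d) (h : φ.1 ∈ cocycles M N d) :
    (F.map d φ).1 ∈ cocycles (F.obj M) (F.obj N) d := by
  refine ⟨(F.map d φ).2, LinearMap.mem_ker.2 ?_⟩
  rw [F.diff_map hM hN d φ 0 (LinearMap.mem_ker.1 h.2).symm, map_zero]
  rfl

lemma HomFunctor.map_coboundary (hM : IsBimodule M) (hN : IsBimodule N) {d : ℤ}
    (φ : homDeg (A := A) M.toGrSpace N.toGrSpace d) (h : φ.1 ∈ coboundaries M N d) :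
    (F.map d φ).1 ∈ coboundaries (F.obj M) (F.obj N) d := by
  obtain ⟨ψ, hψ, e⟩ := h
  obtain ⟨e', he⟩ : ∃ e' : ℤ, d = e' + 1 := ⟨d - 1, by ring⟩
  subst he
  rw [add_sub_cancel_right] at hψ e
  refine ⟨(F.map e' ⟨ψ, hψ⟩).1, by rw [add_sub_cancel_right]; exact (F.map e' ⟨ψ, hψ⟩).2, ?_⟩
  rw [add_sub_cancel_right]
  exact F.diff_map hM hN e' ⟨ψ, hψ⟩ φ e.symm

lemma HomFunctor.homotopyInverse_map (hM : IsBimodule M)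
    (f : homDeg (A := A) M.toGrSpace N.toGrSpace 0) (g : homDeg (A := A) N.toGrSpace M.toGrSpace 0)
    (h : Cochain.comp 0 g.1 f.1 - Cochain.strict LinearMap.id ∈ coboundaries M M 0) :
    Cochain.comp 0 (F.map 0 g).1 (F.map 0 f).1 - Cochain.strict LinearMap.id ∈
      coboundaries (F.obj M) (F.obj M) 0 := by
  have hgf : Cochain.comp 0 g.1 f.1 ∈ homDeg M.toGrSpace M.toGrSpace 0 :=
    cast_mem_homDeg (comp_mem_homDeg g.2 f.2) (zero_add 0)
  let a : homDeg (A := A) M.toGrSpace M.toGrSpace 0 := ⟨Cochain.comp 0 g.1 f.1, hgf⟩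
  let b : homDeg (A := A) M.toGrSpace M.toGrSpace 0 :=
    ⟨Cochain.strict LinearMap.id, (id_cocycle M).1⟩
  have h1 : Cochain.comp 0 (F.map 0 g).1 (F.map 0 f).1 = (F.map 0 a).1 := F.map_comp f g a rfl
  have h2 : (F.map 0 b).1 = Cochain.strict LinearMap.id := F.map_id M
  have h3 : (a - b).1 ∈ coboundaries M M 0 := h
  have h4 := F.map_coboundary hM hM (a - b) h3
  have h5 : (F.map 0 (a - b)).1 = (F.map 0 a).1 - (F.map 0 b).1 := by rw [map_sub]; rfl
  rw [h1, ← h2, ← h5]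
  exact h4

lemma HomFunctor.isQuasiIso_map (hM : IsBimodule M) (hN : IsBimodule N)
    (f : homDeg (A := A) M.toGrSpace N.toGrSpace 0) (hf : IsQuasiIso (P := M) (Q := N) f.1) :
    IsQuasiIso (P := F.obj M) (Q := F.obj N) (F.map 0 f).1 := by
  obtain ⟨g, hg, h1, h2⟩ := hf.exists_homotopyInverse hM hN
  exact isQuasiIso_of_homotopyInverse (F.map_cocycle hM hN f hf.cocycle)
    (F.map_cocycle hN hM ⟨g, hg.1⟩ hg) (F.homotopyInverse_map hN ⟨g, hg.1⟩ f h1)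
    (F.homotopyInverse_map hM f ⟨g, hg.1⟩ h2)

/-- A natural quasi-isomorphism from the identity to `G F`. -/
structure NatQuasiIso where
  app : ∀ M : BimoduleData A, Cochain A M.toGrSpace (G.obj (F.obj M)).toGrSpace
  isQuasiIso : ∀ {M}, IsBimodule M → IsQuasiIso (P := M) (Q := G.obj (F.obj M)) (app M)
  natural : ∀ {M N : BimoduleData A}, IsBimodule M → IsBimodule N → ∀ (d : ℤ) (φ : homDeg (A := A) M.toGrSpace N.toGrSpace d),
    Cochain.comp d (app N) φ.1 = Cochain.comp 0 (G.map d (F.map d φ)).1 (app M)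

variable {F G}

lemma NatQuasiIso.faithful (u : NatQuasiIso F G) (hM : IsBimodule M) (hN : IsBimodule N) {d : ℤ}
    (φ : homDeg (A := A) M.toGrSpace N.toGrSpace d) (h : φ.1 ∈ cocycles M N d)
    (h' : (F.map d φ).1 ∈ coboundaries (F.obj M) (F.obj N) d) : φ.1 ∈ coboundaries M N d := by
  have h1 := G.map_coboundary (F.isBimodule hM) (F.isBimodule hN) (F.map d φ) h'
  have h2 := coboundary_comp hM (G.isBimodule (F.isBimodule hM)) (zero_add d) h1 (u.isQuasiIso hM).cocycle
  rw [← u.natural hM hN] at h2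
  exact (u.isQuasiIso hN).comp_injective hN (G.isBimodule (F.isBimodule hN)) hM h h2

lemma NatQuasiIso.full (u : NatQuasiIso F G) (v : NatQuasiIso G F) (hM : IsBimodule M)
    (hN : IsBimodule N) {d : ℤ} (ψ : homDeg (A := A) (F.obj M).toGrSpace (F.obj N).toGrSpace d)
    (h : ψ.1 ∈ cocycles (F.obj M) (F.obj N) d) :
    ∃ φ : homDeg (A := A) M.toGrSpace N.toGrSpace d, φ.1 ∈ cocycles M N d ∧
      (F.map d φ).1 - ψ.1 ∈ coboundaries (F.obj M) (F.obj N) d := by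
  have hFM := F.isBimodule hM
  have hFN := F.isBimodule hN
  have hGM := G.isBimodule hFM
  have hGN := G.isBimodule hFN
  have hG := G.map_cocycle hFM hFN ψ h
  obtain ⟨φ, hφ, k, hk, e⟩ := (u.isQuasiIso hN).comp_surjective hN hGN hM
    (cocycle_comp hM hGM (zero_add d) hG (u.isQuasiIso hM).cocycle)
  refine ⟨⟨φ, hφ.1⟩, hφ, ?_⟩
  have hFφ := F.map_cocycle hM hN ⟨φ, hφ.1⟩ hφ
  refine v.faithful hFM hFN (F.map d ⟨φ, hφ.1⟩ - ψ) (sub_mem hFφ h) ?_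
  obtain ⟨w, hw, h1, -⟩ := (u.isQuasiIso hM).exists_homotopyInverse hM hGM
  have h2 : Cochain.comp 0 (G.map d (F.map d ⟨φ, hφ.1⟩ - ψ)).1 (u.app M) ∈
      coboundaries M (G.obj (F.obj N)) d := by
    rw [map_sub, AddSubgroupClass.coe_sub, comp_sub_left, ← u.natural hM hN]
    exact ⟨k, hk, e⟩
  have h3 := coboundary_comp hGM hM (zero_add d) h2 hw
  have hχ : (G.map d (F.map d ⟨φ, hφ.1⟩ - ψ)).1 ∈ cocycles _ _ d :=
    G.map_cocycle hFM hFN _ (sub_mem hFφ h)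
  have h4 := comp_coboundary hGM hGM (zero_add d) hχ h1
  rw [comp_sub_right, comp_strict_id] at h4
  have h5 := comp_assoc 0 0 (G.map d (F.map d ⟨φ, hφ.1⟩ - ψ)).1 (u.app M) w
  rw [show (0 : ℤ) + 0 = 0 from rfl] at h5
  rw [h5] at h3
  have := sub_mem h3 h4
  rwa [sub_sub_cancel] at this

end FullyFaithful

section TensorFunctors

variable {K : Type u} [Field K] {A : AInfAlgebra K} {P Q R M N : BimoduleData A}

lemma idTensor_add (d : ℤ) (φ ψ : homDeg (A := A) M.toGrSpace N.toGrSpace d) :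
    idTensor d (φ + ψ) P = idTensor d φ P + idTensor d ψ P := tens_cochain_ext fun l m q b p => by
  simp only [LinearMap.add_apply, idTensor_tens, ← smul_add, ← spl_add, ← map_add]; rfl

lemma idTensor_smul (d : ℤ) (c : K) (φ : homDeg (A := A) M.toGrSpace N.toGrSpace d) :
    idTensor d (c • φ) P = c • idTensor d φ P := tens_cochain_ext fun l m q b p => by
  have e : (c • φ).1 = c • φ.1 := rfl
  simp only [LinearMap.smul_apply, idTensor_tens, e, map_smul, spl_smul]
  rw [smul_comm]

lemma tensorId_add (d : ℤ) (φ ψ : homDeg (A := A) M.toGrSpace N.toGrSpace d) :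
    tensorId d (φ + ψ) P = tensorId d φ P + tensorId d ψ P := tens_cochain_ext fun l m q b p => by
  simp only [LinearMap.add_apply, tensorId_tens, ← smul_add, ← spl_add]
  simp only [← LinearMap.add_apply, ← map_add]; rfl

lemma tensorId_smul (d : ℤ) (c : K) (φ : homDeg (A := A) M.toGrSpace N.toGrSpace d) :
    tensorId d (c • φ) P = c • tensorId d φ P := tens_cochain_ext fun l m q b p => by
  have e : (c • φ).1 = c • φ.1 := rfl
  simp only [LinearMap.smul_apply, tensorId_tens, e, map_smul, spl_smul]
  rw [smul_comm]

lemma tens_parPow (d : ℤ) (q : Q.carrier) (b : Bar A.toGrSpace) (p : P.carrier) :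
    (tensor Q P).parPow d (tens Q P q b p) =
      tens Q P (Q.parPow d q) (A.sgnPow d b) (P.parPow d p) := by
  unfold GrSpace.parPow GrSpace.sgnPow
  split_ifs
  · rfl
  · exact tens_par q b p

lemma ascInv_idTensor (d : ℤ) (φ : homDeg (A := A) M.toGrSpace N.toGrSpace d) :
    Cochain.comp d (Cochain.strict (ascInv Q P N)) (idTensor d φ (tensor Q P)) =
      Cochain.comp 0 (idTensor d ⟨idTensor d φ P, idTensor_mem φ⟩ Q)
        (Cochain.strict (ascInv Q P M)) := by
  refine LinearMap.ext fun x => LinearMap.ext fun y => tens_tens_ext_left fun q b p c r => ?_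
  rw [strict_comp, comp_strict, ascInv_tens, idTensor_tens, idTensor_tens]
  simp only [idTensor_tens, map_smul, spl_hom, ascInv_tens, spl_aug_right]

lemma asc_tensorId (d : ℤ) (hP : P.IsGraded) (φ : homDeg (A := A) M.toGrSpace N.toGrSpace d) :
    Cochain.comp d (Cochain.strict (asc N P R)) (tensorId d φ (tensor P R)) =
      Cochain.comp 0 (tensorId d ⟨tensorId d φ P, tensorId_mem hP φ⟩ R)
        (Cochain.strict (asc M P R)) := by
  refine LinearMap.ext fun x => LinearMap.ext fun y => tens_tens_ext_right fun q b p c r => ?_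
  rw [strict_comp, comp_strict, asc_tens, tensorId_tens, tensorId_tens]
  simp only [tensorId_tens, map_smul, spl_hom, asc_tens, tens_parPow, spl_apply, LinearMap.smul_apply,
    spl_aug_left]

lemma tensorId_id : tensorId 0 ⟨Cochain.strict LinearMap.id, (id_cocycle M).1⟩ P =
    Cochain.strict LinearMap.id := tens_cochain_ext fun l m q b p => by
  rw [tensorId_tens]
  simp only [strict_apply, map_smul, LinearMap.smul_apply, mul_smul, spl_smul, spl_aug_left, sgnPow_zero,
    parPow_zero, LinearMap.id_apply]
  rw [smul_comm]

lemma idTensor_id : idTensor 0 ⟨Cochain.strict LinearMap.id, (id_cocycle M).1⟩ P =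
    Cochain.strict LinearMap.id := tens_cochain_ext fun l m q b p => by
  rw [idTensor_tens]
  simp only [strict_apply, map_smul, LinearMap.smul_apply, mul_smul, spl_smul, spl_aug_right,
    LinearMap.id_apply]

variable [CharZero K]

/-- The functor `P ⊗_A -`. -/
def tensorLeft (hP : IsBimodule P) : HomFunctor A where
  obj := tensor P
  isBimodule hM := IsBimodule.tensor hP hM
  map d :=
    { toFun φ := ⟨idTensor d φ P, idTensor_mem φ⟩
      map_add' φ ψ := Subtype.ext (idTensor_add d φ ψ)
      map_smul' c φ := Subtype.ext (idTensor_smul d c φ) }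
  diff_map hM hN d φ ψ h := diff_idTensor d φ (homDeg.hasParity hM hN φ.2) ψ h
  map_id _ := idTensor_id
  map_comp φ ψ χ h := comp_idTensor φ ψ χ h

/-- The functor `- ⊗_A P`. -/
def tensorRight (hP : IsBimodule P) : HomFunctor A where
  obj M := tensor M P
  isBimodule hM := IsBimodule.tensor hM hP
  map d :=
    { toFun φ := ⟨tensorId d φ P, tensorId_mem hP.graded φ⟩
      map_add' φ ψ := Subtype.ext (tensorId_add d φ ψ)
      map_smul' c φ := Subtype.ext (tensorId_smul d c φ) }
  diff_map _ _ d φ ψ h := diff_tensorId hP d φ ψ h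
  map_id _ := tensorId_id
  map_comp φ ψ χ h := comp_tensorId hP.graded (zero_add 0) φ ψ χ h

/-- A map `A → Q ⊗ P` that is a quasi-isomorphism makes `Q ⊗ -` a left inverse of `P ⊗ -`. -/
def natLeft (hP : IsBimodule P) (hQ : IsBimodule Q) (hA : IsBimodule (diagM A))
    {g : Cochain A (diagM A).toGrSpace (tensor Q P).toGrSpace}
    (hg : IsQuasiIso (P := diagM A) (Q := tensor Q P) g) :
    NatQuasiIso (tensorLeft hP) (tensorLeft hQ) where
  app M := Cochain.comp 0 (Cochain.strict (ascInv Q P M))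
    (Cochain.comp 0 (tensorId 0 ⟨g, hg.cocycle.1⟩ M) (iL M))
  isQuasiIso {M} hM := by
    have h1 := IsBimodule.tensor hA hM
    have h2 := IsBimodule.tensor (IsBimodule.tensor hQ hP) hM
    exact IsQuasiIso.comp hM h2 isQuasiIso_ascInv (IsQuasiIso.comp hM h1
      ((tensorRight hM).isQuasiIso_map hA (IsBimodule.tensor hQ hP) ⟨g, hg.cocycle.1⟩ hg) (isQuasiIso_left hM).1)
  natural {M N} hM hN d φ := by
    have hφ := homDeg.hasParity hM hN φ.2
    have e1 := comp_assoc d 0 (Cochain.strict (ascInv Q P N))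
      (Cochain.comp 0 (tensorId 0 ⟨g, hg.cocycle.1⟩ N) (iL N)) φ.1
    have e2 := comp_assoc d 0 (tensorId 0 ⟨g, hg.cocycle.1⟩ N) (iL N) φ.1
    have e3 := idTensor_iL d φ
    have e4 := comp_assoc 0 d (tensorId 0 ⟨g, hg.cocycle.1⟩ N) (idTensor d φ (diagM A)) (iL M)
    have e5 := tensorId_idTensor (Q := diagM A) (Q' := tensor Q P) ⟨g, hg.cocycle.1⟩ φ hφ
    have e6 := comp_assoc 0 0 (idTensor d φ (tensor Q P)) (tensorId 0 ⟨g, hg.cocycle.1⟩ M) (iL M)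
    have e7 := comp_assoc 0 d (Cochain.strict (ascInv Q P N)) (idTensor d φ (tensor Q P))
      (Cochain.comp 0 (tensorId 0 ⟨g, hg.cocycle.1⟩ M) (iL M))
    have e8 := comp_assoc 0 0 (idTensor d ⟨idTensor d φ P, idTensor_mem φ⟩ Q)
      (Cochain.strict (ascInv Q P M)) (Cochain.comp 0 (tensorId 0 ⟨g, hg.cocycle.1⟩ M) (iL M))
    have e9 := ascInv_idTensor (Q := Q) (P := P) d φ
    rw [zero_mul, ksign_zero, one_smul] at e5
    rw [add_zero] at e1 e2 e6 e8
    rw [zero_add] at e4 e7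
    exact e1.trans (by rw [e2, ← e3, ← e4, e5, e6, ← e7, e9, e8]; rfl)

/-- A map `A → P ⊗ Q` that is a quasi-isomorphism makes `- ⊗ Q` a left inverse of `- ⊗ P`. -/
def natRight (hP : IsBimodule P) (hQ : IsBimodule Q) (hA : IsBimodule (diagM A))
    {g : Cochain A (diagM A).toGrSpace (tensor P Q).toGrSpace}
    (hg : IsQuasiIso (P := diagM A) (Q := tensor P Q) g) :
    NatQuasiIso (tensorRight hP) (tensorRight hQ) where
  app M := Cochain.comp 0 (Cochain.strict (asc M P Q))
    (Cochain.comp 0 (idTensor 0 ⟨g, hg.cocycle.1⟩ M) (iR M))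
  isQuasiIso {M} hM := by
    have h1 := IsBimodule.tensor hM hA
    have h2 := IsBimodule.tensor hM (IsBimodule.tensor hP hQ)
    exact IsQuasiIso.comp hM h2 isQuasiIso_asc (IsQuasiIso.comp hM h1
      ((tensorLeft hM).isQuasiIso_map hA (IsBimodule.tensor hP hQ) ⟨g, hg.cocycle.1⟩ hg)
        (isQuasiIso_right hM).1)
  natural {M N} _ _ d φ := by
    have e1 := comp_assoc d 0 (Cochain.strict (asc N P Q))
      (Cochain.comp 0 (idTensor 0 ⟨g, hg.cocycle.1⟩ N) (iR N)) φ.1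
    have e2 := comp_assoc d 0 (idTensor 0 ⟨g, hg.cocycle.1⟩ N) (iR N) φ.1
    have e3 := tensorId_iR d φ
    have e4 := comp_assoc 0 d (idTensor 0 ⟨g, hg.cocycle.1⟩ N) (tensorId d φ (diagM A)) (iR M)
    have e5 := tensorId_idTensor (P := diagM A) (P' := tensor P Q) φ ⟨g, hg.cocycle.1⟩
      (homDeg.hasParity hA (IsBimodule.tensor hP hQ) hg.cocycle.1)
    have e6 := comp_assoc 0 0 (tensorId d φ (tensor P Q)) (idTensor 0 ⟨g, hg.cocycle.1⟩ M) (iR M)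
    have e7 := comp_assoc 0 d (Cochain.strict (asc N P Q)) (tensorId d φ (tensor P Q))
      (Cochain.comp 0 (idTensor 0 ⟨g, hg.cocycle.1⟩ M) (iR M))
    have e8 := comp_assoc 0 0 (tensorId d ⟨tensorId d φ P, tensorId_mem hP.graded φ⟩ Q)
      (Cochain.strict (asc M P Q)) (Cochain.comp 0 (idTensor 0 ⟨g, hg.cocycle.1⟩ M) (iR M))
    have e9 := asc_tensorId (R := Q) d hP.graded φ
    rw [mul_zero, ksign_zero, one_smul] at e5
    rw [add_zero] at e1 e2 e6 e8
    rw [zero_add] at e4 e7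
    exact e1.trans (by rw [e2, ← e3, ← e4, ← e5, e6, ← e7, e9, e8]; rfl)

end TensorFunctors

section DiagonalBimodule

variable {K : Type u} [Field K]

lemma diagM_isBimodule (A : AInfAlgebra K) : IsBimodule (diagM A) where
  graded := A.isAInf.graded
  degree k m n x y a hx hy ha := by
    have := A.isAInf.degree _ _ ((hx.mul (.cons (e := toA a) ha .nil)).mul (hy.sgnPow A.isAInf.graded 1))
    rw [sgnPow_one, mul_one] at this
    have e : k + m + n + 1 = k + (m + -1 + 0) + n + 2 := by ring
    refine neg_mem ?_
    change A.mu (x * TensorAlgebra.ι K (toA a) * A.sgn y) ∈ A.gr (k + m + n + 1)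
    rw [e]
    rw [mul_assoc] at this ⊢
    exact this
  assoc := by
    have hA := A.isAInf
    refine Cochain.ext_word fun l m a => toA_injective ?_
    have h := hA.assoc (word l * TensorAlgebra.ι K (toA a) * A.sgn (word m))
    have hs : ∀ b : List A.carrier, A.sgn (word b) = word (b.map (A.letterSgn 1)) :=
      sgn_word (M := A.toGrSpace)
    rw [hs, coder_mid, ← hs, map_add, map_add, spl_hom] at h
    simp only [spl_map, spl_hom, ← hs, map_mul A.sgn, sgn_ι, hA.graded.sgn_sgn] at h
    simp only [LinearMap.add_apply, comp_word_spl, insertMu_apply, map_add, spl_hom, toA_op,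
      hA.graded.sgn_sgn, hA.sgn_coder, map_neg, mul_neg, neg_mul, neg_neg, sgnPow_one,
      AlgHom.toLinearMap_apply, toA_par, LinearMap.zero_apply, map_zero] at h ⊢
    rw [← h]
    simp only [mul_neg, map_neg, neg_mul, mul_assoc]
    abel

end DiagonalBimodule

section Invertible

variable {K : Type u} [Field K] {A : AInfAlgebra K} {P M : BimoduleData A}

lemma exists_inverse_isQuasiIso {M : BimoduleData A} (hM : IsBimodule M)
    {f : Cochain A M.toGrSpace (diagonal A).toGrSpace} (hf : IsQuasiIso (P := M) (Q := diagonal A) f) :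
    ∃ g : Cochain A (diagM A).toGrSpace M.toGrSpace, IsQuasiIso (P := diagM A) (Q := M) g := by
  have hf' : IsQuasiIso (P := M) (Q := diagM A) f := hf
  obtain ⟨g, hg, h1, h2⟩ := hf'.exists_homotopyInverse hM (diagM_isBimodule A)
  exact ⟨g, isQuasiIso_of_homotopyInverse hg hf'.cocycle h2 h1⟩

/-- `φ ↦ id_P ⊗ φ`, followed by `P ⊗_A A ≃ P`. -/
def leftConj (P : BimoduleData A) (d : ℤ) (φ : homDeg (A := A) M.toGrSpace (diagM A).toGrSpace d) :
    Cochain A (tensor P M).toGrSpace P.toGrSpace := Cochain.comp d (evR P) (idTensor d φ P)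

/-- `φ ↦ φ ⊗ id_P`, followed by `A ⊗_A P ≃ P`. -/
def rightConj (P : BimoduleData A) (d : ℤ) (φ : homDeg (A := A) M.toGrSpace (diagM A).toGrSpace d) :
    Cochain A (tensor M P).toGrSpace P.toGrSpace := Cochain.comp d (evL P) (tensorId d φ P)

variable [CharZero K]

lemma leftConj_cocycle (hP : IsBimodule P) (hM : IsBimodule M) {d : ℤ}
    (φ : homDeg (A := A) M.toGrSpace (diagM A).toGrSpace d) (h : φ.1 ∈ cocycles M (diagM A) d) :
    leftConj P d φ ∈ cocycles (tensor P M) P d :=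
  cocycle_comp (IsBimodule.tensor hP hM) (IsBimodule.tensor hP (diagM_isBimodule A)) (add_zero d)
    (evR_cocycle hP) ((tensorLeft hP).map_cocycle hM (diagM_isBimodule A) φ h)

lemma rightConj_cocycle (hP : IsBimodule P) (hM : IsBimodule M) {d : ℤ}
    (φ : homDeg (A := A) M.toGrSpace (diagM A).toGrSpace d) (h : φ.1 ∈ cocycles M (diagM A) d) :
    rightConj P d φ ∈ cocycles (tensor M P) P d :=
  cocycle_comp (IsBimodule.tensor hM hP) (IsBimodule.tensor (diagM_isBimodule A) hP) (add_zero d)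
    (evL_cocycle hP) ((tensorRight hP).map_cocycle hM (diagM_isBimodule A) φ h)

lemma leftConj_coboundary (hP : IsBimodule P) (hM : IsBimodule M) {d : ℤ}
    (φ : homDeg (A := A) M.toGrSpace (diagM A).toGrSpace d) (h : φ.1 ∈ coboundaries M (diagM A) d) :
    leftConj P d φ ∈ coboundaries (tensor P M) P d :=
  comp_coboundary (IsBimodule.tensor hP hM) (IsBimodule.tensor hP (diagM_isBimodule A)) (add_zero d)
    (evR_cocycle hP) ((tensorLeft hP).map_coboundary hM (diagM_isBimodule A) φ h)

lemma rightConj_coboundary (hP : IsBimodule P) (hM : IsBimodule M) {d : ℤ}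
    (φ : homDeg (A := A) M.toGrSpace (diagM A).toGrSpace d) (h : φ.1 ∈ coboundaries M (diagM A) d) :
    rightConj P d φ ∈ coboundaries (tensor M P) P d :=
  comp_coboundary (IsBimodule.tensor hM hP) (IsBimodule.tensor (diagM_isBimodule A) hP) (add_zero d)
    (evL_cocycle hP) ((tensorRight hP).map_coboundary hM (diagM_isBimodule A) φ h)

/-- The functor `P ⊗_A -` is fully faithful for invertible `P`. -/
lemma Invertible.left (hP : IsBimodule P) (hinv : Invertible P) : ∃ Q, ∃ hQ : IsBimodule Q,
    Nonempty (NatQuasiIso (tensorLeft hP) (tensorLeft hQ)) ∧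
    Nonempty (NatQuasiIso (tensorLeft hQ) (tensorLeft hP)) ∧
    Nonempty (NatQuasiIso (tensorRight hP) (tensorRight hQ)) ∧
    Nonempty (NatQuasiIso (tensorRight hQ) (tensorRight hP)) := by
  obtain ⟨Q, hQ, ⟨f, hf⟩, ⟨g, hg⟩⟩ := hinv
  obtain ⟨f', hf'⟩ := exists_inverse_isQuasiIso (IsBimodule.tensor hQ hP) hf
  obtain ⟨g', hg'⟩ := exists_inverse_isQuasiIso (IsBimodule.tensor hP hQ) hg
  have hA := diagM_isBimodule A
  exact ⟨Q, hQ, ⟨natLeft hP hQ hA hf'⟩, ⟨natLeft hQ hP hA hg'⟩, ⟨natRight hP hQ hA hg'⟩,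
    ⟨natRight hQ hP hA hf'⟩⟩

lemma leftConj_injective (hP : IsBimodule P) (hinv : Invertible P) (hM : IsBimodule M) {d : ℤ}
    (φ : homDeg (A := A) M.toGrSpace (diagM A).toGrSpace d) (h : φ.1 ∈ cocycles M (diagM A) d)
    (h' : leftConj P d φ ∈ coboundaries (tensor P M) P d) : φ.1 ∈ coboundaries M (diagM A) d := by
  obtain ⟨Q, hQ, ⟨u⟩, -, -, -⟩ := hinv.left hP
  have hA := diagM_isBimodule A
  refine u.faithful hM hA φ h ?_
  exact (isQuasiIso_right hP).2.comp_injective (IsBimodule.tensor hP hA) hP (IsBimodule.tensor hP hM)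
    ((tensorLeft hP).map_cocycle hM hA φ h) h'

lemma rightConj_injective (hP : IsBimodule P) (hinv : Invertible P) (hM : IsBimodule M) {d : ℤ}
    (φ : homDeg (A := A) M.toGrSpace (diagM A).toGrSpace d) (h : φ.1 ∈ cocycles M (diagM A) d)
    (h' : rightConj P d φ ∈ coboundaries (tensor M P) P d) : φ.1 ∈ coboundaries M (diagM A) d := by
  obtain ⟨Q, hQ, -, -, ⟨u⟩, -⟩ := hinv.left hP
  have hA := diagM_isBimodule A
  refine u.faithful hM hA φ h ?_
  exact (isQuasiIso_left hP).2.comp_injective (IsBimodule.tensor hA hP) hP (IsBimodule.tensor hM hP)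
    ((tensorRight hP).map_cocycle hM hA φ h) h'

lemma leftConj_surjective (hP : IsBimodule P) (hinv : Invertible P) (hM : IsBimodule M) {d : ℤ}
    {ψ : Cochain A (tensor P M).toGrSpace P.toGrSpace} (h : ψ ∈ cocycles (tensor P M) P d) :
    ∃ φ : homDeg (A := A) M.toGrSpace (diagM A).toGrSpace d, φ.1 ∈ cocycles M (diagM A) d ∧
      leftConj P d φ - ψ ∈ coboundaries (tensor P M) P d := by
  obtain ⟨Q, hQ, ⟨u⟩, ⟨v⟩, -, -⟩ := hinv.left hP
  have hA := diagM_isBimodule A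
  have hPM := IsBimodule.tensor hP hM
  have hPA := IsBimodule.tensor hP hA
  obtain ⟨χ, hχ, k, hk, e⟩ := (isQuasiIso_right hP).2.comp_surjective hPA hP hPM h
  obtain ⟨φ, hφ, h1⟩ := u.full v hM hA ⟨χ, hχ.1⟩ hχ
  refine ⟨φ, hφ, ?_⟩
  have h2 : Cochain.comp d (evR P) (idTensor d φ P - χ) ∈ coboundaries (tensor P M) P d :=
    comp_coboundary hPM hPA (add_zero d) (evR_cocycle hP) h1
  have h3 : Cochain.comp d (evR P) χ - ψ ∈ coboundaries (tensor P M) P d := ⟨k, hk, e⟩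
  have h4 := add_mem h2 h3
  rw [comp_sub_right, sub_add_sub_cancel] at h4
  exact h4

lemma rightConj_surjective (hP : IsBimodule P) (hinv : Invertible P) (hM : IsBimodule M) {d : ℤ}
    {ψ : Cochain A (tensor M P).toGrSpace P.toGrSpace} (h : ψ ∈ cocycles (tensor M P) P d) :
    ∃ φ : homDeg (A := A) M.toGrSpace (diagM A).toGrSpace d, φ.1 ∈ cocycles M (diagM A) d ∧
      rightConj P d φ - ψ ∈ coboundaries (tensor M P) P d := by
  obtain ⟨Q, hQ, -, -, ⟨u⟩, ⟨v⟩⟩ := hinv.left hP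
  have hA := diagM_isBimodule A
  have hMP := IsBimodule.tensor hM hP
  have hAP := IsBimodule.tensor hA hP
  obtain ⟨χ, hχ, k, hk, e⟩ := (isQuasiIso_left hP).2.comp_surjective hAP hP hMP h
  obtain ⟨φ, hφ, h1⟩ := u.full v hM hA ⟨χ, hχ.1⟩ hχ
  refine ⟨φ, hφ, ?_⟩
  have h2 : Cochain.comp d (evL P) (tensorId d φ P - χ) ∈ coboundaries (tensor M P) P d :=
    comp_coboundary hMP hAP (add_zero d) (evL_cocycle hP) h1
  have h3 : Cochain.comp d (evL P) χ - ψ ∈ coboundaries (tensor M P) P d := ⟨k, hk, e⟩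
  have h4 := add_mem h2 h3
  rw [comp_sub_right, sub_add_sub_cancel] at h4
  exact h4

lemma tensorPow_isBimodule (hP : IsBimodule P) : ∀ i, IsBimodule (tensorPow P i)
  | 0 => diagM_isBimodule A
  | 1 => hP
  | (i + 2) => IsBimodule.tensor hP (tensorPow_isBimodule hP (i + 1))

/-- The vanishing of `H^d(hom(P^i, A))` implies that of `H^d(hom(P^{i+1}, P))`. -/
lemma cocycles_le_coboundaries (hP : IsBimodule P) (hinv : Invertible P) {i : ℕ} {d : ℤ}
    (h : Subsingleton (HomCoh (tensorPow P (i + 1)) (diagonal A) d)) :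
    cocycles (tensorPow P (i + 2)) P d ≤ coboundaries (tensorPow P (i + 2)) P d := by
  intro ψ hψ
  have hM := tensorPow_isBimodule hP (i + 1)
  obtain ⟨φ, hφ, h1⟩ := leftConj_surjective hP hinv hM hψ
  have h2 : φ.1 ∈ coboundaries (tensorPow P (i + 1)) (diagM A) d := by
    have := (Submodule.Quotient.mk_eq_zero _).1 (Subsingleton.elim (Submodule.Quotient.mk (p :=
      (coboundaries (tensorPow P (i + 1)) (diagonal A) d).comap
      (cocycles (tensorPow P (i + 1)) (diagonal A) d).subtype) ⟨φ.1, hφ⟩) 0)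
    exact this
  exact (Submodule.sub_mem_iff_right _ (leftConj_coboundary hP hM φ h2)).1 h1

/-- The self-conjugation automorphism exists. -/
lemma exists_selfConjugation (hP : IsBimodule P) (hinv : Invertible P) :
    ∃ κ : HomCoh P (diagonal A) 0 ≃ₗ[K] HomCoh P (diagonal A) 0, IsSelfConjugation P 0 κ := by
  let ZP := cocycles P (diagM A) 0
  let BP := (coboundaries P (diagM A) 0).comap ZP.subtype
  let ZT := cocycles (tensor P P) P 0
  let BT := (coboundaries (tensor P P) P 0).comap ZT.subtype
  let L₀ : ZP →ₗ[K] ZT :=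
    { toFun := fun φ => ⟨leftConj P 0 ⟨φ.1, φ.2.1⟩, leftConj_cocycle hP hP _ φ.2⟩
      map_add' := fun φ ψ => Subtype.ext (by
        change leftConj P 0 (⟨φ.1, φ.2.1⟩ + ⟨ψ.1, ψ.2.1⟩) = _
        simp only [leftConj, idTensor_add, comp_add_right]; rfl)
      map_smul' := fun c φ => Subtype.ext (by
        change leftConj P 0 (c • ⟨φ.1, φ.2.1⟩) = _
        simp only [leftConj, idTensor_smul, comp_smul_right]; rfl) }
  let R₀ : ZP →ₗ[K] ZT :=
    { toFun := fun φ => ⟨rightConj P 0 ⟨φ.1, φ.2.1⟩, rightConj_cocycle hP hP _ φ.2⟩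
      map_add' := fun φ ψ => Subtype.ext (by
        change rightConj P 0 (⟨φ.1, φ.2.1⟩ + ⟨ψ.1, ψ.2.1⟩) = _
        simp only [rightConj, tensorId_add, comp_add_right]; rfl)
      map_smul' := fun c φ => Subtype.ext (by
        change rightConj P 0 (c • ⟨φ.1, φ.2.1⟩) = _
        simp only [rightConj, tensorId_smul, comp_smul_right]; rfl) }
  let L : (ZP ⧸ BP) →ₗ[K] (ZT ⧸ BT) := Submodule.mapQ BP BT L₀ fun φ h =>
    leftConj_coboundary hP hP ⟨φ.1, φ.2.1⟩ h
  let R : (ZP ⧸ BP) →ₗ[K] (ZT ⧸ BT) := Submodule.mapQ BP BT R₀ fun φ h =>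
    rightConj_coboundary hP hP ⟨φ.1, φ.2.1⟩ h
  have hL : Function.Bijective L := by
    constructor
    · rw [← LinearMap.ker_eq_bot, LinearMap.ker_eq_bot']
      intro q
      obtain ⟨φ, rfl⟩ := Submodule.Quotient.mk_surjective _ q
      intro h
      refine (Submodule.Quotient.mk_eq_zero _).2 ?_
      exact leftConj_injective hP hinv hP ⟨φ.1, φ.2.1⟩ φ.2 ((Submodule.Quotient.mk_eq_zero BT).1 h)
    · intro q
      obtain ⟨ψ, rfl⟩ := Submodule.Quotient.mk_surjective _ q
      obtain ⟨φ, hφ, h⟩ := leftConj_surjective hP hinv hP ψ.2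
      exact ⟨Submodule.Quotient.mk ⟨φ.1, hφ⟩, (Submodule.Quotient.eq BT).2 h⟩
  have hR : Function.Bijective R := by
    constructor
    · rw [← LinearMap.ker_eq_bot, LinearMap.ker_eq_bot']
      intro q
      obtain ⟨φ, rfl⟩ := Submodule.Quotient.mk_surjective _ q
      intro h
      refine (Submodule.Quotient.mk_eq_zero _).2 ?_
      exact rightConj_injective hP hinv hP ⟨φ.1, φ.2.1⟩ φ.2 ((Submodule.Quotient.mk_eq_zero BT).1 h)
    · intro q
      obtain ⟨ψ, rfl⟩ := Submodule.Quotient.mk_surjective _ q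
      obtain ⟨φ, hφ, h⟩ := rightConj_surjective hP hinv hP ψ.2
      exact ⟨Submodule.Quotient.mk ⟨φ.1, hφ⟩, (Submodule.Quotient.eq BT).2 h⟩
  let κ : (ZP ⧸ BP) ≃ₗ[K] (ZP ⧸ BP) :=
    (LinearEquiv.ofBijective L hL).trans (LinearEquiv.ofBijective R hR).symm
  refine ⟨κ, fun φ ψ => ?_⟩
  have h1 : κ (Submodule.Quotient.mk φ) = Submodule.Quotient.mk ψ ↔
      L (Submodule.Quotient.mk φ) = R (Submodule.Quotient.mk ψ) := by
    change (LinearEquiv.ofBijective R hR).symm (L (Submodule.Quotient.mk φ)) = _ ↔ _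
    exact (LinearEquiv.ofBijective R hR).symm_apply_eq
  exact h1.trans (Submodule.Quotient.eq BT)

end Invertible

/-! ### Words in `A ⊕ P[1]` -/

section PureWords

variable {K : Type u} [Field K] {A : AInfAlgebra K} (P : BimoduleData A)

/-- A letter of `A ⊕ P[1]` that lies in one of the two summands. -/
def letter : A.carrier ⊕ P.carrier → (extSpace P).carrier :=
  Sum.elim (fun a => ((a, 0) : A.carrier × P.carrier)) fun p => ((0, p) : A.carrier × P.carrier)

/-- Words whose letters lie in one of the two summands of `A ⊕ P[1]`. -/
def pword (l : List (A.carrier ⊕ P.carrier)) : Bar (extSpace P) := word (l.map (letter P))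

variable {P}

/-- The number of letters in `P[1]`. -/
def numP (l : List (A.carrier ⊕ P.carrier)) : ℕ := l.countP Sum.isRight

@[simp] lemma numP_nil : numP ([] : List (A.carrier ⊕ P.carrier)) = 0 := rfl

@[simp] lemma numP_cons_inl (a : A.carrier) (l : List (A.carrier ⊕ P.carrier)) :
    numP (Sum.inl a :: l) = numP l := List.countP_cons_of_neg (by simp)

@[simp] lemma numP_cons_inr (p : P.carrier) (l : List (A.carrier ⊕ P.carrier)) :
    numP (Sum.inr p :: l) = numP l + 1 := List.countP_cons_of_pos rfl

@[simp] lemma numP_append (l m : List (A.carrier ⊕ P.carrier)) :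
    numP (l ++ m) = numP l + numP m := by simp [numP]

@[simp] lemma numP_map_inl (l : List A.carrier) :
    numP (P := P) (l.map Sum.inl) = 0 := by
  induction l with
  | nil => rfl
  | cons a l ih => simp [ih]

@[simp] lemma pword_nil : pword P [] = 1 := by simp [pword]

lemma pword_cons (s : A.carrier ⊕ P.carrier) (l : List (A.carrier ⊕ P.carrier)) :
    pword P (s :: l) = TensorAlgebra.ι K (letter P s) * pword P l := by simp [pword, word_cons]

lemma pword_append (l m : List (A.carrier ⊕ P.carrier)) :
    pword P (l ++ m) = pword P l * pword P m := by simp [pword, word_append]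

lemma letter_inl (a : A.carrier) : letter P (Sum.inl a) = ((a, 0) : A.carrier × P.carrier) := rfl
lemma letter_inr (p : P.carrier) : letter P (Sum.inr p) = ((0, p) : A.carrier × P.carrier) := rfl

lemma pword_map_inl (l : List A.carrier) : pword P (l.map Sum.inl) = inA P (word l) := by
  induction l with
  | nil => simp
  | cons a l ih => rw [List.map_cons, pword_cons, ih, word_cons, map_mul, inA_ι, letter_inl]

lemma pword_singleton (p : P.carrier) :
    pword P [Sum.inr p] = TensorAlgebra.ι K ((0, p) : A.carrier × P.carrier) := by
  simp [pword, word_singleton, letter_inr]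

lemma span_pword : Submodule.span K (Set.range (pword P)) = ⊤ := by
  refine Submodule.eq_top_iff'.2 fun x => ?_
  induction x using word_induction with
  | h0 => exact Submodule.subset_span ⟨[], by simp⟩
  | hι a x hx =>
    induction hx using Submodule.span_induction with
    | mem x h =>
      obtain ⟨l, rfl⟩ := h
      have : a = letter P (Sum.inl a.1) + letter P (Sum.inr a.2) := by
        refine Prod.ext ?_ ?_ <;> simp [letter]
      rw [this, map_add, add_mul, ← pword_cons, ← pword_cons]
      exact add_mem (Submodule.subset_span ⟨_, rfl⟩) (Submodule.subset_span ⟨_, rfl⟩)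
    | zero => simp
    | add x y _ _ h1 h2 => rw [mul_add]; exact add_mem h1 h2
    | smul c x _ h => rw [mul_smul_comm]; exact Submodule.smul_mem _ _ h
  | hadd x y hx hy => exact add_mem hx hy
  | hsmul c x hx => exact Submodule.smul_mem _ _ hx

variable {X : Type u} [AddCommGroup X] [Module K X]

lemma pword_ext {f g : Bar (extSpace P) →ₗ[K] X} (h : ∀ l, f (pword P l) = g (pword P l)) :
    f = g :=
  LinearMap.ext_on span_pword (by rintro _ ⟨l, rfl⟩; exact h l)

/-- The effect of the sign operator on letters. -/
def pureSgn : A.carrier ⊕ P.carrier → A.carrier ⊕ P.carrier :=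
  Sum.map (fun a => -A.par a) P.par

lemma sgn_pword (l : List (A.carrier ⊕ P.carrier)) :
    (extSpace P).sgn (pword P l) = pword P (l.map pureSgn) := by
  induction l with
  | nil => simp
  | cons s l ih =>
    rw [List.map_cons, pword_cons, pword_cons, map_mul, ih, sgn_ι, ← map_neg]
    congr 2
    cases s
    · exact Prod.ext rfl (by simp [letter, pureSgn])
    · exact Prod.ext (by simp [letter, pureSgn]) (by simp [letter, pureSgn])

@[simp] lemma numP_map_pureSgn (l : List (A.carrier ⊕ P.carrier)) :
    numP (l.map pureSgn) = numP l := by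
  induction l with
  | nil => rfl
  | cons s l ih =>
    cases s
    · exact (numP_cons_inl _ _).trans (ih.trans (numP_cons_inl _ _).symm)
    · exact (numP_cons_inr _ _).trans (by rw [ih, numP_cons_inr])

lemma coder_pword (μ : Bar (extSpace P) →ₗ[K] (extSpace P)) (l : List (A.carrier ⊕ P.carrier)) :
    (extSpace P).coder μ (pword P l) = spl l fun u w => spl w fun v t =>
      pword P u * TensorAlgebra.ι K (μ (pword P v)) * (extSpace P).sgn (pword P t) := by
  rw [pword, coder_word, spl_map]
  refine spl_congr fun u w _ => ?_
  rw [spl_map]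
  refine spl_congr fun v t _ => ?_
  rw [word_append, word_cons, ← sgn_word, mul_assoc]
  rfl

/-- `f` vanishes on words with less than `r` letters in `P[1]`. -/
def Kills (r : ℕ) (f : Bar (extSpace P) →ₗ[K] X) : Prop := ∀ l, numP l < r → f (pword P l) = 0

/-- `f` vanishes on words which contain the unit. -/
def UnitFree (f : Bar (extSpace P) →ₗ[K] X) : Prop :=
  ∀ x y, f (x * TensorAlgebra.ι K ((A.unit, 0) : A.carrier × P.carrier) * y) = 0

lemma Kills.map_inl {r : ℕ} {f : Bar (extSpace P) →ₗ[K] X} (hf : Kills r f)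
    (u t : List (A.carrier ⊕ P.carrier)) (a : A.carrier) (h : numP u + numP t < r) :
    f (pword P u * TensorAlgebra.ι K ((a, 0) : A.carrier × P.carrier) * pword P t) = 0 := by
  have := hf (u ++ Sum.inl a :: t) (by simpa using h)
  rwa [pword_append, pword_cons, ← mul_assoc] at this

lemma Kills.map_mid {r : ℕ} {f : Bar (extSpace P) →ₗ[K] X} (hf : Kills r f)
    (u t : List (A.carrier ⊕ P.carrier)) (b : (extSpace P).carrier) (h : numP u + numP t + 1 < r) :
    f (pword P u * TensorAlgebra.ι K b * pword P t) = 0 := by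
  have h2 := hf (u ++ Sum.inr b.2 :: t) (by simp; omega)
  have h1 := hf.map_inl u t b.1 (by omega)
  rw [pword_append, pword_cons, ← mul_assoc] at h2
  have hb : b = ((b.1, 0) : A.carrier × P.carrier) + letter P (Sum.inr b.2) := by
    refine Prod.ext ?_ ?_ <;> simp [letter]
  rw [hb, map_add, mul_add, add_mul, map_add, h1, h2, add_zero]

lemma Kills.map_snd {r : ℕ} {f : Bar (extSpace P) →ₗ[K] X} (hf : Kills r f)
    (u t : List (A.carrier ⊕ P.carrier)) (b : (extSpace P).carrier) (h : numP u + numP t < r) :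
    f (pword P u * TensorAlgebra.ι K b * pword P t) =
      f (pword P u * TensorAlgebra.ι K ((0, b.2) : A.carrier × P.carrier) * pword P t) := by
  have h1 := hf.map_inl u t b.1 (by omega)
  have hb : b = ((b.1, 0) : A.carrier × P.carrier) + ((0, b.2) : A.carrier × P.carrier) := by
    refine Prod.ext ?_ ?_ <;> simp
  nth_rw 1 [hb]
  rw [map_add, mul_add, add_mul, map_add, h1, zero_add]

lemma UnitFree.comp_mul {f : Bar (extSpace P) →ₗ[K] X} (hf : UnitFree f) (u : Bar (extSpace P)) :
    UnitFree (f ∘ₗ LinearMap.mulLeft K u) := fun x y => by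
  have := hf (u * x) y
  simpa [mul_assoc] using this

lemma coder_inA {μ : Bar (extSpace P) →ₗ[K] (extSpace P)} (h : IsDivisor P μ)
    (x : Bar A.toGrSpace) : (extSpace P).coder μ (inA P x) = inA P (A.coder A.mu x) := by
  have : (extSpace P).coder μ ∘ₗ (inA P).toLinearMap = (inA P).toLinearMap ∘ₗ A.coder A.mu :=
    word_ext fun l => by
      simp only [LinearMap.comp_apply, AlgHom.toLinearMap_apply]
      rw [← pword_map_inl, coder_pword, spl_map, coder_word, spl_hom]
      refine spl_congr fun u w _ => ?_
      rw [spl_map, spl_hom]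
      refine spl_congr fun v t _ => ?_
      rw [pword_map_inl, pword_map_inl, pword_map_inl, h.subalgebra, sgn_inA, ← word_mid,
        map_mul (inA P), map_mul (inA P), inA_ι, sgn_word]
  exact DFunLike.congr_fun this x

end PureWords

/-! ### Words in `A ⊕ P[1]` and tensor powers -/

section TensorPowers

variable {K : Type u} [Field K] {A : AInfAlgebra K} {P : BimoduleData A}

variable (A) in
lemma exists_unitProj : ∃ σ : A.carrier →ₗ[K] A.carrier, σ A.unit = 0 ∧ (∀ a, σ (σ a) = σ a) ∧
    ∀ a, ∃ c : K, a - σ a = c • A.unit := by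
  obtain ⟨f, hf⟩ : ∃ f : A.carrier →ₗ[K] K, f A.unit • A.unit = A.unit := by
    by_cases h : A.unit = 0
    · exact ⟨0, by simp [h]⟩
    · obtain ⟨f, hf⟩ := not_forall.1 (mt (Module.forall_dual_apply_eq_zero_iff K A.unit).1 h)
      exact ⟨(f A.unit)⁻¹ • f, by simp [hf]⟩
  refine ⟨LinearMap.id - f.smulRight A.unit, ?_, fun a => ?_, fun a => ⟨f a, by simp⟩⟩
  · simp [hf]
  · simp [sub_smul, mul_smul, hf]

variable (A) in
/-- A projection of `A` with kernel spanned by the unit. -/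
def unitProj : A.carrier →ₗ[K] A.carrier := Classical.choose (exists_unitProj A)

variable (A) in
/-- The endomorphism of `T(A[1])` induced by `unitProj`. -/
def unitNorm : Bar A.toGrSpace →ₐ[K] Bar A.toGrSpace :=
  TensorAlgebra.lift K (TensorAlgebra.ι K ∘ₗ unitProj A)

lemma unitProj_unit : unitProj A A.unit = 0 := (Classical.choose_spec (exists_unitProj A)).1

lemma unitProj_unitProj (a : A.carrier) : unitProj A (unitProj A a) = unitProj A a :=
  (Classical.choose_spec (exists_unitProj A)).2.1 a

@[simp] lemma unitNorm_ι (a : A.carrier) : unitNorm A (TensorAlgebra.ι K a) =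
    TensorAlgebra.ι K (unitProj A a) := by simp [unitNorm]

lemma unitNorm_word (l : List A.carrier) : unitNorm A (word l) = word (l.map (unitProj A)) := by
  induction l with
  | nil => simp
  | cons a l ih => rw [word_cons, map_mul, ih, unitNorm_ι, List.map_cons, word_cons]

variable {X : Type u} [AddCommGroup X] [Module K X]

/-- Maps that vanish on words with a unit cannot distinguish `b` from `unitNorm A b`. -/
lemma map_unitNorm_mul {f : Bar A.toGrSpace →ₗ[K] X}
    (hf : ∀ x y, f (x * TensorAlgebra.ι K A.unit * y) = 0) (b : Bar A.toGrSpace) :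
    f (unitNorm A b) = f b := by
  suffices h : ∀ u, f (u * unitNorm A b) = f (u * b) by simpa using h 1
  induction b using word_induction with
  | h0 => simp
  | hι a b hb =>
    intro u
    obtain ⟨c, hc⟩ := (Classical.choose_spec (exists_unitProj A)).2.2 a
    have e : unitProj A a = a - c • A.unit := by rw [← hc]; simp [unitProj]
    have h1 : u * TensorAlgebra.ι K (unitProj A a) * b = u * TensorAlgebra.ι K a * b -
        c • (u * TensorAlgebra.ι K A.unit * b) := by
      rw [e, map_sub, map_smul, mul_sub, sub_mul, mul_smul_comm, smul_mul_assoc]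
    rw [map_mul (unitNorm A), unitNorm_ι, ← mul_assoc, hb, h1, map_sub, map_smul, hf, smul_zero, sub_zero,
      mul_assoc]
  | hadd x y hx hy => intro u; simp only [map_add, mul_add, hx, hy]
  | hsmul c x hx => intro u; simp only [map_smul, mul_smul_comm, hx]

lemma unitNorm_unit (x y : Bar A.toGrSpace) :
    unitNorm A (x * TensorAlgebra.ι K A.unit * y) = 0 := by
  simp [unitProj_unit]

lemma UnitFree.map_unitNorm {f : Bar (extSpace P) →ₗ[K] X} (hf : UnitFree f)
    (u v : Bar (extSpace P)) (b : Bar A.toGrSpace) :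
    f (u * inA P (unitNorm A b) * v) = f (u * inA P b * v) := by
  refine map_unitNorm_mul (f := f ∘ₗ LinearMap.mulRight K v ∘ₗ LinearMap.mulLeft K u ∘ₗ
    (inA P).toLinearMap) (fun x y => ?_) b
  have := hf (u * inA P x) (inA P y * v)
  simpa [mul_assoc] using this

lemma UnitFree.map_sgn_unitNorm {f : Bar (extSpace P) →ₗ[K] X} (hf : UnitFree f)
    (u v : Bar (extSpace P)) (b : Bar A.toGrSpace) :
    f (u * inA P (A.sgn (unitNorm A b)) * v) = f (u * inA P (A.sgn b) * v) := by
  refine map_unitNorm_mul (f := f ∘ₗ LinearMap.mulRight K v ∘ₗ LinearMap.mulLeft K u ∘ₗ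
    (inA P).toLinearMap ∘ₗ A.sgn.toLinearMap) (fun x y => ?_) b
  have := hf (u * inA P (A.sgn x)) (inA P (A.sgn y) * v)
  simp only [LinearMap.comp_apply, LinearMap.mulLeft_apply, LinearMap.mulRight_apply,
    AlgHom.toLinearMap_apply, map_mul A.sgn, A.sgn_unit, map_mul (inA P), map_neg, mul_neg, neg_mul,
    inA_ι, mul_assoc] at this ⊢
  rw [this, neg_zero]

lemma tens_unitNorm {Q R : BimoduleData A} (q : Q.carrier) (b : Bar A.toGrSpace) (r : R.carrier) :
    tens Q R q (unitNorm A b) r = tens Q R q b r :=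
  map_unitNorm_mul (f := (tens Q R q).flip r) (fun x y => tens_unit q x y r) b

/-- Elements of `P`, as elements of its first tensor power. -/
def genZero : P.carrier →ₗ[K] (tensorPow P (0 + 1)).carrier := LinearMap.id

/-- The generators of the higher tensor powers. -/
def genSucc (i : ℕ) : P.carrier →ₗ[K] Bar A.toGrSpace →ₗ[K] (tensorPow P (i + 1)).carrier →ₗ[K]
    (tensorPow P (i + 1 + 1)).carrier := tens P (tensorPow P (i + 1))

lemma genZero_ext {f g : (tensorPow P (0 + 1)).carrier →ₗ[K] X}
    (h : ∀ p, f (genZero p) = g (genZero p)) : f = g := LinearMap.ext h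

lemma genSucc_ext {i : ℕ} {f g : (tensorPow P (i + 1 + 1)).carrier →ₗ[K] X}
    (h : ∀ p b z, f (genSucc i p (word b) z) = g (genSucc i p (word b) z)) : f = g := tens_ext h

lemma genZero_par (p : P.carrier) : (tensorPow P (0 + 1)).par (genZero p) = genZero (P.par p) := rfl

lemma genZero_op (x y : Bar A.toGrSpace) (p : P.carrier) :
    (tensorPow P (0 + 1)).op x y (genZero p) = genZero (P.op x y p) := rfl

lemma genSucc_par {i : ℕ} (p : P.carrier) (b : Bar A.toGrSpace) (z : (tensorPow P (i + 1)).carrier) :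
    (tensorPow P (i + 1 + 1)).par (genSucc i p b z) =
      genSucc i (P.par p) (A.sgn b) ((tensorPow P (i + 1)).par z) := rfl

lemma genSucc_op {i : ℕ} (x y : Bar A.toGrSpace) (p : P.carrier) (b : List A.carrier)
    (z : (tensorPow P (i + 1)).carrier) :
    (tensorPow P (i + 1 + 1)).op x y (genSucc i p (word b) z) =
      (aug y • spl b fun u v =>
        genSucc i (P.op x (word u) p) (A.sgn (word v)) ((tensorPow P (i + 1)).par z)) +
      (aug x * aug y) • genSucc i p (A.coder A.mu (word b)) ((tensorPow P (i + 1)).par z) +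
      aug x • spl b fun u v => genSucc i p (word u) ((tensorPow P (i + 1)).op (word v) y z) :=
  op_tens x y p b z

lemma genSucc_unitNorm {i : ℕ} (p : P.carrier) (b : Bar A.toGrSpace)
    (z : (tensorPow P (i + 1)).carrier) : genSucc i p (unitNorm A b) z = genSucc i p b z :=
  tens_unitNorm p b z

variable (P) in
/-- The inclusion `P ⊗ T(Ā[1]) ⊗ P ⊗ ⋯ ⊗ P → T(B[1])` on the `i + 1`-st tensor power. -/
def core : ∀ i : ℕ, (tensorPow P (i + 1)).carrier →ₗ[K] Bar (extSpace P)
  | 0 => TensorAlgebra.ι K ∘ₗ LinearMap.inr K A.carrier P.carrier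
  | i + 1 => tensLift (Q := P) (P := tensorPow P (i + 1))
      (((LinearMap.mul K (Bar (extSpace P))).compl₁₂
        (TensorAlgebra.ι K ∘ₗ LinearMap.inr K A.carrier P.carrier)
        ((inA P).toLinearMap ∘ₗ (unitNorm A).toLinearMap)).compr₂
          ((LinearMap.mul K (Bar (extSpace P))).compl₂ (core i)))
      (fun q x y z => by
        simp only [LinearMap.compr₂_apply, LinearMap.compl₁₂_apply, LinearMap.comp_apply,
          AlgHom.toLinearMap_apply, unitNorm_unit, map_zero, LinearMap.zero_apply])

lemma core_genZero (p : P.carrier) :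
    core P 0 (genZero p) = TensorAlgebra.ι K ((0, p) : A.carrier × P.carrier) := rfl

lemma core_genSucc (i : ℕ) (p : P.carrier) (b : Bar A.toGrSpace) (z : (tensorPow P (i + 1)).carrier) :
    core P (i + 1) (genSucc i p b z) =
      TensorAlgebra.ι K ((0, p) : A.carrier × P.carrier) * inA P (unitNorm A b) * core P i z := rfl

variable (P) in
/-- `Rep P i z c` says that `c` is a word of normalized letters that represents the generator `z`
of the `i + 1`-st tensor power. -/
def Rep : ∀ i : ℕ, (tensorPow P (i + 1)).carrier → List (A.carrier ⊕ P.carrier) → Prop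
  | 0, z, c => ∃ p : P.carrier, z = genZero p ∧ c = [Sum.inr p]
  | i + 1, z, c => ∃ (p : P.carrier) (b : List A.carrier) (z' : (tensorPow P (i + 1)).carrier)
      (c' : List (A.carrier ⊕ P.carrier)), Rep i z' c' ∧ b.map (unitProj A) = b ∧
      z = genSucc i p (word b) z' ∧ c = Sum.inr p :: (b.map Sum.inl ++ c')

lemma Rep.core_eq : ∀ {i : ℕ} {z : (tensorPow P (i + 1)).carrier} {c : List (A.carrier ⊕ P.carrier)},
    Rep P i z c → core P i z = pword P c
  | 0, _, _, ⟨p, hz, hc⟩ => by subst hz hc; exact (pword_singleton _).symm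
  | i + 1, _, _, ⟨p, b, z', c', h, hb, hz, hc⟩ => by
    subst hz hc
    rw [core_genSucc, h.core_eq, unitNorm_word, hb, pword_cons, pword_append, pword_map_inl,
      letter_inr, mul_assoc]

lemma Rep.numP_eq : ∀ {i : ℕ} {z : (tensorPow P (i + 1)).carrier} {c : List (A.carrier ⊕ P.carrier)},
    Rep P i z c → numP c = i + 1
  | 0, _, _, ⟨p, hz, hc⟩ => by subst hz hc; rfl
  | i + 1, _, _, ⟨p, b, z', c', h, hb, hz, hc⟩ => by
    subst hz hc
    simp [h.numP_eq]

lemma Rep.exists_cons : ∀ {i : ℕ} {z : (tensorPow P (i + 1)).carrier}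
    {c : List (A.carrier ⊕ P.carrier)}, Rep P i z c → ∃ p c', c = Sum.inr p :: c'
  | 0, _, _, ⟨p, _, hc⟩ => ⟨p, [], hc⟩
  | _ + 1, _, _, ⟨p, b, _, c', _, _, _, hc⟩ => ⟨p, b.map Sum.inl ++ c', hc⟩

lemma Rep.exists_append : ∀ {i : ℕ} {z : (tensorPow P (i + 1)).carrier}
    {c : List (A.carrier ⊕ P.carrier)}, Rep P i z c → ∃ p c', c = c' ++ [Sum.inr p]
  | 0, _, _, ⟨p, _, hc⟩ => ⟨p, [], hc⟩
  | _ + 1, _, _, ⟨p, b, _, c', h, _, _, hc⟩ => by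
    obtain ⟨q, d, hd⟩ := h.exists_append
    exact ⟨q, Sum.inr p :: (b.map Sum.inl ++ d), by rw [hc, hd]; simp⟩

lemma Rep.ext : ∀ {i : ℕ} {f g : (tensorPow P (i + 1)).carrier →ₗ[K] X}
    (_ : ∀ z c, Rep P i z c → f z = g z), f = g
  | 0, f, g, h => genZero_ext fun p => h _ _ ⟨p, rfl, rfl⟩
  | i + 1, f, g, h => genSucc_ext fun p b z => by
    rw [← genSucc_unitNorm, unitNorm_word]
    refine DFunLike.congr_fun (Rep.ext (f := f ∘ₗ genSucc i p (word (b.map (unitProj A))))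
      (g := g ∘ₗ genSucc i p (word (b.map (unitProj A)))) fun z c hz => ?_) z
    refine h _ _ ⟨p, b.map (unitProj A), z, c, hz, ?_, rfl, rfl⟩
    rw [List.map_map]
    exact List.map_congr_left fun a _ => unitProj_unitProj a

/-- Restriction of a map on `T(B[1])` to words with `i + 1` letters in `P[1]`. -/
def pull (i : ℕ) {R : GrSpace K} (f : Bar (extSpace P) →ₗ[K] R) :
    Cochain A (tensorPow P (i + 1)).toGrSpace R :=
  LinearMap.mk₂ K
    (fun x y => f ∘ₗ LinearMap.mulRight K (inA P y) ∘ₗ LinearMap.mulLeft K (inA P x) ∘ₗ core P i)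
    (fun x x' y => LinearMap.ext fun z => by simp [add_mul])
    (fun c x y => LinearMap.ext fun z => by simp)
    (fun x y y' => LinearMap.ext fun z => by simp [mul_add])
    (fun c x y => LinearMap.ext fun z => by simp)

lemma pull_apply (i : ℕ) {R : GrSpace K} (f : Bar (extSpace P) →ₗ[K] R) (x y : Bar A.toGrSpace)
    (z : (tensorPow P (i + 1)).carrier) :
    pull i f x y z = f (inA P x * core P i z * inA P y) := rfl

lemma UnitFree.map_core_par : ∀ {i : ℕ} {f : Bar (extSpace P) →ₗ[K] X} (_ : UnitFree f)
    (u v : Bar (extSpace P)) (z : (tensorPow P (i + 1)).carrier),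
    f (u * core P i ((tensorPow P (i + 1)).par z) * v) = f (u * (extSpace P).sgn (core P i z) * v)
  | 0, f, hf, u, v, z => by
    refine DFunLike.congr_fun (f := f ∘ₗ LinearMap.mulRight K v ∘ₗ LinearMap.mulLeft K u ∘ₗ
      core P 0 ∘ₗ (tensorPow P (0 + 1)).par) (g := f ∘ₗ LinearMap.mulRight K v ∘ₗ
      LinearMap.mulLeft K u ∘ₗ (extSpace P).sgn.toLinearMap ∘ₗ core P 0)
      (genZero_ext fun p => ?_) z
    simp only [LinearMap.comp_apply, AlgHom.toLinearMap_apply, genZero_par, core_genZero]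
    rw [sgn_once]
  | i + 1, f, hf, u, v, z => by
    refine DFunLike.congr_fun (f := f ∘ₗ LinearMap.mulRight K v ∘ₗ LinearMap.mulLeft K u ∘ₗ
      core P (i + 1) ∘ₗ (tensorPow P (i + 1 + 1)).par) (g := f ∘ₗ LinearMap.mulRight K v ∘ₗ
      LinearMap.mulLeft K u ∘ₗ (extSpace P).sgn.toLinearMap ∘ₗ core P (i + 1))
      (genSucc_ext fun p b z => ?_) z
    have h2 := hf.map_unitNorm (u * TensorAlgebra.ι K ((0, P.par p) : A.carrier × P.carrier))
      (core P i ((tensorPow P (i + 1)).par z) * v) (A.sgn (word b))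
    have h3 := hf.map_core_par (i := i) (u * TensorAlgebra.ι K ((0, P.par p) : A.carrier × P.carrier)
      * inA P (A.sgn (word b))) v z
    have h4 := hf.map_sgn_unitNorm (u * TensorAlgebra.ι K ((0, P.par p) : A.carrier × P.carrier))
      ((extSpace P).sgn (core P i z) * v) (word b)
    simp only [LinearMap.comp_apply, LinearMap.mulLeft_apply, LinearMap.mulRight_apply,
      AlgHom.toLinearMap_apply]
    rw [genSucc_par, core_genSucc, core_genSucc, map_mul (extSpace P).sgn, map_mul (extSpace P).sgn,
      sgn_once, sgn_inA]
    simp only [mul_assoc] at h2 h3 h4 ⊢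
    rw [h2, h3, h4]

end TensorPowers

section CoderTensorPowers

variable {K : Type u} [Field K] {A : AInfAlgebra K} {P : BimoduleData A}

variable {X : Type u} [AddCommGroup X] [Module K X]

lemma coder_pword_mid (μ : Bar (extSpace P) →ₗ[K] (extSpace P)) (l : List A.carrier) (p : P.carrier)
    (v : List (A.carrier ⊕ P.carrier)) (hμ : IsDivisor P μ) :
    (extSpace P).coder μ (inA P (word l) * TensorAlgebra.ι K ((0, p) : A.carrier × P.carrier) *
      pword P v) =
      inA P (word l) * TensorAlgebra.ι K ((0, p) : A.carrier × P.carrier) *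
        (extSpace P).coder μ (pword P v) +
      inA P (A.coder A.mu (word l)) * TensorAlgebra.ι K ((0, P.par p) : A.carrier × P.carrier) *
        (extSpace P).sgn (pword P v) +
      spl l fun l₁ l₂ => spl v fun v₁ v₂ => inA P (word l₁) *
        TensorAlgebra.ι K (μ (inA P (word l₂) * TensorAlgebra.ι K ((0, p) : A.carrier × P.carrier) *
          pword P v₁)) * (extSpace P).sgn (pword P v₂) := by
  have h := coder_mid μ ((l.map Sum.inl).map (letter P)) (v.map (letter P))
    ((0, p) : A.carrier × P.carrier)
  rw [spl_map, spl_map] at h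
  simp only [spl_map] at h
  have h1 : ∀ m : List A.carrier, word (K := K) ((m.map Sum.inl).map (letter P)) = inA P (word m) :=
    pword_map_inl
  have h2 : ∀ m, word (K := K) (m.map (letter P)) = pword P m := fun m => rfl
  rw [h1, h2, coder_inA hμ, map_mul (extSpace P).sgn, sgn_once] at h
  simp only [h1, h2] at h
  rw [h]
  simp only [mul_assoc]

lemma UnitFree.pull_genSucc {R : GrSpace K} {f : Bar (extSpace P) →ₗ[K] R} (hf : UnitFree f) {i : ℕ}
    (x y b : Bar A.toGrSpace) (p : P.carrier) (z : (tensorPow P (i + 1)).carrier) :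
    pull (i + 1) f x y (genSucc i p b z) = f (inA P x *
      TensorAlgebra.ι K ((0, p) : A.carrier × P.carrier) * (inA P b * (core P i z * inA P y))) := by
  have h := hf.map_unitNorm (inA P x * TensorAlgebra.ι K ((0, p) : A.carrier × P.carrier))
    (core P i z * inA P y) b
  rw [pull_apply, core_genSucc]
  simp only [mul_assoc] at h ⊢
  exact h

/-- On words with `i + 1` letters in `P[1]`, and modulo maps that vanish on words with fewer
letters in `P[1]`, the coderivation of `B` is given by the structure maps of the tensor power. -/
lemma pull_coder {μ : Bar (extSpace P) →ₗ[K] (extSpace P)} (hμ : IsDivisor P μ) {R : GrSpace K} :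
    ∀ (i : ℕ) {f : Bar (extSpace P) →ₗ[K] R} (_ : UnitFree f) (_ : Kills (i + 1) f),
    pull i (f ∘ₗ (extSpace P).coder μ) =
      Cochain.comp 1 (pull i f) (tensorPow P (i + 1)).op + (pull i f).insertMu
  | 0, f, hu, hf => by
    refine LinearMap.ext fun x => LinearMap.ext fun y => genZero_ext fun p => ?_
    refine congrArg (fun φ : Cochain A P.toGrSpace R => φ x y p) (Cochain.ext_word
      (φ := (pull 0 (f ∘ₗ (extSpace P).coder μ)).compr₂ (LinearMap.lcomp K _ genZero))
      (ψ := (Cochain.comp 1 (pull 0 f) (tensorPow P (0 + 1)).op + (pull 0 f).insertMu).compr₂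
        (LinearMap.lcomp K _ genZero)) fun l m p => ?_)
    simp only [LinearMap.compr₂_apply, LinearMap.lcomp_apply]
    have h := congrArg f (coder_pword_mid μ l p (m.map Sum.inl) hμ)
    rw [map_add, map_add, spl_hom, pword_map_inl, coder_inA hμ, sgn_inA, spl_congr (G := fun l₁ l₂ =>
      spl m fun m₁ m₂ => pull 0 f (word l₁) (A.sgn (word m₂))
        (genZero (P.op (word l₂) (word m₁) p)))] at h
    · simp only [LinearMap.add_apply, comp_word_spl, insertMu_apply, sgnPow_one, pull_apply,
        genZero_op, genZero_par, core_genZero, LinearMap.comp_apply, AlgHom.toLinearMap_apply] at h ⊢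
      rw [h]
      abel
    · intro l₁ l₂ _
      rw [spl_map, spl_hom]
      refine spl_congr fun m₁ m₂ _ => ?_
      have := hf.map_snd (l₁.map Sum.inl) ((m₂.map Sum.inl).map pureSgn)
        (μ (onceP P (word l₂) (word m₁) p)) (by rw [numP_map_pureSgn]; simp)
      rw [← sgn_pword, pword_map_inl, pword_map_inl] at this
      rw [pword_map_inl, pword_map_inl]
      refine this.trans ?_
      rw [hμ.quotient, sgn_inA]
      rfl
  | i + 1, f, hu, hf => by
    refine Cochain.ext_word fun l m z => ?_
    refine DFunLike.congr_fun (Rep.ext (f := pull (i + 1) (f ∘ₗ (extSpace P).coder μ) (word l) (word m))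
      (g := (Cochain.comp 1 (pull (i + 1) f) (tensorPow P (i + 1 + 1)).op + (pull (i + 1) f).insertMu)
        (word l) (word m)) fun z c hz => ?_) z
    obtain ⟨p, b, z', c', hz', hb, rfl, -⟩ := hz
    obtain ⟨q, c'', hc⟩ := hz'.exists_cons
    have hn := hz'.numP_eq
    set v := b.map Sum.inl ++ Sum.inr q :: (c'' ++ m.map Sum.inl) with hv
    have hvw : pword P v = inA P (word b) * core P i z' * inA P (word m) := by
      rw [hz'.core_eq, hc, ← pword_map_inl, ← pword_map_inl, ← pword_append, ← pword_append, hv]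
      simp
    have hw : core P (i + 1) (genSucc i p (word b) z') =
        TensorAlgebra.ι K ((0, p) : A.carrier × P.carrier) * inA P (word b) * core P i z' := by
      rw [core_genSucc, unitNorm_word, hb]
    set f' := f ∘ₗ LinearMap.mulLeft K (inA P (word l) *
      TensorAlgebra.ι K ((0, p) : A.carrier × P.carrier)) with hf'
    have hu' : UnitFree f' := hu.comp_mul _
    have hk' : Kills (i + 1) f' := fun v hv => by
      have := hf (l.map Sum.inl ++ Sum.inr p :: v) (by simpa using hv)
      rwa [pword_append, pword_cons, pword_map_inl, ← mul_assoc] at this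
    have ih := congrArg (fun φ : Cochain A (tensorPow P (i + 1)).toGrSpace R => φ (word b) (word m) z')
      (pull_coder hμ i hu' hk')
    have h := congrArg f (coder_pword_mid μ l p v hμ)
    have h3 : (f (spl l fun l₁ l₂ => spl v fun v₁ v₂ => inA P (word l₁) *
        TensorAlgebra.ι K (μ (inA P (word l₂) * TensorAlgebra.ι K ((0, p) : A.carrier × P.carrier) *
          pword P v₁)) * (extSpace P).sgn (pword P v₂))) =
        spl l fun l₁ l₂ => spl b fun b₁ b₂ => f (inA P (word l₁) *
          TensorAlgebra.ι K ((0, P.op (word l₂) (word b₁) p) : A.carrier × P.carrier) *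
          (inA P (A.sgn (word b₂)) * (core P i ((tensorPow P (i + 1)).par z') *
            inA P (A.sgn (word m))))) := by
      rw [spl_hom]
      refine spl_congr fun l₁ l₂ _ => ?_
      rw [spl_hom, hv, spl_append_cons, spl_map, add_eq_left.2 (spl_eq_zero fun v₁ v₂ hv' => ?_)]
      · refine spl_congr fun b₁ b₂ _ => ?_
        have h1 := hf.map_snd (l₁.map Sum.inl)
          ((b₂.map Sum.inl ++ Sum.inr q :: (c'' ++ m.map Sum.inl)).map pureSgn)
          (μ (onceP P (word l₂) (word b₁) p)) (by rw [numP_map_pureSgn]; simp [hc] at hn ⊢; omega)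
        rw [← sgn_pword, pword_map_inl, hμ.quotient] at h1
        rw [pword_map_inl]
        refine h1.trans ?_
        have h2 : pword P (b₂.map Sum.inl ++ Sum.inr q :: (c'' ++ m.map Sum.inl)) =
            inA P (word b₂) * (core P i z' * inA P (word m)) := by
          rw [hz'.core_eq, hc, ← pword_map_inl, ← pword_map_inl, ← pword_append, ← pword_append]
          simp
        have h5 := hu.map_core_par (i := i) (inA P (word l₁) *
          TensorAlgebra.ι K ((0, P.op (word l₂) (word b₁) p) : A.carrier × P.carrier) *
            inA P (A.sgn (word b₂))) (inA P (A.sgn (word m))) z'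
        rw [h2, map_mul (extSpace P).sgn, map_mul (extSpace P).sgn, sgn_inA, sgn_inA]
        simp only [mul_assoc] at h5 ⊢
        exact h5.symm
      · have hc2 : numP v₁ + numP v₂ = i := by
          have := congrArg numP hv'
          rw [hc] at hn
          simp at this hn
          omega
        have := hf.map_mid (l₁.map Sum.inl) (v₂.map pureSgn) (μ (inA P (word l₂) *
          TensorAlgebra.ι K ((0, p) : A.carrier × P.carrier) *
          pword P (b.map Sum.inl ++ Sum.inr q :: v₁))) (by simp; omega)
        rwa [pword_map_inl, ← sgn_pword] at this
    have hpull := hu.pull_genSucc (i := i)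
    have hcomp : Cochain.comp 1 (pull (i + 1) f) (tensorPow P (i + 1 + 1)).op (word l) (word m)
        (genSucc i p (word b) z') =
        (spl l fun l₁ l₂ => spl b fun b₁ b₂ => f (inA P (word l₁) *
          TensorAlgebra.ι K ((0, P.op (word l₂) (word b₁) p) : A.carrier × P.carrier) *
          (inA P (A.sgn (word b₂)) * (core P i ((tensorPow P (i + 1)).par z') *
            inA P (A.sgn (word m)))))) +
        pull i f' (A.coder A.mu (word b)) (A.sgn (word m)) ((tensorPow P (i + 1)).par z') +
        Cochain.comp 1 (pull i f') (tensorPow P (i + 1)).op (word b) (word m) z' := by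
      rw [comp_word_spl, comp_word_spl, spl_comm b m]
      have h1 : ∀ l₁ l₂, l₁ ++ l₂ = l → (spl m fun m₁ m₂ => pull (i + 1) f (word l₁)
          (A.sgnPow 1 (word m₂)) ((tensorPow P (i + 1 + 1)).op (word l₂) (word m₁)
            (genSucc i p (word b) z'))) =
          (spl b fun b₁ b₂ => f (inA P (word l₁) *
            TensorAlgebra.ι K ((0, P.op (word l₂) (word b₁) p) : A.carrier × P.carrier) *
            (inA P (A.sgn (word b₂)) * (core P i ((tensorPow P (i + 1)).par z') *
            inA P (A.sgn (word m)))))) +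
          aug (word (K := K) l₂) • (pull i (f ∘ₗ LinearMap.mulLeft K (inA P (word l₁) *
            TensorAlgebra.ι K ((0, p) : A.carrier × P.carrier)))
              (A.coder A.mu (word b)) (A.sgn (word m)) ((tensorPow P (i + 1)).par z') +
            spl m fun m₁ m₂ => spl b fun b₁ b₂ =>
              pull i (f ∘ₗ LinearMap.mulLeft K (inA P (word l₁) *
                TensorAlgebra.ι K ((0, p) : A.carrier × P.carrier))) (word b₁)
                (A.sgnPow 1 (word m₂)) ((tensorPow P (i + 1)).op (word b₂) (word m₁) z')) := by
        intro l₁ l₂ _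
        have h2 : ∀ m₁ m₂, m₁ ++ m₂ = m → pull (i + 1) f (word l₁) (A.sgnPow 1 (word m₂))
            ((tensorPow P (i + 1 + 1)).op (word l₂) (word m₁)
              (genSucc i p (word b) z')) =
            aug (word (K := K) m₁) • ((spl b fun b₁ b₂ => f (inA P (word l₁) *
              TensorAlgebra.ι K ((0, P.op (word l₂) (word b₁) p) : A.carrier × P.carrier) *
              (inA P (A.sgn (word b₂)) * (core P i ((tensorPow P (i + 1)).par z') *
              inA P (A.sgn (word m₂)))))) +
              aug (word (K := K) l₂) • f (inA P (word l₁) *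
                TensorAlgebra.ι K ((0, p) : A.carrier × P.carrier) * (inA P (A.coder A.mu (word b)) *
                (core P i ((tensorPow P (i + 1)).par z') * inA P (A.sgn (word m₂)))))) +
            aug (word (K := K) l₂) • spl b fun b₁ b₂ => f (inA P (word l₁) *
                TensorAlgebra.ι K ((0, p) : A.carrier × P.carrier) * (inA P (word b₁) *
                (core P i ((tensorPow P (i + 1)).op (word b₂) (word m₁) z') *
                  inA P (A.sgn (word m₂))))) := by
          intro m₁ m₂ _
          rw [genSucc_op, map_add, map_add, map_smul, map_smul, map_smul, spl_hom, spl_hom]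
          simp only [hpull, sgnPow_one, AlgHom.toLinearMap_apply]
          module
        rw [spl_congr h2, spl_add, spl_aug_left, spl_smul, smul_add, ← add_assoc]
        simp only [sgnPow_one, pull_apply, LinearMap.comp_apply, LinearMap.mulLeft_apply, mul_assoc,
          AlgHom.toLinearMap_apply]
      rw [spl_congr h1, spl_add, spl_aug_right, ← add_assoc]
    have hins : (pull (i + 1) f).insertMu (word l) (word m)
        (genSucc i p (word b) z') =
        pull i f' (word b) (A.coder A.mu (word m)) z' +
        f (inA P (A.coder A.mu (word l)) *
          TensorAlgebra.ι K ((0, P.par p) : A.carrier × P.carrier) * (extSpace P).sgn (pword P v)) := by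
      have h5 := hu.map_core_par (i := i) (inA P (A.coder A.mu (word l)) *
          TensorAlgebra.ι K ((0, P.par p) : A.carrier × P.carrier) *
            inA P (A.sgn (word b))) (inA P (A.sgn (word m))) z'
      have h2 := hpull (word l) (A.coder A.mu (word m)) (word b) p z'
      have h3 := hpull (A.coder A.mu (word l)) (A.sgn (word m)) (A.sgn (word b)) (P.par p)
        ((tensorPow P (i + 1)).par z')
      rw [insertMu_apply, genSucc_par, h2, h3, hvw, map_mul (extSpace P).sgn, map_mul (extSpace P).sgn, sgn_inA, sgn_inA]
      simp only [mul_assoc] at h5 ⊢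
      rw [h5, hf', pull_apply]
      simp only [mul_assoc, LinearMap.comp_apply, LinearMap.mulLeft_apply]
    have hl : pull (i + 1) (f ∘ₗ (extSpace P).coder μ) (word l) (word m)
        (genSucc i p (word b) z') = f ((extSpace P).coder μ (inA P (word l) *
          TensorAlgebra.ι K ((0, p) : A.carrier × P.carrier) * pword P v)) := by
      rw [pull_apply, hw, hvw]
      simp only [mul_assoc, LinearMap.comp_apply]
    have ih' : f (inA P (word l) * TensorAlgebra.ι K ((0, p) : A.carrier × P.carrier) *
        (extSpace P).coder μ (pword P v)) =
        Cochain.comp 1 (pull i f') (tensorPow P (i + 1)).op (word b) (word m) z' +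
        (pull i f' (word b) (A.coder A.mu (word m)) z' +
          pull i f' (A.coder A.mu (word b)) (A.sgn (word m)) ((tensorPow P (i + 1)).par z')) := by
      rw [← insertMu_apply, hvw]
      exact ih
    refine hl.trans (h.trans ?_)
    rw [map_add, map_add, h3, ih', LinearMap.add_apply, LinearMap.add_apply, LinearMap.add_apply,
      hcomp, hins]
    abel

end CoderTensorPowers

section PullDegree

variable {K : Type u} [Field K] {A : AInfAlgebra K} {P : BimoduleData A}
variable {X : Type u} [AddCommGroup X] [Module K X]

lemma HomWord.inr {m : ℤ} {p : P.carrier} (hp : p ∈ P.gr m) :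
    HomWord (extSpace P).gr (-1) (m - 2) (TensorAlgebra.ι K ((0, p) : A.carrier × P.carrier)) := by
  have h : ((0, p) : A.carrier × P.carrier) ∈ (extSpace P).gr (m - 1) :=
    Submodule.mem_prod.2 ⟨zero_mem _, by simpa using hp⟩
  have := HomWord.cons (c := -1) h .nil
  rw [mul_one] at this
  convert this using 1
  ring

lemma UnitFree.map_core_mem : ∀ {i : ℕ} {f : Bar (extSpace P) →ₗ[K] X} (_ : UnitFree f)
    {S : ℤ → Submodule K X} (_ : ∀ n x, HomWord (extSpace P).gr (-1) n x → f x ∈ S n)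
    {k m n : ℤ} {u v : Bar (extSpace P)} {z : (tensorPow P (i + 1)).carrier}
    (_ : HomWord (extSpace P).gr (-1) k u) (_ : HomWord (extSpace P).gr (-1) n v)
    (_ : z ∈ (tensorPow P (i + 1)).gr m), f (u * core P i z * v) ∈ S (k + m + n - 2 * (i + 1))
  | 0, f, _, S, hS, k, m, n, u, v, z, hu, hv, hz => by
    have := hS _ _ ((hu.mul (HomWord.inr (p := z) hz)).mul hv)
    rw [show k + m + n - 2 * ((0 : ℕ) + 1) = k + (m - 2) + n by push_cast; ring]
    exact this
  | i + 1, f, hf, S, hS, k, m, n, u, v, z, hu, hv, hz => by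
    suffices h : (tensorPow P (i + 1 + 1)).gr m ≤ (S (k + m + n - 2 * ((i + 1 : ℕ) + 1))).comap
        (f ∘ₗ LinearMap.mulRight K v ∘ₗ LinearMap.mulLeft K u ∘ₗ core P (i + 1)) from h hz
    refine Submodule.span_le.2 ?_
    rintro _ ⟨i₁, i₂, i₃, p, b, z', hp, hb, hz', rfl, rfl⟩
    have h1 := hf.map_core_mem (i := i) hS ((hu.mul (HomWord.inr hp)).mul (hb.inA (P := P))) hv hz'
    have h2 := hf.map_unitNorm (u * TensorAlgebra.ι K ((0, p) : A.carrier × P.carrier))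
      (core P i z' * v) b
    change f (u * core P (i + 1) (genSucc i p b z') * v) ∈
      S (k + (i₁ + i₂ + i₃) + n - 2 * ((i + 1 : ℕ) + 1))
    rw [core_genSucc]
    simp only [mul_assoc] at h1 h2 ⊢
    rw [h2]
    convert h1 using 2
    push_cast; ring

lemma pull_mem_homDeg (i : ℕ) {R : GrSpace K} {f : Bar (extSpace P) →ₗ[K] R} (hf : UnitFree f)
    {s d : ℤ} (hs : ∀ n x, HomWord (extSpace P).gr (-1) n x → f x ∈ R.gr (n + s))
    (hd : d = s - 2 * (i + 1)) : pull i f ∈ homDeg (A := A) (tensorPow P (i + 1)).toGrSpace R d := by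
  refine ⟨⟨fun x x' y => LinearMap.ext fun z => ?_, fun x y y' => LinearMap.ext fun z => ?_⟩,
    fun k m n x y z hx hy hz => ?_⟩
  · have := hf (inA P x) (inA P x' * core P i z * inA P y)
    simpa [pull_apply, mul_assoc] using this
  · have := hf (inA P x * core P i z * inA P y) (inA P y')
    simpa [pull_apply, mul_assoc] using this
  · have := hf.map_core_mem (S := fun n => R.gr (n + s)) hs hx.inA hy.inA hz
    rw [pull_apply]
    convert this using 2
    rw [hd]; ring

end PullDegree

section Spread

variable {K : Type u} [Field K] {A : AInfAlgebra K} {P : BimoduleData A}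
variable {X Y Z : Type u} [AddCommGroup X] [Module K X] [AddCommGroup Y] [Module K Y]
  [AddCommGroup Z] [Module K Z]

variable (P) in
/-- The projection `T(B[1]) → T(A[1])`. -/
def projA : Bar (extSpace P) →ₐ[K] Bar A.toGrSpace :=
  TensorAlgebra.lift K (TensorAlgebra.ι K ∘ₗ LinearMap.fst K A.carrier P.carrier)

variable (P) in
/-- The projection `T(B[1]) → P` to words of length one. -/
def projP : Bar (extSpace P) →ₗ[K] P.carrier := LinearMap.snd K A.carrier P.carrier ∘ₗ len1

lemma projA_ι (b : A.carrier × P.carrier) :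
    projA P (TensorAlgebra.ι K b) = TensorAlgebra.ι K b.1 := by simp [projA]

lemma projA_inA (x : Bar A.toGrSpace) : projA P (inA P x) = x := by
  have : (projA P).comp (inA P) = AlgHom.id K _ := by
    ext a
    change projA P (inA P (TensorAlgebra.ι K a)) = TensorAlgebra.ι K a
    rw [inA_ι, projA_ι]
  exact DFunLike.congr_fun this x

lemma projA_pword (l : List (A.carrier ⊕ P.carrier)) (h : numP l ≠ 0) :
    projA P (pword P l) = 0 := by
  induction l with
  | nil => exact absurd rfl h
  | cons s l ih =>
    rw [pword_cons, map_mul]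
    cases s with
    | inl a => rw [ih (by simpa using h), mul_zero]
    | inr p => rw [projA_ι, letter_inr]; simp

lemma projA_word (l : List (A.carrier × P.carrier)) :
    projA P (word l) = word (l.map Prod.fst) := by
  induction l with
  | nil => simp
  | cons a l ih => rw [word_cons, map_mul, ih, projA_ι, List.map_cons, word_cons]

lemma projP_ι_mul (b : A.carrier × P.carrier) (x : Bar (extSpace P)) :
    projP P (TensorAlgebra.ι K b * x) = aug x • b.2 := by
  simp [projP, len1_mul]

lemma projP_one : projP P 1 = 0 := by simp [projP]

lemma projP_pword (l : List (A.carrier ⊕ P.carrier)) (h : numP l ≠ 1) :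
    projP P (pword P l) = 0 := by
  cases l with
  | nil => rw [pword_nil, projP_one]
  | cons s l =>
    rw [pword_cons, projP_ι_mul]
    cases s with
    | inl a => simp [letter]
    | inr p =>
      cases l with
      | nil => exact absurd rfl h
      | cons t l => rw [pword_cons]; simp

lemma projP_unit (x y : Bar (extSpace P)) :
    projP P (x * TensorAlgebra.ι K ((A.unit, 0) : A.carrier × P.carrier) * y) = 0 := by
  simp [projP, len1_mul]

lemma projA_unit (x y : Bar (extSpace P)) :
    projA P (x * TensorAlgebra.ι K ((A.unit, 0) : A.carrier × P.carrier) * y) =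
      projA P x * TensorAlgebra.ι K A.unit * projA P y := by
  rw [map_mul, map_mul, projA_ι]

lemma conv_unitFree (m : X →ₗ[K] Y →ₗ[K] Z) {f : Bar (extSpace P) →ₗ[K] X}
    {g : Bar (extSpace P) →ₗ[K] Y}
    (hf : ∀ x y z, m (f (x * TensorAlgebra.ι K ((A.unit, 0) : A.carrier × P.carrier) * y)) z = 0)
    (hg : ∀ x y z, m (f z) (g (x * TensorAlgebra.ι K ((A.unit, 0) : A.carrier × P.carrier) * y)) = 0) :
    UnitFree (conv m f g) := fun x y => by
  have key {f : Bar (extSpace P) →ₗ[K] Z} (h : ∀ l, f (word l) = 0) (x : Bar (extSpace P)) :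
      f x = 0 := DFunLike.congr_fun (word_ext (g := 0) h) x
  set e : (extSpace P).carrier := ((A.unit, 0) : A.carrier × P.carrier) with he
  refine key (f := conv m f g ∘ₗ LinearMap.mulLeft K (x * TensorAlgebra.ι K e)) (fun v => ?_) y
  refine key (f := conv m f g ∘ₗ LinearMap.mulRight K (word v) ∘ₗ
    LinearMap.mulRight K (TensorAlgebra.ι K e)) (fun u => ?_) x
  change conv m f g (word u * TensorAlgebra.ι K e * word v) = 0
  rw [word_mid, conv_word_spl, spl_append_cons, spl_eq_zero, spl_eq_zero, add_zero]
  · intro a b _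
    rw [← word_mid, hf]
  · intro a b _
    rw [← word_mid, hg]

variable (P) in
/-- A retraction of `core` which vanishes on words that do not begin and end in `P[1]`. -/
def uncore : ∀ i : ℕ, Bar (extSpace P) →ₗ[K] (tensorPow P (i + 1)).carrier
  | 0 => genZero ∘ₗ projP P
  | i + 1 => conv LinearMap.id (conv (genSucc i) (projP P) (projA P).toLinearMap) (uncore i)

lemma uncore_unitFree : ∀ i : ℕ, UnitFree (uncore P i)
  | 0 => fun x y => by
    change genZero (projP P _) = 0
    rw [projP_unit, map_zero]
  | i + 1 => by
    have h : UnitFree (conv (genSucc i) (projP P) (projA P).toLinearMap) := by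
      refine conv_unitFree _ (fun x y z => ?_) (fun x y z => ?_)
      · rw [projP_unit, map_zero, LinearMap.zero_apply]
      · rw [AlgHom.toLinearMap_apply, projA_unit]
        exact LinearMap.ext fun w => tens_unit _ _ _ _
    refine conv_unitFree _ (fun x y z => ?_) (fun x y z => ?_)
    · rw [h]; rfl
    · rw [uncore_unitFree i, map_zero]

lemma uncore_pword : ∀ {i : ℕ} {l : List (A.carrier ⊕ P.carrier)} (_ : numP l ≠ i + 1),
    uncore P i (pword P l) = 0
  | 0, l, h => by
    change genZero (projP P _) = 0
    rw [projP_pword l (by simpa using h), map_zero]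
  | i + 1, l, h => by
    rw [uncore, pword, conv_word_spl, spl_map]
    refine spl_eq_zero fun u v huv => ?_
    rw [conv_word_spl, spl_map]
    by_cases hv : numP v = i + 1
    · rw [spl_eq_zero, map_zero, LinearMap.zero_apply]
      intro a b hab
      have hn : numP a + numP b + numP v ≠ i + 1 + 1 := by
        rw [← numP_append, hab, ← numP_append, huv]; exact h
      by_cases ha : numP a = 1
      · have := projA_pword b (by omega)
        rw [AlgHom.toLinearMap_apply]
        exact (congrArg _ this).trans (map_zero _)
      · have := projP_pword a ha
        rw [show projP P (word (a.map (letter P))) = 0 from this, map_zero, LinearMap.zero_apply]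
    · exact (congrArg _ (uncore_pword hv)).trans (map_zero _)

lemma uncore_inl (i : ℕ) (a : A.carrier) (l : List (A.carrier ⊕ P.carrier)) :
    uncore P i (pword P (Sum.inl a :: l)) = 0 := by
  have h : ∀ l, projP P (pword P (Sum.inl a :: l)) = 0 := fun l => by
    rw [pword_cons, projP_ι_mul]; simp [letter]
  cases i with
  | zero => change genZero (projP P _) = 0; rw [h, map_zero]
  | succ i =>
    rw [uncore, pword, conv_word_spl, spl_map]
    refine spl_eq_zero fun u v huv => ?_
    rw [conv_word_spl, spl_map, spl_eq_zero, map_zero, LinearMap.zero_apply]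
    intro b c hbc
    cases b with
    | nil =>
      rw [show projP P (word (([] : List (A.carrier ⊕ P.carrier)).map (letter P))) = 0 by
        simp [projP_one], map_zero, LinearMap.zero_apply]
    | cons t b =>
      obtain rfl : t = Sum.inl a := by
        rw [← hbc] at huv
        exact (List.cons.inj huv).1
      rw [show projP P (word ((Sum.inl a :: b).map (letter P))) = 0 from h b, map_zero,
        LinearMap.zero_apply]

lemma uncore_rep : ∀ {i : ℕ} {z : (tensorPow P (i + 1)).carrier} {c : List (A.carrier ⊕ P.carrier)}
    (_ : Rep P i z c) (m : List A.carrier),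
    uncore P i (pword P (c ++ m.map Sum.inl)) = aug (word (K := K) m) • z
  | 0, z, c, ⟨p, hz, hc⟩, m => by
    rw [hz, hc]
    change genZero (projP P _) = _
    rw [List.cons_append, List.nil_append, pword_cons, projP_ι_mul, map_smul, pword_map_inl,
      aug_inA, letter_inr]
  | i + 1, z, c, ⟨p, b, z', c', hz', hb, hz, hc⟩, m => by
    obtain ⟨q, c'', hc'⟩ := hz'.exists_cons
    subst hz hc
    have h0 : projP P (1 : Bar (extSpace P)) = 0 := projP_one
    have h1 : ∀ t : List (A.carrier ⊕ P.carrier), conv (genSucc i) (projP P) (projA P).toLinearMap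
        (word ((Sum.inr p :: t).map (letter P))) = genSucc i p (projA P (pword P t)) := by
      intro t
      rw [conv_word_spl, List.map_cons, spl_cons, spl_left]
      · rw [word_nil, h0, word_singleton, ← mul_one (TensorAlgebra.ι K _), projP_ι_mul]
        simp [letter]
        rfl
      · intro a u v _
        rw [word_cons, projP_ι_mul, aug_word_cons, zero_smul, map_zero, LinearMap.zero_apply]
    have h2 : Sum.inr p :: (b.map Sum.inl ++ c') ++ m.map Sum.inl =
      Sum.inr p :: (b.map Sum.inl ++ Sum.inr q :: (c'' ++ m.map Sum.inl)) := by simp [hc']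
    have h3 : conv (genSucc i) (projP P) (projA P).toLinearMap (1 : Bar (extSpace P)) = 0 := by
      have := conv_word_spl (genSucc i) (projP P) (projA P).toLinearMap []
      simpa [h0] using this
    rw [h2, uncore, pword, conv_word_spl, spl_map, spl_cons, List.map_nil, word_nil, h3,
      spl_congr (fun u v _ => by rw [h1]), spl_append_cons, spl_map,
      spl_right, spl_eq_zero]
    · have := uncore_rep hz' m
      rw [hc', List.cons_append] at this
      rw [List.map_nil, List.nil_append, pword_map_inl, projA_inA]
      change 0 + (genSucc i p (word b) (uncore P i (pword P _)) + 0) = _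
      rw [this, map_smul, zero_add, add_zero]
    · intro u v _
      rw [projA_pword _ (by simp), map_zero, map_zero, LinearMap.zero_apply]
    · intro u a v _
      rw [List.map_cons, List.cons_append]
      change genSucc i p _ (uncore P i (pword P _)) = 0
      rw [uncore_inl, map_zero]

end Spread

section SpreadMaps

variable {K : Type u} [Field K] {A : AInfAlgebra K} {P : BimoduleData A} {R : GrSpace K}

/-- Extension by zero of a family of maps on the `i + 1`-st tensor power to `T(B[1])`. -/
def spread (i : ℕ) (ψ : Cochain A (tensorPow P (i + 1)).toGrSpace R) :
    Bar (extSpace P) →ₗ[K] R :=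
  conv LinearMap.id (conv (LinearMap.lflip.toLinearMap ∘ₗ ψ) (projA P).toLinearMap (uncore P i))
    (projA P).toLinearMap

lemma spread_word (i : ℕ) (ψ : Cochain A (tensorPow P (i + 1)).toGrSpace R)
    (l : List (A.carrier × P.carrier)) :
    spread i ψ (word l) = spl l fun u s => spl u fun a v =>
      ψ (projA P (word a)) (projA P (word s)) (uncore P i (word v)) := by
  rw [spread, conv_word_spl]
  refine spl_congr fun u s _ => ?_
  rw [conv_word_spl, LinearMap.id_apply, spl_apply]
  rfl

lemma spread_pword_spl (i : ℕ) (ψ : Cochain A (tensorPow P (i + 1)).toGrSpace R)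
    (l : List (A.carrier ⊕ P.carrier)) :
    spread i ψ (pword P l) = spl l fun u s => spl u fun a v =>
      ψ (projA P (pword P a)) (projA P (pword P s)) (uncore P i (pword P v)) := by
  rw [pword, spread_word, spl_map]
  refine spl_congr fun u s _ => ?_
  rw [spl_map]
  rfl

lemma spread_unitFree (i : ℕ) {ψ : Cochain A (tensorPow P (i + 1)).toGrSpace R}
    (hψ : ψ.Normalized) : UnitFree (spread i ψ) := by
  refine conv_unitFree _ (fun x y z => ?_) (fun x y z => ?_)
  · rw [conv_unitFree _ (fun x y w => ?_) (fun x y w => ?_)]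
    · rfl
    · rw [AlgHom.toLinearMap_apply, projA_unit]
      refine LinearMap.ext fun v => ?_
      exact DFunLike.congr_fun (hψ.1 _ _ v) w
    · rw [uncore_unitFree, map_zero]
  · rw [AlgHom.toLinearMap_apply, projA_unit]
    set y' := projA P x * TensorAlgebra.ι K A.unit * projA P y with hy'
    refine DFunLike.congr_fun (f := (LinearMap.applyₗ y').comp
      (conv (LinearMap.lflip.toLinearMap ∘ₗ ψ) (projA P).toLinearMap (uncore P i))) (g := 0)
      (word_ext fun l => ?_) z
    rw [LinearMap.comp_apply, conv_word_spl, spl_hom]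
    refine spl_eq_zero fun u v _ => ?_
    exact DFunLike.congr_fun (hψ.2 _ _ _) _

lemma spread_pword {i : ℕ} (ψ : Cochain A (tensorPow P (i + 1)).toGrSpace R)
    {l : List (A.carrier ⊕ P.carrier)} (h : numP l ≠ i + 1) : spread i ψ (pword P l) = 0 := by
  rw [spread_pword_spl]
  refine spl_eq_zero fun u s hus => spl_eq_zero fun a v hav => ?_
  by_cases hs : numP s = 0
  · by_cases ha : numP a = 0
    · rw [uncore_pword, map_zero]
      rw [← hus, ← hav] at h
      simp at h
      omega
    · rw [projA_pword a ha, map_zero, LinearMap.zero_apply, LinearMap.zero_apply]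
  · rw [projA_pword s hs, map_zero, LinearMap.zero_apply]

lemma pull_spread (i : ℕ) (ψ : Cochain A (tensorPow P (i + 1)).toGrSpace R) :
    pull i (spread i ψ) = ψ := by
  refine word_ext fun l => word_ext fun m => Rep.ext fun z c hz => ?_
  rw [pull_apply, hz.core_eq, ← pword_map_inl, ← pword_map_inl, ← pword_append, ← pword_append]
  obtain ⟨p, c₁, h₁⟩ := hz.exists_cons
  obtain ⟨q, c₂, h₂⟩ := hz.exists_append
  have h3 : ∀ m₁ s, (spl (l.map Sum.inl ++ c ++ m₁.map Sum.inl) fun a v =>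
      ψ (projA P (pword P a)) (word s) (uncore P i (pword P v))) =
      aug (word (K := K) m₁) • ψ (word l) (word s) z := by
    intro m₁ s
    rw [h₁, List.append_assoc, List.cons_append, spl_append_cons, spl_map, spl_right,
      spl_eq_zero, add_zero, List.map_nil, List.nil_append, pword_map_inl, projA_inA,
      ← List.cons_append, ← h₁, uncore_rep hz, map_smul]
    · intro u v _
      rw [projA_pword _ (by simp), map_zero, LinearMap.zero_apply, LinearMap.zero_apply]
    · intro u a v _
      rw [List.map_cons, List.cons_append, uncore_inl, map_zero]
  have h4 : l.map Sum.inl ++ c ++ m.map Sum.inl =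
      (l.map Sum.inl ++ c₂) ++ Sum.inr q :: m.map Sum.inl := by simp [h₂]
  have h5 : ∀ a : List A.carrier, l.map Sum.inl ++ c₂ ++ Sum.inr q :: a.map Sum.inl =
      l.map Sum.inl ++ c ++ a.map Sum.inl := fun a => by simp [h₂]
  rw [spread_pword_spl, h4, spl_append_cons, spl_eq_zero, zero_add, spl_map]
  · rw [spl_left]
    · have := h3 [] m
      rw [List.map_nil, List.append_nil] at this
      rw [h5, List.map_nil, List.append_nil, pword_map_inl, projA_inA, this]
      simp
    · intro a u v _
      rw [h5, pword_map_inl, projA_inA, h3, aug_word_cons, zero_smul]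
  · intro u v _
    refine spl_eq_zero fun a b _ => ?_
    rw [projA_pword (v ++ Sum.inr q :: m.map Sum.inl) (by simp), map_zero, LinearMap.zero_apply]

lemma HomList.map_fst {n : ℤ} {l : List (A.carrier × P.carrier)}
    (h : HomList (extSpace P).gr (-1) n l) : HomList A.gr (-1) n (l.map Prod.fst) := by
  induction l generalizing n with
  | nil => exact h
  | cons a l ih =>
    obtain ⟨m, k, ha, hl, hn⟩ := h
    exact ⟨m, k, (Submodule.mem_prod.1 ha).1, ih hl, hn⟩

lemma projP_mem {n : ℤ} {l : List (A.carrier × P.carrier)}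
    (h : HomList (extSpace P).gr (-1) n l) : projP P (word l) ∈ P.gr (n + 2) := by
  cases l with
  | nil => rw [word_nil, projP_one]; exact zero_mem _
  | cons a l =>
    obtain ⟨m, k, ha, hl, hn⟩ := h
    rw [word_cons, projP_ι_mul]
    cases l with
    | nil =>
      have h0 : k = 0 := hl
      have := (Submodule.mem_prod.1 ha).2
      refine Submodule.smul_mem _ _ ?_
      convert this using 2
      omega
    | cons => simp

lemma uncore_mem : ∀ {i : ℕ} {n : ℤ} {l : List (A.carrier × P.carrier)}
    (_ : HomList (extSpace P).gr (-1) n l),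
    uncore P i (word l) ∈ (tensorPow P (i + 1)).gr (n + 2 * (i + 1))
  | 0, n, l, h => by
    have := projP_mem h
    rw [show n + 2 * ((0 : ℕ) + 1) = n + 2 by push_cast; ring]
    exact this
  | i + 1, n, l, h => by
    rw [uncore, conv_word_spl]
    refine spl_mem fun u v huv => ?_
    rw [conv_word_spl, LinearMap.id_apply, spl_apply]
    refine spl_mem fun a b hab => ?_
    subst huv hab
    obtain ⟨m, k, rfl, hav, hs⟩ := h.split
    obtain ⟨m, j, rfl, ha, hv⟩ := hav.split
    rw [AlgHom.toLinearMap_apply, projA_word]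
    rw [show m + j + k + 2 * ((i + 1 : ℕ) + 1 : ℤ) = m + 2 + j + (k + 2 * (i + 1)) by
      push_cast; ring]
    exact tens_mem (projP_mem ha) hv.map_fst.homWord (uncore_mem hs) rfl

/-- A map of degree `d` on the `i + 1`-st tensor power spreads to a map of degree
`d + 2 (i + 1)` on `T(B[1])`. -/
lemma spread_mem {i : ℕ} {d : ℤ} {ψ : Cochain A (tensorPow P (i + 1)).toGrSpace R}
    (hψ : ψ.HasDegree d) {n : ℤ} {x : Bar (extSpace P)} (hx : HomWord (extSpace P).gr (-1) n x) :
    spread i ψ x ∈ R.gr (n + (d + 2 * (i + 1))) := by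
  obtain ⟨l, rfl, hl⟩ := hx.exists_word
  rw [spread_word]
  refine spl_mem fun u s hus => spl_mem fun a v hav => ?_
  subst hus hav
  obtain ⟨m, k, rfl, hav, hs⟩ := hl.split
  obtain ⟨m, j, rfl, ha, hv⟩ := hav.split
  rw [projA_word, projA_word]
  have := hψ _ _ _ _ _ _ ha.map_fst.homWord hs.map_fst.homWord (uncore_mem (i := i) hv)
  convert this using 2
  ring

end SpreadMaps

section LocallyFinite

/-- The sum of a locally finite sequence of linear maps. -/
def lsum {K X Y : Type*} [Field K] [AddCommGroup X] [Module K X] [AddCommGroup Y] [Module K Y]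
    (g : ℕ → X →ₗ[K] Y) (h : ∀ x, ∃ N, ∀ k, N ≤ k → g k x = 0) : X →ₗ[K] Y :=
  have hf : ∀ x, (Function.support fun k => g k x).Finite := fun x => by
    obtain ⟨N, hN⟩ := h x
    refine (Set.finite_lt_nat N).subset fun k hk => ?_
    by_contra hkN
    exact hk (hN k (not_lt.1 hkN))
  { toFun := fun x => ∑ᶠ k, g k x
    map_add' := fun x y => by
      simp only [map_add]
      exact finsum_add_distrib (hf x) (hf y)
    map_smul' := fun c x => by
      simp only [map_smul, RingHom.id_apply]
      exact (smul_finsum' c (hf x)).symm }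

lemma lsum_apply {K X Y : Type*} [Field K] [AddCommGroup X] [Module K X] [AddCommGroup Y]
    [Module K Y] (g : ℕ → X →ₗ[K] Y) (h : ∀ x, ∃ N, ∀ k, N ≤ k → g k x = 0) {x : X} {N : ℕ}
    (hN : ∀ k, N ≤ k → g k x = 0) : lsum g h x = ∑ k ∈ Finset.range N, g k x := by
  refine finsum_eq_sum_of_support_subset _ fun k hk => ?_
  by_contra hkN
  exact hk (hN k (by simpa using hkN))

end LocallyFinite

section BarHom

variable {K : Type u} [Field K] {M : GrSpace K}
variable {X Y Z : Type u} [AddCommGroup X] [Module K X] [AddCommGroup Y] [Module K Y]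
  [AddCommGroup Z] [Module K Z]

lemma convPow_succ_word (f : Bar M →ₗ[K] Bar M) (k : ℕ) (l : List M) :
    convPow f (k + 1) (word l) = spl l fun u v => f (word u) * convPow f k (word v) := by
  rw [convPow, conv_word_spl]
  rfl

lemma convPow_word_eq_zero {f : Bar M →ₗ[K] Bar M} (hf : f 1 = 0) : ∀ (k : ℕ) (l : List M),
    l.length < k → convPow f k (word l) = 0
  | k + 1, l, h => by
    rw [convPow_succ_word]
    refine spl_eq_zero fun u v huv => ?_
    cases u with
    | nil => rw [word_nil, hf, zero_mul]
    | cons a u =>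
      rw [convPow_word_eq_zero hf k v, mul_zero]
      rw [← huv] at h
      simp at h
      omega

lemma convPow_locallyFinite {f : Bar M →ₗ[K] Bar M} (hf : f 1 = 0) (x : Bar M) :
    ∃ N, ∀ k, N ≤ k → convPow f k x = 0 := by
  have hx : x ∈ Submodule.span K (Set.range (word (K := K) (E := M.carrier))) := by
    rw [span_word]; trivial
  induction hx using Submodule.span_induction with
  | mem x hx =>
    obtain ⟨l, rfl⟩ := hx
    exact ⟨l.length + 1, fun k hk => convPow_word_eq_zero hf k l hk⟩
  | zero => exact ⟨0, fun k _ => map_zero _⟩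
  | add x y _ _ hx hy =>
    obtain ⟨m, hm⟩ := hx
    obtain ⟨n, hn⟩ := hy
    exact ⟨max m n, fun k hk => by
      rw [map_add, hm k (le_of_max_le_left hk), hn k (le_of_max_le_right hk), add_zero]⟩
  | smul c x _ hx =>
    obtain ⟨m, hm⟩ := hx
    exact ⟨m, fun k hk => by rw [map_smul, hm k hk, smul_zero]⟩

/-- The map of bar words `e₁ ⋯ eₙ ↦ ∑ φ(w₁) ⋯ φ(w_r)`, the sum being over all ways of cutting
the word into pieces. -/
def hat (φ : Bar M →ₗ[K] M) (hφ : φ 1 = 0) : Bar M →ₗ[K] Bar M :=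
  lsum (convPow (TensorAlgebra.ι K ∘ₗ φ)) (convPow_locallyFinite (by simp [hφ]))

variable {φ φ' : Bar M →ₗ[K] M} (hφ : φ 1 = 0) (hφ' : φ' 1 = 0)

lemma hat_word (l : List M) {N : ℕ} (h : l.length < N) : hat φ hφ (word l) =
    ∑ r ∈ Finset.range N, convPow (TensorAlgebra.ι K ∘ₗ φ) r (word l) :=
  lsum_apply _ _ fun k hk => convPow_word_eq_zero (by simp [hφ]) k l (h.trans_le hk)

lemma hat_word_eq (l : List M) : hat φ hφ (word l) = algebraMap K _ (aug (word l)) +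
    spl l fun u v => TensorAlgebra.ι K (φ (word u)) * hat φ hφ (word v) := by
  rw [hat_word hφ l (N := l.length + 1 + 1) (by omega), Finset.sum_range_succ', add_comm]
  congr 1
  simp_rw [convPow_succ_word]
  have : ∀ v : List M, v.length < l.length + 1 → hat φ hφ (word v) =
      ∑ r ∈ Finset.range (l.length + 1), convPow (TensorAlgebra.ι K ∘ₗ φ) r (word v) :=
    fun v hv => hat_word hφ v hv
  simp only [spl]
  rw [Finset.sum_comm]
  refine Finset.sum_congr rfl fun i _ => ?_
  rw [this _ (by rw [List.length_drop]; omega), Finset.mul_sum]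
  rfl

lemma hat_eq : hat φ hφ =
    Algebra.linearMap K (Bar M) ∘ₗ (aug (K := K) (E := M.carrier)).toLinearMap +
      star (TensorAlgebra.ι K ∘ₗ φ) (hat φ hφ) := word_ext fun l => by
  rw [hat_word_eq, LinearMap.add_apply, star_word]
  rfl

@[simp] lemma hat_one : hat φ hφ 1 = 1 := by
  have := hat_word_eq hφ []
  simpa [hφ] using this

lemma star_unit (g : Bar M →ₗ[K] Bar M) :
    star (Algebra.linearMap K (Bar M) ∘ₗ (aug (K := K) (E := M.carrier)).toLinearMap) g = g :=
  word_ext fun l => by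
  rw [star_word]
  have : (spl l fun u v => aug (word (K := K) u) • g (word v)) = g (word l) := spl_aug_left l _
  rw [← this]
  refine spl_congr fun u v _ => ?_
  rw [Algebra.smul_def]
  rfl

lemma eq_zero_of_eq_star {f : Bar M →ₗ[K] Bar M} (hf : f 1 = 0) {y : Bar M →ₗ[K] Bar M} (h : y = star f y) : y = 0 := by
  suffices h' : ∀ n, ∀ l : List M, l.length ≤ n → y (word l) = 0 from word_ext fun l => h' _ l le_rfl
  intro n
  induction n with
  | zero =>
    intro l hl
    rw [h, star_word, List.length_eq_zero_iff.1 (Nat.le_zero.1 hl), spl_nil, word_nil, hf, zero_mul]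
  | succ n ih =>
    intro l hl
    rw [h, star_word]
    refine spl_eq_zero fun u v huv => ?_
    cases u with
    | nil => rw [word_nil, hf, zero_mul]
    | cons a u =>
      rw [ih, mul_zero]
      rw [← huv] at hl
      simp at hl
      omega

lemma star_add_left (a b c : Bar M →ₗ[K] Bar M) : star (a + b) c = star a c + star b c := by
  simp [star]

lemma star_sub_left (a b c : Bar M →ₗ[K] Bar M) : star (a - b) c = star a c - star b c := by
  simp [star]

lemma star_sub_right (a b c : Bar M →ₗ[K] Bar M) : star a (b - c) = star a b - star a c := by
  simp [star]

/-- The equation `y = φ ⋆ y + g` has a unique solution. -/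
lemma eq_star_hat {y g : Bar M →ₗ[K] Bar M} (h : y = star (TensorAlgebra.ι K ∘ₗ φ) y + g) :
    y = star (hat φ hφ) g := by
  have h1 : star (hat φ hφ) g =
      g + star (TensorAlgebra.ι K ∘ₗ φ) (star (hat φ hφ) g) := by
    conv_lhs => rw [hat_eq hφ, star_add_left, star_unit, star_assoc]
  rw [← sub_eq_zero]
  apply eq_zero_of_eq_star (f := TensorAlgebra.ι K ∘ₗ φ) (by simp [hφ])
  rw [star_sub_right]
  nth_rewrite 1 [h]
  nth_rewrite 1 [h1]
  abel

/-- The resolvent identity. -/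
lemma hat_sub_hat : hat φ' hφ' - hat φ hφ =
    star (hat φ hφ) (star (TensorAlgebra.ι K ∘ₗ (φ' - φ)) (hat φ' hφ')) := by
  apply eq_star_hat hφ
  conv_lhs => rw [hat_eq hφ, hat_eq hφ']
  rw [LinearMap.comp_sub, star_sub_right, star_sub_left]
  abel

lemma conv_ι_mul (m : X →ₗ[K] Y →ₗ[K] Z) (g : Bar M →ₗ[K] X) (h : Bar M →ₗ[K] Y) (a : M)
    (x : Bar M) : conv m g h (TensorAlgebra.ι K a * x) = m (g 1) (h (TensorAlgebra.ι K a * x)) +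
      conv m (g ∘ₗ LinearMap.mulLeft K (TensorAlgebra.ι K a)) h x := by
  rw [conv_apply, conv_apply, deconc_ι_mul, map_add]
  congr 1
  refine DFunLike.congr_fun (f := TensorProduct.lift (m.compl₁₂ g h) ∘ₗ
    LinearMap.mulLeft K (TensorAlgebra.ι K a ⊗ₜ[K] (1 : Bar M))) ?_ (deconc x)
  ext
  simp

/-- `hat` is compatible with deconcatenation. -/
lemma conv_hat (m : X →ₗ[K] Y →ₗ[K] Z)
    (g : Bar M →ₗ[K] X) (h : Bar M →ₗ[K] Y) : conv m g h ∘ₗ hat φ hφ =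
      conv m (g ∘ₗ hat φ hφ) (h ∘ₗ hat φ hφ) := by
  set H := hat φ hφ with hH
  have e (l : List M) : H (word l) = algebraMap K _ (aug (word l)) +
      spl l fun u v => TensorAlgebra.ι K (φ (word u)) * H (word v) := hat_word_eq hφ l
  have h1 (g : Bar M →ₗ[K] X) (h : Bar M →ₗ[K] Y) : conv m g h 1 = m (g 1) (h 1) := by
    rw [conv_apply, deconc_one]; simp
  suffices key : ∀ n, ∀ (g : Bar M →ₗ[K] X) (l : List M), l.length ≤ n →
      conv m g h (H (word l)) = spl l fun u v => m (g (H (word u))) (h (H (word v))) by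
    refine word_ext fun l => ?_
    rw [conv_word_spl]
    exact key _ g l le_rfl
  intro n
  induction n with
  | zero =>
    intro g l hl
    rw [List.length_eq_zero_iff.1 (Nat.le_zero.1 hl), spl_nil, word_nil, hH, hat_one, conv_apply,
      deconc_one]
    simp
  | succ n ih =>
    intro g l hl
    have step : ∀ u v : List M, u ++ v = l → conv m g h (TensorAlgebra.ι K (φ (word u)) * H (word v)) =
        m (g 1) (h (TensorAlgebra.ι K (φ (word u)) * H (word v))) + spl v fun a b =>
          m (g (TensorAlgebra.ι K (φ (word u)) * H (word a))) (h (H (word b))) := by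
      intro u v huv
      rw [conv_ι_mul]
      congr 1
      cases u with
      | nil =>
        have h0 : TensorAlgebra.ι K (φ (word [])) = 0 := by simp [hφ]
        rw [h0]
        simp [conv_apply]
      | cons c u =>
        rw [ih _ v (by rw [← huv] at hl; simp at hl; omega)]
        rfl
    have h2 : ∀ u v : List M, u ++ v = l → m (g (H (word u))) (h (H (word v))) =
        aug (word (K := K) u) • m (g 1) (h (H (word v))) + spl u fun a b =>
          m (g (TensorAlgebra.ι K (φ (word a)) * H (word b))) (h (H (word v))) := by
      intro u v _
      rw [e u, map_add, map_add, LinearMap.add_apply, spl_hom, spl_hom, spl_apply,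
        Algebra.algebraMap_eq_smul_one, map_smul, map_smul, LinearMap.smul_apply]
    have h3 : m (g 1) (h (H (word l))) = aug (word (K := K) l) • m (g 1) (h 1) +
        spl l fun u v => m (g 1) (h (TensorAlgebra.ι K (φ (word u)) * H (word v))) := by
      rw [e l, map_add, map_add, spl_hom, spl_hom, Algebra.algebraMap_eq_smul_one, map_smul,
        map_smul]
    rw [e l, map_add, spl_hom, spl_congr step, spl_congr h2, spl_add, spl_add, spl_coassoc,
      spl_aug_left l fun u v => m (g 1) (h (H (word v))), h3, Algebra.algebraMap_eq_smul_one,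
      map_smul, h1, add_assoc]

lemma aug_hat (x : Bar M) : aug (hat φ hφ x) = aug x := by
  refine DFunLike.congr_fun (f := aug.toLinearMap ∘ₗ hat φ hφ)
    (g := aug.toLinearMap) (word_ext fun l => ?_) x
  change aug (hat φ hφ (word l)) = aug (word l)
  rw [hat_word_eq, map_add, spl_hom, spl_eq_zero fun u v _ => by simp]
  simp

lemma len1_hat (x : Bar M) : len1 (hat φ hφ x) = φ x := by
  refine DFunLike.congr_fun (f := len1 ∘ₗ hat φ hφ)
    (g := φ) (word_ext fun l => ?_) x
  have h : (spl l fun u v => aug (word (K := K) v) • φ (word u)) = φ (word l) :=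
    spl_aug_right l fun u v => φ (word u)
  rw [← h, LinearMap.comp_apply, hat_word_eq, map_add, spl_hom, Algebra.algebraMap_eq_smul_one,
    map_smul, len1_one, smul_zero, zero_add]
  refine spl_congr fun u v _ => ?_
  rw [len1_mul, aug_ι, zero_smul, zero_add, aug_hat, len1_ι]

lemma sgn_hat (hs : ∀ x, M.par (φ x) = -φ (M.sgn x)) (x : Bar M) :
    M.sgn (hat φ hφ x) = hat φ hφ (M.sgn x) := by
  set H := hat φ hφ with hH
  rw [← sub_eq_zero]
  refine DFunLike.congr_fun (f := M.sgn.toLinearMap ∘ₗ H - H ∘ₗ M.sgn.toLinearMap) (g := 0)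
    (eq_zero_of_eq_star (f := M.sgn.toLinearMap ∘ₗ TensorAlgebra.ι K ∘ₗ φ) (by simp [hφ]) ?_) x
  refine word_ext fun l => ?_
  rw [star_word]
  have h1 : H (M.sgn (word l)) = algebraMap K _ (aug (word l)) +
      spl l fun u v => M.sgn (TensorAlgebra.ι K (φ (word u))) * H (M.sgn (word v)) := by
    rw [sgn_word, hH, hat_word_eq, spl_map, ← sgn_word, ← sgnPow_one_apply, aug_sgnPow]
    congr 1
    refine spl_congr fun u v _ => ?_
    rw [← sgn_word, ← sgn_word, sgn_ι, hs, map_neg, neg_neg]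
  have h2 : M.sgn (H (word l)) = algebraMap K _ (aug (word l)) +
      spl l fun u v => M.sgn (TensorAlgebra.ι K (φ (word u))) * M.sgn (H (word v)) := by
    rw [hH, hat_word_eq, map_add, spl_hom, AlgHom.commutes]
    simp only [map_mul M.sgn]
  have h3 : ∀ u, TensorAlgebra.ι K (φ (M.sgn u)) = M.sgn (TensorAlgebra.ι K (φ u)) := fun u => by
    rw [sgn_ι, hs, map_neg, neg_neg]
  change M.sgn (H (word l)) - H (M.sgn (word l)) = _
  rw [h1, h2, add_sub_add_left_eq_sub, ← spl_sub]
  refine spl_congr fun u v _ => ?_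
  rw [← mul_sub]
  rfl

lemma hat_coder (μ : Bar M →ₗ[K] M) : hat φ hφ ∘ₗ M.coder μ = star (hat φ hφ)
    (star (TensorAlgebra.ι K ∘ₗ φ ∘ₗ M.coder μ) (hat φ hφ ∘ₗ M.sgnPow 1)) := by
  apply eq_star_hat hφ
  nth_rewrite 1 [hat_eq hφ]
  rw [LinearMap.add_comp, star_coder]
  have : (Algebra.linearMap K (Bar M) ∘ₗ (aug (K := K) (E := M.carrier)).toLinearMap) ∘ₗ
      M.coder μ = 0 := LinearMap.ext fun x => by simp [aug_coder]
  rw [this, zero_add, add_comm]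
  rfl

lemma coder_hat (hs : ∀ x, M.par (φ x) = -φ (M.sgn x)) (μ : Bar M →ₗ[K] M) :
    M.coder μ ∘ₗ hat φ hφ =
    star (hat φ hφ) (star (TensorAlgebra.ι K ∘ₗ μ ∘ₗ
      hat φ hφ) (hat φ hφ ∘ₗ M.sgnPow 1)) := by
  have h : M.sgn.toLinearMap ∘ₗ hat φ hφ =
      hat φ hφ ∘ₗ M.sgnPow 1 := by
    rw [sgnPow_one]
    exact LinearMap.ext (sgn_hat hφ hs)
  rw [GrSpace.coder, conv_hat, conv_hat, h]
  rfl

/-- The failure of `φ` to be a homomorphism from `μ` to `μ'`. -/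
def homDefect (μ μ' φ : Bar M →ₗ[K] M) (hφ : φ 1 = 0) : Bar M →ₗ[K] M :=
  μ' ∘ₗ hat φ hφ - φ ∘ₗ M.coder μ

/-- The equation which the failure of `φ` to be a homomorphism always satisfies. -/
lemma homDefect_closed {μ μ' : Bar M →ₗ[K] M} {e : M} (hs : ∀ x, M.par (φ x) = -φ (M.sgn x))
    (hμ : IsAInf M e μ) (hμ' : IsAInf M e μ') :
    μ' ∘ₗ star (hat φ hφ) (star (TensorAlgebra.ι K ∘ₗ homDefect μ μ' φ hφ)
      (hat φ hφ ∘ₗ M.sgnPow 1)) + homDefect μ μ' φ hφ ∘ₗ M.coder μ = 0 := by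
  have h1 := coder_hat hφ hs μ'
  have h2 := hat_coder hφ μ
  set H := hat φ hφ with hH
  have h3 : star H (star (TensorAlgebra.ι K ∘ₗ homDefect μ μ' φ hφ) (H ∘ₗ M.sgnPow 1)) =
      M.coder μ' ∘ₗ H - H ∘ₗ M.coder μ := by
    rw [h1, h2, ← star_sub_right, ← star_sub_left, ← LinearMap.comp_sub]
    rfl
  rw [h3]
  ext x
  have h4 := hμ'.assoc (H x)
  have h5 := hμ.coder_coder x
  simp [homDefect, h4, h5, ← hH]

lemma homDefect_apply (μ μ' : Bar M →ₗ[K] M) (x : Bar M) :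
    homDefect μ μ' φ hφ x = μ' (hat φ hφ x) - φ (M.coder μ x) := rfl

lemma homDefect_eq_zero_iff (μ μ' : Bar M →ₗ[K] M) : homDefect μ μ' φ hφ = 0 ↔
    ∀ l : List M, ∑ r ∈ Finset.range (l.length + 1),
      μ' (convPow (TensorAlgebra.ι K ∘ₗ φ) r (word l)) = φ (M.coder μ (word l)) := by
  have h (l : List M) : homDefect μ μ' φ hφ (word l) = ∑ r ∈ Finset.range (l.length + 1),
      μ' (convPow (TensorAlgebra.ι K ∘ₗ φ) r (word l)) - φ (M.coder μ (word l)) := by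
    rw [homDefect_apply, hat_word hφ l (Nat.lt_succ_self _), map_sum]
  refine ⟨fun h0 l => ?_, fun h0 => word_ext fun l => ?_⟩
  · rw [← sub_eq_zero, ← h, h0, LinearMap.zero_apply]
  · rw [h, h0, sub_self, LinearMap.zero_apply]

/-- The effect of a change of `φ` on its failure to be a homomorphism. -/
lemma homDefect_sub (μ μ' : Bar M →ₗ[K] M) : homDefect μ μ' φ' hφ' - homDefect μ μ' φ hφ =
    μ' ∘ₗ star (hat φ hφ) (star (TensorAlgebra.ι K ∘ₗ (φ' - φ)) (hat φ' hφ')) -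
      (φ' - φ) ∘ₗ M.coder μ := by
  rw [← hat_sub_hat]
  ext x
  simp [homDefect_apply]
  abel

lemma hat_len1 : hat (len1 (K := K) (E := M.carrier)) len1_one = LinearMap.id := by
  rw [eq_comm, ← sub_eq_zero]
  refine eq_zero_of_eq_star (f := TensorAlgebra.ι K ∘ₗ len1) (by simp) ?_
  rw [star_sub_right]
  have h : star (TensorAlgebra.ι K ∘ₗ len1) LinearMap.id = LinearMap.id -
      Algebra.linearMap K (Bar M) ∘ₗ (aug (K := K) (E := M.carrier)).toLinearMap := by
    refine word_ext fun l => ?_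
    rw [star_word]
    cases l with
    | nil => simp
    | cons a l =>
      rw [spl_cons]
      have h1 : ∀ u : List M, len1 (word (K := K) (a :: u)) = aug (word (K := K) u) • a := fun u => by
        simp [word_cons, len1_mul]
      have h2 : ∀ u v : List M, (TensorAlgebra.ι K ∘ₗ len1) (word (K := K) (a :: u)) *
          LinearMap.id (R := K) (word (K := K) v) =
          aug (word (K := K) u) • (TensorAlgebra.ι K a * word v) := fun u v => by
        simp [h1]
      simp_rw [h2]
      rw [spl_aug_left l fun u v => TensorAlgebra.ι K a * word v]
      simp [word_cons]
  rw [h]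
  nth_rewrite 1 [hat_eq len1_one]
  abel

lemma homDefect_len1 (μ μ' : Bar M →ₗ[K] M) : homDefect μ μ' len1 len1_one = μ' - μ := by
  rw [homDefect, hat_len1]
  ext x
  simp [len1_coder]

lemma hat_unit {e : M} (he : ∀ x y, φ (x * TensorAlgebra.ι K e * y) = (aug x * aug y) • e)
    (x y : Bar M) : hat φ hφ (x * TensorAlgebra.ι K e * y) =
      hat φ hφ x * TensorAlgebra.ι K e * hat φ hφ y := by
  set H := hat φ hφ with hH
  have h1 (l : List M) : H (word l) = algebraMap K _ (aug (word l)) + spl l fun u v =>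
    TensorAlgebra.ι K (φ (word u)) * H (word v) := hat_word_eq hφ l
  suffices key : ∀ n, ∀ u v : List M, u.length ≤ n → H (word (u ++ e :: v)) =
      H (word u) * TensorAlgebra.ι K e * H (word v) by
    refine DFunLike.congr_fun (f := H ∘ₗ LinearMap.mulRight K y ∘ₗ
      LinearMap.mulRight K (TensorAlgebra.ι K e)) (g := LinearMap.mulRight K (H y) ∘ₗ
      LinearMap.mulRight K (TensorAlgebra.ι K e) ∘ₗ H) (word_ext fun u => ?_) x
    refine DFunLike.congr_fun (f := H ∘ₗ LinearMap.mulLeft K (word u * TensorAlgebra.ι K e))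
      (g := LinearMap.mulLeft K (H (word u) * TensorAlgebra.ι K e) ∘ₗ H) (word_ext fun v => ?_) y
    have := key _ u v le_rfl
    rw [← word_mid] at this
    exact this
  have h2 (u v a : List M) : TensorAlgebra.ι K (φ (word (u ++ e :: v))) * H (word a) =
      aug (word (K := K) v) • (aug (word (K := K) u) • (TensorAlgebra.ι K e * H (word a))) := by
    rw [← word_mid, he, map_smul, smul_mul_assoc, mul_comm, mul_smul]
  intro n
  induction n with
  | zero =>
    intro u v hu
    rw [List.length_eq_zero_iff.1 (Nat.le_zero.1 hu), h1, spl_append_cons]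
    simp_rw [h2]
    rw [spl_aug_left v fun a b => aug (word (K := K) []) • (TensorAlgebra.ι K e * H (word b))]
    simp [hφ, hH]
  | succ n ih =>
    intro u v hu
    rw [h1, spl_append_cons]
    simp_rw [h2]
    rw [spl_aug_left v fun a b => aug (word (K := K) u) • (TensorAlgebra.ι K e * H (word b)),
      aug_word_append_cons, map_zero, zero_add, h1 u, add_mul, add_mul,
      Algebra.algebraMap_eq_smul_one, smul_mul_assoc, smul_mul_assoc, one_mul, add_comm]
    congr 1
    have h3 : (spl u fun a b => TensorAlgebra.ι K (φ (word a)) * H (word b)) *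
        TensorAlgebra.ι K e * H (word v) = LinearMap.mulRight K (H (word v))
          (LinearMap.mulRight K (TensorAlgebra.ι K e)
            (spl u fun a b => TensorAlgebra.ι K (φ (word a)) * H (word b))) := rfl
    rw [h3, spl_hom, spl_hom]
    refine spl_congr fun a b hab => ?_
    cases a with
    | nil => simp [hφ]
    | cons c a =>
      rw [ih b v (by rw [← hab] at hu; simp at hu; omega)]
      simp [mul_assoc]

lemma aug_mul_ι (x : Bar M) (a : M) : aug (x * TensorAlgebra.ι K a) = 0 := by
  rw [map_mul, aug_ι, mul_zero]

lemma homDefect_unit {μ μ' : Bar M →ₗ[K] M} {e : M}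
    (hs : ∀ x, M.par (φ x) = -φ (M.sgn x))
    (he : ∀ x y, φ (x * TensorAlgebra.ι K e * y) = (aug x * aug y) • e)
    (hμ : IsAInf M e μ) (hμ' : IsAInf M e μ') (x y : Bar M) :
    homDefect μ μ' φ hφ (x * TensorAlgebra.ι K e * y) = 0 := by
  let A' : AInfAlgebra K := { M with unit := e, mu := μ, isAInf := hμ }
  have h1 := map_coder_unit (A := A') (φ - len1) (fun x y => by
    change φ (x * TensorAlgebra.ι K e * y) - len1 (x * TensorAlgebra.ι K e * y) = 0
    rw [he, len1_mul, len1_mul, len1_ι, aug_mul_ι, aug_ι, zero_smul, zero_smul, add_zero, zero_add,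
      smul_smul, mul_comm, sub_self]) x y
  have h2 : φ (M.coder μ (x * TensorAlgebra.ι K e * y)) -
      len1 (M.coder μ (x * TensorAlgebra.ι K e * y)) =
      aug y • (φ x - len1 x) - aug x • (φ (M.sgn y) - len1 (M.sgn y)) := h1
  have h3 : M.par (len1 y) = - len1 (M.sgn y) := by
    refine DFunLike.congr_fun (f := M.par ∘ₗ len1) (g := -(len1 ∘ₗ M.sgn.toLinearMap))
      (word_ext fun l => ?_) y
    cases l with
    | nil => simp
    | cons a l =>
      have : aug (M.sgn (word (K := K) l)) = aug (word l) := by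
        rw [← sgnPow_one_apply, aug_sgnPow]
      change M.par (len1 (word (a :: l))) = -len1 (M.sgn (word (a :: l)))
      rw [word_cons, len1_mul, map_mul M.sgn, sgn_ι, len1_mul, this]
      simp
  rw [len1_coder, hμ.unital, sub_eq_iff_eq_add] at h2
  rw [homDefect_apply, hat_unit hφ he, hμ'.unital, aug_hat, aug_hat, len1_hat, len1_hat, h2, hs, h3]
  module

lemma map_hat_mem {S : ℤ → Submodule K X} {c : ℤ} {g : Bar M →ₗ[K] X}
    (hφd : ∀ n x, HomWord M.gr (-1) n x → φ x ∈ M.gr (n + 1))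
    (hg : ∀ n x, HomWord M.gr (-1) n x → g x ∈ S (n + c)) {n : ℤ} {x : Bar M}
    (hx : HomWord M.gr (-1) n x) : g (hat φ hφ x) ∈ S (n + c) := by
  obtain ⟨l, rfl, hl⟩ := hx.exists_word
  suffices key : ∀ k, ∀ (c n : ℤ) (g : Bar M →ₗ[K] X) (l : List M), l.length ≤ k →
      HomList M.gr (-1) n l → (∀ n x, HomWord M.gr (-1) n x → g x ∈ S (n + c)) →
      g (hat φ hφ (word l)) ∈ S (n + c) from key _ c n g l le_rfl hl hg
  intro k
  induction k with
  | zero =>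
    intro c n g l hk hl hg
    obtain rfl := List.length_eq_zero_iff.1 (Nat.le_zero.1 hk)
    rw [word_nil, hat_one]
    have h0 : n = 0 := hl
    rw [h0]
    exact hg _ _ HomWord.nil
  | succ k ih =>
    intro c n g l hk hl hg
    cases l with
    | nil =>
      rw [word_nil, hat_one]
      have h0 : n = 0 := hl
      rw [h0]
      exact hg _ _ HomWord.nil
    | cons a l =>
      rw [hat_word_eq, aug_word_cons, map_zero, zero_add, spl_hom]
      refine spl_mem fun u v huv => ?_
      cases u with
      | nil => simp [hφ]
      | cons b u =>
        rw [← huv] at hl hk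
        obtain ⟨i, j, rfl, hi, hj⟩ := hl.split
        have := ih (c + i) j (g ∘ₗ LinearMap.mulLeft K (TensorAlgebra.ι K (φ (word (b :: u))))) v
          (by simp at hk; omega) hj (fun n x hx => by
            have := hg _ _ (HomWord.cons (hφd _ _ hi.homWord) hx)
            rw [show i + 1 + -1 + n + c = n + (c + i) by ring] at this
            exact this)
        rw [show i + j + c = j + (c + i) by ring]
        exact this

lemma homDefect_mem {μ μ' : Bar M →ₗ[K] M} {e : M}
    (hφd : ∀ n x, HomWord M.gr (-1) n x → φ x ∈ M.gr (n + 1))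
    (hμ : IsAInf M e μ) (hμ' : IsAInf M e μ') {n : ℤ} {x : Bar M} (hx : HomWord M.gr (-1) n x) :
    homDefect μ μ' φ hφ x ∈ M.gr (n + 2) := by
  refine Submodule.sub_mem _ (map_hat_mem hφ hφd hμ'.degree hx) ?_
  refine hμ.coder_mem (fun z hz => ?_) hx
  have := hφd _ _ hz
  rwa [add_assoc] at this

end BarHom

section Deformation

variable {K : Type u} [Field K] {A : AInfAlgebra K} {P : BimoduleData A}

lemma exists_map_inl {l : List (A.carrier ⊕ P.carrier)} (h : numP l = 0) :
    ∃ v : List A.carrier, l = v.map Sum.inl := by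
  induction l with
  | nil => exact ⟨[], rfl⟩
  | cons s l ih =>
    cases s with
    | inl a =>
      obtain ⟨v, rfl⟩ := ih (by simpa using h)
      exact ⟨a :: v, rfl⟩
    | inr p => simp at h

lemma exists_eq_append_inr {l : List (A.carrier ⊕ P.carrier)} (h : numP l ≠ 0) :
    ∃ (v : List A.carrier) (p : P.carrier) (l' : List (A.carrier ⊕ P.carrier)),
      l = v.map Sum.inl ++ Sum.inr p :: l' := by
  induction l with
  | nil => exact absurd rfl h
  | cons s l ih =>
    cases s with
    | inl a =>
      obtain ⟨v, p, l', rfl⟩ := ih (by simpa using h)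
      exact ⟨a :: v, p, l', rfl⟩
    | inr p => exact ⟨[], p, l, rfl⟩

/-- Cutting a word in three pieces, the middle one of which contains all letters from `P`. -/
lemma spl_core {X : Type u} [AddCommGroup X] {i : ℕ} {z : (tensorPow P (i + 1)).carrier} {c : List (A.carrier ⊕ P.carrier)}
    (hz : Rep P i z c) (l m : List A.carrier)
    (F : List (A.carrier ⊕ P.carrier) → List (A.carrier ⊕ P.carrier) →
      List (A.carrier ⊕ P.carrier) → X) (hF : ∀ u v t, numP v < i + 1 → F u v t = 0) :
    (spl (l.map Sum.inl ++ c ++ m.map Sum.inl) fun u w => spl w fun v t => F u v t) =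
      spl l fun a b => spl m fun s t =>
        F (a.map Sum.inl) (b.map Sum.inl ++ c ++ s.map Sum.inl) (t.map Sum.inl) := by
  obtain ⟨p, c₁, h₁⟩ := hz.exists_cons
  obtain ⟨q, c₂, h₂⟩ := hz.exists_append
  have hn := hz.numP_eq
  have n1 : numP c₁ = i := by rw [h₁] at hn; simpa using hn
  have n2 : numP c₂ = i := by rw [h₂] at hn; simpa using hn
  have e1 : ∀ b : List A.carrier, b.map Sum.inl ++ Sum.inr p :: (c₁ ++ m.map Sum.inl) =
      (b.map Sum.inl ++ c₂) ++ Sum.inr q :: m.map Sum.inl := fun b => by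
    have : Sum.inr p :: c₁ = c₂ ++ [Sum.inr q] := h₁.symm.trans h₂
    rw [← List.cons_append, this]; simp
  have e2 : l.map Sum.inl ++ c ++ m.map Sum.inl =
    l.map Sum.inl ++ Sum.inr p :: (c₁ ++ m.map Sum.inl) := by simp [h₁]
  rw [e2, spl_append_cons, spl_map]
  have e3 : (spl (c₁ ++ m.map Sum.inl) fun a b => spl b fun v t =>
      F (l.map Sum.inl ++ Sum.inr p :: a) v t) = 0 := by
    refine spl_eq_zero fun a b hab => spl_eq_zero fun v t hvt => hF _ _ _ ?_
    have := congrArg numP hab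
    have h3 := congrArg numP hvt
    simp at this h3
    omega
  rw [e3, add_zero]
  refine spl_congr fun a b _ => ?_
  rw [e1, spl_append_cons, spl_map]
  have e4 : (spl (b.map Sum.inl ++ c₂) fun v t => F (a.map Sum.inl) v
      (t ++ Sum.inr q :: m.map Sum.inl)) = 0 := by
    refine spl_eq_zero fun v t hvt => hF _ _ _ ?_
    have h3 := congrArg numP hvt
    simp at h3
    omega
  rw [e4, zero_add]
  refine spl_congr fun s t _ => ?_
  simp [h₂]

variable {X : Type u} [AddCommGroup X] [Module K X]

lemma star_star_pword (f g : Bar (extSpace P) →ₗ[K] Bar (extSpace P))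
    (e : Bar (extSpace P) →ₗ[K] (extSpace P)) (l : List (A.carrier ⊕ P.carrier)) :
    star f (star (TensorAlgebra.ι K ∘ₗ e) g) (pword P l) = spl l fun u w => spl w fun v t =>
      f (pword P u) * TensorAlgebra.ι K (e (pword P v)) * g (pword P t) := by
  rw [pword, star_word, spl_map]
  refine spl_congr fun u w _ => ?_
  rw [star_word, spl_map]
  change LinearMap.mulLeft K _ (spl w _) = _
  rw [spl_hom]
  refine spl_congr fun v t _ => ?_
  rw [LinearMap.mulLeft_apply, ← mul_assoc]
  rfl

lemma pull_star {R : GrSpace K} {i : ℕ} {e : Bar (extSpace P) →ₗ[K] (extSpace P)}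
    (he : Kills (i + 1) e) (f g : Bar (extSpace P) →ₗ[K] Bar (extSpace P))
    (h : Bar (extSpace P) →ₗ[K] R) {z : (tensorPow P (i + 1)).carrier}
    {c : List (A.carrier ⊕ P.carrier)} (hz : Rep P i z c) (l m : List A.carrier) :
    pull i (h ∘ₗ star f (star (TensorAlgebra.ι K ∘ₗ e) g)) (word l) (word m) z =
      spl l fun a b => spl m fun s t => h (f (inA P (word a)) *
        TensorAlgebra.ι K (e (inA P (word b) * core P i z * inA P (word s))) *
          g (inA P (word t))) := by
  rw [pull_apply, hz.core_eq, ← pword_map_inl, ← pword_map_inl, ← pword_append, ← pword_append,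
    LinearMap.comp_apply, star_star_pword, spl_hom]
  simp_rw [spl_hom h]
  rw [spl_core hz]
  · simp only [pword_append, pword_map_inl]
  · intro u v t hv
    rw [he v hv, map_zero, mul_zero, zero_mul, map_zero]

lemma Kills.star {r : ℕ} {e : Bar (extSpace P) →ₗ[K] (extSpace P)} (he : Kills r e)
    (f g : Bar (extSpace P) →ₗ[K] Bar (extSpace P)) :
    Kills r (star f (star (TensorAlgebra.ι K ∘ₗ e) g)) := fun l hl => by
  rw [star_star_pword]
  refine spl_eq_zero fun u w huw => spl_eq_zero fun v t hvt => ?_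
  rw [he, map_zero, mul_zero, zero_mul]
  rw [← huw, ← hvt] at hl
  simp at hl
  omega

lemma Kills.comp {Y : Type u} [AddCommGroup Y] [Module K Y] {r : ℕ}
    {f : Bar (extSpace P) →ₗ[K] X} (hf : Kills r f) (g : X →ₗ[K] Y) : Kills r (g ∘ₗ f) :=
  fun l hl => by rw [LinearMap.comp_apply, hf l hl, map_zero]

lemma Kills.sub {r : ℕ} {f g : Bar (extSpace P) →ₗ[K] X} (hf : Kills r f) (hg : Kills r g) :
    Kills r (f - g) := fun l hl => by rw [LinearMap.sub_apply, hf l hl, hg l hl, sub_zero]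

lemma Kills.add {r : ℕ} {f g : Bar (extSpace P) →ₗ[K] X} (hf : Kills r f) (hg : Kills r g) :
    Kills r (f + g) := fun l hl => by rw [LinearMap.add_apply, hf l hl, hg l hl, add_zero]

lemma Kills.coder {r : ℕ} {f : Bar (extSpace P) →ₗ[K] X} (hf : Kills r f)
    {μ : Bar (extSpace P) →ₗ[K] (extSpace P)} (hμ : IsDivisor P μ) :
    Kills r (f ∘ₗ (extSpace P).coder μ) := fun l hl => by
  rw [LinearMap.comp_apply, coder_pword, spl_hom]
  refine spl_eq_zero fun u w huw => ?_
  rw [spl_hom]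
  refine spl_eq_zero fun v t hvt => ?_
  rw [← huw, ← hvt, numP_append, numP_append] at hl
  rw [sgn_pword]
  by_cases hv : numP v = 0
  · obtain ⟨v', rfl⟩ := exists_map_inl hv
    rw [pword_map_inl, hμ.subalgebra]
    exact hf.map_inl _ _ _ (by rw [numP_map_pureSgn]; omega)
  · exact hf.map_mid _ _ _ (by rw [numP_map_pureSgn]; omega)

/-- The conditions on an isomorphism of noncommutative divisors other than the equation for
`A_∞`-homomorphisms. -/
structure IsPreIso (P : BimoduleData A) (Φ : Bar (extSpace P) →ₗ[K] (extSpace P)) : Prop where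
  map_one : Φ 1 = 0
  degree : ∀ n x, HomWord (extSpace P).gr (-1) n x → Φ x ∈ (extSpace P).gr (n + 1)
  unital : ∀ x y, Φ (x * TensorAlgebra.ι K ((A.unit, 0) : A.carrier × P.carrier) * y) =
    (aug x * aug y) • ((A.unit, 0) : A.carrier × P.carrier)
  subalgebra : ∀ x, Φ (inA P x) = (len1 x, 0)
  quotient : ∀ x y p, (Φ (onceP P x y p)).2 = (aug x * aug y) • p

variable {μ μ' Φ Φ' : Bar (extSpace P) →ₗ[K] (extSpace P)}

lemma IsPreIso.par_map (hg : (extSpace P).IsGraded) (hΦ : IsPreIso P Φ) (x : Bar (extSpace P)) :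
    (extSpace P).par (Φ x) = -Φ ((extSpace P).sgn x) := by
  induction x using hg.bar_induction with
  | hw n x hx =>
    rw [hg.par_apply _ _ (hΦ.degree n x hx), hx.sgn hg, map_smul, ksign_add, ksign_one]
    simp
  | hadd x y h1 h2 => rw [map_add, map_add, map_add, map_add, h1, h2, neg_add]
  | hsmul c x h1 => rw [map_smul, map_smul, map_smul, map_smul, h1, smul_neg]

lemma IsPreIso.hat_inA (hΦ : IsPreIso P Φ) (x : Bar A.toGrSpace) :
    hat Φ hΦ.map_one (inA P x) = inA P x := by
  refine DFunLike.congr_fun (f := hat Φ hΦ.map_one ∘ₗ (inA P).toLinearMap)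
    (g := (inA P).toLinearMap) (word_ext fun l => ?_) x
  change hat Φ hΦ.map_one (inA P (word l)) = inA P (word l)
  induction l with
  | nil => simp
  | cons a l ih =>
    rw [← pword_map_inl, pword, hat_word_eq, List.map_cons, List.map_cons, aug_word_cons, map_zero,
      zero_add, spl_cons, word_nil, hΦ.map_one, map_zero, zero_mul, zero_add, List.map_map,
      spl_map, spl_left]
    · have h1 := hΦ.subalgebra (TensorAlgebra.ι K a)
      rw [inA_ι] at h1
      rw [List.map_nil, word_singleton, letter_inl, h1, len1_ι, ← List.map_map, ← pword,
        pword_map_inl, ih, word_cons, ← pword, pword_map_inl]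
    · intro b u v _
      have h1 := hΦ.subalgebra (word (a :: b :: u))
      rw [← pword_map_inl, pword, word_cons, len1_mul] at h1
      have h2 : Φ (word (letter P (Sum.inl a) :: ((b :: u).map (letter P ∘ Sum.inl)))) = 0 := by
        rw [← List.map_map]
        refine h1.trans ?_
        simp
      rw [h2, map_zero, zero_mul]

lemma isPreIso_len1 : IsPreIso P (len1 (K := K) (E := (extSpace P).carrier)) where
  map_one := len1_one
  degree n x hx := by
    obtain ⟨l, rfl, hl⟩ := hx.exists_word
    cases l with
    | nil => simp
    | cons a l =>
      rw [word_cons, len1_mul]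
      obtain ⟨m, k, ha, hl, hn⟩ := hl
      cases l with
      | nil =>
        have h0 : k = 0 := hl
        have : n + 1 = m := by omega
        simpa [this] using ha
      | cons => simp
  unital x y := by
    rw [len1_mul, len1_mul, len1_ι, aug_mul_ι, aug_ι, zero_smul, zero_smul, add_zero, zero_add,
      smul_smul, mul_comm]
  subalgebra x := by
    refine DFunLike.congr_fun (f := len1 ∘ₗ (inA P).toLinearMap)
      (g := LinearMap.inl K A.carrier P.carrier ∘ₗ len1) (word_ext fun l => ?_) x
    change len1 (inA P (word l)) = (len1 (word l), (0 : P.carrier))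
    cases l with
    | nil => rw [word_nil, map_one, len1_one, len1_one]; rfl
    | cons a l =>
      rw [word_cons, map_mul, len1_mul, len1_mul, inA_ι, aug_ι, aug_ι, len1_ι, len1_ι, aug_inA]
      simp
  quotient x y p := by
    rw [onceP, len1_mul, len1_mul, aug_mul_ι, len1_ι, aug_inA, aug_inA]
    simp [smul_smul, mul_comm]

lemma IsPreIso.unitFree_sub (hΦ : IsPreIso P Φ) (hΦ' : IsPreIso P Φ') : UnitFree (Φ' - Φ) :=
  fun x y => by rw [LinearMap.sub_apply, hΦ.unital, hΦ'.unital, sub_self]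

lemma IsPreIso.kills_sub (hΦ : IsPreIso P Φ) (hΦ' : IsPreIso P Φ') : Kills 1 (Φ' - Φ) := fun l hl => by
  obtain ⟨v, rfl⟩ := exists_map_inl (Nat.lt_one_iff.1 hl)
  rw [pword_map_inl, LinearMap.sub_apply, hΦ.subalgebra, hΦ'.subalgebra, sub_self]

lemma isDivisorIso_iff : IsDivisorIso P μ μ' Φ ↔
    ∃ h : IsPreIso P Φ, homDefect μ μ' Φ h.map_one = 0 :=
  ⟨fun h => ⟨⟨h.map_one, h.degree, h.unital, h.subalgebra, h.quotient⟩,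
    (homDefect_eq_zero_iff _ _ _).2 h.hom⟩, fun ⟨h, h'⟩ => ⟨h.map_one, h.degree, h.unital,
      (homDefect_eq_zero_iff _ _ _).1 h', h.subalgebra, h.quotient⟩⟩

lemma UnitFree.kills_of_pull {R : GrSpace K} : ∀ (i : ℕ) {f : Bar (extSpace P) →ₗ[K] R}
    (_ : UnitFree f) (_ : Kills (i + 1) f) (_ : pull i f = 0), Kills (i + 2) f := by
  have key : ∀ (i : ℕ) {f : Bar (extSpace P) →ₗ[K] R} (_ : UnitFree f) (_ : pull i f = 0)
      (l : List (A.carrier ⊕ P.carrier)), numP l = i + 1 → f (pword P l) = 0 := by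
    intro i
    induction i with
    | zero =>
      intro f _ h l hl
      obtain ⟨v, p, l', rfl⟩ := exists_eq_append_inr (l := l) (by omega)
      obtain ⟨m, rfl⟩ := exists_map_inl (l := l') (by simpa using hl)
      rw [pword_append, pword_cons, pword_map_inl, pword_map_inl, letter_inr, ← mul_assoc,
        ← core_genZero, ← pull_apply, h]
      rfl
    | succ i ih =>
      intro f hf h l hl
      obtain ⟨v, p, l', rfl⟩ := exists_eq_append_inr (l := l) (by omega)
      rw [pword_append, pword_cons, ← mul_assoc]
      refine ih (f := f ∘ₗ LinearMap.mulLeft K _) (hf.comp_mul _) ?_ l' (by simpa using hl)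
      refine LinearMap.ext fun b => LinearMap.ext fun y => LinearMap.ext fun z => ?_
      have h1 := hf.pull_genSucc (word v) y b p z
      rw [h] at h1
      rw [pull_apply, LinearMap.comp_apply, LinearMap.mulLeft_apply, pword_map_inl, letter_inr,
        mul_assoc (inA P b)]
      exact h1.symm
  intro i f hu hf h l hl
  rcases Nat.lt_or_ge (numP l) (i + 1) with h1 | h1
  · exact hf l h1
  · exact key i hu h l (by omega)

lemma IsDivisor.snd_map_mid (hμ : IsDivisor P μ) (x y : Bar A.toGrSpace) (b : A.carrier × P.carrier) :
    (μ (inA P x * TensorAlgebra.ι K b * inA P y)).2 = P.op x y b.2 := by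
  have h : b = (b.1, 0) + (0, b.2) := by simp
  have h1 : μ (inA P x * TensorAlgebra.ι K ((b.1, 0) : A.carrier × P.carrier) * inA P y) =
      (A.mu (x * TensorAlgebra.ι K b.1 * y), 0) := by
    rw [← inA_ι, ← map_mul, ← map_mul, hμ.subalgebra]
  rw [← hμ.quotient x y b.2, onceP]
  nth_rewrite 1 [h]
  rw [map_add, mul_add, add_mul, map_add, h1]
  exact zero_add _

lemma IsDivisor.fst_map_mid (hμ : IsDivisor P μ) (x y : Bar A.toGrSpace) {b : A.carrier × P.carrier}
    (hb : b.2 = 0) : (μ (inA P x * TensorAlgebra.ι K b * inA P y)).1 =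
      A.mu (x * TensorAlgebra.ι K b.1 * y) := by
  have h : b = (b.1, 0) := by rw [← hb]
  rw [h, ← inA_ι, ← map_mul, ← map_mul, hμ.subalgebra]

variable {e : Bar (extSpace P) →ₗ[K] (extSpace P)} {f g : Bar (extSpace P) →ₗ[K] Bar (extSpace P)}

variable (P) in
/-- The projection `B → A`. -/
abbrev toFst : (extSpace P) →ₗ[K] A.toGrSpace := LinearMap.fst K A.carrier P.carrier

variable (P) in
/-- The projection `B → P[1]`. -/
abbrev toSnd : (extSpace P) →ₗ[K] P.toGrSpace := LinearMap.snd K A.carrier P.carrier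

lemma pull_snd_star (hμ : IsDivisor P μ) {i : ℕ} (he : Kills (i + 1) e) {d : ℤ}
    (hf : ∀ x, f (inA P x) = inA P x) (hg : ∀ x, g (inA P x) = inA P (A.sgnPow d x)) :
    pull i ((toSnd P ∘ₗ μ) ∘ₗ star f (star (TensorAlgebra.ι K ∘ₗ e) g)) =
      Cochain.comp d P.op (pull i (toSnd P ∘ₗ e)) := by
  refine word_ext fun l => word_ext fun m => Rep.ext fun z c hz => ?_
  rw [pull_star he _ _ _ hz, comp_word_spl]
  refine spl_congr fun a b _ => spl_congr fun s t _ => ?_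
  rw [hf, hg]
  exact hμ.snd_map_mid _ _ _

lemma sgnPow_congr {M : GrSpace K} {d e : ℤ} (h : Even (d - e)) : M.sgnPow d = M.sgnPow e := by
  have : Even d ↔ Even e := Int.even_sub.1 h
  simp [GrSpace.sgnPow, this]

lemma pull_fst_star (hμ : IsDivisor P μ) {i : ℕ} (he : Kills (i + 1) e)
    (hs : Kills (i + 2) (toSnd P ∘ₗ e)) {d : ℤ}
    (hf : ∀ x, f (inA P x) = inA P x) (hg : ∀ x, g (inA P x) = inA P (A.sgnPow d x)) :
    pull i ((toFst P ∘ₗ μ) ∘ₗ star f (star (TensorAlgebra.ι K ∘ₗ e) g)) =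
      -Cochain.comp (d + 1) (diagonal A).op (pull i (toFst P ∘ₗ e)) := by
  refine word_ext fun l => word_ext fun m => Rep.ext fun z c hz => ?_
  rw [pull_star he _ _ _ hz, LinearMap.neg_apply, LinearMap.neg_apply, LinearMap.neg_apply,
    comp_word_spl, ← spl_neg]
  refine spl_congr fun a b _ => ?_
  rw [← spl_neg]
  refine spl_congr fun s t _ => ?_
  rw [hf, hg]
  have h0 : (e (inA P (word b) * core P i z * inA P (word s))).2 = 0 := by
    have := hs (b.map Sum.inl ++ c ++ s.map Sum.inl) (by simp [hz.numP_eq])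
    rw [hz.core_eq, ← pword_map_inl, ← pword_map_inl, ← pword_append, ← pword_append]
    exact this
  refine (hμ.fst_map_mid _ _ h0).trans ?_
  rw [eq_comm, neg_eq_iff_eq_neg]
  change -A.mu (word a * TensorAlgebra.ι K _ * A.sgn (A.sgnPow (d + 1) (word t))) = _
  rw [← sgnPow_one_apply, A.isAInf.graded.sgnPow_sgnPow, sgnPow_congr (e := d) ⟨1, by ring⟩]
  rfl

/-- Two maps which satisfy all conditions on an isomorphism of divisors from `μ` to `μ'`, except
for the `A_∞`-equation. -/
lemma IsPreIso.homDefect_unitFree (hΦ : IsPreIso P Φ) (hμ : IsDivisor P μ) (hμ' : IsDivisor P μ') :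
    UnitFree (homDefect μ μ' Φ hΦ.map_one) := fun x y =>
  homDefect_unit _ (hΦ.par_map hμ.isAInf.graded) hΦ.unital hμ.isAInf hμ'.isAInf x y

lemma UnitFree.comp {Y : Type u} [AddCommGroup Y] [Module K Y] {f : Bar (extSpace P) →ₗ[K] X}
    (hf : UnitFree f) (g : X →ₗ[K] Y) : UnitFree (g ∘ₗ f) := fun x y => by
  rw [LinearMap.comp_apply, hf, map_zero]

lemma IsPreIso.pull_snd_mem (hΦ : IsPreIso P Φ) (hμ : IsDivisor P μ) (hμ' : IsDivisor P μ') (i : ℕ) :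
    pull i (toSnd P ∘ₗ homDefect μ μ' Φ hΦ.map_one) ∈
      homDeg (A := A) (tensorPow P (i + 1)).toGrSpace P.toGrSpace (1 - 2 * i) :=
  pull_mem_homDeg i ((hΦ.homDefect_unitFree hμ hμ').comp _) (s := 3) (fun n x hx => by
    have := (Submodule.mem_prod.1 (homDefect_mem hΦ.map_one hΦ.degree hμ.isAInf hμ'.isAInf hx)).2
    rw [show n + 3 = n + 2 + 1 by ring]
    exact this) (by ring)

lemma IsPreIso.pull_fst_mem (hΦ : IsPreIso P Φ) (hμ : IsDivisor P μ) (hμ' : IsDivisor P μ') (i : ℕ) :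
    pull i (toFst P ∘ₗ homDefect μ μ' Φ hΦ.map_one) ∈
      homDeg (A := A) (tensorPow P (i + 1)).toGrSpace A.toGrSpace (-2 * i) :=
  pull_mem_homDeg i ((hΦ.homDefect_unitFree hμ hμ').comp _) (s := 2) (fun n x hx =>
    (Submodule.mem_prod.1 (homDefect_mem hΦ.map_one hΦ.degree hμ.isAInf hμ'.isAInf hx)).1) (by ring)

lemma pull_add {R : GrSpace K} (i : ℕ) (f g : Bar (extSpace P) →ₗ[K] R) :
    pull i (f + g) = pull i f + pull i g := rfl

lemma pull_sub {R : GrSpace K} (i : ℕ) (f g : Bar (extSpace P) →ₗ[K] R) :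
    pull i (f - g) = pull i f - pull i g := rfl

lemma ksign_odd (d : ℤ) : ksign K (1 - 2 * d) = -1 := by simp

lemma ksign_even (d : ℤ) : ksign K (-2 * d) = 1 := by simp [neg_mul]

lemma pull_comp_add {R : GrSpace K} (i : ℕ) (h : (extSpace P) →ₗ[K] R)
    {a b : Bar (extSpace P) →ₗ[K] (extSpace P)} (hab : a + b = 0) :
    pull i (h ∘ₗ a) + pull i (h ∘ₗ b) = 0 := by
  rw [← pull_add, ← LinearMap.comp_add, hab, LinearMap.comp_zero]
  rfl

/-- The lowest `P`-valued part of the failure to be a homomorphism is closed. -/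
lemma IsPreIso.diff_pull_snd (hΦ : IsPreIso P Φ) (hμ : IsDivisor P μ) (hμ' : IsDivisor P μ') {i : ℕ}
    (hk : Kills (i + 1) (homDefect μ μ' Φ hΦ.map_one)) :
    diff (tensorPow P (i + 1)) P (1 - 2 * i) (pull i (toSnd P ∘ₗ homDefect μ μ' Φ hΦ.map_one)) = 0 := by
  have h1 := homDefect_closed hΦ.map_one (hΦ.par_map hμ.isAInf.graded) hμ.isAInf hμ'.isAInf
  have h2 := pull_coder hμ i (f := toSnd P ∘ₗ homDefect μ μ' Φ hΦ.map_one)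
    ((hΦ.homDefect_unitFree hμ hμ').comp _) (hk.comp _)
  have h3 := pull_snd_star hμ' hk (f := hat Φ hΦ.map_one)
    (g := hat Φ hΦ.map_one ∘ₗ (extSpace P).sgnPow 1) (d := 1) hΦ.hat_inA (fun x => by
      rw [LinearMap.comp_apply, sgnPow_one_apply, sgn_inA, hΦ.hat_inA, sgnPow_one_apply])
  have h4 := pull_comp_add i (toSnd P) h1
  rw [← LinearMap.comp_assoc, ← LinearMap.comp_assoc, h2, h3] at h4
  rw [diff_apply, ksign_odd, neg_one_smul, sub_neg_eq_add,
    comp_congr_even (d := 1 - 2 * i) (e := 1) ⟨-i, by ring⟩]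
  exact h4

/-- If its `P`-valued part vanishes, then the lowest `A`-valued part of the failure to be a
homomorphism is closed. -/
lemma IsPreIso.diff_pull_fst (hΦ : IsPreIso P Φ) (hμ : IsDivisor P μ) (hμ' : IsDivisor P μ') {i : ℕ}
    (hk : Kills (i + 1) (homDefect μ μ' Φ hΦ.map_one))
    (hs : Kills (i + 2) (toSnd P ∘ₗ homDefect μ μ' Φ hΦ.map_one)) :
    diff (tensorPow P (i + 1)) (diagonal A) (-2 * i)
      (pull i (toFst P ∘ₗ homDefect μ μ' Φ hΦ.map_one)) = 0 := by
  have h1 := homDefect_closed hΦ.map_one (hΦ.par_map hμ.isAInf.graded) hμ.isAInf hμ'.isAInf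
  have h2 := pull_coder hμ i (f := toFst P ∘ₗ homDefect μ μ' Φ hΦ.map_one)
    ((hΦ.homDefect_unitFree hμ hμ').comp _) (hk.comp _)
  have h3 := pull_fst_star hμ' hk hs (f := hat Φ hΦ.map_one)
    (g := hat Φ hΦ.map_one ∘ₗ (extSpace P).sgnPow 1) (d := 1) hΦ.hat_inA (fun x => by
      rw [LinearMap.comp_apply, sgnPow_one_apply, sgn_inA, hΦ.hat_inA, sgnPow_one_apply])
  have h4 := pull_comp_add i (toFst P) h1
  rw [← LinearMap.comp_assoc, ← LinearMap.comp_assoc, h2, h3] at h4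
  rw [diff_apply, ksign_even, one_smul,
    comp_congr_even (d := -2 * i) (e := 1 + 1) ⟨-i - 1, by ring⟩, ← neg_eq_zero, neg_sub,
    sub_eq_neg_add]
  exact h4

/-- A change of the `P`-valued part changes the lowest `P`-valued part of the failure to be a
homomorphism by a coboundary. -/
lemma IsPreIso.pull_snd_sub (hΦ : IsPreIso P Φ) (hΦ' : IsPreIso P Φ') (hμ : IsDivisor P μ)
    (hμ' : IsDivisor P μ') {i : ℕ} (hk : Kills (i + 1) (Φ' - Φ)) :
    pull i (toSnd P ∘ₗ (homDefect μ μ' Φ' hΦ'.map_one - homDefect μ μ' Φ hΦ.map_one)) =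
      diff (tensorPow P (i + 1)) P (-2 * i) (pull i (toSnd P ∘ₗ (Φ' - Φ))) := by
  have h2 := pull_coder hμ i (f := toSnd P ∘ₗ (Φ' - Φ)) ((hΦ.unitFree_sub hΦ').comp _) (hk.comp _)
  have h3 := pull_snd_star hμ' hk (f := hat Φ hΦ.map_one) (g := hat Φ' hΦ'.map_one) (d := 0)
    hΦ.hat_inA (fun x => by rw [hΦ'.hat_inA, sgnPow_zero]; rfl)
  rw [homDefect_sub, diff_apply, ← h2, ksign_even, one_smul,
    comp_congr_even (d := -2 * i) (e := 0) ⟨-i, by ring⟩, ← h3, ← pull_sub, LinearMap.comp_sub,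
    LinearMap.comp_assoc, LinearMap.comp_assoc]

lemma IsPreIso.pull_fst_sub (hΦ : IsPreIso P Φ) (hΦ' : IsPreIso P Φ') (hμ : IsDivisor P μ)
    (hμ' : IsDivisor P μ') {i : ℕ} (hk : Kills (i + 1) (Φ' - Φ))
    (hs : Kills (i + 2) (toSnd P ∘ₗ (Φ' - Φ))) :
    pull i (toFst P ∘ₗ (homDefect μ μ' Φ' hΦ'.map_one - homDefect μ μ' Φ hΦ.map_one)) =
      -diff (tensorPow P (i + 1)) (diagonal A) (-1 - 2 * i) (pull i (toFst P ∘ₗ (Φ' - Φ))) := by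
  have h2 := pull_coder hμ i (f := toFst P ∘ₗ (Φ' - Φ)) ((hΦ.unitFree_sub hΦ').comp _) (hk.comp _)
  have h3 := pull_fst_star hμ' hk hs (f := hat Φ hΦ.map_one) (g := hat Φ' hΦ'.map_one) (d := 0)
    hΦ.hat_inA (fun x => by rw [hΦ'.hat_inA, sgnPow_zero]; rfl)
  rw [homDefect_sub, diff_apply, ← h2, show (-1 - 2 * i : ℤ) = 1 - 2 * (i + 1) by ring, ksign_odd,
    neg_one_smul, comp_congr_even (d := 1 - 2 * (i + 1)) (e := 0 + 1) ⟨-i - 1, by ring⟩,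
    sub_neg_eq_add, neg_add, ← h3, LinearMap.comp_sub, pull_sub, LinearMap.comp_assoc,
    LinearMap.comp_assoc, sub_eq_add_neg]

lemma IsPreIso.kills_homDefect_sub (hΦ : IsPreIso P Φ) (hΦ' : IsPreIso P Φ') (hμ : IsDivisor P μ)
    {r : ℕ} (hk : Kills r (Φ' - Φ)) :
    Kills r (homDefect μ μ' Φ' hΦ'.map_one - homDefect μ μ' Φ hΦ.map_one) := by
  rw [homDefect_sub]
  exact ((hk.star _ _).comp μ').sub (hk.coder hμ)

end Deformation

section SingleDivisors

variable {K : Type u} [Field K] {A : AInfAlgebra K} {P : BimoduleData A}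
variable {μ μ' Φ : Bar (extSpace P) →ₗ[K] (extSpace P)}

lemma pull_zero_eq_section (μ : Bar (extSpace P) →ₗ[K] (extSpace P)) :
    pull 0 (toFst P ∘ₗ μ) = sectionCochain P μ := rfl

lemma divisorSection_eq_iff (hμ : IsDivisor P μ) (hμ' : IsDivisor P μ') :
    divisorSection P hμ = divisorSection P hμ' ↔
      sectionCochain P μ - sectionCochain P μ' ∈ coboundaries P (diagonal A) 0 := by
  rw [divisorSection, divisorSection, Submodule.Quotient.eq]
  rfl

lemma IsPreIso.kills_two (hΦ : IsPreIso P Φ) : Kills 2 (toSnd P ∘ₗ (Φ - len1)) := by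
  intro l hl
  rcases Nat.lt_or_ge (numP l) 1 with h | h
  · exact (isPreIso_len1.kills_sub hΦ).comp (toSnd P) l h
  · obtain ⟨v, p, l', rfl⟩ := exists_eq_append_inr (l := l) (by omega)
    obtain ⟨m, rfl⟩ := exists_map_inl (l := l') (by simp at hl; omega)
    rw [pword_append, pword_cons, pword_map_inl, pword_map_inl, letter_inr, ← mul_assoc]
    have h1 := hΦ.quotient (word v) (word m) p
    have h2 := (isPreIso_len1 (P := P)).quotient (word v) (word m) p
    exact (congrArg₂ (· - ·) h1 h2).trans (sub_self _)

/-- Isomorphic noncommutative divisors have the same section. -/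
lemma IsDivisorIso.section_eq (hμ : IsDivisor P μ) (hμ' : IsDivisor P μ')
    (h : IsDivisorIso P μ μ' Φ) : divisorSection P hμ = divisorSection P hμ' := by
  obtain ⟨hΦ, h0⟩ := isDivisorIso_iff.1 h
  have h1 := isPreIso_len1.pull_fst_sub hΦ hμ hμ' (i := 0) (isPreIso_len1.kills_sub hΦ) hΦ.kills_two
  rw [homDefect_len1, h0, zero_sub, neg_sub, LinearMap.comp_sub, pull_sub, pull_zero_eq_section,
    pull_zero_eq_section] at h1
  rw [divisorSection_eq_iff]
  have h2 : sectionCochain P μ - sectionCochain P μ' =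
      -diff P (diagonal A) (-1) (pull 0 (toFst P ∘ₗ (Φ - len1))) := h1
  rw [h2]
  refine Submodule.neg_mem _ (Submodule.mem_map_of_mem ?_)
  refine pull_mem_homDeg 0 ((isPreIso_len1.unitFree_sub hΦ).comp _) (s := 1) (fun n x hx => ?_)
    (by norm_num)
  exact Submodule.sub_mem _ (Submodule.mem_prod.1 (hΦ.degree _ _ hx)).1
    (Submodule.mem_prod.1 (isPreIso_len1.degree _ _ hx)).1

/-- The extension of the bimodule structure by zero. -/
def spreadOp (P : BimoduleData A) : Bar (extSpace P) →ₗ[K] P.toGrSpace :=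
  spread 0 (P.op : Cochain A (tensorPow P (0 + 1)).toGrSpace P.toGrSpace)

lemma spreadOp_pword {l : List (A.carrier ⊕ P.carrier)} (h : numP l ≠ 1) :
    spreadOp P (pword P l) = 0 := spread_pword _ h

lemma spreadOp_onceP (x y : Bar A.toGrSpace) (p : P.carrier) :
    spreadOp P (inA P x * TensorAlgebra.ι K ((0, p) : A.carrier × P.carrier) * inA P y) =
      P.op x y p := by
  have := pull_spread 0 (P.op : Cochain A (tensorPow P (0 + 1)).toGrSpace P.toGrSpace)
  exact congrArg (fun φ : Cochain A P.toGrSpace P.toGrSpace => φ x y p) this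

lemma spreadOp_mid (l m : List A.carrier) (b : A.carrier × P.carrier) :
    spreadOp P (inA P (word l) * TensorAlgebra.ι K b * inA P (word m)) =
      P.op (word l) (word m) b.2 := by
  have h : b = (b.1, 0) + (0, b.2) := by simp
  have h1 : spreadOp P (inA P (word l) * TensorAlgebra.ι K ((b.1, 0) : A.carrier × P.carrier) *
      inA P (word m)) = 0 := by
    rw [← inA_ι, ← map_mul, ← map_mul, word_mid, ← pword_map_inl, spreadOp_pword (by simp)]
  rw [← spreadOp_onceP]
  nth_rewrite 1 [h]
  rw [map_add, mul_add, add_mul, map_add, h1, zero_add]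

lemma spreadOp_snd (u t : List (A.carrier ⊕ P.carrier)) (b : A.carrier × P.carrier)
    (h : numP u + numP t ≠ 0) : spreadOp P (pword P u * TensorAlgebra.ι K b * pword P t) =
      spreadOp P (pword P u * TensorAlgebra.ι K ((b.1, 0) : A.carrier × P.carrier) * pword P t) := by
  have e : b = (b.1, 0) + (0, b.2) := by simp
  have h1 : spreadOp P (pword P u * TensorAlgebra.ι K ((0, b.2) : A.carrier × P.carrier) *
      pword P t) = 0 := by
    rw [← letter_inr, mul_assoc, ← pword_cons, ← pword_append, spreadOp_pword]
    simp
    omega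
  nth_rewrite 1 [e]
  rw [map_add, mul_add, add_mul, map_add, h1, add_zero]

/-- The part of the `P`-component of `μ` with at least two inputs in `P`. -/
def higherPart (μ : Bar (extSpace P) →ₗ[K] (extSpace P)) : Bar (extSpace P) →ₗ[K] P.toGrSpace :=
  toSnd P ∘ₗ μ - spreadOp P

lemma higherPart_kills (hμ : IsDivisor P μ) : Kills 2 (higherPart μ) := by
  intro l hl
  rw [higherPart, LinearMap.sub_apply]
  rcases Nat.lt_or_ge (numP l) 1 with h | h
  · obtain ⟨v, rfl⟩ := exists_map_inl (Nat.lt_one_iff.1 h)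
    rw [spreadOp_pword (by simp), sub_zero, pword_map_inl]
    exact congrArg Prod.snd (hμ.subalgebra (word v))
  · obtain ⟨v, p, l', rfl⟩ := exists_eq_append_inr (l := l) (by omega)
    obtain ⟨m, rfl⟩ := exists_map_inl (l := l') (by simp at hl; omega)
    rw [pword_append, pword_cons, pword_map_inl, pword_map_inl, letter_inr, ← mul_assoc,
      spreadOp_onceP, sub_eq_zero]
    exact hμ.quotient (word v) (word m) p

lemma higherPart_unitFree (hμ : IsDivisor P μ) : UnitFree (higherPart μ) := by
  have key (u v : List (A.carrier ⊕ P.carrier)) : higherPart μ (pword P u *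
      TensorAlgebra.ι K ((A.unit, 0) : A.carrier × P.carrier) * pword P v) = 0 := by
    rcases Nat.lt_or_ge (numP u + numP v) 2 with h | h
    · exact (higherPart_kills hμ).map_inl _ _ _ h
    · have h1 : spreadOp P (pword P u * TensorAlgebra.ι K ((A.unit, 0) : A.carrier × P.carrier) *
          pword P v) = 0 := by
        rw [← letter_inl, mul_assoc, ← pword_cons, ← pword_append, spreadOp_pword]
        simp
        omega
      rw [higherPart, LinearMap.sub_apply, h1, sub_zero, LinearMap.comp_apply, hμ.isAInf.unital]
      have h2 (u v : List (A.carrier ⊕ P.carrier)) (h : 2 ≤ numP u + numP v) :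
          aug (pword P u) • len1 (pword P v) = 0 := by
        cases u with
        | cons s u => rw [pword_cons, map_mul, aug_ι, zero_mul, zero_smul]
        | nil =>
          cases v with
          | nil => simp at h
          | cons s v =>
            cases v with
            | nil => cases s <;> simp at h
            | cons s' v => simp [pword_cons, len1_mul]
      rw [← map_smul, h2 u v h, h2 v u (by omega), map_zero, add_zero, map_zero]
  intro x y
  refine DFunLike.congr_fun (f := higherPart μ ∘ₗ LinearMap.mulRight K y ∘ₗ LinearMap.mulRight K
    (TensorAlgebra.ι K ((A.unit, 0) : A.carrier × P.carrier))) (g := 0) (pword_ext fun u => ?_) x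
  exact DFunLike.congr_fun (f := higherPart μ ∘ₗ LinearMap.mulLeft K (pword P u *
    TensorAlgebra.ι K ((A.unit, 0) : A.carrier × P.carrier))) (g := 0) (pword_ext fun v => key u v) y

lemma spreadOp_mem (hP : IsBimodule P) {n : ℤ} {x : Bar (extSpace P)}
    (hx : HomWord (extSpace P).gr (-1) n x) : spreadOp P x ∈ P.gr (n + 3) :=
  spread_mem (i := 0) (hP.hasDegree : Cochain.HasDegree (A := A)
    (P := (tensorPow P (0 + 1)).toGrSpace) P.op 1) hx

lemma higherPart_mem (hP : IsBimodule P) (hμ : IsDivisor P μ) : pull (0 + 1) (higherPart μ) ∈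
    homDeg (A := A) (tensorPow P (0 + 1 + 1)).toGrSpace P.toGrSpace (-1) := by
  refine pull_mem_homDeg 1 (higherPart_unitFree hμ) (s := 3) (fun n x hx => ?_) (by norm_num)
  have := (Submodule.mem_prod.1 (hμ.isAInf.degree _ _ hx)).2
  rw [show n + 2 + 1 = n + 3 by ring] at this
  exact Submodule.sub_mem _ this (spreadOp_mem hP hx)

lemma conjLeft_word {d : ℤ} (hd : d = 0) (φ : homDeg (A := A) P.toGrSpace (diagonal A).toGrSpace d)
    (l b m : List A.carrier) (p q : P.carrier) :
    conjLeft P d φ (word l) (word m) (tens P P p (word b) q) = spl b fun u v => spl m fun s t =>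
      P.op (word l) (word u * TensorAlgebra.ι K (φ.1 (word v) (word s) q) * A.sgn (word t)) p := by
  subst hd
  rw [conjLeft, comp_word_spl, spl_right]
  · rw [spl_comm]
    refine spl_congr fun s t _ => ?_
    rw [idTensor_tens, sgnPow_zero, word_nil, map_one, one_smul, spl_hom]
    rfl
  · intro u a v _
    refine spl_eq_zero fun s t _ => ?_
    rw [idTensor_tens, aug_word_cons, zero_smul, map_zero]

lemma conjRight_word {d : ℤ} (hd : d = 0) (φ : homDeg (A := A) P.toGrSpace (diagonal A).toGrSpace d)
    (l b m : List A.carrier) (p q : P.carrier) :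
    conjRight P d φ (word l) (word m) (tens P P p (word b) q) = -spl l fun u v => spl b fun s t =>
      P.op (word u * TensorAlgebra.ι K (φ.1 (word v) (word s) p) * A.sgn (word t))
        (A.sgn (word m)) (P.par q) := by
  subst hd
  rw [conjRight, comp_word_spl, ← spl_neg]
  refine spl_congr fun u v _ => ?_
  rw [spl_left]
  · rw [tensorId_tens, sgnPow_zero, word_nil, map_one, one_smul, spl_hom, ← spl_neg]
    rfl
  · intro a s t _
    rw [tensorId_tens, aug_word_cons, zero_smul, map_zero]

lemma spreadOp_coder_word (hμ : IsDivisor P μ) (l b m : List A.carrier) (p q : P.carrier) :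
    spreadOp P ((extSpace P).coder μ (pword P (l.map Sum.inl ++ Sum.inr p ::
      (b.map Sum.inl ++ Sum.inr q :: m.map Sum.inl)))) =
    (spl l fun a a' => spl m fun s t => P.op (word a) (A.sgn (word t))
      (μ (pword P (a'.map Sum.inl ++ Sum.inr p :: (b.map Sum.inl ++ Sum.inr q :: s.map Sum.inl)))).2) +
    (spl b fun u v => spl m fun s t => P.op (word l) (word u *
      TensorAlgebra.ι K (sectionCochain P μ (word v) (word s) q) * A.sgn (word t)) p) +
    spl l fun u v => spl b fun s t => P.op (word u *
      TensorAlgebra.ι K (sectionCochain P μ (word v) (word s) p) * A.sgn (word t))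
        (A.sgn (word m)) (P.par q) := by
  set T : List (A.carrier ⊕ P.carrier) → List (A.carrier ⊕ P.carrier) →
    List (A.carrier ⊕ P.carrier) → P.carrier := fun u v t => spreadOp P
      (pword P u * TensorAlgebra.ι K (μ (pword P v)) * (extSpace P).sgn (pword P t)) with hT
  have T0 (u t : List (A.carrier ⊕ P.carrier)) (v : List A.carrier) (h : numP u + numP t ≠ 1) :
      T u (v.map Sum.inl) t = 0 := by
    rw [hT]
    simp only
    rw [pword_map_inl, hμ.subalgebra, sgn_pword]
    have := spreadOp_pword (P := P) (l := u ++ Sum.inl (A.mu (word v)) :: t.map pureSgn) (by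
      rw [numP_append, numP_cons_inl, numP_map_pureSgn]; exact h)
    rwa [pword_append, pword_cons, ← mul_assoc] at this
  have hρ (c s : List A.carrier) (p : P.carrier) : (μ (pword P (c.map Sum.inl ++ Sum.inr p ::
      s.map Sum.inl))).1 = sectionCochain P μ (word c) (word s) p := by
    rw [sectionCochain_apply, onceP, pword_append, pword_cons, pword_map_inl, pword_map_inl,
      letter_inr, mul_assoc]
  have T1 (a c s t : List A.carrier) (p q : P.carrier) : T (a.map Sum.inl)
      (c.map Sum.inl ++ Sum.inr p :: s.map Sum.inl) (t.map Sum.inl ++ Sum.inr q :: m.map Sum.inl) =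
      P.op (word a * TensorAlgebra.ι K (sectionCochain P μ (word c) (word s) p) * A.sgn (word t))
        (A.sgn (word m)) (P.par q) := by
    rw [hT]
    simp only
    rw [sgn_pword, spreadOp_snd _ _ _ (by rw [numP_map_pureSgn]; simp), ← sgn_pword, pword_append (t.map _),
      pword_cons, pword_map_inl, pword_map_inl, map_mul (extSpace P).sgn, map_mul (extSpace P).sgn,
      letter_inr, sgn_once, sgn_inA, pword_map_inl, sgn_inA, hρ, ← inA_ι]
    simp only [← mul_assoc]
    rw [← map_mul, ← map_mul]
    exact spreadOp_onceP _ _ _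
  have T2 (b u v s t : List A.carrier) (p q : P.carrier) : T (b.map Sum.inl ++ Sum.inr p :: u.map Sum.inl)
      (v.map Sum.inl ++ Sum.inr q :: s.map Sum.inl) (t.map Sum.inl) =
      P.op (word b) (word u * TensorAlgebra.ι K (sectionCochain P μ (word v) (word s) q) *
        A.sgn (word t)) p := by
    rw [hT]
    simp only
    rw [sgn_pword, spreadOp_snd _ _ _ (by rw [numP_map_pureSgn]; simp), ← sgn_pword, hρ,
      pword_append (b.map _), pword_cons, pword_map_inl, pword_map_inl, pword_map_inl, sgn_inA,
      letter_inr, ← inA_ι]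
    simp only [mul_assoc]
    rw [← map_mul, ← map_mul, ← mul_assoc]
    exact spreadOp_onceP _ _ _
  have T3 (a t : List A.carrier) (v : List (A.carrier ⊕ P.carrier)) :
      T (a.map Sum.inl) v (t.map Sum.inl) = P.op (word a) (A.sgn (word t)) (μ (pword P v)).2 := by
    rw [hT]
    simp only
    rw [pword_map_inl, pword_map_inl, sgn_inA, sgn_word, spreadOp_mid]
  rw [coder_pword, spl_hom]
  simp_rw [spl_hom (spreadOp P)]
  change (spl _ fun u w => spl w fun v t => T u v t) = _
  rw [spl_append_cons, spl_map]
  have h1 : ∀ a a' : List A.carrier, a ++ a' = l →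
      (spl (a'.map Sum.inl ++ Sum.inr p :: (b.map Sum.inl ++ Sum.inr q :: m.map Sum.inl))
        fun v t => T (a.map Sum.inl) v t) =
      (spl m fun s t => P.op (word a) (A.sgn (word t)) (μ (pword P (a'.map Sum.inl ++
        Sum.inr p :: (b.map Sum.inl ++ Sum.inr q :: s.map Sum.inl)))).2) +
      spl b fun s t => P.op (word a * TensorAlgebra.ι K (sectionCochain P μ (word a') (word s) p) *
        A.sgn (word t)) (A.sgn (word m)) (P.par q) := by
    intro a a' _
    rw [spl_append_cons, spl_map, spl_eq_zero (fun u v _ => T0 _ _ _ (by simp)), zero_add,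
      spl_append_cons, spl_map, spl_map, add_comm]
    congr 1
    · exact spl_congr fun s t _ => T3 _ _ _
    · exact spl_congr fun s t _ => T1 _ _ _ _ _ _
  have h2 : (spl (b.map Sum.inl ++ Sum.inr q :: m.map Sum.inl) fun a w => spl w fun v t =>
      T (l.map Sum.inl ++ Sum.inr p :: a) v t) = spl b fun u v => spl m fun s t =>
        P.op (word l) (word u * TensorAlgebra.ι K (sectionCochain P μ (word v) (word s) q) *
          A.sgn (word t)) p := by
    rw [spl_append_cons, spl_map, spl_map]
    have h3 : (spl m fun u v => spl (v.map Sum.inl) fun v t => T (l.map Sum.inl ++ Sum.inr p ::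
        (b.map Sum.inl ++ Sum.inr q :: u.map Sum.inl)) v t) = 0 :=
      spl_eq_zero fun u v _ => by
        rw [spl_map]
        exact spl_eq_zero fun v t _ => T0 _ _ _ (by simp)
    rw [h3, add_zero]
    refine spl_congr fun u v _ => ?_
    rw [spl_append_cons, spl_map, spl_eq_zero (fun u v _ => T0 _ _ _ (by simp)), zero_add, spl_map]
    exact spl_congr fun s t _ => T2 _ _ _ _ _ _ _
  rw [spl_congr h1, h2, spl_add]
  abel

lemma pull_spreadOp_coder (hμ : IsDivisor P μ) (x y : Bar A.toGrSpace)
    (z : (tensorPow P (0 + 1 + 1)).carrier) :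
    pull (0 + 1) (spreadOp P ∘ₗ (extSpace P).coder μ) x y z =
      Cochain.comp 1 P.op (pull (0 + 1) (higherPart μ)) x y z +
      ((conjLeft P 0 ⟨sectionCochain P μ, section_mem_homDeg hμ⟩ -
      conjRight P 0 ⟨sectionCochain P μ, section_mem_homDeg hμ⟩ :
        Cochain A (tensor P P).toGrSpace P.toGrSpace) :
          Bar A.toGrSpace →ₗ[K] Bar A.toGrSpace →ₗ[K] (tensor P P).carrier →ₗ[K] P.carrier) x y z := by
  set D : Cochain A (tensor P P).toGrSpace P.toGrSpace :=
    conjLeft P 0 ⟨sectionCochain P μ, section_mem_homDeg hμ⟩ -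
      conjRight P 0 ⟨sectionCochain P μ, section_mem_homDeg hμ⟩ with hD
  let D' : Cochain A (tensorPow P (0 + 1 + 1)).toGrSpace P.toGrSpace := D
  suffices h : pull (0 + 1) (spreadOp P ∘ₗ (extSpace P).coder μ) =
      Cochain.comp 1 P.op (pull (0 + 1) (higherPart μ)) + D' from
    congrArg (fun φ : Cochain A (tensorPow P (0 + 1 + 1)).toGrSpace P.toGrSpace => φ x y z) h
  refine word_ext fun l => word_ext fun m => Rep.ext fun z c hz => ?_
  obtain ⟨p, b, z', c', ⟨q, hz', hc'⟩, hb, h1, h2⟩ := id hz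
  have h3 : D (word l) (word m) (tens P P p (word b) q) = _ := congrArg₂ (· - ·)
    (conjLeft_word rfl ⟨sectionCochain P μ, section_mem_homDeg hμ⟩ l b m p q)
    (conjRight_word rfl ⟨sectionCochain P μ, section_mem_homDeg hμ⟩ l b m p q)
  rw [sub_neg_eq_add] at h3
  have h4 := spreadOp_coder_word hμ l b m p q
  have e : ∀ l m : List A.carrier, l.map Sum.inl ++ c ++ m.map Sum.inl =
      l.map Sum.inl ++ Sum.inr p :: (b.map Sum.inl ++ Sum.inr q :: m.map Sum.inl) := by
    intro l m
    simp [h2, hc']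
  have h5 : Cochain.comp 1 P.op (pull (0 + 1) (higherPart μ)) (word l) (word m) z =
      spl l fun a a' => spl m fun s t => P.op (word a) (A.sgn (word t)) (μ (pword P (a'.map Sum.inl ++
        Sum.inr p :: (b.map Sum.inl ++ Sum.inr q :: s.map Sum.inl)))).2 := by
    rw [comp_word_spl]
    refine spl_congr fun a a' _ => spl_congr fun s t _ => ?_
    rw [sgnPow_one_apply, pull_apply, hz.core_eq, ← pword_map_inl, ← pword_map_inl, ← pword_append,
      ← pword_append, e, higherPart, LinearMap.sub_apply, spreadOp_pword (by simp), sub_zero]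
    rfl
  rw [LinearMap.add_apply, LinearMap.add_apply, LinearMap.add_apply, h5, pull_apply, hz.core_eq,
    ← pword_map_inl, ← pword_map_inl, ← pword_append, ← pword_append, e, LinearMap.comp_apply, h4,
    add_assoc]
  congr 1
  have h6 : z = genSucc 0 p (word b) (genZero q) := by rw [h1, hz']
  rw [h6]
  exact h3.symm

/-- The section of a noncommutative divisor is invariant under self-conjugation. -/
lemma conj_section_mem (hP : IsBimodule P) (hμ : IsDivisor P μ) :
    conjLeft P 0 ⟨sectionCochain P μ, section_mem_homDeg hμ⟩ -
      conjRight P 0 ⟨sectionCochain P μ, section_mem_homDeg hμ⟩ ∈ coboundaries (tensor P P) P 0 := by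
  have h1 := pull_coder hμ (0 + 1) (higherPart_unitFree hμ) (higherPart_kills hμ)
  have h2 : pull (0 + 1) (higherPart μ ∘ₗ (extSpace P).coder μ) =
      -pull (0 + 1) (spreadOp P ∘ₗ (extSpace P).coder μ) := by
    have : higherPart μ ∘ₗ (extSpace P).coder μ = -(spreadOp P ∘ₗ (extSpace P).coder μ) :=
      LinearMap.ext fun x => by simp [higherPart, hμ.isAInf.assoc]
    rw [this]
    rfl
  rw [h2] at h1
  refine Submodule.mem_map.2 ⟨(-pull (0 + 1) (higherPart μ) :
    Cochain A (tensorPow P (0 + 1 + 1)).toGrSpace P.toGrSpace),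
    Submodule.neg_mem _ (higherPart_mem hP hμ), ?_⟩
  have h3 := diff_apply (P := tensorPow P (0 + 1 + 1)) (Q := P) (-1) (pull (0 + 1) (higherPart μ))
  rw [← h1, comp_congr_even (d := -1) (e := 1) (by decide), ksign_neg, ksign_one, neg_smul, one_smul,
    sub_neg_eq_add] at h3
  refine LinearMap.ext fun x => LinearMap.ext fun y => LinearMap.ext fun z => ?_
  have h4 := pull_spreadOp_coder hμ x y z
  have h5 := congrArg (fun φ : Cochain A (tensorPow P (0 + 1 + 1)).toGrSpace P.toGrSpace =>
    φ x y z) h3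
  have h6 : diff (tensorPow P (0 + 1 + 1)) P (-1) (pull (0 + 1) (higherPart μ)) x y z =
    Cochain.comp 1 P.op (pull (0 + 1) (higherPart μ)) x y z -
      pull (0 + 1) (spreadOp P ∘ₗ (extSpace P).coder μ) x y z := by
    rw [sub_eq_add_neg]
    exact h5
  rw [h4, sub_add_cancel_left] at h6
  have h7 : diff (tensorPow P (0 + 1 + 1)) P (-1) (-pull (0 + 1) (higherPart μ)) x y z =
      (conjLeft P 0 ⟨sectionCochain P μ, section_mem_homDeg hμ⟩ -
      conjRight P 0 ⟨sectionCochain P μ, section_mem_homDeg hμ⟩ :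
        Cochain A (tensor P P).toGrSpace P.toGrSpace) x y z := by
    rw [map_neg]
    exact neg_eq_iff_eq_neg.2 h6
  exact h7

end SingleDivisors

section Polynomial

variable {K : Type u} [Field K] {Ω : Type*} (s t : Ω → K)
variable {X Y : Type u} [AddCommGroup X] [Module K X] [AddCommGroup Y] [Module K Y]
variable {S T : Type*}

/-- Polynomial functions `Ω → X` in the two parameters `s`, `t`, homogeneous of degree `r` if the
coefficient `v x` is given the degree `wt x`. -/
def polySpan (v : T → X) (wt : T → ℕ) (r : ℕ) : Submodule K (Ω → X) :=
  Submodule.span K {F | ∃ i j x, i + j + wt x = r ∧ F = fun ω => (s ω ^ i * t ω ^ j) • v x}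

variable {s t} {v : T → X} {wt : T → ℕ} {v' : S → Y} {wt' : S → ℕ}

lemma mem_polySpan (i j : ℕ) (x : T) {r : ℕ} (h : i + j + wt x = r) :
    (fun ω => (s ω ^ i * t ω ^ j) • v x) ∈ polySpan s t v wt r :=
  Submodule.subset_span ⟨i, j, x, h, rfl⟩

lemma const_mem_polySpan (x : T) : (fun _ => v x) ∈ polySpan s t v wt (wt x) := by
  simpa using mem_polySpan (s := s) (t := t) (v := v) (wt := wt) 0 0 x (by simp)

lemma smul_mem_polySpan {F : Ω → X} {r : ℕ} (hF : F ∈ polySpan s t v wt r) (i j : ℕ) :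
    (fun ω => (s ω ^ i * t ω ^ j) • F ω) ∈ polySpan s t v wt (i + j + r) := by
  suffices h : polySpan s t v wt r ≤ (polySpan s t v wt (i + j + r)).comap
    (LinearMap.pi fun ω => (s ω ^ i * t ω ^ j) • LinearMap.proj (R := K) (φ := fun _ => X) ω) from h hF
  refine Submodule.span_le.2 ?_
  rintro _ ⟨k, l, x, rfl, rfl⟩
  have := mem_polySpan (s := s) (t := t) (v := v) (wt := wt) (i + k) (j + l) x rfl
  have e : (fun ω => (s ω ^ i * t ω ^ j) • (s ω ^ k * t ω ^ l) • v x) =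
      fun ω => (s ω ^ (i + k) * t ω ^ (j + l)) • v x := funext fun ω => by
    rw [smul_smul]; congr 1; ring
  rw [show i + k + (j + l) + wt x = i + j + (k + l + wt x) by ring, ← e] at this
  exact this

/-- Families of linear maps which are homogeneous of degree `c` on the generators preserve
homogeneous functions. -/
lemma apply_mem_polySpan {F : Ω → X} {r c : ℕ} (hF : F ∈ polySpan s t v wt r) (G : Ω → X →ₗ[K] Y)
    (hG : ∀ x, (fun ω => G ω (v x)) ∈ polySpan s t v' wt' (wt x + c)) :
    (fun ω => G ω (F ω)) ∈ polySpan s t v' wt' (r + c) := by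
  suffices h : polySpan s t v wt r ≤ (polySpan s t v' wt' (r + c)).comap
    (LinearMap.pi fun ω => G ω ∘ₗ LinearMap.proj (R := K) (φ := fun _ => X) ω) from h hF
  refine Submodule.span_le.2 ?_
  rintro _ ⟨k, l, x, rfl, rfl⟩
  have := smul_mem_polySpan (hG x) k l
  rw [← add_assoc] at this
  have e : (fun ω => G ω ((s ω ^ k * t ω ^ l) • v x)) =
      fun ω => (s ω ^ k * t ω ^ l) • G ω (v x) := funext fun ω => map_smul _ _ _
  rw [← e] at this
  exact this

lemma spl_mem_polySpan {E : Type*} {l : List E} {F : Ω → List E → List E → X} {r : ℕ}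
    (h : ∀ a b, a ++ b = l → (fun ω => F ω a b) ∈ polySpan s t v wt r) :
    (fun ω => spl l (F ω)) ∈ polySpan s t v wt r := by
  have : (fun ω => spl l (F ω)) = spl l fun a b => fun ω => F ω a b :=
    funext fun ω => by simp [spl]
  rw [this]
  exact spl_mem h

variable (s t X) in
/-- Homogeneous polynomials of degree `n` with coefficients in `X`. -/
abbrev homogPoly (n : ℕ) : Submodule K (Ω → X) := polySpan s t (id : X → X) (fun _ => 0) n

lemma homogPoly_one {F : Ω → X} (hF : F ∈ homogPoly s t X 1) {ω₀ ω₁ : Ω} (h0 : s ω₀ = 1)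
    (h0' : t ω₀ = 0) (h1 : s ω₁ = 0) (h1' : t ω₁ = 1) (ω : Ω) :
    F ω = s ω • F ω₀ + t ω • F ω₁ := by
  induction hF using Submodule.span_induction with
  | mem F hF =>
    obtain ⟨i, j, x, h, rfl⟩ := hF
    have : i = 0 ∧ j = 1 ∨ i = 1 ∧ j = 0 := by simp only at h; omega
    rcases this with ⟨rfl, rfl⟩ | ⟨rfl, rfl⟩ <;> simp [h0, h0', h1, h1']
  | zero => simp
  | add F G _ _ hF hG => rw [Pi.add_apply, hF, hG]; simp only [Pi.add_apply]; module
  | smul c F _ hF => rw [Pi.smul_apply, hF]; simp only [Pi.smul_apply]; module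

variable (K) in
/-- The coefficients of the Lagrange polynomials for the points `0, …, n`. -/
def lagrangeCoeff (n : ℕ) : Matrix (Fin (n + 1)) (Fin (n + 1)) K :=
  (Matrix.vandermonde fun k : Fin (n + 1) => ((k : ℕ) : K))⁻¹

lemma homogPoly_interpolation [CharZero K] {n : ℕ} {F : Ω → X} (hF : F ∈ homogPoly s t X n)
    {p : Fin (n + 1) → Ω} (h0 : ∀ k, s (p k) = 1) (h1 : ∀ k, t (p k) = (k : ℕ)) (ω : Ω) :
    F ω = ∑ k, (∑ m, lagrangeCoeff K n m k * (s ω ^ (n - m : ℕ) * t ω ^ (m : ℕ))) • F (p k) := by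
  induction hF using Submodule.span_induction with
  | mem F hF =>
    obtain ⟨i, j, x, h, rfl⟩ := hF
    have hV : lagrangeCoeff K n * Matrix.vandermonde (fun k : Fin (n + 1) => ((k : ℕ) : K)) = 1 := by
      refine Matrix.nonsing_inv_mul _ (isUnit_iff_ne_zero.2 (Matrix.det_vandermonde_ne_zero_iff.2 ?_))
      exact fun a b hab => Fin.ext (Nat.cast_injective (R := K) hab)
    have hj : j < n + 1 := by omega
    have key (m : Fin (n + 1)) : ∑ k, lagrangeCoeff K n m k * ((k : ℕ) : K) ^ j =
        if m = ⟨j, hj⟩ then 1 else 0 := by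
      have := congrFun (congrFun hV m) ⟨j, hj⟩
      rw [Matrix.mul_apply, Matrix.one_apply] at this
      exact this
    simp only [h0, h1, one_pow, one_mul, smul_smul, ← Finset.sum_smul]
    congr 1
    simp_rw [Finset.sum_mul]
    rw [Finset.sum_comm]
    have h2 (m : Fin (n + 1)) : ∑ k : Fin (n + 1), lagrangeCoeff K n m k *
        (s ω ^ (n - m : ℕ) * t ω ^ (m : ℕ)) * ((k : ℕ) : K) ^ j =
        (if m = ⟨j, hj⟩ then 1 else 0) * (s ω ^ (n - m : ℕ) * t ω ^ (m : ℕ)) := by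
      rw [← key, Finset.sum_mul]
      exact Finset.sum_congr rfl fun k _ => by ring
    simp_rw [h2]
    simp
    left
    congr 1
    simp only at h
    omega
  | zero => simp
  | add F G _ _ hF hG => rw [Pi.add_apply, hF, hG]; simp [Finset.sum_add_distrib]
  | smul c F _ hF => rw [Pi.smul_apply, hF, Finset.smul_sum]; simp [smul_comm c]

end Polynomial

section PolynomialFamilies

variable {K : Type u} [Field K] {A : AInfAlgebra K} {P : BimoduleData A} {Ω : Type*} {s t : Ω → K}

variable (P s t) in
/-- Homogeneous functions with values in `T(B[1])`, the parameters and `P` having degree `1`. -/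
abbrev barPoly (r : ℕ) : Submodule K (Ω → Bar (extSpace P)) := polySpan s t (pword P) numP r

variable (P s t) in
/-- Homogeneous functions with values in `B`, the parameters and `P` having degree `1`. -/
abbrev extPoly (r : ℕ) : Submodule K (Ω → extSpace P) :=
  polySpan s t (letter P) (fun a => numP [a]) r

lemma pword_mul_mem {F : Ω → Bar (extSpace P)} {r : ℕ} (l : List (A.carrier ⊕ P.carrier))
    (hF : F ∈ barPoly P s t r) : (fun ω => pword P l * F ω) ∈ barPoly P s t (r + numP l) :=
  apply_mem_polySpan hF (fun _ => LinearMap.mulLeft K (pword P l)) fun m => by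
    have := const_mem_polySpan (s := s) (t := t) (v := pword P) (wt := numP) (l ++ m)
    rw [pword_append, numP_append, add_comm] at this
    exact this

lemma mul_mem_barPoly {F G : Ω → Bar (extSpace P)} {r q : ℕ} (hF : F ∈ barPoly P s t r)
    (hG : G ∈ barPoly P s t q) : (fun ω => F ω * G ω) ∈ barPoly P s t (r + q) :=
  apply_mem_polySpan hF (fun ω => LinearMap.mulRight K (G ω)) fun m => by
    have := pword_mul_mem m hG
    rwa [add_comm] at this

lemma ι_mem_barPoly {F : Ω → extSpace P} {r : ℕ} (hF : F ∈ extPoly P s t r) :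
    (fun ω => TensorAlgebra.ι K (F ω)) ∈ barPoly P s t r :=
  apply_mem_polySpan (c := 0) hF (fun _ => TensorAlgebra.ι K) fun m => by
    have := const_mem_polySpan (s := s) (t := t) (v := pword P) (wt := numP) [m]
    rw [pword_cons, pword_nil, mul_one] at this
    exact this

variable {μ μ' Φ : Ω → Bar (extSpace P) →ₗ[K] (extSpace P)}

variable (s t) in
/-- Families of maps `T(B[1]) → B` which are polynomial in the parameters and homogeneous. -/
def PolyFamily (f : Ω → Bar (extSpace P) →ₗ[K] (extSpace P)) : Prop :=
  ∀ l, (fun ω => f ω (pword P l)) ∈ extPoly P s t (numP l)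

lemma PolyFamily.hat (hΦ : PolyFamily s t Φ) (h0 : ∀ ω, Φ ω 1 = 0)
    (l : List (A.carrier ⊕ P.carrier)) :
    (fun ω => NCPencil.hat (Φ ω) (h0 ω) (pword P l)) ∈ barPoly P s t (numP l) := by
  have e (ω : Ω) (l : List (A.carrier ⊕ P.carrier)) : NCPencil.hat (Φ ω) (h0 ω) (pword P l) =
      algebraMap K _ (aug (pword P l)) + spl l fun a b =>
        TensorAlgebra.ι K (Φ ω (pword P a)) * NCPencil.hat (Φ ω) (h0 ω) (pword P b) := by
    rw [pword, hat_word_eq, spl_map]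
    rfl
  have h1 : (fun _ => (1 : Bar (extSpace P))) ∈ barPoly P s t 0 :=
    const_mem_polySpan (s := s) (t := t) (v := pword P) (wt := numP) []
  induction hn : l.length using Nat.strong_induction_on generalizing l with
  | _ n ih =>
    cases l with
    | nil =>
      simp only [pword_nil, hat_one, numP_nil]
      exact h1
    | cons a l =>
      have e' : (fun ω => NCPencil.hat (Φ ω) (h0 ω) (pword P (a :: l))) = fun ω =>
          spl (a :: l) fun c d => TensorAlgebra.ι K (Φ ω (pword P c)) *
            NCPencil.hat (Φ ω) (h0 ω) (pword P d) := funext fun ω => by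
        rw [e, pword_cons, map_mul, aug_ι, zero_mul, map_zero, zero_add]
      rw [e']
      refine spl_mem_polySpan fun c d hcd => ?_
      cases c with
      | nil =>
        have : (fun ω => TensorAlgebra.ι K (Φ ω (pword P [])) *
            NCPencil.hat (Φ ω) (h0 ω) (pword P d)) = 0 := funext fun ω => by
          rw [pword_nil, h0, map_zero, zero_mul]
          rfl
        exact this ▸ zero_mem _
      | cons b c =>
        have := mul_mem_barPoly (ι_mem_barPoly (hΦ (b :: c))) (ih d.length (by
          rw [← hn, ← hcd]; simp) d rfl)
        rwa [← numP_append, hcd] at this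

lemma PolyFamily.coder (hμ : PolyFamily s t μ) (l : List (A.carrier ⊕ P.carrier)) :
    (fun ω => (extSpace P).coder (μ ω) (pword P l)) ∈ barPoly P s t (numP l) := by
  simp_rw [coder_pword]
  refine spl_mem_polySpan fun a b hab => spl_mem_polySpan fun c d hcd => ?_
  rw [sgn_pword]
  have := mul_mem_barPoly (pword_mul_mem a (ι_mem_barPoly (hμ c)))
    (const_mem_polySpan (s := s) (t := t) (v := pword P) (wt := numP) (d.map pureSgn))
  rw [numP_map_pureSgn, add_comm (numP c), add_assoc, ← numP_append, hcd, ← numP_append, hab] at this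
  exact this

lemma PolyFamily.comp {F : Ω → Bar (extSpace P)} {r : ℕ} (hμ : PolyFamily s t μ)
    (hF : F ∈ barPoly P s t r) : (fun ω => μ ω (F ω)) ∈ extPoly P s t r :=
  apply_mem_polySpan (c := 0) hF μ hμ

lemma PolyFamily.homDefect (hμ : PolyFamily s t μ) (hμ' : PolyFamily s t μ') (hΦ : PolyFamily s t Φ)
    (h0 : ∀ ω, Φ ω 1 = 0) : PolyFamily s t fun ω => homDefect (μ ω) (μ' ω) (Φ ω) (h0 ω) := fun l =>
  Submodule.sub_mem _ (hμ'.comp (hΦ.hat h0 l)) (hΦ.comp (hμ.coder l))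

lemma PolyFamily.fst (hΦ : PolyFamily s t Φ) (l : List (A.carrier ⊕ P.carrier)) :
    (fun ω => toFst P (Φ ω (pword P l))) ∈ homogPoly s t A.carrier (numP l) :=
  apply_mem_polySpan (c := 0) (hΦ l) (fun _ => toFst P) fun x => by
    cases x with
    | inl a => exact const_mem_polySpan (s := s) (t := t) (v := id) (wt := fun _ : A.carrier => 0) a
    | inr p => exact zero_mem _

lemma PolyFamily.snd (hΦ : PolyFamily s t Φ) {l : List (A.carrier ⊕ P.carrier)} {r : ℕ}
    (hl : numP l = r + 1) : (fun ω => toSnd P (Φ ω (pword P l))) ∈ homogPoly s t P.carrier r := by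
  have h := hΦ l
  rw [hl] at h
  suffices h' : extPoly P s t (r + 1) ≤ (homogPoly s t P.carrier r).comap (LinearMap.pi fun ω =>
    toSnd P ∘ₗ LinearMap.proj (R := K) (φ := fun _ => (extSpace P).carrier) ω) from h' h
  refine Submodule.span_le.2 ?_
  rintro _ ⟨k, j, x, hx, rfl⟩
  cases x with
  | inl a =>
    have : (fun ω => toSnd P ((s ω ^ k * t ω ^ j) • letter P (Sum.inl a))) = 0 :=
      funext fun ω => by rw [map_smul]; exact smul_zero _
    change (fun ω => toSnd P ((s ω ^ k * t ω ^ j) • letter P (Sum.inl a))) ∈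
      homogPoly s t P.carrier r
    exact this ▸ zero_mem _
  | inr p =>
    have : (fun ω => toSnd P ((s ω ^ k * t ω ^ j) • letter P (Sum.inr p))) =
      fun ω => (s ω ^ k * t ω ^ j) • id p := funext fun ω => by rw [map_smul]; rfl
    change (fun ω => toSnd P ((s ω ^ k * t ω ^ j) • letter P (Sum.inr p))) ∈
      homogPoly s t P.carrier r
    rw [this]
    exact mem_polySpan k j p (by simpa using hx)

end PolynomialFamilies

section PencilFamilies

variable {K : Type u} [Field K] {A : AInfAlgebra K} {P : BimoduleData A}
variable {V : Type v} [AddCommGroup V] [Module K V] (b : Module.Basis (Fin 2) K V)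

lemma specialize_tmul (w : Module.Dual K V) (a : extSpace P) (x : SymmetricAlgebra K V) :
    specialize P w (a ⊗ₜ x) = SymmetricAlgebra.lift w x • a := by
  simp [specialize]

lemma lift_mem_homogPoly (j : ℕ) {x : SymmetricAlgebra K V}
    (hx : x ∈ LinearMap.range (SymmetricAlgebra.ι K V) ^ j) :
    (fun w : Module.Dual K V => SymmetricAlgebra.lift w x) ∈
      homogPoly (fun w : Module.Dual K V => w (b 0)) (fun w => w (b 1)) K j := by
  induction j generalizing x with
  | zero =>
    obtain ⟨c, rfl⟩ := Submodule.mem_one.1 (by simpa using hx)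
    have := mem_polySpan (s := fun w : Module.Dual K V => w (b 0)) (t := fun w => w (b 1))
      (v := (id : K → K)) (wt := fun _ => 0) 0 0 c rfl
    simpa using this
  | succ j ih =>
    rw [pow_succ] at hx
    induction hx using Submodule.mul_induction_on' with
    | mem_mul_mem x hx y hy =>
      obtain ⟨v, rfl⟩ := hy
      have h1 : (fun w : Module.Dual K V => SymmetricAlgebra.lift w (x * SymmetricAlgebra.ι K V v)) =
          b.coord 0 v • (fun w : Module.Dual K V => (w (b 0) ^ 1 * w (b 1) ^ 0) •
            SymmetricAlgebra.lift w x) + b.coord 1 v • fun w : Module.Dual K V =>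
              (w (b 0) ^ 0 * w (b 1) ^ 1) • SymmetricAlgebra.lift w x := by
        funext w
        have h2 : w v = b.coord 0 v * w (b 0) + b.coord 1 v * w (b 1) := by
          have h := congrArg w (b.sum_repr v)
          rw [Fin.sum_univ_two, map_add, map_smul, map_smul] at h
          exact h.symm
        simp [h2]
        ring
      rw [h1]
      have h3 := ih hx
      refine Submodule.add_mem _ (Submodule.smul_mem _ _ ?_) (Submodule.smul_mem _ _ ?_)
      · have := smul_mem_polySpan h3 1 0
        rwa [show 1 + 0 + j = j + 1 by ring] at this
      · have := smul_mem_polySpan h3 0 1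
        rwa [show 0 + 1 + j = j + 1 by ring] at this
    | add x _ y _ hx hy =>
      simp only [map_add]
      exact Submodule.add_mem _ hx hy

lemma letter_mem_extWt (a : A.carrier ⊕ P.carrier) : letter P a ∈ extWt P (-(numP [a] : ℤ)) := by
  cases a with
  | inl a => simpa [extWt] using ⟨a, rfl⟩
  | inr p => simpa [extWt] using ⟨p, rfl⟩

lemma homWord_pword (l : List (A.carrier ⊕ P.carrier)) :
    HomWord (extWt P) 0 (-(numP l : ℤ)) (pword P l) := by
  induction l with
  | nil => exact HomWord.nil
  | cons a l ih =>
    have := HomWord.cons (letter_mem_extWt a) ih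
    rw [pword_cons]
    convert this using 1
    have : numP (a :: l) = numP [a] + numP l := numP_append [a] l
    rw [this]
    push_cast
    ring

lemma extWt_cases {n : ℤ} {a : A.carrier × P.carrier} (ha : a ∈ extWt P n) :
    a = 0 ∨ ∃ x, a = letter P x ∧ n = -(numP [x] : ℤ) := by
  rw [extWt] at ha
  split_ifs at ha with h1 h2
  · obtain ⟨x, rfl⟩ := ha
    exact Or.inr ⟨Sum.inl x, rfl, by simpa using h1⟩
  · obtain ⟨x, rfl⟩ := ha
    exact Or.inr ⟨Sum.inr x, rfl, by simpa using h2⟩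
  · exact Or.inl ha

lemma HomWord.eq_pword {m : ℤ} {x : Bar (extSpace P)} (hx : HomWord (extWt P) 0 m x) :
    x = 0 ∨ ∃ l, x = pword P l ∧ m = -(numP l : ℤ) := by
  induction hx with
  | nil => exact Or.inr ⟨[], rfl, rfl⟩
  | cons he _ ih =>
    rcases extWt_cases he with rfl | ⟨a, rfl, rfl⟩
    · exact Or.inl (by rw [map_zero, zero_mul])
    · rcases ih with rfl | ⟨l, rfl, rfl⟩
      · exact Or.inl (by rw [mul_zero])
      · refine Or.inr ⟨a :: l, (pword_cons _ _).symm, ?_⟩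
        have : numP (a :: l) = numP [a] + numP l := numP_append [a] l
        rw [this]
        push_cast
        ring

lemma PreservesGradings.polyFamily {d : ℤ} {f : Bar (extSpace P) →ₗ[K] ExtSym P V}
    (hf : PreservesGradings P d f) : PolyFamily (fun w : Module.Dual K V => w (b 0))
      (fun w => w (b 1)) fun w => specialize P w ∘ₗ f := fun l => by
  have h := hf.weight _ _ (homWord_pword l)
  suffices h' : (⨆ j : ℕ, LinearMap.range (TensorProduct.mapIncl (extWt P (-(numP l : ℤ) + j))
      (LinearMap.range (SymmetricAlgebra.ι K V) ^ j))) ≤ (extPoly P (fun w : Module.Dual K V =>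
        w (b 0)) (fun w => w (b 1)) (numP l)).comap (LinearMap.pi fun w => specialize P w) from h' h
  refine iSup_le fun j => ?_
  rintro _ ⟨y, rfl⟩
  induction y using TensorProduct.induction_on with
  | zero => rw [LinearMap.map_zero]; exact zero_mem _
  | add y z hy hz => rw [map_add]; exact Submodule.add_mem _ hy hz
  | tmul a x =>
    have e : (LinearMap.pi fun w => specialize P w) (TensorProduct.mapIncl
        (extWt P (-(numP l : ℤ) + j)) (LinearMap.range (SymmetricAlgebra.ι K V) ^ j) (a ⊗ₜ x)) =
        fun w => SymmetricAlgebra.lift w x.1 • a.1 := funext fun w => specialize_tmul w a.1 x.1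
    rw [Submodule.mem_comap, e]
    rcases extWt_cases a.2 with h0 | ⟨c, hc, hn⟩
    · simp only [h0, smul_zero]
      exact zero_mem _
    · have h1 := lift_mem_homogPoly b j x.2
      rw [hc, show numP l = j + numP [c] by omega]
      refine apply_mem_polySpan h1 (fun _ => LinearMap.toSpanSingleton K _ (letter P c)) fun k => ?_
      have := Submodule.smul_mem _ k (const_mem_polySpan (s := fun w : Module.Dual K V => w (b 0))
        (t := fun w => w (b 1)) (v := letter P) (wt := fun a => numP [a]) c)
      rw [zero_add]
      exact this

/-- Lifts of the homogeneous Lagrange polynomials to the symmetric algebra. -/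
def lagrangeSym (n : ℕ) (k : Fin (n + 1)) : SymmetricAlgebra K V :=
  ∑ m : Fin (n + 1), lagrangeCoeff K n m k •
    (SymmetricAlgebra.ι K V (b 0) ^ (n - m : ℕ) * SymmetricAlgebra.ι K V (b 1) ^ (m : ℕ))

lemma lagrangeSym_mem (n : ℕ) (k : Fin (n + 1)) :
    lagrangeSym b n k ∈ LinearMap.range (SymmetricAlgebra.ι K V) ^ n := by
  refine Submodule.sum_mem _ fun m _ => Submodule.smul_mem _ _ ?_
  have h := Submodule.mul_mem_mul (Submodule.pow_mem_pow _ (LinearMap.mem_range_self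
    (SymmetricAlgebra.ι K V) (b 0)) (n - m)) (Submodule.pow_mem_pow _ (LinearMap.mem_range_self
    (SymmetricAlgebra.ι K V) (b 1)) m)
  rwa [← pow_add, Nat.sub_add_cancel (by omega)] at h

lemma lift_lagrangeSym (w : Module.Dual K V) (n : ℕ) (k : Fin (n + 1)) :
    SymmetricAlgebra.lift w (lagrangeSym b n k) =
      ∑ m, lagrangeCoeff K n m k * (w (b 0) ^ (n - m : ℕ) * w (b 1) ^ (m : ℕ)) := by
  simp [lagrangeSym]

/-- The polynomial family of maps with given values at the interpolation points. -/
def interpolate (n : ℕ) (f : Fin (n + 1) → Bar (extSpace P) →ₗ[K] (extSpace P)) :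
    Bar (extSpace P) →ₗ[K] ExtSym P V :=
  ∑ k, (TensorProduct.mk K _ _).flip (lagrangeSym b n k) ∘ₗ f k

lemma interpolate_apply (n : ℕ) (f : Fin (n + 1) → Bar (extSpace P) →ₗ[K] (extSpace P))
    (x : Bar (extSpace P)) : interpolate b n f x = ∑ k, f k x ⊗ₜ lagrangeSym b n k := by
  simp [interpolate]

lemma specialize_interpolate (w : Module.Dual K V) (n : ℕ)
    (f : Fin (n + 1) → Bar (extSpace P) →ₗ[K] (extSpace P)) :
    specialize P w ∘ₗ interpolate b n f = ∑ k, SymmetricAlgebra.lift w (lagrangeSym b n k) • f k := by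
  refine LinearMap.ext fun x => ?_
  rw [LinearMap.comp_apply, interpolate_apply, map_sum, LinearMap.sum_apply]
  exact Finset.sum_congr rfl fun k _ => specialize_tmul w _ _

lemma interpolate_gradings {n r : ℕ} {f : Fin (n + 1) → Bar (extSpace P) →ₗ[K] (extSpace P)}
    (hd : ∀ k n x, HomWord (extSpace P).gr (-1) n x → f k x ∈ (extSpace P).gr (n + 1))
    (h0 : ∀ k l, numP l ≠ r → f k (pword P l) = 0)
    (hr : ∀ k x, f k x ∈ extWt P (-(r : ℤ) + n)) : PreservesGradings P 1 (interpolate b n f) where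
  degree m x hx := by
    rw [interpolate_apply]
    exact Submodule.sum_mem _ fun k _ => ⟨⟨_, hd k m x hx⟩ ⊗ₜ ⟨lagrangeSym b n k, trivial⟩, rfl⟩
  weight m x hx := by
    rcases hx.eq_pword with rfl | ⟨l, rfl, rfl⟩
    · rw [map_zero]; exact zero_mem _
    · rw [interpolate_apply]
      refine Submodule.sum_mem _ fun k _ => ?_
      by_cases hl : numP l = r
      · rw [hl]
        exact Submodule.mem_iSup_of_mem n ⟨⟨_, hr k _⟩ ⊗ₜ ⟨_, lagrangeSym_mem b n k⟩, rfl⟩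
      · rw [h0 k l hl, TensorProduct.zero_tmul]
        exact zero_mem _

lemma PreservesGradings.add {d : ℤ} {f g : Bar (extSpace P) →ₗ[K] ExtSym P V}
    (hf : PreservesGradings P d f) (hg : PreservesGradings P d g) : PreservesGradings P d (f + g) where
  degree n x hx := Submodule.add_mem _ (hf.degree n x hx) (hg.degree n x hx)
  weight n x hx := Submodule.add_mem _ (hf.weight n x hx) (hg.weight n x hx)

end PencilFamilies

section PencilDeformation

variable {K : Type u} [Field K] {A : AInfAlgebra K} {P : BimoduleData A}
variable {V : Type v} [AddCommGroup V] [Module K V] (b : Module.Basis (Fin 2) K V)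

lemma Kills.smul {X : Type u} [AddCommGroup X] [Module K X] {r : ℕ}
    {f : Bar (extSpace P) →ₗ[K] X} (hf : Kills r f) (c : K) : Kills r (c • f) :=
  fun l hl => by rw [LinearMap.smul_apply, hf l hl, smul_zero]

lemma Kills.sum {X : Type u} {ι : Type*} [AddCommGroup X] [Module K X] {r : ℕ} {s : Finset ι}
    {f : ι → Bar (extSpace P) →ₗ[K] X} (hf : ∀ k, Kills r (f k)) : Kills r (∑ k ∈ s, f k) :=
  fun l hl => by rw [LinearMap.sum_apply]; exact Finset.sum_eq_zero fun k _ => hf k l hl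

lemma IsPreIso.add {Φ φ : Bar (extSpace P) →ₗ[K] (extSpace P)} (hΦ : IsPreIso P Φ)
    (hd : ∀ n x, HomWord (extSpace P).gr (-1) n x → φ x ∈ (extSpace P).gr (n + 1))
    (hu : UnitFree φ) (h1 : Kills 1 φ) (h2 : Kills 2 (toSnd P ∘ₗ φ)) : IsPreIso P (Φ + φ) where
  map_one := by
    rw [LinearMap.add_apply, hΦ.map_one, zero_add]
    exact h1 [] Nat.one_pos
  degree n x hx := Submodule.add_mem _ (hΦ.degree n x hx) (hd n x hx)
  unital x y := by rw [LinearMap.add_apply, hΦ.unital, hu, add_zero]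
  subalgebra x := by
    have h : φ ∘ₗ (inA P).toLinearMap = 0 := word_ext fun l => by
      have := h1 (l.map Sum.inl) (by simp)
      rwa [pword_map_inl] at this
    have h' : φ (inA P x) = 0 := LinearMap.congr_fun h x
    rw [LinearMap.add_apply, hΦ.subalgebra, h', add_zero]
  quotient x y p := by
    have h : pull 0 (toSnd P ∘ₗ φ) = 0 := word_ext fun l => word_ext fun m => genZero_ext fun p => by
      have := h2 (l.map Sum.inl ++ Sum.inr p :: m.map Sum.inl) (by simp)
      rw [pword_append, pword_cons, pword_map_inl, pword_map_inl, ← mul_assoc] at this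
      exact this
    have h' : (φ (onceP P x y p)).2 = 0 :=
      LinearMap.congr_fun (LinearMap.congr_fun (LinearMap.congr_fun h x) y) p
    rw [LinearMap.add_apply, Prod.snd_add, hΦ.quotient, h', add_zero]

/-- Graded families whose specializations satisfy the conditions of `IsPreIso`. -/
structure IsPreFamily (P : BimoduleData A) (Φ : Bar (extSpace P) →ₗ[K] ExtSym P V) : Prop where
  gradings : PreservesGradings P 1 Φ
  spec : ∀ w, IsPreIso P (specialize P w ∘ₗ Φ)

lemma homogPoly_primitive [CharZero K] {R : GrSpace K} {i n : ℕ}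
    {C : Module.Dual K V → Cochain A (tensorPow P (i + 1)).toGrSpace R}
    (hC : ∀ l m z c, Rep P i z c → (fun w => C w (word l) (word m) z) ∈
      homogPoly (fun w : Module.Dual K V => w (b 0)) (fun w => w (b 1)) R n)
    (D : Cochain A (tensorPow P (i + 1)).toGrSpace R →ₗ[K] Cochain A (tensorPow P (i + 1)).toGrSpace R)
    {S : Submodule K (Cochain A (tensorPow P (i + 1)).toGrSpace R)} (h : ∀ w, C w ∈ S.map D) :
    ∃ η : Fin (n + 1) → Cochain A (tensorPow P (i + 1)).toGrSpace R, (∀ k, η k ∈ S) ∧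
      ∀ w, D (∑ k, SymmetricAlgebra.lift w (lagrangeSym b n k) • η k) = C w := by
  let p (k : Fin (n + 1)) : Module.Dual K V := b.coord 0 + (k : K) • b.coord 1
  choose η hη hD using fun k => h (p k)
  refine ⟨η, hη, fun w => ?_⟩
  refine word_ext fun l => word_ext fun m => Rep.ext fun z c hz => ?_
  have h1 := homogPoly_interpolation (hC l m z c hz) (p := p) (by simp [p]) (by simp [p]) w
  rw [h1, map_sum, LinearMap.sum_apply, LinearMap.sum_apply, LinearMap.sum_apply]
  refine Finset.sum_congr rfl fun k _ => ?_
  rw [map_smul, hD, lift_lagrangeSym]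
  rfl

/-- Adding a polynomial family of cochains to a family of maps. -/
lemma IsPreFamily.add_interpolate {Φ : Bar (extSpace P) →ₗ[K] ExtSym P V} (hΦ : IsPreFamily P Φ)
    {R : GrSpace K} {i n : ℕ} (incl : R →ₗ[K] (extSpace P)) {d c : ℤ}
    (hgr : ∀ m x, x ∈ R.gr m → incl x ∈ (extSpace P).gr (m + c)) (hd : d + 2 * (i + 1) + c = 1)
    (hwt : ∀ x, incl x ∈ extWt P (-((i + 1 : ℕ) : ℤ) + n))
    (h2 : i ≠ 0 ∨ toSnd P ∘ₗ incl = 0)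
    {η : Fin (n + 1) → Cochain A (tensorPow P (i + 1)).toGrSpace R} (hη : ∀ k, η k ∈ homDeg _ _ d) :
    IsPreFamily P (Φ + interpolate b n fun k => incl ∘ₗ spread i (η k)) ∧
    ∀ w, specialize P w ∘ₗ (Φ + interpolate b n fun k => incl ∘ₗ spread i (η k)) -
      specialize P w ∘ₗ Φ = ∑ k, SymmetricAlgebra.lift w (lagrangeSym b n k) • (incl ∘ₗ spread i (η k)) := by
  have hdeg : ∀ k m x, HomWord (extSpace P).gr (-1) m x →
      (incl ∘ₗ spread i (η k)) x ∈ (extSpace P).gr (m + 1) := fun k m x hx => by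
    have := hgr _ _ (spread_mem (i := i) (hη k).2 hx)
    rwa [show m + (d + 2 * (i + 1)) + c = m + 1 by omega] at this
  have hs (w : Module.Dual K V) :
      specialize P w ∘ₗ (Φ + interpolate b n fun k => incl ∘ₗ spread i (η k)) =
        specialize P w ∘ₗ Φ +
          ∑ k, SymmetricAlgebra.lift w (lagrangeSym b n k) • (incl ∘ₗ spread i (η k)) := by
    rw [LinearMap.comp_add, specialize_interpolate]
  have h0 : ∀ k l, numP l ≠ i + 1 → (incl ∘ₗ spread i (η k)) (pword P l) = 0 := fun k l hl => by
    rw [LinearMap.comp_apply, spread_pword _ hl, map_zero]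
  refine ⟨⟨hΦ.gradings.add (interpolate_gradings b hdeg h0 fun k x => hwt _), fun w => ?_⟩,
    fun w => by rw [hs, add_sub_cancel_left]⟩
  rw [hs]
  refine (hΦ.spec w).add (fun m x hx => ?_) (fun x y => ?_) (Kills.sum fun k => Kills.smul
    (fun l hl => h0 k l (by omega)) _) ?_
  · rw [LinearMap.sum_apply]
    exact Submodule.sum_mem _ fun k _ => Submodule.smul_mem _ _ (hdeg k m x hx)
  · rw [LinearMap.sum_apply]
    refine Finset.sum_eq_zero fun k _ => ?_
    rw [LinearMap.smul_apply, LinearMap.comp_apply, spread_unitFree i (hη k).1, map_zero, smul_zero]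
  · intro l hl
    rcases h2 with h2 | h2
    · exact ((Kills.sum fun k => Kills.smul (fun l hl => h0 k l (by omega)) _).comp _ : Kills 2 _) l hl
    · rw [LinearMap.comp_apply, LinearMap.sum_apply, map_sum]
      refine Finset.sum_eq_zero fun k _ => ?_
      rw [LinearMap.smul_apply, map_smul, ← LinearMap.comp_apply (toSnd P), ← LinearMap.comp_assoc, h2]
      exact smul_zero _

lemma pull_sum_spread {R : GrSpace K} {i : ℕ} (q : (extSpace P) →ₗ[K] R) (incl : R →ₗ[K] (extSpace P))
    (hq : q ∘ₗ incl = LinearMap.id) {ι : Type*} [Fintype ι] (c : ι → K)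
    (η : ι → Cochain A (tensorPow P (i + 1)).toGrSpace R) :
    pull i (q ∘ₗ ∑ k, c k • (incl ∘ₗ spread i (η k))) = ∑ k, c k • η k := by
  refine LinearMap.ext fun x => LinearMap.ext fun y => LinearMap.ext fun z => ?_
  rw [pull_apply, LinearMap.comp_apply, LinearMap.sum_apply, map_sum, LinearMap.sum_apply,
    LinearMap.sum_apply, LinearMap.sum_apply]
  refine Finset.sum_congr rfl fun k _ => ?_
  rw [LinearMap.smul_apply, map_smul, ← LinearMap.comp_apply q, ← LinearMap.comp_assoc, hq]
  conv_rhs => rw [← pull_spread i (η k)]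
  rfl

end PencilDeformation

section PencilSteps

variable {K : Type u} [Field K] {A : AInfAlgebra K} {P : BimoduleData A}
variable {V : Type v} [AddCommGroup V] [Module K V]
variable {𝔭 𝔮 : Pencil P V} {Φ : Bar (extSpace P) →ₗ[K] ExtSym P V}

variable (𝔭 𝔮) in
/-- The failure of the specializations of `Φ` to be `A_∞`-homomorphisms. -/
def IsPreFamily.defect (hΦ : IsPreFamily P Φ) (w : Module.Dual K V) :
    Bar (extSpace P) →ₗ[K] (extSpace P) :=
  homDefect (specialize P w ∘ₗ 𝔭.toFun) (specialize P w ∘ₗ 𝔮.toFun) (specialize P w ∘ₗ Φ)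
    (hΦ.spec w).map_one

lemma IsPreFamily.polyFamily_defect (b : Module.Basis (Fin 2) K V)
    (hΦ : IsPreFamily P Φ) :
    PolyFamily (fun w : Module.Dual K V => w (b 0)) (fun w => w (b 1)) (hΦ.defect 𝔭 𝔮) :=
  (𝔭.gradings.polyFamily b).homDefect (𝔮.gradings.polyFamily b) (hΦ.gradings.polyFamily b) _

lemma pull_word_eq {R : GrSpace K} {i : ℕ} {z : (tensorPow P (i + 1)).carrier}
    {c : List (A.carrier ⊕ P.carrier)} (hz : Rep P i z c) (f : Bar (extSpace P) →ₗ[K] R)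
    (l m : List A.carrier) :
    pull i f (word l) (word m) z = f (pword P (l.map Sum.inl ++ c ++ m.map Sum.inl)) := by
  rw [pull_apply, hz.core_eq, pword_append, pword_append, pword_map_inl, pword_map_inl]

lemma interpolate_spread_pword (b : Module.Basis (Fin 2) K V)
    {R : GrSpace K} {i n : ℕ} (incl : R →ₗ[K] (extSpace P))
    (η : Fin (n + 1) → Cochain A (tensorPow P (i + 1)).toGrSpace R)
    {l : List (A.carrier ⊕ P.carrier)} (hl : numP l < i + 1) :
    interpolate b n (fun k => incl ∘ₗ spread i (η k)) (pword P l) = 0 := by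
  rw [interpolate_apply]
  refine Finset.sum_eq_zero fun k _ => ?_
  rw [LinearMap.comp_apply, spread_pword _ hl.ne, map_zero, TensorProduct.zero_tmul]

lemma kills_specialize_sub {Φ' : Bar (extSpace P) →ₗ[K] ExtSym P V} {r : ℕ}
    (h : ∀ l, numP l < r → Φ' (pword P l) = Φ (pword P l)) (w : Module.Dual K V) :
    Kills r (specialize P w ∘ₗ Φ' - specialize P w ∘ₗ Φ) := fun l hl => by
  rw [LinearMap.sub_apply, LinearMap.comp_apply, LinearMap.comp_apply, h l hl, sub_self]

lemma Kills.of_fst_snd {r : ℕ} {f : Bar (extSpace P) →ₗ[K] (extSpace P)}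
    (h1 : Kills r (toFst P ∘ₗ f)) (h2 : Kills r (toSnd P ∘ₗ f)) : Kills r f :=
  fun l hl => Prod.ext (h1 l hl) (h2 l hl)

lemma IsPreFamily.defect_unitFree (hΦ : IsPreFamily P Φ) (w : Module.Dual K V) :
    UnitFree (hΦ.defect 𝔭 𝔮 w) :=
  (hΦ.spec w).homDefect_unitFree (𝔭.divisor w) (𝔮.divisor w)

lemma IsPreFamily.kills_defect {Φ' : Bar (extSpace P) →ₗ[K] ExtSym P V} (hΦ : IsPreFamily P Φ)
    (hΦ' : IsPreFamily P Φ') {r : ℕ} (h : ∀ l, numP l < r → Φ' (pword P l) = Φ (pword P l))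
    {w : Module.Dual K V} (hk : Kills r (hΦ.defect 𝔭 𝔮 w)) : Kills r (hΦ'.defect 𝔭 𝔮 w) := by
  have h1 := ((hΦ.spec w).kills_homDefect_sub (μ' := specialize P w ∘ₗ 𝔮.toFun) (hΦ'.spec w)
    (𝔭.divisor w) (kills_specialize_sub h w)).add hk
  rw [defect, sub_add_cancel] at h1
  exact h1

/-- One step of the inductive construction of isomorphisms: the `P`-valued part. -/
lemma IsPreFamily.exists_step_snd [CharZero K] (b : Module.Basis (Fin 2) K V)
    (hΦ : IsPreFamily P Φ) {i : ℕ} (hi : i ≠ 0)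
    (hk : ∀ w, Kills (i + 1) (hΦ.defect 𝔭 𝔮 w))
    (hp : ∀ w, pull i (toSnd P ∘ₗ hΦ.defect 𝔭 𝔮 w) ∈
      (homDeg _ _ (-2 * i)).map (diff (tensorPow P (i + 1)) P (-2 * i))) :
    ∃ (Φ' : Bar (extSpace P) →ₗ[K] ExtSym P V) (hΦ' : IsPreFamily P Φ'),
      (∀ l, numP l < i + 1 → Φ' (pword P l) = Φ (pword P l)) ∧
      ∀ w, Kills (i + 1) (hΦ'.defect 𝔭 𝔮 w) ∧ Kills (i + 2) (toSnd P ∘ₗ hΦ'.defect 𝔭 𝔮 w) := by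
  obtain ⟨η, hη, hD⟩ := homogPoly_primitive b (n := i)
    (C := fun w => pull i (toSnd P ∘ₗ hΦ.defect 𝔭 𝔮 w))
    (fun l m z c hz => by
      have := (hΦ.polyFamily_defect (𝔭 := 𝔭) (𝔮 := 𝔮) b).snd
        (l := l.map Sum.inl ++ c ++ m.map Sum.inl) (r := i) (by simp [hz.numP_eq])
      simp_rw [pull_word_eq hz]
      exact this)
    (-diff (tensorPow P (i + 1)) P (-2 * i)) (S := homDeg _ _ (-2 * i)) (fun w => by
      obtain ⟨η, hη, h⟩ := hp w
      exact ⟨-η, Submodule.neg_mem _ hη, by rw [LinearMap.neg_apply, map_neg, neg_neg, h]⟩)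
  obtain ⟨hΦ', hs⟩ := hΦ.add_interpolate b (LinearMap.inr K A.carrier P.carrier) (c := -1)
    (fun m x hx => Submodule.mem_prod.2 ⟨zero_mem _, by simpa using hx⟩) (by ring)
    (fun x => by simp [extWt]) (Or.inl hi) hη
  have hag : ∀ l, numP l < i + 1 → (Φ + interpolate b i fun k =>
      LinearMap.inr K A.carrier P.carrier ∘ₗ spread i (η k)) (pword P l) = Φ (pword P l) :=
    fun l hl => by rw [LinearMap.add_apply, interpolate_spread_pword b _ _ hl, add_zero]
  refine ⟨_, hΦ', hag, fun w => ?_⟩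
  have h1 : Kills (i + 1) (hΦ'.defect 𝔭 𝔮 w) := hΦ.kills_defect hΦ' hag (hk w)
  refine ⟨h1, ((hΦ'.defect_unitFree w).comp _).kills_of_pull i (h1.comp _) ?_⟩
  have h2 := (hΦ.spec w).pull_snd_sub (hΦ'.spec w) (𝔭.divisor w) (𝔮.divisor w)
    (kills_specialize_sub hag w)
  rw [hs w, pull_sum_spread (toSnd P) _ (LinearMap.snd_comp_inr _ _ _), LinearMap.comp_sub, pull_sub,
    sub_eq_iff_eq_add] at h2
  refine h2.trans ?_
  have h3 := hD w
  rw [LinearMap.neg_apply, neg_eq_iff_eq_neg] at h3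
  rw [h3]
  exact neg_add_cancel _

/-- One step of the inductive construction of isomorphisms: the `A`-valued part. -/
lemma IsPreFamily.exists_step_fst [CharZero K] (b : Module.Basis (Fin 2) K V)
    (hΦ : IsPreFamily P Φ) {i : ℕ}
    (hk : ∀ w, Kills (i + 1) (hΦ.defect 𝔭 𝔮 w))
    (hk' : ∀ w, Kills (i + 2) (toSnd P ∘ₗ hΦ.defect 𝔭 𝔮 w))
    (hp : ∀ w, pull i (toFst P ∘ₗ hΦ.defect 𝔭 𝔮 w) ∈
      (homDeg _ _ (-1 - 2 * i)).map (diff (tensorPow P (i + 1)) (diagonal A) (-1 - 2 * i))) :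
    ∃ (Φ' : Bar (extSpace P) →ₗ[K] ExtSym P V) (hΦ' : IsPreFamily P Φ'),
      (∀ l, numP l < i + 1 → Φ' (pword P l) = Φ (pword P l)) ∧
      ∀ w, Kills (i + 2) (hΦ'.defect 𝔭 𝔮 w) := by
  obtain ⟨η, hη, hD⟩ := homogPoly_primitive b (n := i + 1)
    (fun l m z c hz => by
      simp_rw [pull_word_eq hz]
      have := (hΦ.polyFamily_defect (𝔭 := 𝔭) (𝔮 := 𝔮) b).fst (l.map Sum.inl ++ c ++ m.map Sum.inl)
      rwa [numP_append, numP_append, hz.numP_eq, numP_map_inl, numP_map_inl, zero_add] at this)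
    (diff (tensorPow P (i + 1)) (diagonal A) (-1 - 2 * i)) hp
  obtain ⟨hΦ', hs⟩ := hΦ.add_interpolate b (LinearMap.inl K A.carrier P.carrier) (c := 0)
    (fun m x hx => Submodule.mem_prod.2 ⟨by simpa using hx, zero_mem _⟩) (by ring)
    (fun x => by simp [extWt]) (Or.inr (LinearMap.snd_comp_inl _ _ _)) hη
  have hag : ∀ l, numP l < i + 1 → (Φ + interpolate b (i + 1) fun k =>
      LinearMap.inl K A.carrier P.carrier ∘ₗ spread i (η k)) (pword P l) = Φ (pword P l) :=
    fun l hl => by rw [LinearMap.add_apply, interpolate_spread_pword b _ _ hl, add_zero]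
  refine ⟨_, hΦ', hag, fun w => ?_⟩
  have h1 : Kills (i + 1) (hΦ'.defect 𝔭 𝔮 w) := hΦ.kills_defect hΦ' hag (hk w)
  have h0 : toSnd P ∘ₗ (specialize P w ∘ₗ (Φ + interpolate b (i + 1) fun k =>
      LinearMap.inl K A.carrier P.carrier ∘ₗ spread i (η k)) - specialize P w ∘ₗ Φ) = 0 := by
    rw [hs w]
    refine LinearMap.ext fun x => ?_
    rw [LinearMap.comp_apply, LinearMap.sum_apply, map_sum]
    exact Finset.sum_eq_zero fun k _ => smul_zero _
  have h2 : Kills (i + 2) (toSnd P ∘ₗ hΦ'.defect 𝔭 𝔮 w) := by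
    refine ((hΦ'.defect_unitFree w).comp _).kills_of_pull i (h1.comp _) ?_
    have h2 := (hΦ.spec w).pull_snd_sub (hΦ'.spec w) (𝔭.divisor w) (𝔮.divisor w)
      (kills_specialize_sub hag w)
    rw [h0, LinearMap.comp_sub, pull_sub, sub_eq_iff_eq_add] at h2
    refine h2.trans ?_
    have h4 : pull i (toSnd P ∘ₗ hΦ.defect 𝔭 𝔮 w) = 0 := word_ext fun l => word_ext fun m =>
      Rep.ext fun z c hz => by
        rw [pull_word_eq hz]
        exact hk' w _ (by simp [hz.numP_eq])
    have h5 : pull i (0 : Bar (extSpace P) →ₗ[K] P.toGrSpace) = 0 := rfl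
    rw [h5, map_zero, zero_add]
    exact h4
  refine Kills.of_fst_snd (((hΦ'.defect_unitFree w).comp _).kills_of_pull i (h1.comp _) ?_) h2
  have h3 := (hΦ.spec w).pull_fst_sub (hΦ'.spec w) (𝔭.divisor w) (𝔮.divisor w)
    (kills_specialize_sub hag w) (by rw [h0]; exact fun _ _ => rfl)
  rw [hs w, pull_sum_spread (toFst P) _ (LinearMap.fst_comp_inl _ _ _), LinearMap.comp_sub, pull_sub,
    sub_eq_iff_eq_add] at h3
  refine h3.trans ?_
  rw [hD w]
  exact neg_add_cancel _

end PencilSteps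

section PencilIsomorphisms

variable {K : Type u} [Field K] {A : AInfAlgebra K} {P : BimoduleData A}
variable {V : Type v} [AddCommGroup V] [Module K V]
variable {𝔭 𝔮 : Pencil P V} {Φ : Bar (extSpace P) →ₗ[K] ExtSym P V}

lemma exists_limit {X Y : Type*} [AddCommGroup X] [Module K X] [AddCommGroup Y] [Module K Y]
    (g : ℕ → X →ₗ[K] Y) (h : ∀ x, ∃ N, ∀ k, N ≤ k → g (k + 1) x = g k x) :
    ∃ f : X →ₗ[K] Y, ∀ x N, (∀ k, N ≤ k → g (k + 1) x = g k x) → f x = g N x := by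
  refine ⟨g 0 + lsum (fun k => g (k + 1) - g k) fun x => ?_, fun x N hN => ?_⟩
  · obtain ⟨N, hN⟩ := h x
    exact ⟨N, fun k hk => by rw [LinearMap.sub_apply, hN k hk, sub_self]⟩
  · rw [LinearMap.add_apply, lsum_apply _ _ (N := N) fun k hk => by
      rw [LinearMap.sub_apply, hN k hk, sub_self]]
    simp_rw [LinearMap.sub_apply]
    rw [Finset.sum_range_sub fun k => g k x, add_sub_cancel]

/-- One step of the inductive construction of isomorphisms. -/
lemma IsPreFamily.exists_step [CharZero K] (hP : IsBimodule P) (hinv : Invertible P)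
    (b : Module.Basis (Fin 2) K V)
    (hvan : ∀ i : ℕ, 1 ≤ i → ∀ d : ℤ, d < 0 → Subsingleton (HomCoh (tensorPow P i) (diagonal A) d))
    (hΦ : IsPreFamily P Φ) {n : ℕ} (hk : ∀ w, Kills (n + 1) (hΦ.defect 𝔭 𝔮 w))
    (hk' : ∀ w, Kills (n + 2) (toSnd P ∘ₗ hΦ.defect 𝔭 𝔮 w))
    (hp : ∀ w, pull n (toFst P ∘ₗ hΦ.defect 𝔭 𝔮 w) ∈
      (homDeg _ _ (-1 - 2 * n)).map (diff (tensorPow P (n + 1)) (diagonal A) (-1 - 2 * n))) :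
    ∃ (Φ' : Bar (extSpace P) →ₗ[K] ExtSym P V) (hΦ' : IsPreFamily P Φ'),
      (∀ l, numP l < n + 1 → Φ' (pword P l) = Φ (pword P l)) ∧
      ∀ w, Kills (n + 2) (hΦ'.defect 𝔭 𝔮 w) ∧ Kills (n + 3) (toSnd P ∘ₗ hΦ'.defect 𝔭 𝔮 w) := by
  obtain ⟨Φ₁, h₁, hag, hk₁⟩ := hΦ.exists_step_fst b hk hk' hp
  obtain ⟨Φ₂, h₂, hag', hk₂⟩ := h₁.exists_step_snd b (i := n + 1) n.succ_ne_zero hk₁ fun w => by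
    have h := cocycles_le_coboundaries hP hinv (hvan (n + 1) (by omega) (1 - 2 * (n + 1 : ℕ))
      (by push_cast; omega)) ⟨(h₁.spec w).pull_snd_mem (𝔭.divisor w) (𝔮.divisor w) (n + 1),
        (h₁.spec w).diff_pull_snd (𝔭.divisor w) (𝔮.divisor w) (hk₁ w)⟩
    rw [coboundaries, show (1 - 2 * (n + 1 : ℕ) - 1 : ℤ) = -2 * (n + 1 : ℕ) by ring] at h
    exact h
  exact ⟨Φ₂, h₂, fun l hl => (hag' l (by omega)).trans (hag l hl), hk₂⟩

lemma IsPreFamily.pull_fst_mem_map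
    (hvan : ∀ i : ℕ, 1 ≤ i → ∀ d : ℤ, d < 0 → Subsingleton (HomCoh (tensorPow P i) (diagonal A) d))
    (hΦ : IsPreFamily P Φ) {n : ℕ} (hn : n ≠ 0) {w : Module.Dual K V}
    (hk : Kills (n + 1) (hΦ.defect 𝔭 𝔮 w)) (hk' : Kills (n + 2) (toSnd P ∘ₗ hΦ.defect 𝔭 𝔮 w)) :
    pull n (toFst P ∘ₗ hΦ.defect 𝔭 𝔮 w) ∈
      (homDeg _ _ (-1 - 2 * n)).map (diff (tensorPow P (n + 1)) (diagonal A) (-1 - 2 * n)) := by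
  have hc : pull n (toFst P ∘ₗ hΦ.defect 𝔭 𝔮 w) ∈
      cocycles (tensorPow P (n + 1)) (diagonal A) (-2 * n) :=
    ⟨(hΦ.spec w).pull_fst_mem (𝔭.divisor w) (𝔮.divisor w) n,
      (hΦ.spec w).diff_pull_fst (𝔭.divisor w) (𝔮.divisor w) hk hk'⟩
  have hs := hvan (n + 1) (by omega) (-2 * n) (by omega)
  have h := (Submodule.Quotient.mk_eq_zero _).1 (hs.elim (Submodule.Quotient.mk ⟨_, hc⟩) 0)
  rw [Submodule.mem_comap, coboundaries, show (-2 * n - 1 : ℤ) = -1 - 2 * n by ring] at h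
  exact h

variable (P V) in
/-- The constant family with value the identity. -/
def idFamily : Bar (extSpace P) →ₗ[K] ExtSym P V :=
  (TensorProduct.mk K _ _).flip (1 : SymmetricAlgebra K V) ∘ₗ len1

lemma specialize_idFamily (w : Module.Dual K V) : specialize P w ∘ₗ idFamily P V = len1 := by
  refine LinearMap.ext fun x => (specialize_tmul w (len1 x) 1).trans ?_
  rw [map_one, one_smul]

lemma isPreFamily_idFamily : IsPreFamily P (idFamily P V) where
  spec w := by
    rw [specialize_idFamily]
    exact isPreIso_len1
  gradings := {
    degree := fun n x hx => ⟨⟨_, isPreIso_len1.degree n x hx⟩ ⊗ₜ ⟨1, trivial⟩, rfl⟩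
    weight := fun m x hx => by
      rcases hx.eq_pword with rfl | ⟨l, rfl, rfl⟩
      · rw [map_zero]; exact zero_mem _
      · have h : len1 (pword P l) ∈ extWt P (-(numP l : ℤ) + (0 : ℕ)) := by
          rw [Nat.cast_zero, add_zero]
          match l with
          | [] => rw [pword_nil, len1_one]; exact zero_mem _
          | [a] =>
            rw [pword_cons, pword_nil, mul_one, len1_ι]
            exact letter_mem_extWt a
          | a :: a' :: l =>
            rw [pword_cons, pword_cons, len1_mul, aug_ι, zero_smul, map_mul aug, aug_ι, zero_mul,
              zero_smul, add_zero]
            exact zero_mem _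
        exact Submodule.mem_iSup_of_mem 0 ⟨⟨_, h⟩ ⊗ₜ ⟨1, by simp⟩, rfl⟩ }

lemma idFamily_defect (w : Module.Dual K V) : (isPreFamily_idFamily (P := P)).defect 𝔭 𝔮 w =
    specialize P w ∘ₗ 𝔮.toFun - specialize P w ∘ₗ 𝔭.toFun := by
  rw [← homDefect_len1, IsPreFamily.defect]
  congr 1
  exact specialize_idFamily w

lemma IsDivisor.kills_sub {μ μ' : Bar (extSpace P) →ₗ[K] (extSpace P)} (hμ : IsDivisor P μ)
    (hμ' : IsDivisor P μ') : Kills 1 (μ' - μ) := fun l hl => by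
  obtain ⟨v, rfl⟩ := exists_map_inl (Nat.lt_one_iff.1 hl)
  rw [pword_map_inl, LinearMap.sub_apply, hμ.subalgebra, hμ'.subalgebra, sub_self]

lemma IsDivisor.kills_snd_sub {μ μ' : Bar (extSpace P) →ₗ[K] (extSpace P)} (hμ : IsDivisor P μ)
    (hμ' : IsDivisor P μ') : Kills 2 (toSnd P ∘ₗ (μ' - μ)) := fun l hl => by
  rcases Nat.lt_or_ge (numP l) 1 with h | h
  · exact (hμ.kills_sub hμ').comp (toSnd P) l h
  · obtain ⟨v, p, l', rfl⟩ := exists_eq_append_inr (l := l) (by omega)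
    obtain ⟨m, rfl⟩ := exists_map_inl (l := l') (by simp at hl; omega)
    rw [pword_append, pword_cons, pword_map_inl, pword_map_inl, ← mul_assoc]
    exact sub_eq_zero.2 ((hμ'.quotient _ _ _).trans (hμ.quotient _ _ _).symm)

/-- Sections depend linearly on the parameter. -/
lemma Pencil.sectionCochain_eq (b : Module.Basis (Fin 2) K V) (𝔭 : Pencil P V) (w : Module.Dual K V) :
    sectionCochain P (specialize P w ∘ₗ 𝔭.toFun) =
      w (b 0) • sectionCochain P (specialize P (b.coord 0) ∘ₗ 𝔭.toFun) +
      w (b 1) • sectionCochain P (specialize P (b.coord 1) ∘ₗ 𝔭.toFun) := by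
  refine word_ext fun l => word_ext fun m => LinearMap.ext fun p => ?_
  have h := (𝔭.gradings.polyFamily b).fst (l.map Sum.inl ++ Sum.inr p :: m.map Sum.inl)
  rw [show numP (l.map Sum.inl ++ Sum.inr p :: m.map Sum.inl) = 1 by simp, pword_append, pword_cons,
    pword_map_inl, pword_map_inl, ← mul_assoc] at h
  exact homogPoly_one h (ω₀ := b.coord 0) (ω₁ := b.coord 1) (by simp) (by simp) (by simp) (by simp) w

/-- Pencils with the same sections are isomorphic. -/
lemma Pencil.isomorphic_of_sectionClass_eq [CharZero K] (hP : IsBimodule P) (hinv : Invertible P)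
    (b : Module.Basis (Fin 2) K V)
    (hvan : ∀ i : ℕ, 1 ≤ i → ∀ d : ℤ, d < 0 → Subsingleton (HomCoh (tensorPow P i) (diagonal A) d))
    (h0 : 𝔭.sectionClass (b.coord 0) = 𝔮.sectionClass (b.coord 0))
    (h1 : 𝔭.sectionClass (b.coord 1) = 𝔮.sectionClass (b.coord 1)) : 𝔭.Isomorphic 𝔮 := by
  have hsec : ∀ w, sectionCochain P (specialize P w ∘ₗ 𝔮.toFun) -
      sectionCochain P (specialize P w ∘ₗ 𝔭.toFun) ∈ coboundaries P (diagonal A) 0 := fun w => by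
    rw [Pencil.sectionCochain_eq b 𝔮, Pencil.sectionCochain_eq b 𝔭, add_sub_add_comm, ← smul_sub,
      ← smul_sub]
    exact Submodule.add_mem _
      (Submodule.smul_mem _ _ ((divisorSection_eq_iff (𝔮.divisor _) (𝔭.divisor _)).1 h0.symm))
      (Submodule.smul_mem _ _ ((divisorSection_eq_iff (𝔮.divisor _) (𝔭.divisor _)).1 h1.symm))
  obtain ⟨Φ₀, hΦ₀, -, hk₀⟩ := (isPreFamily_idFamily (P := P)).exists_step (𝔭 := 𝔭) (𝔮 := 𝔮) hP hinv b
    hvan (n := 0) (fun w => by rw [idFamily_defect]; exact (𝔭.divisor w).kills_sub (𝔮.divisor w))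
    (fun w => by rw [idFamily_defect]; exact (𝔭.divisor w).kills_snd_sub (𝔮.divisor w))
    (fun w => by rw [idFamily_defect]; exact hsec w)
  let X (n : ℕ) := {Φ : Bar (extSpace P) →ₗ[K] ExtSym P V // ∃ hΦ : IsPreFamily P Φ, ∀ w,
    Kills (n + 2) (hΦ.defect 𝔭 𝔮 w) ∧ Kills (n + 3) (toSnd P ∘ₗ hΦ.defect 𝔭 𝔮 w)}
  have step : ∀ n (x : X n), ∃ y : X (n + 1),
      ∀ l, numP l < n + 2 → y.1 (pword P l) = x.1 (pword P l) := fun n ⟨Φ, hΦ, hk⟩ => by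
    obtain ⟨Φ', h', hag, hk'⟩ := hΦ.exists_step hP hinv b hvan (n := n + 1) (fun w => (hk w).1)
      (fun w => (hk w).2) fun w => hΦ.pull_fst_mem_map hvan n.succ_ne_zero (hk w).1 (hk w).2
    exact ⟨⟨Φ', h', hk'⟩, hag⟩
  choose F hF using step
  let g (n : ℕ) : X n := Nat.rec ⟨Φ₀, hΦ₀, hk₀⟩ F n
  have hg : ∀ n l, numP l < n + 2 → (g (n + 1)).1 (pword P l) = (g n).1 (pword P l) :=
    fun n => hF n (g n)
  have hst : ∀ x, ∃ N, ∀ k, N ≤ k → (g (k + 1)).1 x = (g k).1 x := fun x => by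
    have hx : x ∈ Submodule.span K (Set.range (pword P)) := by rw [span_pword]; trivial
    induction hx using Submodule.span_induction with
    | mem x hx =>
      obtain ⟨l, rfl⟩ := hx
      exact ⟨numP l, fun k hk => hg k l (by omega)⟩
    | zero => exact ⟨0, fun k _ => by rw [map_zero, map_zero]⟩
    | add x y _ _ hx hy =>
      obtain ⟨M, hM⟩ := hx
      obtain ⟨N, hN⟩ := hy
      exact ⟨max M N, fun k hk => by
        rw [map_add, map_add, hM k (le_of_max_le_left hk), hN k (le_of_max_le_right hk)]⟩
    | smul c x _ hx =>
      obtain ⟨N, hN⟩ := hx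
      exact ⟨N, fun k hk => by rw [map_smul, map_smul, hN k hk]⟩
  obtain ⟨Φ, hlim⟩ := exists_limit (fun n => (g n).1) hst
  have hx : ∀ x, ∃ N, Φ x = (g N).1 x := fun x => by
    obtain ⟨N, hN⟩ := hst x
    exact ⟨N, hlim x N hN⟩
  have hpre : IsPreFamily P Φ := by
    refine ⟨⟨fun n x h => ?_, fun n x h => ?_⟩, fun w => ⟨?_, fun n x h => ?_, fun x y => ?_, fun x => ?_,
      fun x y p => ?_⟩⟩
    all_goals try rw [LinearMap.comp_apply]
    · obtain ⟨N, hN⟩ := hx x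
      rw [hN]
      exact (g N).2.choose.gradings.degree n x h
    · obtain ⟨N, hN⟩ := hx x
      rw [hN]
      exact (g N).2.choose.gradings.weight n x h
    · obtain ⟨N, hN⟩ := hx 1
      rw [hN]
      exact ((g N).2.choose.spec w).map_one
    · obtain ⟨N, hN⟩ := hx x
      rw [hN]
      exact ((g N).2.choose.spec w).degree n x h
    · obtain ⟨N, hN⟩ := hx (x * TensorAlgebra.ι K ((A.unit, 0) : A.carrier × P.carrier) * y)
      rw [hN]
      exact ((g N).2.choose.spec w).unital x y
    · obtain ⟨N, hN⟩ := hx (inA P x)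
      rw [hN]
      exact ((g N).2.choose.spec w).subalgebra x
    · obtain ⟨N, hN⟩ := hx (onceP P x y p)
      rw [hN]
      exact ((g N).2.choose.spec w).quotient x y p
  refine ⟨Φ, hpre.gradings, fun w => isDivisorIso_iff.2 ⟨hpre.spec w, pword_ext fun l => ?_⟩⟩
  obtain ⟨hN, hk⟩ := (g (numP l)).2
  refine hN.kills_defect hpre (r := numP l + 2) (fun l' hl' => hlim _ _ fun k hk => hg k l' (by omega))
    (hk w).1 l (by omega)

end PencilIsomorphisms

end NCPencil

end

theorem mainTheorem11 {K : Type u} [Field K] [CharZero K] (A : AInfAlgebra K)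
    (P : BimoduleData A) (hP : IsBimodule P) (hinv : Invertible P)
    {V : Type v} [AddCommGroup V] [Module K V] (b : Module.Basis (Fin 2) K V)
    (hvan : ∀ i : ℕ, 1 ≤ i → ∀ d : ℤ, d < 0 →
      Subsingleton (HomCoh (tensorPow P i) (diagonal A) d)) :
    (∀ 𝔭 𝔮 : Pencil P V, 𝔭.Isomorphic 𝔮 ↔
      𝔭.sectionClass (b.coord 0) = 𝔮.sectionClass (b.coord 0) ∧
      𝔭.sectionClass (b.coord 1) = 𝔮.sectionClass (b.coord 1)) ∧
    ∃ κ : HomCoh P (diagonal A) 0 ≃ₗ[K] HomCoh P (diagonal A) 0, IsSelfConjugation P 0 κ ∧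
      ∀ 𝔭 : Pencil P V,
        κ (𝔭.sectionClass (b.coord 0)) = 𝔭.sectionClass (b.coord 0) ∧
        κ (𝔭.sectionClass (b.coord 1)) = 𝔭.sectionClass (b.coord 1) := by
  refine ⟨fun 𝔭 𝔮 => ⟨fun ⟨Φ, _, h⟩ => ⟨?_, ?_⟩, fun h =>
    Pencil.isomorphic_of_sectionClass_eq hP hinv b hvan h.1 h.2⟩, ?_⟩
  · exact (h _).section_eq (𝔭.divisor _) (𝔮.divisor _)
  · exact (h _).section_eq (𝔭.divisor _) (𝔮.divisor _)
  · obtain ⟨κ, hκ⟩ := exists_selfConjugation hP hinv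
    exact ⟨κ, hκ, fun 𝔭 => ⟨(hκ _ _).2 (conj_section_mem hP (𝔭.divisor _)),
      (hκ _ _).2 (conj_section_mem hP (𝔭.divisor _))⟩⟩
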